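/- **Conventions.** For a topological group $G$ and $n\ge 1$, let $r_n(G)\in\{0,1,2,\dots,\infty\}$ be the number of equivalence classes of continuous irreducible complex representations of $G$ of degree $n$. The group $G$ is *rigid* if $r_n(G)<\infty$ for all $n\ge 1$; then $\zeta_G(s)=\zeta(G,s)=\sum_{n\ge 1}r_n(G)n^{-s}$. For a finite group $Q$ acting on a finite set $X$, let $H\wr_X Q=H^X\rtimes Q$ with $(qb)(x)=b(q^{-1}x)$, where $H^X$ has the product topology and is open. Put $W(Q,0)=1$, $W(Q,k+1)=W(Q,k)\wr_X Q$, and let $W(Q)=\varprojlim_k W(Q,k)$ be the profinite inverse limit along the natural epimorphisms $W(Q,k+1)\to W(Q,k)$. We consider three actions: $A_5$ on $5$ points ($\wr_5$), $PSL_2(\mathbf F_5)$ on the $6$ points of the projective line over $\mathbf F_5$ ($\wr_6$), and $PGL_3(\mathbf F_2)$ on the $7$ points of the projective plane over $\mathbf F_2$ ($\wr_7$). **Proposition 25.** (1) Let $H$ be a rigid topological group. Then $H\wr_5 A_5$, $H\wr_6 PSL_2(\mathbf F_5)$ and $H\wr_7 PGL_3(\mathbf F_2)$ are rigid, and the following identities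 hold as identities of formal Dirichlet series, and also for every $s\in\mathbf C$ at which $\zeta_H(s)$ converges absolutely (the left-hand sides then also converge absolutely): $$\begin{aligned} \zeta(H\wr_5A_5,s)={}&60^{-1-s}\zeta_H(s)^5+\big(20^{-1-s}\cdot30-60^{-1-s}\cdot10\big)\zeta_H(s)^2\zeta_H(3s)\\ &+\big(30^{-1-s}\cdot30-60^{-1-s}\cdot15\big)\zeta_H(s)\zeta_H(2s)^2\\ &+\big(5^{-1-s}(3+3^{-s})5-20^{-1-s}\cdot60-30^{-1-s}\cdot30+60^{-1-s}\cdot30\big)\zeta_H(s)\zeta_H(4s)\\ &+\big(10^{-1-s}(2+2^{-s})10-20^{-1-s}\cdot30-30^{-1-s}\cdot60+60^{-1-s}\cdot30\big)\zeta_H(2s)\zeta_H(3s)\\ &+\big(1+2\cdot3^{-s}+4^{-s}+5^{-s}-5^{-1-s}(3+3^{-s})5-10^{-1-s}(2+2^{-s})10\\ &\qquad+20^{-1-s}\cdot60+30^{-1-s}\cdot60-60^{-1-s}\cdot36\big)\zeta_H(5s), \end{aligned}$$ $$\begin{aligned} \zeta(H\wr_6PSL_2(\mathbf F_5),s)={}&60^{-1-s}\zeta_H(s)^6+\big(30^{-s}-\tfrac14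 60^{-s}\big)\zeta_H(s)^2\zeta_H(2s)^2\\ &+\big(2\cdot6^{-s}+2\cdot12^{-s}-2\cdot30^{-s}+\tfrac25 60^{-s}\big)\zeta_H(s)\zeta_H(5s)\\ &+\big(\tfrac43 15^{-s}-30^{-s}+\tfrac16 60^{-s}\big)\zeta_H(2s)^3\\ &+\big(2\cdot10^{-s}+20^{-s}-2\cdot30^{-s}+\tfrac13 60^{-s}\big)\zeta_H(3s)^2\\ &+\big(1+2\cdot3^{-s}+4^{-s}+5^{-s}-2\cdot6^{-s}-2\cdot10^{-s}-2\cdot12^{-s}-\tfrac43 15^{-s}\\ &\qquad-20^{-s}+4\cdot30^{-s}-\tfrac23 60^{-s}\big)\zeta_H(6s), \end{aligned}$$ $$\begin{aligned} \zeta(H\wr_7PGL_3(\mathbf F_2),s)={}&\tfrac1{168}168^{-s}\zeta_H(s)^7+\big(\tfrac12 84^{-s}-\tfrac18 168^{-s}\big)\zeta_H(s)^3\zeta_H(2s)^2\\ &+\big(\tfrac23 42^{-s}-\tfrac12 84^{-s}+\tfrac1{12}168^{-s}\big)\big(\zeta_H(s)^3\zeta_H(4s)+\zeta_H(s)\zeta_H(2s)^3\big)\\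 &+\big(4\cdot21^{-s}-3\cdot42^{-s}+\tfrac12 84^{-s}\big)\zeta_H(s)\zeta_H(2s)\zeta_H(4s)\\ &+\big(2\cdot28^{-s}+56^{-s}-2\cdot84^{-s}+\tfrac13 168^{-s}\big)\zeta_H(s)\zeta_H(3s)^2\\ &+\big(2\cdot7^{-s}+14^{-s}-2\cdot21^{-s}-2\cdot28^{-s}+\tfrac13 42^{-s}-56^{-s}+2\cdot84^{-s}-\tfrac13 168^{-s}\big)\\ &\qquad\cdot\big(\zeta_H(s)\zeta_H(6s)+\zeta_H(3s)\zeta_H(4s)\big)\\ &+\big(1+2\cdot3^{-s}+6^{-s}-3\cdot7^{-s}+8^{-s}-2\cdot14^{-s}+2\cdot28^{-s}+42^{-s}+56^{-s}\\ &\qquad-2\cdot84^{-s}+\tfrac27 168^{-s}\big)\zeta_H(7s). \end{aligned}$$ (2) The group $W(A_5)$ is rigid, its zeta function $\zeta(s)=\zeta(W(A_5),s)$ has a finite positive abscissa of convergence, and, as formal Dirichlet series and for every $s\in\mathbf C$ at which $\zeta(s)$ converges absolutely, $$\begin{aligned} \zeta(s)={}&60^{-1-s}\big(\zeta(s)^5-10\zeta(s)^2\zeta(3s)-15\zeta(s)\zeta(2s)^2+30\zeta(2s)\zeta(3s)+30\zeta(s)\zeta(4s)-36\zeta(5s)\big)\\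 &+15\cdot30^{-1-s}\cdot2\big(\zeta(s)\zeta(2s)^2-2\zeta(2s)\zeta(3s)-\zeta(s)\zeta(4s)+2\zeta(5s)\big)\\ &+10\cdot20^{-1-s}\cdot3\big(\zeta(s)^2\zeta(3s)-\zeta(2s)\zeta(3s)-2\zeta(s)\zeta(4s)+2\zeta(5s)\big)\\ &+10\cdot10^{-1-s}(2+2^{-s})\big(\zeta(2s)\zeta(3s)-\zeta(5s)\big)\\ &+5\cdot5^{-1-s}(3+3^{-s})\big(\zeta(s)\zeta(4s)-\zeta(5s)\big)\\ &+\big(1+2\cdot3^{-s}+4^{-s}+5^{-s}\big)\zeta(5s). \end{aligned}$$ (3) For $W=W(PSL_2(\mathbf F_5))$ and for $W=W(PGL_3(\mathbf F_2))$, the group $W$ is rigid, $\zeta(W,s)$ has a finite positive abscissa of convergence $\sigma_0$, and near $\sigma_0$ it has a Puiseux expansion in $\sqrt{s-\sigma_0}$: there are complex numbers $a_n$, with $a_n\neq0$ for some odd $n$, and $\varepsilon>0$ such that $\zeta(W,s)=\sum_{n\ge0}a_n(s-\sigma_0)^{n/2}$ (principal branch) whenever $\operatorname{Re}(s)>\sigma_0$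 and $|s-\sigma_0|<\varepsilon$. -/

import Mathlib

open scoped LinearAlgebra.Projectivization

namespace RepZeta

universe u v w

/-! ### Irreducible representations and the zeta function -/

/-- Irreducible linear representations of the topological group `G` on `ℂⁿ` that are continuous
(for a finite-dimensional space, continuity of all orbit maps `g ↦ ρ g v` is the same as
continuity of `g ↦ ρ g` as a map to `GL_n(ℂ)`). -/
def Irrep (G : Type u) [Group G] [TopologicalSpace G] (n : ℕ) : Type u :=
  {ρ : Representation ℂ G (Fin n → ℂ) // ρ.IsIrreducible ∧ ∀ v, Continuous fun g => ρ g v}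

/-- Equivalence (isomorphism) of irreducible representations. -/
instance irrepSetoid (G : Type u) [Group G] [TopologicalSpace G] (n : ℕ) :
    Setoid (Irrep G n) where
  r ρ σ := Nonempty (ρ.1.Equiv σ.1)
  iseqv := ⟨fun ρ => ⟨.refl ρ.1⟩, fun ⟨e⟩ => ⟨e.symm⟩, fun ⟨e⟩ ⟨f⟩ => ⟨e.trans f⟩⟩

/-- `r_n(G) ∈ {0, 1, 2, …, ∞}`: the number of equivalence classes of continuous irreducible
complex representations of `G` of degree `n`. -/
noncomputable def irrepCount (G : Type u) [Group G] [TopologicalSpace G] (n : ℕ) : ℕ∞ :=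
  ENat.card (Quotient (irrepSetoid G n))

/-- `G` is rigid if `r_n(G) < ∞` for all `n ≥ 1`. -/
def Rigid (G : Type u) [Group G] [TopologicalSpace G] : Prop :=
  ∀ n : ℕ, 1 ≤ n → irrepCount G n < ⊤

/-- The representation zeta function of a rigid group `G`, as a formal Dirichlet series: the
sequence of coefficients `n ↦ r_n(G)`, `n ≥ 1`, in the ring (under Dirichlet convolution) of
arithmetic functions. -/
noncomputable def formalZeta (G : Type u) [Group G] [TopologicalSpace G] :
    ArithmeticFunction ℂ :=
  ⟨fun n => if n = 0 then 0 else ((irrepCount G n).toNat : ℂ), by simp⟩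

/-- The representation zeta function `ζ(G, s) = ∑_{n ≥ 1} r_n(G) n^{-s}` of a rigid group, at a
complex number `s` at which the series converges absolutely. -/
noncomputable def zeta (G : Type u) [Group G] [TopologicalSpace G] (s : ℂ) : ℂ :=
  LSeries (formalZeta G) s

/-- (Absolute) convergence of `∑_{n ≥ 1} r_n(G) n^{-s}` at `s`. -/
def ZetaConverges (G : Type u) [Group G] [TopologicalSpace G] (s : ℂ) : Prop :=
  LSeriesSummable (formalZeta G) s

/-- The real number `σ` is the abscissa of convergence of `ζ(G, s)` (the coefficients are
nonnegative, so convergence and absolute convergence have the same abscissa). -/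
def IsAbscissa (G : Type u) [Group G] [TopologicalSpace G] (σ : ℝ) : Prop :=
  LSeries.abscissaOfAbsConv (formalZeta G) = (σ : EReal)

/-- If `f` is the formal Dirichlet series `∑ f(m) m^{-s}`, then `dilate k f` is the series
`∑ f(m) m^{-ks}`, i.e. `f` with `s` replaced by `k s` (for `k ≥ 1`). -/
def dilate (k : ℕ) (f : ArithmeticFunction ℂ) : ArithmeticFunction ℂ :=
  ⟨fun n => ∑ m ∈ (Finset.range (n + 1)).filter (fun m => m ^ k = n), f m, by
    rw [Finset.sum_filter]; simp⟩

/-- The one-term formal Dirichlet series `n^{-s}`, for `n ≥ 1`. -/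
def monoSeries (n : ℕ) : ArithmeticFunction ℂ :=
  ⟨fun m => if m ≠ 0 ∧ m = n then 1 else 0, by simp⟩

/-! ### Permutational wreath products -/

/-- The permutational wreath product `H ≀_X Q = H^X ⋊ Q`. -/
@[ext]
structure PermWreath (H : Type u) (Q : Type v) (X : Type w) where
  /-- the component in `H^X` -/
  base : X → H
  /-- the component in `Q` -/
  top : Q

namespace PermWreath

set_option linter.unusedSectionVars false

variable {H : Type u} {Q : Type v} {X : Type w} [Group H] [Group Q] [MulAction Q X]

/-- `(b, q) (b', q') = (b · (q b'), q q')`, where `(q b')(x) = b'(q⁻¹ x)`. -/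
instance : Mul (PermWreath H Q X) where
  mul g h := ⟨fun x => g.base x * h.base (g.top⁻¹ • x), g.top * h.top⟩

instance : One (PermWreath H Q X) where
  one := ⟨fun _ => 1, 1⟩

instance : Inv (PermWreath H Q X) where
  inv g := ⟨fun x => (g.base (g.top • x))⁻¹, g.top⁻¹⟩

@[simp] theorem mul_base (g h : PermWreath H Q X) (x : X) :
    (g * h).base x = g.base x * h.base (g.top⁻¹ • x) := rfl
@[simp] theorem mul_top (g h : PermWreath H Q X) : (g * h).top = g.top * h.top := rfl
@[simp] theorem one_base (x : X) : (1 : PermWreath H Q X).base x = 1 := rfl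
@[simp] theorem one_top : (1 : PermWreath H Q X).top = 1 := rfl
@[simp] theorem inv_base (g : PermWreath H Q X) (x : X) :
    (g⁻¹).base x = (g.base (g.top • x))⁻¹ := rfl
@[simp] theorem inv_top (g : PermWreath H Q X) : (g⁻¹).top = g.top⁻¹ := rfl

instance group : Group (PermWreath H Q X) where
  mul_assoc a b c := by ext <;> simp [mul_assoc, mul_smul]
  one_mul a := by ext <;> simp
  mul_one a := by ext <;> simp
  inv_mul_cancel a := by ext <;> simp

/-- The topology of the wreath product: the product of the product topology on `H^X` and the
discrete topology on `Q` (so that `H^X` is an open subgroup with its product topology). -/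
instance [TopologicalSpace H] : TopologicalSpace (PermWreath H Q X) :=
  TopologicalSpace.induced PermWreath.base inferInstance ⊓
    TopologicalSpace.induced PermWreath.top ⊥

end PermWreath

/-! ### Iterated wreath products and their inverse limit -/

/-- `W(Q, 0) = 1` and `W(Q, k + 1) = W(Q, k) ≀_X Q`. -/
def IterWreath (Q : Type u) (X : Type v) : ℕ → Type (max u v)
  | 0 => PUnit
  | k + 1 => PermWreath (IterWreath Q X k) Q X

instance IterWreath.group (Q : Type u) (X : Type v) [instQ : Group Q] [instX : MulAction Q X] :
    ∀ k, Group (IterWreath Q X k)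
  | 0 => (inferInstance : Group PUnit)
  | k + 1 => @PermWreath.group (IterWreath Q X k) Q X (IterWreath.group Q X k) instQ instX

/-- Applying a homomorphism `f : H → H'` to all coordinates of the base gives a homomorphism
`H ≀_X Q → H' ≀_X Q`. -/
def PermWreath.map {H : Type u} {H' : Type v} {Q : Type w} {X : Type*} [Group H] [Group H']
    [Group Q] [MulAction Q X] (f : H →* H') : PermWreath H Q X →* PermWreath H' Q X where
  toFun g := ⟨fun x => f (g.base x), g.top⟩
  map_one' := by ext <;> simp
  map_mul' a b := by ext <;> simp

/-- The natural epimorphism `W(Q, k + 1) → W(Q, k)` which forgets the deepest level: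
`W(Q, 1) → 1` for `k = 0`, and `(b, q) ↦ (x ↦ p_k (b x), q)` for `p_{k+1}`. -/
def IterWreath.proj (Q : Type u) (X : Type v) [Group Q] [MulAction Q X] :
    ∀ k, IterWreath Q X (k + 1) →* IterWreath Q X k
  | 0 => 1
  | k + 1 => PermWreath.map (Q := Q) (X := X) (IterWreath.proj Q X k)

/-- The profinite group `W(Q) = lim_k W(Q, k)`, as a subgroup of `∏_k W(Q, k)`. -/
def ProfWreath (Q : Type u) (X : Type v) [Group Q] [MulAction Q X] :
    Subgroup (∀ k, IterWreath Q X k) where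
  carrier := {g | ∀ k, IterWreath.proj Q X k (g (k + 1)) = g k}
  mul_mem' := fun ha hb k => by rw [Pi.mul_apply, map_mul, ha k, hb k, Pi.mul_apply]
  one_mem' := fun k => by rw [Pi.one_apply, map_one, Pi.one_apply]
  inv_mem' := fun ha k => by rw [Pi.inv_apply, map_inv, ha k, Pi.inv_apply]

/-- The inverse limit topology: the coarsest one making every projection to a (discrete) group
`W(Q, k)` continuous. -/
instance ProfWreath.topologicalSpace (Q : Type u) (X : Type v) [Group Q] [MulAction Q X] :
    TopologicalSpace (ProfWreath Q X) :=
  ⨅ k, TopologicalSpace.induced (fun g : ProfWreath Q X => g.1 k) ⊥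

/-! ### The three permutation groups -/

instance factPrimeFive : Fact (Nat.Prime 5) := ⟨Nat.prime_five⟩

/-- `A_5`, acting on the five points of `Fin 5`. -/
abbrev A5 : Type := alternatingGroup (Fin 5)

/-- `PSL_2(𝔽_5)`. -/
abbrev PSL25 : Type := Matrix.ProjectiveSpecialLinearGroup (Fin 2) (ZMod 5)

/-- The projective line over `𝔽_5` (six points), on which `PSL_2(𝔽_5)` acts naturally. -/
abbrev Line5 : Type := ℙ (ZMod 5) (Fin 2 → ZMod 5)

/-- `PGL_3(𝔽_2)`. -/
abbrev PGL32 : Type := Matrix.ProjGenLinGroup (Fin 3) (ZMod 2)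

/-- The projective plane over `𝔽_2` (seven points), on which `PGL_3(𝔽_2)` acts naturally. -/
abbrev Plane2 : Type := ℙ (ZMod 2) (Fin 3 → ZMod 2)

/-! ### The formulas

Each right-hand side below is a polynomial expression with rational coefficients in quantities
`z k`, standing for `ζ_H(k s)`, and `q n`, standing for `n^{-s}`. It can be read in `ℂ` (values at
a complex number `s`) or in the ring of formal Dirichlet series. -/

section Formulas

variable {R : Type} [CommRing R] [Algebra ℚ R]

/-- `n^{-1-s}`, given `q n = n^{-s}`. -/
def shift (q : ℕ → R) (n : ℕ) : R := (1 / n : ℚ) • q n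

/-- Right-hand side of the formula for `ζ(H ≀_5 A_5, s)`. -/
def rhsA5 (z q : ℕ → R) : R :=
  shift q 60 * z 1 ^ 5
  + (shift q 20 * 30 - shift q 60 * 10) * (z 1 ^ 2 * z 3)
  + (shift q 30 * 30 - shift q 60 * 15) * (z 1 * z 2 ^ 2)
  + (shift q 5 * (3 + q 3) * 5 - shift q 20 * 60 - shift q 30 * 30 + shift q 60 * 30)
      * (z 1 * z 4)
  + (shift q 10 * (2 + q 2) * 10 - shift q 20 * 30 - shift q 30 * 60 + shift q 60 * 30)
      * (z 2 * z 3)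
  + (1 + 2 * q 3 + q 4 + q 5 - shift q 5 * (3 + q 3) * 5 - shift q 10 * (2 + q 2) * 10
      + shift q 20 * 60 + shift q 30 * 60 - shift q 60 * 36) * z 5

/-- Right-hand side of the formula for `ζ(H ≀_6 PSL_2(𝔽_5), s)`. -/
def rhsPSL25 (z q : ℕ → R) : R :=
  shift q 60 * z 1 ^ 6
  + (q 30 - (1 / 4 : ℚ) • q 60) * (z 1 ^ 2 * z 2 ^ 2)
  + (2 * q 6 + 2 * q 12 - 2 * q 30 + (2 / 5 : ℚ) • q 60) * (z 1 * z 5)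
  + ((4 / 3 : ℚ) • q 15 - q 30 + (1 / 6 : ℚ) • q 60) * z 2 ^ 3
  + (2 * q 10 + q 20 - 2 * q 30 + (1 / 3 : ℚ) • q 60) * z 3 ^ 2
  + (1 + 2 * q 3 + q 4 + q 5 - 2 * q 6 - 2 * q 10 - 2 * q 12 - (4 / 3 : ℚ) • q 15
      - q 20 + 4 * q 30 - (2 / 3 : ℚ) • q 60) * z 6

/-- Right-hand side of the formula for `ζ(H ≀_7 PGL_3(𝔽_2), s)`. -/
def rhsPGL32 (z q : ℕ → R) : R :=
  (1 / 168 : ℚ) • q 168 * z 1 ^ 7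
  + ((1 / 2 : ℚ) • q 84 - (1 / 8 : ℚ) • q 168) * (z 1 ^ 3 * z 2 ^ 2)
  + ((2 / 3 : ℚ) • q 42 - (1 / 2 : ℚ) • q 84 + (1 / 12 : ℚ) • q 168) * (z 1 ^ 3 * z 4)
  + ((2 / 3 : ℚ) • q 42 - (1 / 2 : ℚ) • q 84 + (1 / 12 : ℚ) • q 168) * (z 1 * z 2 ^ 3)
  + (4 * q 21 - 3 * q 42 + (1 / 2 : ℚ) • q 84) * (z 1 * z 2 * z 4)
  + (2 * q 28 + q 56 - 2 * q 84 + (1 / 3 : ℚ) • q 168) * (z 1 * z 3 ^ 2)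
  + (2 * q 7 + q 14 - 2 * q 21 - 2 * q 28 + (1 / 3 : ℚ) • q 42 - q 56 + 2 * q 84
      - (1 / 3 : ℚ) • q 168) * (z 1 * z 6 + z 3 * z 4)
  + (1 + 2 * q 3 + q 6 - 3 * q 7 + q 8 - 2 * q 14 + 2 * q 28 + q 42 + q 56
      - 2 * q 84 + (2 / 7 : ℚ) • q 168) * z 7

/-- Right-hand side of the functional equation of `ζ(s) = ζ(W(A_5), s)`. -/
def rhsFunctionalEquation (z q : ℕ → R) : R :=
  shift q 60 * (z 1 ^ 5 - 10 * (z 1 ^ 2 * z 3) - 15 * (z 1 * z 2 ^ 2)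
      + 30 * (z 2 * z 3) + 30 * (z 1 * z 4) - 36 * z 5)
  + 15 * shift q 30 * 2 * (z 1 * z 2 ^ 2 - 2 * (z 2 * z 3) - z 1 * z 4 + 2 * z 5)
  + 10 * shift q 20 * 3 * (z 1 ^ 2 * z 3 - z 2 * z 3 - 2 * (z 1 * z 4) + 2 * z 5)
  + 10 * shift q 10 * (2 + q 2) * (z 2 * z 3 - z 5)
  + 5 * shift q 5 * (3 + q 3) * (z 1 * z 4 - z 5)
  + (1 + 2 * q 3 + q 4 + q 5) * z 5

end Formulas

/-! ### Puiseux expansions in a square root -/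

/-- Near `σ`, the function `f` on `{Re s > σ}` has a Puiseux expansion in `√(s - σ)`:
`f(s) = ∑_{n ≥ 0} a_n (s - σ)^{n/2}` (principal branch), with some `a_n ≠ 0`, `n` odd, so that the
expansion really involves the square root. -/
def HasSqrtPuiseux (f : ℂ → ℂ) (σ : ℝ) : Prop :=
  ∃ (a : ℕ → ℂ) (ε : ℝ), 0 < ε ∧ (∃ n, Odd n ∧ a n ≠ 0) ∧
    ∀ s : ℂ, σ < s.re → ‖s - σ‖ < ε →
      HasSum (fun n : ℕ => a n * (s - σ) ^ ((n : ℂ) / 2)) (f s)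

end RepZeta

open RepZeta

/-! The formulas come from Clifford theory. Let `f : X → Irr H` have stabilizer `Q_f` in `Q`. The
representation `⊗ σ_{f x}` of `H^X` extends to `H^X ⋊ Q_f`, because `Q_f` only permutes equal tensor
factors. The irreducible representations of `H ≀_X Q` over the orbit of `f` therefore correspond to
the irreducible representations `χ` of `Q_f`, with degree `[Q : Q_f] · ∏ deg σ_{f x} · deg χ`
(`nonempty_constituentClasses_equiv`). An orbit has `[Q : Q_f]` members, so `ζ(H ≀_X Q, s) = ∑_f [Q
: Q_f]^{-1-s} ζ(Q_f, s) ∏_x (deg σ_{f x})^{-s}`; only finitely many `f` matter below a given degree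
(`exists_wreath_count`).

The weight in front of the product depends only on the partition of `X` into the fibres of `f`.
Möbius inversion writes it as a sum of coefficients, one for each orbit partition of a stabilizer
that refines the fibre partition. Summing over all `f` constant on the blocks of a fixed partition
gives `∏_B ζ_H(|B| s)`, and these products are the monomials of the formulas
(`rigid_and_formalZeta_eq`). What remains is a finite verification over the partitions of 5, 6 or 7
points, together with the degrees of the stabilizers. These degrees follow from the order and the
class number, since their squares sum to the order. Only the full group of order 168 needs more.

No induced module is built in order to set up the correspondence. The density theorem gives elements
of the group algebra of `H` that act as matrix units on the finitely many relevant `σ_c`. Their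
tensor products act on `V`, and the image of a diagonal unit is a corner of `V` on which `Q_f` acts.
Passing to the corner is the correspondence; `bigRep` shows that every `χ` occurs.

For `W(Q)`, every term on the right other than `ζ(m s)` contains a factor `n^{-s}` with `n ≥ 2`. The
first `N + 1` coefficients on the right are therefore determined by the first `N` of `ζ_H`
(`EqUpTo.formulaValue_succ`). The coefficients of `W(Q, k)` stabilize, and every continuous
irreducible representation of `W(Q)` factors through some level because `GL_n(ℂ)` has no small
subgroups (`inflateClass_bijective`). Hence the limit satisfies the functional equation.

The same recursion bounds the partial sums far to the right, so the abscissa is finite. At real `s ≥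
0` of convergence `ζ(k s) ≤ ζ(s)`, and `ζ(s)^m` is the only monomial of top degree, with positive
coefficient. So `ζ` stays bounded, and the series converges at its abscissa. If the abscissa were
not positive, the equation at `s = 0` would have a real solution `x ≥ 1`, and it has none
(`exists_pos_abscissa`).

Near the abscissa `σ₀ > 0` the functions `ζ(k s)`, `k ≥ 2`, are analytic, so `ζ` is a root of a
polynomial with analytic coefficients. By Landau's theorem (`not_analytic_continuation`) it is not
analytic at `σ₀`, so the first derivative of the polynomial vanishes there. The second derivative is
positive. Hence `ζ` is an analytic function of `√(s - σ₀)`, and some odd coefficient is nonzero,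
since otherwise `ζ` would continue (`hasSqrtPuiseux_of_polynomial`). -/

namespace RepZeta

open Representation

universe u v w

set_option linter.unusedSectionVars false

/-! ### Irreducibility through stable subspaces, continuity through matrix coefficients -/

section Basics

variable {G : Type u} [Group G] {V : Type v} [AddCommGroup V] [Module ℂ V]
  {W : Type w} [AddCommGroup W] [Module ℂ W]

/-- A submodule which is stable under a representation. -/
def IsStable (ρ : Representation ℂ G V) (U : Submodule ℂ V) : Prop :=
  ∀ g, ∀ v ∈ U, ρ g v ∈ U

theorem isIrreducible_iff (ρ : Representation ℂ G V) :
    ρ.IsIrreducible ↔ Nontrivial V ∧ ∀ U, IsStable ρ U → U = ⊥ ∨ U = ⊤ := by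
  constructor
  · intro h
    refine ⟨?_, fun U hU => ?_⟩
    · obtain ⟨a, b, hab⟩ := h.toNontrivial
      by_contra hn
      rw [not_nontrivial_iff_subsingleton] at hn
      apply hab
      apply Subrepresentation.toSubmodule_injective
      exact Subsingleton.elim _ _
    · have h2 := @IsSimpleOrder.eq_bot_or_eq_top _ _ _ h
        (⟨U, fun g v hv => hU g v hv⟩ : Subrepresentation ρ)
      rcases h2 with h | h
      · left; exact congrArg Subrepresentation.toSubmodule h
      · right; exact congrArg Subrepresentation.toSubmodule h
  · rintro ⟨hn, h⟩
    have : Nontrivial (Subrepresentation ρ) := by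
      refine ⟨⊥, ⊤, fun hbt => ?_⟩
      have h2 : (⊥ : Submodule ℂ V) = ⊤ := congrArg Subrepresentation.toSubmodule hbt
      exact bot_ne_top h2
    refine ⟨fun U => ?_⟩
    rcases h U.toSubmodule (fun g v hv => U.apply_mem_toSubmodule g hv) with h | h
    · left; exact Subrepresentation.toSubmodule_injective h
    · right; exact Subrepresentation.toSubmodule_injective h

theorem IsStable.asAlgebraHom_mem {ρ : Representation ℂ G V} {U : Submodule ℂ V}
    (h : IsStable ρ U) (α : MonoidAlgebra ℂ G) {v : V} (hv : v ∈ U) :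
    ρ.asAlgebraHom α v ∈ U := by
  induction α using MonoidAlgebra.induction_linear with
  | zero => simp
  | add x y hx hy => rw [map_add]; exact U.add_mem hx hy
  | single g a => rw [asAlgebraHom_single]; exact U.smul_mem _ (h g v hv)

/-- The restriction of a representation to a stable submodule. -/
def IsStable.subrep {ρ : Representation ℂ G V} {U : Submodule ℂ V} (h : IsStable ρ U) :
    Representation ℂ G U where
  toFun g := (ρ g).restrict (fun v hv => h g v hv)
  map_one' := by ext; simp
  map_mul' a b := by ext; simp

@[simp] theorem IsStable.subrep_apply {ρ : Representation ℂ G V} {U : Submodule ℂ V}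
    (h : IsStable ρ U) (g : G) (u : U) : (h.subrep g u : V) = ρ g u := rfl

theorem IsStable.subrep_asAlgebraHom {ρ : Representation ℂ G V} {U : Submodule ℂ V}
    (h : IsStable ρ U) (α : MonoidAlgebra ℂ G) (u : U) :
    (h.subrep.asAlgebraHom α u : V) = ρ.asAlgebraHom α u := by
  induction α using MonoidAlgebra.induction_linear with
  | zero => simp
  | add x y hx hy => simp [hx, hy]
  | single g a => simp [asAlgebraHom_single]

theorem IsStable.isIrreducible_subrep {ρ : Representation ℂ G V} {U : Submodule ℂ V}
    (h : IsStable ρ U) :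
    h.subrep.IsIrreducible ↔ U ≠ ⊥ ∧ ∀ U' ≤ U, IsStable ρ U' → U' = ⊥ ∨ U' = U := by
  rw [isIrreducible_iff, Submodule.nontrivial_iff_ne_bot]
  refine and_congr Iff.rfl ⟨fun H U' hle hU' => ?_, fun H U' hU' => ?_⟩
  · rcases H (U'.comap U.subtype) (fun g v hv => hU' g _ hv) with h1 | h1
    · left
      rw [eq_bot_iff]
      intro v hv
      have : (⟨v, hle hv⟩ : U) ∈ U'.comap U.subtype := hv
      rw [h1] at this
      simpa using this
    · right
      refine le_antisymm hle fun v hv => ?_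
      have : (⟨v, hv⟩ : U) ∈ U'.comap U.subtype := by rw [h1]; trivial
      exact this
  · rcases H (U'.map U.subtype) (Submodule.map_subtype_le _ _) (by
      rintro g _ ⟨v, hv, rfl⟩
      exact ⟨h.subrep g v, hU' g v hv, rfl⟩) with h1 | h1
    · left
      exact Submodule.map_injective_of_injective U.injective_subtype (by rw [h1, Submodule.map_bot])
    · right
      apply Submodule.map_injective_of_injective U.injective_subtype
      rw [h1]; simp

theorem exists_irreducible_le [FiniteDimensional ℂ V] {ρ : Representation ℂ G V}
    {U : Submodule ℂ V} (hU : IsStable ρ U) (hne : U ≠ ⊥) :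
    ∃ U' ≤ U, ∃ h : IsStable ρ U', h.subrep.IsIrreducible := by
  induction hn : Module.finrank ℂ U using Nat.strong_induction_on generalizing U with
  | _ n ih =>
    by_cases hirr : hU.subrep.IsIrreducible
    · exact ⟨U, le_rfl, hU, hirr⟩
    · rw [hU.isIrreducible_subrep] at hirr
      push Not at hirr
      obtain ⟨U', hle, hst, hne', hneU⟩ := hirr hne
      have hlt : U' < U := lt_of_le_of_ne hle hneU
      obtain ⟨U'', h1, h2⟩ := ih _ (hn ▸ Submodule.finrank_lt_finrank_of_lt hlt) hst hne' rfl
      exact ⟨U'', h1.trans hle, h2⟩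

/-- All matrix coefficients of the representation are continuous. -/
def HasContCoeff [TopologicalSpace G] (ρ : Representation ℂ G V) : Prop :=
  ∀ (v : V) (l : Module.Dual ℂ V), Continuous fun g => l (ρ g v)

/-- Matrix coefficients need no topology on the space, so continuity passes to stable subspaces and
corners; on `ℂⁿ` they give back the orbit maps. -/
theorem hasContCoeff_iff [TopologicalSpace G] {n : ℕ} (ρ : Representation ℂ G (Fin n → ℂ)) :
    HasContCoeff ρ ↔ ∀ v, Continuous fun g => ρ g v := by
  refine ⟨fun h v => continuous_pi fun i => h v (LinearMap.proj i), fun h v l => ?_⟩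
  exact (LinearMap.continuous_of_finiteDimensional l).comp (h v)

/-- A linear retraction of `f` extends every functional on `V` to one on `W`. -/
theorem HasContCoeff.of_injective [TopologicalSpace G] {ρ : Representation ℂ G V}
    {σ : Representation ℂ G W} (h : HasContCoeff σ) (f : V →ₗ[ℂ] W)
    (hf : Function.Injective f) (hc : ∀ g v, f (ρ g v) = σ g (f v)) : HasContCoeff ρ := by
  intro v l
  obtain ⟨k, hk⟩ := LinearMap.exists_leftInverse_of_injective f (LinearMap.ker_eq_bot.2 hf)
  have := h (f v) (l ∘ₗ k)
  refine this.congr fun g => ?_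
  rw [LinearMap.comp_apply, ← hc, ← LinearMap.comp_apply k f, hk, LinearMap.id_apply]

theorem HasContCoeff.subrep [TopologicalSpace G] {ρ : Representation ℂ G V}
    (h : HasContCoeff ρ) {U : Submodule ℂ V} (hU : IsStable ρ U) : HasContCoeff hU.subrep :=
  h.of_injective U.subtype U.injective_subtype fun _ _ => rfl

theorem equiv_apply {ρ : Representation ℂ G V} {σ : Representation ℂ G W}
    (e : ρ.Equiv σ) (g : G) (v : V) : e (ρ g v) = σ g (e v) :=
  congrArg (fun l => l v) (e.isIntertwining' g)

theorem isIrreducible_of_equiv {ρ : Representation ℂ G V} {σ : Representation ℂ G W}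
    (e : ρ.Equiv σ) (h : ρ.IsIrreducible) : σ.IsIrreducible := by
  rw [isIrreducible_iff] at h ⊢
  obtain ⟨hn, H⟩ := h
  refine ⟨e.toLinearEquiv.symm.toEquiv.nontrivial, fun U hU => ?_⟩
  have h1 := H (U.comap e.toLinearEquiv.toLinearMap) (fun g v hv => by
    have h2 := hU g _ hv
    have h3 : e (ρ g v) = σ g (e v) := equiv_apply e g v
    change e (ρ g v) ∈ U
    rw [h3]; exact h2)
  rcases h1 with h1 | h1
  · left
    rw [eq_bot_iff]
    intro w hw
    have : e.toLinearEquiv.symm w ∈ U.comap e.toLinearEquiv.toLinearMap := by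
      change e.toLinearEquiv (e.toLinearEquiv.symm w) ∈ U
      rwa [LinearEquiv.apply_symm_apply]
    rw [h1, Submodule.mem_bot] at this
    exact (LinearEquiv.map_eq_zero_iff _).1 this
  · right
    rw [eq_top_iff]
    intro w _
    have : e.toLinearEquiv.symm w ∈ U.comap e.toLinearEquiv.toLinearMap := by rw [h1]; trivial
    have h4 : e.toLinearEquiv (e.toLinearEquiv.symm w) ∈ U := this
    rwa [LinearEquiv.apply_symm_apply] at h4

/-- Every finite-dimensional irreducible representation with continuous coefficients is equivalent
to one on some `ℂⁿ`. -/
theorem exists_irrep_equiv [TopologicalSpace G] [FiniteDimensional ℂ V]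
    {ρ : Representation ℂ G V} (hirr : ρ.IsIrreducible) (hc : HasContCoeff ρ) {n : ℕ}
    (hn : Module.finrank ℂ V = n) : ∃ σ : Irrep G n, Nonempty (ρ.Equiv σ.1) := by
  let b : V ≃ₗ[ℂ] (Fin n → ℂ) := LinearEquiv.ofFinrankEq _ _ (by simp [hn])
  let σ : Representation ℂ G (Fin n → ℂ) :=
    { toFun := fun g => b.conj (ρ g)
      map_one' := by ext; simp [LinearEquiv.conj_apply]
      map_mul' := fun g h => by ext; simp [LinearEquiv.conj_apply] }
  have hσ : ∀ g v, σ g v = b (ρ g (b.symm v)) := fun g v => rfl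
  let e : ρ.Equiv σ := Representation.Equiv.mk b (fun g => by ext v; simp [hσ])
  refine ⟨⟨σ, isIrreducible_of_equiv e hirr, ?_⟩, ⟨e⟩⟩
  rw [← hasContCoeff_iff]
  refine hc.of_injective b.symm.toLinearMap b.symm.injective fun g v => ?_
  simp [hσ]

theorem finrank_eq_of_equiv {ρ : Representation ℂ G V} {σ : Representation ℂ G W}
    (e : ρ.Equiv σ) : Module.finrank ℂ V = Module.finrank ℂ W := e.toLinearEquiv.finrank_eq

theorem equiv_asAlgebraHom {ρ : Representation ℂ G V} {σ : Representation ℂ G W}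
    (e : ρ.Equiv σ) (α : MonoidAlgebra ℂ G) (v : V) :
    e (ρ.asAlgebraHom α v) = σ.asAlgebraHom α (e v) := by
  induction α using MonoidAlgebra.induction_linear with
  | zero => simp
  | add x y hx hy => simp [hx, hy]
  | single g a =>
    simp only [asAlgebraHom_single, LinearMap.smul_apply, map_smul]
    rw [equiv_apply]

/-- Irreducible representations which have isomorphic nonzero corners under an idempotent are
equivalent. -/
theorem nonempty_equiv_of_corner {ρ : Representation ℂ G V} {σ : Representation ℂ G W}
    (hρ : ρ.IsIrreducible) (hσ : σ.IsIrreducible) (a : MonoidAlgebra ℂ G)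
    (A : Submodule ℂ V) (hA : A ≠ ⊥) (f : A →ₗ[ℂ] W) (hfi : Function.Injective f)
    (haf : ∀ v : A, σ.asAlgebraHom a (f v) = f v) (hav : ∀ v : A, ρ.asAlgebraHom a v = v)
    (hf : ∀ (g : G) (v : A), ∃ w : A, ρ.asAlgebraHom a (ρ g v) = w ∧
      σ.asAlgebraHom a (σ g (f v)) = f w) :
    Nonempty (ρ.Equiv σ) := by
  classical
  rw [isIrreducible_iff] at hρ hσ
  -- The stable subspace generated by the graph of `f`. It turns out to be the graph of an
  -- isomorphism.
  let D : Submodule ℂ (V × W) := Submodule.span ℂ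
    {p | ∃ (g : G) (v : A), p = (ρ g v, σ g (f v))}
  have hD : ∀ g : G, ∀ p ∈ D, (ρ g p.1, σ g p.2) ∈ D := by
    intro g p hp
    induction hp using Submodule.span_induction with
    | mem p hp =>
      obtain ⟨k, v, rfl⟩ := hp
      exact Submodule.subset_span ⟨g * k, v, by simp⟩
    | zero =>
      simp only [Prod.fst_zero, Prod.snd_zero, map_zero]
      exact D.zero_mem
    | add p q _ _ hp hq => simpa using D.add_mem hp hq
    | smul c p _ hp => simpa using D.smul_mem c hp
  -- The element `a` compresses all of `D` back into the graph of `f`, so `D` is not too large.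
  have hDa : ∀ p ∈ D, ∃ w : A, ρ.asAlgebraHom a p.1 = w ∧ σ.asAlgebraHom a p.2 = f w := by
    intro p hp
    induction hp using Submodule.span_induction with
    | mem p hp =>
      obtain ⟨k, v, rfl⟩ := hp
      exact hf k v
    | zero => exact ⟨0, by simp⟩
    | add p q _ _ hp hq =>
      obtain ⟨w, h1, h2⟩ := hp
      obtain ⟨w', h1', h2'⟩ := hq
      exact ⟨w + w', by simp [h1, h1'], by simp [h2, h2']⟩
    | smul c p _ hp =>
      obtain ⟨w, h1, h2⟩ := hp
      exact ⟨c • w, by simp [h1], by simp [h2]⟩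
  obtain ⟨v0, hv0, hv0n⟩ := Submodule.exists_mem_ne_zero_of_ne_bot hA
  have hv0' : f ⟨v0, hv0⟩ ≠ 0 := fun h => hv0n (by
    have := hfi (h.trans (map_zero f).symm); simpa using congrArg Subtype.val this)
  have hgraph : ∀ v : A, ((v : V), f v) ∈ D := fun v =>
    Submodule.subset_span ⟨1, v, by simp⟩
  -- By irreducibility `D` meets the factor `W` in zero or contains it. In the second case `(0, f
  -- v0)` lies in `D`; it is fixed by `a` but is not on the graph of `f`.
  have h1 : D.comap (LinearMap.inr ℂ V W) = ⊥ := by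
    rcases hσ.2 (D.comap (LinearMap.inr ℂ V W)) (fun g w hw => by
      have := hD g _ hw; simpa using this) with h | h
    · exact h
    · exfalso
      have : f ⟨v0, hv0⟩ ∈ D.comap (LinearMap.inr ℂ V W) := by rw [h]; trivial
      obtain ⟨w, hw1, hw2⟩ := hDa _ this
      simp only [LinearMap.coe_inr, map_zero] at hw1 hw2
      rw [haf] at hw2
      apply hv0'
      rw [hw2, show w = 0 from Subtype.ext hw1.symm, map_zero]
  have h2 : D.comap (LinearMap.inl ℂ V W) = ⊥ := by
    rcases hρ.2 (D.comap (LinearMap.inl ℂ V W)) (fun g w hw => by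
      have := hD g _ hw; simpa using this) with h | h
    · exact h
    · exfalso
      have : v0 ∈ D.comap (LinearMap.inl ℂ V W) := by rw [h]; trivial
      obtain ⟨w, hw1, hw2⟩ := hDa _ this
      simp only [LinearMap.coe_inl, map_zero] at hw1 hw2
      rw [hav ⟨v0, hv0⟩] at hw1
      have : w = 0 := hfi (by rw [← hw2, map_zero])
      exact hv0n (hw1.trans (by rw [this]; rfl))
  have h3 : D.map (LinearMap.fst ℂ V W) = ⊤ := by
    rcases hρ.2 (D.map (LinearMap.fst ℂ V W)) (by
      rintro g _ ⟨p, hp, rfl⟩; exact ⟨_, hD g p hp, rfl⟩) with h | h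
    · exfalso
      have : v0 ∈ D.map (LinearMap.fst ℂ V W) := ⟨_, hgraph ⟨v0, hv0⟩, rfl⟩
      rw [h] at this; exact hv0n (by simpa using this)
    · exact h
  have h4 : D.map (LinearMap.snd ℂ V W) = ⊤ := by
    rcases hσ.2 (D.map (LinearMap.snd ℂ V W)) (by
      rintro g _ ⟨p, hp, rfl⟩; exact ⟨_, hD g p hp, rfl⟩) with h | h
    · exfalso
      have : f ⟨v0, hv0⟩ ∈ D.map (LinearMap.snd ℂ V W) := ⟨_, hgraph ⟨v0, hv0⟩, rfl⟩
      rw [h] at this; exact hv0' (by simpa using this)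
    · exact h
  let p1 : D →ₗ[ℂ] V := LinearMap.fst ℂ V W ∘ₗ D.subtype
  let p2 : D →ₗ[ℂ] W := LinearMap.snd ℂ V W ∘ₗ D.subtype
  have hp1 : Function.Bijective p1 := by
    constructor
    · rw [injective_iff_map_eq_zero]
      rintro ⟨⟨v, w⟩, hp⟩ h0
      change v = 0 at h0
      subst h0
      have : w ∈ D.comap (LinearMap.inr ℂ V W) := hp
      rw [h1] at this
      have hw : w = 0 := by simpa using this
      subst hw; rfl
    · intro v
      have : v ∈ D.map (LinearMap.fst ℂ V W) := by rw [h3]; trivial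
      obtain ⟨p, hp, rfl⟩ := this
      exact ⟨⟨p, hp⟩, rfl⟩
  have hp2 : Function.Bijective p2 := by
    constructor
    · rw [injective_iff_map_eq_zero]
      rintro ⟨⟨v, w⟩, hp⟩ h0
      change w = 0 at h0
      subst h0
      have : v ∈ D.comap (LinearMap.inl ℂ V W) := hp
      rw [h2] at this
      have hw : v = 0 := by simpa using this
      subst hw; rfl
    · intro v
      have : v ∈ D.map (LinearMap.snd ℂ V W) := by rw [h4]; trivial
      obtain ⟨p, hp, rfl⟩ := this
      exact ⟨⟨p, hp⟩, rfl⟩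
  let e1 := LinearEquiv.ofBijective p1 hp1
  let e2 := LinearEquiv.ofBijective p2 hp2
  refine ⟨Representation.Equiv.mk (e1.symm.trans e2) (fun g => ?_)⟩
  ext v
  obtain ⟨d, rfl⟩ := e1.surjective v
  have h5 : e1 ⟨_, hD g _ d.2⟩ = ρ g (e1 d) := rfl
  have h6 : e2 ⟨_, hD g _ d.2⟩ = σ g (e2 d) := rfl
  simp only [LinearMap.comp_apply, LinearEquiv.coe_coe, LinearEquiv.trans_apply,
    LinearEquiv.symm_apply_apply]
  rw [← h5, LinearEquiv.symm_apply_apply, h6]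

end Basics

/-! ### Matrix units in the group algebra from the density theorem -/

section Density

variable {H : Type u} [Group H] {C : Type v} [Fintype C] [DecidableEq C] {n : C → ℕ}
  (σ : ∀ c, Representation ℂ H (Fin (n c) → ℂ))

/-- The matrix of an element of the group algebra on the direct sum of a family of
representations. -/
noncomputable def sumMatrix :
    MonoidAlgebra ℂ H →+* Matrix (Σ c, Fin (n c)) (Σ c, Fin (n c)) ℂ :=
  (Matrix.blockDiagonal'RingHom (fun c => Fin (n c)) ℂ).comp
    (RingHom.pi fun c => ((LinearMap.toMatrixAlgEquiv' (R := ℂ) (n := Fin (n c))).toAlgHom.comp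
      (σ c).asAlgebraHom).toRingHom)

theorem sumMatrix_apply (α : MonoidAlgebra ℂ H) : sumMatrix σ α =
    Matrix.blockDiagonal' fun c => LinearMap.toMatrix' ((σ c).asAlgebraHom α) := rfl

theorem sumMatrix_apply_ne (α : MonoidAlgebra ℂ H) {j k : Σ c, Fin (n c)} (h : j.1 ≠ k.1) :
    sumMatrix σ α j k = 0 := by
  rw [sumMatrix_apply, Matrix.blockDiagonal'_apply, dif_neg h]

theorem sumMatrix_smul (z : ℂ) (α : MonoidAlgebra ℂ H) :
    sumMatrix σ (z • α) = z • sumMatrix σ α := by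
  rw [sumMatrix_apply, sumMatrix_apply, ← Matrix.blockDiagonal'_smul]
  congr 1
  ext c : 1
  simp

theorem sumMatrix_eq_zero_iff (α : MonoidAlgebra ℂ H) :
    sumMatrix σ α = 0 ↔ ∀ c, (σ c).asAlgebraHom α = 0 := by
  rw [sumMatrix_apply, ← Matrix.blockDiagonal'_zero, Matrix.blockDiagonal'_inj]
  constructor
  · intro h c
    have := congrFun h c
    simpa using this
  · intro h; funext c; simp [h c]

/-- The direct sum of a family of representations, as a module over the group algebra. -/
abbrev SumModule : Type v := ∀ c, (σ c).asModule

/-- By Schur's lemma an endomorphism of a sum of pairwise inequivalent irreducible modules is a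
scalar on each summand. It therefore commutes with every blockwise linear map, in particular with
the matrix unit `F`. Jacobson density then realizes `F` on a finite set by an element of the group
algebra. -/
theorem exists_sumMatrix_eq_single (hσ : ∀ c, (σ c).IsIrreducible)
    (hne : ∀ c c', c ≠ c' → (σ c).Equiv (σ c') → False) (c : C) (j k : Fin (n c)) :
    ∃ α, sumMatrix σ α = Matrix.single ⟨c, j⟩ ⟨c, k⟩ 1 := by
  classical
  have := fun c => hσ c
  let F : (SumModule σ) → (SumModule σ) := fun x => Pi.single c ((σ c).asModuleEquiv.symm
    (Pi.single j ((σ c).asModuleEquiv (x c) k)))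
  have hFadd : ∀ x y, F (x + y) = F x + F y := by
    intro x y
    have : (x + y) c = x c + y c := rfl
    simp only [F, this, map_add, Pi.single_add, Pi.add_apply]
  have hcomm : ∀ (φ : Module.End (MonoidAlgebra ℂ H) (SumModule σ)) (x : (SumModule σ)), F (φ x) = φ (F x) := by
    intro φ x
    -- Off-diagonal components of `φ` vanish by inequivalence; a diagonal one is a scalar because
    -- `ℂ` is algebraically closed. The scalar does not depend on the vector.
    have hφ : ∀ y : (SumModule σ), ∀ c, ∃ z : ℂ, ∀ y : (SumModule σ), φ y c = z • y c := by
      intro _ c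
      have hz : ∀ c', c' ≠ c → ∀ v : (σ c').asModule, φ (Pi.single c' v) c = 0 := by
        intro c' hc' v
        let ψ : (σ c').asModule →ₗ[MonoidAlgebra ℂ H] (σ c).asModule :=
          LinearMap.proj c ∘ₗ φ ∘ₗ LinearMap.single (MonoidAlgebra ℂ H) (fun c => (σ c).asModule) c'
        have : ψ = 0 := by
          rcases LinearMap.bijective_or_eq_zero ψ with h | h
          · exfalso
            refine hne c' c hc' ?_
            exact (((IntertwiningMap.equivLinearMapAsModule (σ c') (σ c)).symm ψ)).ofBijective h
          · exact h
        exact congrArg (fun l => l v) this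
      let ψ : (σ c).asModule →ₗ[MonoidAlgebra ℂ H] (σ c).asModule :=
          LinearMap.proj c ∘ₗ φ ∘ₗ LinearMap.single (MonoidAlgebra ℂ H) (fun c => (σ c).asModule) c
      obtain ⟨z, hz'⟩ := (IsSimpleModule.algebraMap_end_bijective_of_isAlgClosed (A := MonoidAlgebra ℂ H) (V := (σ c).asModule) ℂ).2 ψ
      refine ⟨z, fun y => ?_⟩
      have hy : y = ∑ c', Pi.single c' (y c') := (Finset.univ_sum_single y).symm
      conv_lhs => rw [hy]
      rw [map_sum, Finset.sum_apply, Finset.sum_eq_single c]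
      · have h2 : ψ (y c) = z • y c := by rw [← hz']; rfl
        exact h2
      · intro c' _ hc'; exact hz c' hc' _
      · simp
    choose z hz using hφ x
    funext c'
    rw [hz c']
    by_cases hcc : c' = c
    · subst hcc
      simp only [F, Pi.single_eq_same]
      rw [hz c', map_smul, Pi.smul_apply, Pi.single_smul, map_smul]
    · simp [F, Pi.single_eq_of_ne hcc]
  let f : Module.End (Module.End (MonoidAlgebra ℂ H) (SumModule σ)) (SumModule σ) :=
    { toFun := F
      map_add' := hFadd
      map_smul' := fun φ x => hcomm φ x }
  -- Agreement on the standard basis vectors is enough to identify the matrix.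
  let s : Finset (SumModule σ) := Finset.univ.image fun p : Σ c, Fin (n c) =>
    (Pi.single p.1 ((σ p.1).asModuleEquiv.symm (Pi.single p.2 1)) : (SumModule σ))
  obtain ⟨r, hr⟩ := jacobson_density f s
  refine ⟨r, ?_⟩
  have key : ∀ (c' : C) (k' : Fin (n c')), (σ c').asAlgebraHom r (Pi.single k' 1) =
      if h : c' = c then (fun i => if (⟨c', i⟩ : Σ c, Fin (n c)) = ⟨c, j⟩ ∧
        (⟨c', k'⟩ : Σ c, Fin (n c)) = ⟨c, k⟩ then 1 else 0) else 0 := by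
    intro c' k'
    have h1 := hr (Pi.single c' ((σ c').asModuleEquiv.symm (Pi.single k' 1)))
      (Finset.mem_image.2 ⟨⟨c', k'⟩, Finset.mem_univ _, rfl⟩)
    have h2 := congrArg (fun x : (SumModule σ) => (σ c').asModuleEquiv (x c')) h1
    simp only [Pi.smul_apply, Pi.single_eq_same, asModuleEquiv_map_smul,
      LinearEquiv.apply_symm_apply] at h2
    rw [← h2]
    change (σ c').asModuleEquiv (F _ c') = _
    by_cases hcc : c' = c
    · subst hcc
      simp only [F, Pi.single_eq_same, LinearEquiv.apply_symm_apply, dif_pos]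
      funext i
      by_cases hij : i = j <;> by_cases hk : k' = k <;>
        simp [hij, hk]
    · simp [F, hcc]
  rw [sumMatrix_apply]
  ext ⟨c1, i⟩ ⟨c2, l⟩
  rw [Matrix.blockDiagonal'_apply, Matrix.single_apply]
  by_cases h12 : c1 = c2
  · subst h12
    simp only [cast_eq, dite_true]
    rw [LinearMap.toMatrix'_apply]
    have := congrFun (key c1 l) i
    have h3 : (fun j' => if j' = l then (1 : ℂ) else 0) = Pi.single l 1 := by
      funext x; simp [Pi.single_apply]
    rw [show ((σ c1).asAlgebraHom r) (Pi.single l 1) i = _ from this]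
    by_cases hcc : c1 = c
    · rw [dif_pos hcc]
      simp only [eq_comm]
    · rw [dif_neg hcc, if_neg]
      · rfl
      · rintro ⟨h, -⟩; exact hcc (congrArg Sigma.fst h).symm
  · rw [dif_neg h12, if_neg]
    rintro ⟨h, h'⟩
    exact h12 ((congrArg Sigma.fst h).symm.trans (congrArg Sigma.fst h'))

end Density

/-! ### Elementary tensors in the group algebra of the wreath product -/

section TensorHom

variable {H : Type u} {Q : Type v} {X : Type w} [Group H] [Group Q] [MulAction Q X]
  [DecidableEq X]

/-- The inclusion of `H` as the `x`-th factor of the base of the wreath product. -/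
def coordHom (x : X) : H →* PermWreath H Q X where
  toFun h := ⟨Pi.mulSingle x h, 1⟩
  map_one' := by ext <;> simp
  map_mul' a b := by ext <;> simp [Pi.mulSingle_mul]

/-- The inclusion of `Q` in the wreath product. -/
def topHom : Q →* PermWreath H Q X where
  toFun q := ⟨fun _ => 1, q⟩
  map_one' := rfl
  map_mul' a b := by ext <;> simp

/-- The inclusion of the base in the wreath product. -/
def baseHom : (X → H) →* PermWreath H Q X where
  toFun b := ⟨b, 1⟩
  map_one' := rfl
  map_mul' a b := by ext <;> simp

omit [DecidableEq X] in
theorem eq_baseHom_mul_topHom (g : PermWreath H Q X) : g = baseHom g.base * topHom g.top := by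
  ext <;> simp [baseHom, topHom]

/-- The inclusion of the group algebra of `H` as the `x`-th factor. -/
noncomputable def coordAlg (x : X) : MonoidAlgebra ℂ H →ₐ[ℂ] MonoidAlgebra ℂ (PermWreath H Q X) :=
  MonoidAlgebra.mapDomainAlgHom ℂ ℂ (coordHom x)

theorem coordAlg_single (x : X) (h : H) (a : ℂ) :
    coordAlg (Q := Q) x (MonoidAlgebra.single h a) = MonoidAlgebra.single (coordHom x h) a := by
  simp [coordAlg]

theorem coordHom_commute {x y : X} (hxy : x ≠ y) (h k : H) :
    Commute (coordHom (Q := Q) x h) (coordHom y k) := by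
  ext z
  · simp only [coordHom, MonoidHom.coe_mk, OneHom.coe_mk, PermWreath.mul_base, inv_one, one_smul]
    by_cases hz : z = x
    · subst hz; simp [Pi.mulSingle_eq_of_ne hxy]
    · simp [Pi.mulSingle_eq_of_ne hz]
  · simp [coordHom]

theorem coordAlg_commute {x y : X} (hxy : x ≠ y) (a b : MonoidAlgebra ℂ H) :
    Commute (coordAlg (Q := Q) x a) (coordAlg y b) := by
  induction a using MonoidAlgebra.induction_linear with
  | zero => simp
  | add a a' h h' => rw [map_add]; exact h.add_left h'
  | single g c =>
    induction b using MonoidAlgebra.induction_linear with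
    | zero => simp
    | add a a' h h' => rw [map_add]; exact h.add_right h'
    | single g' c' =>
      rw [coordAlg_single, coordAlg_single, Commute, SemiconjBy, MonoidAlgebra.single_mul_single,
        MonoidAlgebra.single_mul_single, coordHom_commute hxy, mul_comm]

variable [Fintype X]

/-- The multiplicative map `(a_x) ↦ ⊗ a_x` from tuples in the group algebra of `H` to the group
algebra of the wreath product. -/
noncomputable def tensorHom :
    (X → MonoidAlgebra ℂ H) →* MonoidAlgebra ℂ (PermWreath H Q X) :=
  MonoidHom.noncommPiCoprod (N := fun _ : X => MonoidAlgebra ℂ H)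
    (fun x => (coordAlg x : MonoidAlgebra ℂ H →ₐ[ℂ] MonoidAlgebra ℂ (PermWreath H Q X)).toMonoidHom')
    (fun _ _ hxy a b => coordAlg_commute hxy a b)

theorem tensorHom_mulSingle (x : X) (a : MonoidAlgebra ℂ H) :
    tensorHom (Q := Q) (Pi.mulSingle x a) = coordAlg x a :=
  MonoidHom.noncommPiCoprod_mulSingle _ _ _

/-- Splitting off one coordinate as a factor turns multiplicativity into linearity in that
coordinate. -/
theorem tensorHom_update (a : X → MonoidAlgebra ℂ H) (x : X) (b : MonoidAlgebra ℂ H) :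
    tensorHom (Q := Q) (Function.update a x b) =
      tensorHom (Function.update a x 1) * coordAlg x b := by
  rw [← tensorHom_mulSingle, ← map_mul]
  congr 1
  funext y
  by_cases hy : y = x
  · subst hy; simp
  · simp [hy]

/-- `tensorHom` as a multilinear map. -/
noncomputable def tensorMultilinear :
    MultilinearMap ℂ (fun _ : X => MonoidAlgebra ℂ H) (MonoidAlgebra ℂ (PermWreath H Q X)) where
  toFun := tensorHom
  map_update_add' a x b c := by
    have h := tensorHom_update (Q := Q) a x (b + c)
    rw [map_add, mul_add, ← tensorHom_update, ← tensorHom_update] at h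
    convert h
  map_update_smul' a x c b := by
    have h := tensorHom_update (Q := Q) a x (c • b)
    rw [map_smul, mul_smul_comm, ← tensorHom_update] at h
    convert h

theorem tensorHom_of (b : X → H) :
    tensorHom (Q := Q) (fun x => MonoidAlgebra.of ℂ H (b x)) =
      MonoidAlgebra.of ℂ _ (baseHom b) := by
  let f : (X → H) →* MonoidAlgebra ℂ (PermWreath H Q X) :=
    tensorHom.comp ((MonoidAlgebra.of ℂ H).compLeft X)
  let g : (X → H) →* MonoidAlgebra ℂ (PermWreath H Q X) := (MonoidAlgebra.of ℂ _).comp baseHom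
  have : f = g := by
    apply MonoidHom.pi_ext
    intro x h
    have h1 : (MonoidAlgebra.of ℂ H).compLeft X (Pi.mulSingle x h) =
        Pi.mulSingle x (MonoidAlgebra.of ℂ H h) := by
      funext y
      by_cases hy : y = x
      · subst hy; simp
      · simp [Pi.mulSingle_eq_of_ne hy, MonoidAlgebra.one_def]
    simp only [f, g, MonoidHom.comp_apply, h1, tensorHom_mulSingle]
    rw [MonoidAlgebra.of_apply, coordAlg_single]; rfl
  exact congrArg (fun l => l b) this

/-- The permutation of the coordinates of a tuple. -/
def permute {A : Type*} (q : Q) (a : X → A) : X → A := fun x => a (q⁻¹ • x)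

omit [DecidableEq X] [Fintype X] in
theorem permute_mul {A : Type*} (q r : Q) (a : X → A) :
    permute (q * r) a = permute q (permute r a) := by
  funext x; simp [permute, mul_smul]

omit [DecidableEq X] [Fintype X] in
@[simp] theorem permute_one {A : Type*} (a : X → A) : permute (1 : Q) a = a := by
  funext x; simp [permute]

/-- Conjugation by `q` after `tensorHom`, and `tensorHom` after the permutation, are both
multiplicative in `a`. It suffices to compare them on tuples with a single entry different from `1`.
-/
theorem top_mul_tensorHom (q : Q) (a : X → MonoidAlgebra ℂ H) :
    MonoidAlgebra.of ℂ _ (topHom q) * tensorHom a =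
      tensorHom (permute q a) * MonoidAlgebra.of ℂ (PermWreath H Q X) (topHom q) := by
  let f : (X → MonoidAlgebra ℂ H) →* MonoidAlgebra ℂ (PermWreath H Q X) :=
    { toFun := fun a => MonoidAlgebra.of ℂ _ (topHom q) * tensorHom a *
        MonoidAlgebra.of ℂ _ (topHom q⁻¹)
      map_one' := by
        rw [map_one, mul_one, ← map_mul, ← map_mul, mul_inv_cancel, map_one, map_one]
      map_mul' := fun a b => by
        have : MonoidAlgebra.of ℂ (PermWreath H Q X) (topHom q⁻¹) *
            MonoidAlgebra.of ℂ _ (topHom q) = 1 := by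
          rw [← map_mul, ← map_mul, inv_mul_cancel, map_one, map_one]
        rw [map_mul]
        simp only [mul_assoc]
        rw [← mul_assoc _ (MonoidAlgebra.of ℂ _ (topHom q)) _, this, one_mul] }
  let g : (X → MonoidAlgebra ℂ H) →* MonoidAlgebra ℂ (PermWreath H Q X) :=
    { toFun := fun a => tensorHom (permute q a)
      map_one' := map_one _
      map_mul' := fun a b => map_mul tensorHom (permute q a) (permute q b) }
  have hfg : f = g := by
    apply MonoidHom.pi_ext
    intro x b
    have h1 : permute q (Pi.mulSingle x b) = (Pi.mulSingle (q • x) b : X → MonoidAlgebra ℂ H) := by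
      funext y
      by_cases hy : y = q • x
      · subst hy; simp [permute]
      · rw [Pi.mulSingle_eq_of_ne hy, permute, Pi.mulSingle_eq_of_ne]
        intro h; apply hy; rw [← h]; simp
    change MonoidAlgebra.of ℂ _ (topHom q) * tensorHom (Pi.mulSingle x b) *
        MonoidAlgebra.of ℂ _ (topHom q⁻¹) = tensorHom (permute q (Pi.mulSingle x b))
    rw [h1, tensorHom_mulSingle, tensorHom_mulSingle]
    induction b using MonoidAlgebra.induction_linear with
    | zero => simp
    | add a b ha hb =>
      rw [map_add, map_add, mul_add, add_mul, ha (by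
        funext y; by_cases hy : y = q • x
        · subst hy; simp [permute]
        · rw [Pi.mulSingle_eq_of_ne hy, permute, Pi.mulSingle_eq_of_ne]
          intro h; apply hy; rw [← h]; simp), hb (by
        funext y; by_cases hy : y = q • x
        · subst hy; simp [permute]
        · rw [Pi.mulSingle_eq_of_ne hy, permute, Pi.mulSingle_eq_of_ne]
          intro h; apply hy; rw [← h]; simp)]
    | single h c =>
      rw [coordAlg_single, coordAlg_single, MonoidAlgebra.of_apply, MonoidAlgebra.of_apply,
        MonoidAlgebra.single_mul_single, MonoidAlgebra.single_mul_single, one_mul, mul_one]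
      congr 1
      ext y
      · simp only [topHom, coordHom, MonoidHom.coe_mk, OneHom.coe_mk, PermWreath.mul_base,
          mul_one, one_mul]
        by_cases hy : y = q • x
        · subst hy; simp
        · rw [Pi.mulSingle_eq_of_ne hy, Pi.mulSingle_eq_of_ne]
          intro h; apply hy; rw [← h]; simp
      · simp [topHom, coordHom]
  have h2 : MonoidAlgebra.of ℂ _ (topHom q) * tensorHom a * MonoidAlgebra.of ℂ _ (topHom q⁻¹) =
      tensorHom (permute q a) := congrArg (fun l => l a) hfg
  rw [← h2, mul_assoc, ← map_mul, ← map_mul, inv_mul_cancel, map_one, map_one, mul_one]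

end TensorHom

/-! ### Matrix units acting on a representation of the wreath product -/

section Corner

variable {H : Type u} {Q : Type v} {X : Type w} [Group H] [Group Q] [MulAction Q X]
  [DecidableEq X] [Fintype X] {C : Type*} [Fintype C] [DecidableEq C] {n : C → ℕ}
  (σ : ∀ c, Representation ℂ H (Fin (n c) → ℂ))
  {V : Type*} [AddCommGroup V] [Module ℂ V] (ρ : Representation ℂ (PermWreath H Q X) V)

/-- The representation `ρ` of the wreath product is made of the representations `σ c` of `H`:
in each coordinate it kills what all the `σ c` kill. -/
def HasType : Prop := ∀ (x : X) (α : MonoidAlgebra ℂ H), sumMatrix σ α = 0 →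
  ρ.asAlgebraHom (coordAlg x α) = 0

/-- Elements of the group algebra which act as the matrix units. -/
def IsMatrixUnits (u : (Σ c, Fin (n c)) → (Σ c, Fin (n c)) → MonoidAlgebra ℂ H) : Prop :=
  ∀ j k, sumMatrix σ (u j k) = if j.1 = k.1 then Matrix.single j k 1 else 0

theorem exists_isMatrixUnits (hσ : ∀ c, (σ c).IsIrreducible)
    (hne : ∀ c c', c ≠ c' → (σ c).Equiv (σ c') → False) :
    ∃ u, IsMatrixUnits σ u := by
  have : ∀ j k : Σ c, Fin (n c), ∃ α, sumMatrix σ α =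
      if j.1 = k.1 then Matrix.single j k 1 else 0 := by
    rintro ⟨c, j⟩ ⟨c', k⟩
    by_cases h : c = c'
    · subst h
      obtain ⟨α, hα⟩ := exists_sumMatrix_eq_single σ hσ hne c j k
      exact ⟨α, by simp [hα]⟩
    · exact ⟨0, by simp [h]⟩
  choose u hu using this
  exact ⟨u, hu⟩

/-- The operator on `V` of an elementary tensor. -/
noncomputable def tensorOp : (X → MonoidAlgebra ℂ H) →* Module.End ℂ V :=
  ρ.asAlgebraHom.toMonoidHom'.comp tensorHom

variable {σ ρ}

/-- The operator of a tuple is a product of commuting operators, one for each coordinate, and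
`HasType` says that each of them depends only on the matrix of its entry. -/
theorem HasType.tensorOp_congr (hρ : HasType σ ρ) {a b : X → MonoidAlgebra ℂ H}
    (h : ∀ x, sumMatrix σ (a x) = sumMatrix σ (b x)) : tensorOp ρ a = tensorOp ρ b := by
  let φ : ∀ _ : X, MonoidAlgebra ℂ H →* Module.End ℂ V := fun x =>
    ρ.asAlgebraHom.toMonoidHom'.comp (coordAlg (Q := Q) x).toMonoidHom'
  have hφ : Pairwise fun x y => ∀ a b, Commute (φ x a) (φ y b) := by
    intro x y hxy a b
    exact (coordAlg_commute hxy a b).map ρ.asAlgebraHom.toMonoidHom'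
  have heq : tensorOp ρ = MonoidHom.noncommPiCoprod φ hφ := by
    apply MonoidHom.pi_ext
    intro x c
    rw [MonoidHom.noncommPiCoprod_mulSingle]
    change ρ.asAlgebraHom (tensorHom (Pi.mulSingle x c)) = _
    rw [tensorHom_mulSingle]; rfl
  rw [heq, MonoidHom.noncommPiCoprod_apply, MonoidHom.noncommPiCoprod_apply]
  apply Finset.noncommProd_congr rfl
  intro x _
  have := hρ x (a x - b x) (by rw [map_sub, h x, sub_self])
  rw [map_sub, map_sub, sub_eq_zero] at this
  exact this

theorem tensorOp_eq_zero {a : X → MonoidAlgebra ℂ H} (x : X) (h : a x = 0) :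
    tensorOp ρ a = 0 := by
  have : tensorHom (Q := Q) a = 0 := (tensorMultilinear (Q := Q)).map_coord_zero x h
  change ρ.asAlgebraHom (tensorHom a) = 0
  rw [this, map_zero]

theorem HasType.tensorOp_eq_zero (hρ : HasType σ ρ) {a : X → MonoidAlgebra ℂ H} (x : X)
    (h : sumMatrix σ (a x) = 0) : tensorOp ρ a = 0 := by
  rw [← RepZeta.tensorOp_eq_zero (ρ := ρ) (a := Function.update a x 0) x (by simp)]
  apply hρ.tensorOp_congr
  intro y
  by_cases hy : y = x
  · subst hy; simp [h]
  · simp [hy]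

theorem tensorOp_smul (z : X → ℂ) (a : X → MonoidAlgebra ℂ H) :
    tensorOp ρ (fun x => z x • a x) = (∏ x, z x) • tensorOp ρ a := by
  have : tensorHom (Q := Q) (fun x => z x • a x) = (∏ x, z x) • tensorHom a :=
    (tensorMultilinear (Q := Q)).map_smul_univ z a
  change ρ.asAlgebraHom (tensorHom _) = _ • ρ.asAlgebraHom (tensorHom _)
  rw [this, map_smul]

theorem tensorOp_of (b : X → H) :
    tensorOp ρ (fun x => MonoidAlgebra.of ℂ H (b x)) = ρ (baseHom b) := by
  change ρ.asAlgebraHom (tensorHom _) = _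
  rw [tensorHom_of, asAlgebraHom_of]

theorem top_mul_tensorOp (q : Q) (a : X → MonoidAlgebra ℂ H) :
    ρ (topHom q) * tensorOp ρ a = tensorOp ρ (permute q a) * ρ (topHom q) := by
  have := congrArg ρ.asAlgebraHom (top_mul_tensorHom (H := H) q a)
  rwa [map_mul, map_mul, asAlgebraHom_of] at this

variable (ρ) in
/-- The operator of a matrix unit of the tensor product. -/
noncomputable def unitOp (u : (Σ c, Fin (n c)) → (Σ c, Fin (n c)) → MonoidAlgebra ℂ H)
    (i k : X → Σ c, Fin (n c)) : Module.End ℂ V := tensorOp ρ fun x => u (i x) (k x)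

variable {u : (Σ c, Fin (n c)) → (Σ c, Fin (n c)) → MonoidAlgebra ℂ H}

theorem HasType.unitOp_mul (hρ : HasType σ ρ) (hu : IsMatrixUnits σ u)
    {i k m : X → Σ c, Fin (n c)} (hik : ∀ x, (i x).1 = (k x).1) (hkm : ∀ x, (k x).1 = (m x).1) :
    unitOp ρ u i k * unitOp ρ u k m = unitOp ρ u i m := by
  rw [unitOp, unitOp, ← map_mul]
  apply hρ.tensorOp_congr
  intro x
  rw [Pi.mul_apply, map_mul, hu, hu, hu, if_pos (hik x), if_pos (hkm x),
    if_pos ((hik x).trans (hkm x)), Matrix.single_mul_single_same, mul_one]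

theorem HasType.unitOp_mul_of_ne (hρ : HasType σ ρ) (hu : IsMatrixUnits σ u)
    {i k l m : X → Σ c, Fin (n c)} (hkl : k ≠ l) :
    unitOp ρ u i k * unitOp ρ u l m = 0 := by
  rw [unitOp, unitOp, ← map_mul]
  obtain ⟨x, hx⟩ := Function.ne_iff.1 hkl
  apply hρ.tensorOp_eq_zero x
  rw [Pi.mul_apply, map_mul, hu, hu]
  split_ifs <;> simp [Matrix.single_mul_single_of_ne, hx]

theorem HasType.unitOp_eq_zero (hρ : HasType σ ρ) (hu : IsMatrixUnits σ u)
    {i k : X → Σ c, Fin (n c)} (h : ¬ ∀ x, (i x).1 = (k x).1) : unitOp ρ u i k = 0 := by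
  push Not at h
  obtain ⟨x, hx⟩ := h
  exact hρ.tensorOp_eq_zero x (by rw [hu, if_neg hx])

/-- By multilinearity the sum is the operator of the constant tuple `∑ j, u j j`, which acts as the
identity on all `σ c`. This decomposes `V` into corners. -/
theorem HasType.sum_unitOp (hρ : HasType σ ρ) (hu : IsMatrixUnits σ u) :
    ∑ i : X → Σ c, Fin (n c), unitOp ρ u i i = 1 := by
  have h1 : ∑ i : X → Σ c, Fin (n c), tensorHom (Q := Q) (fun x => u (i x) (i x)) =
      tensorHom (fun _ => ∑ j, u j j) :=
    ((tensorMultilinear (Q := Q)).map_sum (fun (_ : X) j => u j j)).symm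
  have h2 : ∑ i : X → Σ c, Fin (n c), unitOp ρ u i i = tensorOp ρ (fun _ => ∑ j, u j j) := by
    change ∑ i : X → Σ c, Fin (n c), ρ.asAlgebraHom (tensorHom _) = ρ.asAlgebraHom (tensorHom _)
    rw [← map_sum, h1]
  rw [h2, ← map_one (tensorOp ρ)]
  apply hρ.tensorOp_congr
  intro x
  rw [map_sum, Pi.one_apply, map_one]
  rw [Finset.sum_congr rfl fun j _ => (show sumMatrix σ (u j j) = Matrix.single j j 1 by
    rw [hu, if_pos rfl])]
  ext j k
  rw [Matrix.sum_apply, Matrix.one_apply]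
  simp [Matrix.single_apply]
  by_cases hjk : j = k
  · subst hjk
    rw [Finset.card_eq_one.2 ⟨j, by ext; simp [eq_comm]⟩]; simp
  · rw [if_neg hjk, Finset.card_eq_zero.2]
    · simp
    · ext l; simp; rintro rfl; exact hjk

omit [Fintype C] [DecidableEq C] in
theorem top_mul_unitOp (q : Q) (i k : X → Σ c, Fin (n c)) :
    ρ (topHom q) * unitOp ρ u i k = unitOp ρ u (permute q i) (permute q k) * ρ (topHom q) :=
  top_mul_tensorOp q _

variable (σ) in
/-- The coefficient by which an element of the wreath product acts between two corners. -/
noncomputable def cornerCoeff (g : PermWreath H Q X) (i k : X → Σ c, Fin (n c)) : ℂ :=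
  ∏ x, sumMatrix σ (MonoidAlgebra.of ℂ H (g.base x)) (i x) (permute g.top k x)

/-- A matrix squeezed between two diagonal units keeps a single entry. The base component of `g`
thus contributes only a scalar, and between two corners `g` acts like its top component. -/
theorem HasType.unitOp_mul_mul (hρ : HasType σ ρ) (hu : IsMatrixUnits σ u)
    (g : PermWreath H Q X) (i k : X → Σ c, Fin (n c)) :
    unitOp ρ u i i * ρ g * unitOp ρ u k k =
      cornerCoeff σ g i k • (unitOp ρ u i (permute g.top k) * ρ (topHom g.top)) := by
  conv_lhs => rw [eq_baseHom_mul_topHom g, map_mul, mul_assoc, mul_assoc, top_mul_unitOp]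
  rw [← mul_assoc, ← mul_assoc, ← smul_mul_assoc]
  congr 1
  rw [← tensorOp_of, unitOp, unitOp, ← map_mul, ← map_mul, cornerCoeff, unitOp, ← tensorOp_smul]
  apply hρ.tensorOp_congr
  intro x
  set m := permute g.top k
  rw [Pi.mul_apply, Pi.mul_apply, map_mul, map_mul, sumMatrix_smul, hu, hu, hu, if_pos rfl,
    if_pos rfl]
  by_cases h : (i x).1 = (m x).1
  · rw [if_pos h]
    rw [Matrix.single_mul_mul_single]
    simp
  · rw [if_neg h, sumMatrix_apply_ne σ _ h, Matrix.single_mul_mul_single,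
      sumMatrix_apply_ne σ _ h]
    simp

end Corner

/-- The subgroup of the elements which preserve all the fibres of the map `f`. -/
def fixer {Q : Type v} {X : Type w} [Group Q] [MulAction Q X] {C : Type*} (f : X → C) :
    Subgroup Q where
  carrier := {q | ∀ x, f (q • x) = f x}
  one_mem' := fun x => by simp
  mul_mem' := fun {a b} ha hb x => by rw [mul_smul, ha, hb]
  inv_mem' := fun {a} ha x => by rw [← ha, smul_inv_smul]

theorem mem_fixer_iff_permute {Q : Type v} {X : Type w} [Group Q] [MulAction Q X] {C : Type*}
    {f : X → C} {q : Q} : q ∈ fixer f ↔ permute q f = f := by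
  rw [← inv_mem_iff]
  exact ⟨fun h => funext h, fun h x => congrFun h x⟩

/-! ### Corners as representations of the stabilizers -/

section Corner

variable {H : Type u} {Q : Type v} {X : Type w} [Group H] [Group Q] [MulAction Q X]
  [DecidableEq X] [Fintype X] {C : Type*} [Fintype C] [DecidableEq C] {n : C → ℕ}
  {σ : ∀ c, Representation ℂ H (Fin (n c) → ℂ)}
  {V : Type*} [AddCommGroup V] [Module ℂ V] {ρ : Representation ℂ (PermWreath H Q X) V}
  {W : Type*} [AddCommGroup W] [Module ℂ W] {ρ' : Representation ℂ (PermWreath H Q X) W}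
  {u : (Σ c, Fin (n c)) → (Σ c, Fin (n c)) → MonoidAlgebra ℂ H}

variable (ρ u) in
/-- The part of `V` which corresponds to the basis vector `i` of the tensor product. -/
noncomputable def corner (i : X → Σ c, Fin (n c)) : Submodule ℂ V :=
  LinearMap.range (unitOp ρ u i i)

theorem HasType.mem_corner (hρ : HasType σ ρ) (hu : IsMatrixUnits σ u)
    {i : X → Σ c, Fin (n c)} {v : V} : v ∈ corner ρ u i ↔ unitOp ρ u i i v = v := by
  constructor
  · rintro ⟨w, rfl⟩
    rw [← Module.End.mul_apply, hρ.unitOp_mul hu (fun _ => rfl) (fun _ => rfl)]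
  · intro h; exact ⟨v, h⟩

theorem HasType.unitOp_apply (hρ : HasType σ ρ) (hu : IsMatrixUnits σ u)
    {i k m : X → Σ c, Fin (n c)} (hik : ∀ x, (i x).1 = (k x).1) (hkm : ∀ x, (k x).1 = (m x).1)
    (v : V) : unitOp ρ u i k (unitOp ρ u k m v) = unitOp ρ u i m v := by
  rw [← hρ.unitOp_mul hu hik hkm]; rfl

theorem top_unitOp_apply (q : Q) (i k : X → Σ c, Fin (n c)) (v : V) :
    ρ (topHom q) (unitOp ρ u i k v) =
      unitOp ρ u (permute q i) (permute q k) (ρ (topHom q) v) :=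
  congrArg (fun l => l v) (top_mul_unitOp (ρ := ρ) q i k)

theorem HasType.unitOp_mem_corner (hρ : HasType σ ρ) (hu : IsMatrixUnits σ u)
    {i k : X → Σ c, Fin (n c)} (v : V) : unitOp ρ u i k v ∈ corner ρ u i := by
  rw [hρ.mem_corner hu]
  by_cases h : ∀ x, (i x).1 = (k x).1
  · exact hρ.unitOp_apply hu (fun _ => rfl) h v
  · rw [hρ.unitOp_eq_zero hu h]; simp

theorem HasType.unitOp_group_apply (hρ : HasType σ ρ) (hu : IsMatrixUnits σ u)
    (g : PermWreath H Q X) {i k : X → Σ c, Fin (n c)} {v : V} (hv : v ∈ corner ρ u k) :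
    unitOp ρ u i i (ρ g v) =
      cornerCoeff σ g i k • unitOp ρ u i (permute g.top k) (ρ (topHom g.top) v) := by
  have := congrArg (fun l => l v) (hρ.unitOp_mul_mul hu g i k)
  simp only [Module.End.mul_apply, LinearMap.smul_apply] at this
  rwa [(hρ.mem_corner hu).1 hv] at this

/-- The representation of the inertia quotient on a corner. -/
noncomputable def cornerRep (hρ : HasType σ ρ) (hu : IsMatrixUnits σ u) {f : X → C}
    {i : X → Σ c, Fin (n c)} (hi : ∀ x, (i x).1 = f x) :
    Representation ℂ (fixer (Q := Q) f) (corner ρ u i) where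
  -- The element `q` carries the corner of `i` to that of `permute q i`, which lies over the same
  -- `f`, and a matrix unit carries it back. The matrix units compose exactly, so no cocycle
  -- appears.
  toFun q := (unitOp ρ u i (permute q.1 i) * ρ (topHom q.1)).restrict
    (fun _ _ => hρ.unitOp_mem_corner hu _)
  map_one' := by
    ext ⟨v, hv⟩
    simpa using (hρ.mem_corner hu).1 hv
  map_mul' q r := by
    ext ⟨v, hv⟩
    have hs : ∀ q : fixer (Q := Q) f, ∀ x, (permute q.1 i x).1 = f x := fun q x => by
      rw [permute, hi]; exact (inv_mem q.2) x
    simp only [LinearMap.coe_restrict_apply, Module.End.mul_apply, Subgroup.coe_mul, map_mul]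
    rw [top_unitOp_apply, ← permute_mul, hρ.unitOp_apply hu]
    · intro x; rw [hi, hs]
    · intro x; rw [hs]; exact (hs (q * r) x).symm

/-- The span of the translates of a submodule. -/
def translates (ρ : Representation ℂ (PermWreath H Q X) V) (U : Submodule ℂ V) : Submodule ℂ V :=
  Submodule.span ℂ {w | ∃ g, ∃ v ∈ U, w = ρ g v}

omit [DecidableEq X] [Fintype X] in
theorem isStable_translates (U : Submodule ℂ V) : IsStable ρ (translates ρ U) := by
  intro g v hv
  rw [translates] at hv
  induction hv using Submodule.span_induction with
  | mem v hv =>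
    obtain ⟨k, w, hw, rfl⟩ := hv
    exact Submodule.subset_span ⟨g * k, w, hw, by simp⟩
  | zero => simp
  | add x y _ _ hx hy => rw [map_add]; exact Submodule.add_mem _ hx hy
  | smul c x _ hx => rw [map_smul]; exact Submodule.smul_mem _ c hx

omit [DecidableEq X] [Fintype X] in
theorem le_translates (U : Submodule ℂ V) : U ≤ translates ρ U := fun v hv =>
  Submodule.subset_span ⟨1, v, hv, by simp⟩

omit [DecidableEq X] [Fintype X] in
theorem translates_le {U D : Submodule ℂ V} (hD : IsStable ρ D) (h : U ≤ D) :
    translates ρ U ≤ D := by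
  rw [translates, Submodule.span_le]
  rintro _ ⟨g, v, hv, rfl⟩
  exact hD g v (h hv)

theorem HasType.not_exists_permute (hρ : HasType σ ρ) (hu : IsMatrixUnits σ u)
    {i k : X → Σ c, Fin (n c)} (h : ∀ q : Q, ¬ ∀ x, (k x).1 = (permute q i x).1)
    {U : Submodule ℂ V} (hU : U ≤ corner ρ u i) {d : V} (hd : d ∈ translates ρ U) :
    unitOp ρ u k k d = 0 := by
  rw [translates] at hd
  induction hd using Submodule.span_induction with
  | mem v hv =>
    obtain ⟨g, w, hw, rfl⟩ := hv
    rw [hρ.unitOp_group_apply hu g (hU hw), hρ.unitOp_eq_zero hu (h g.top)]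
    simp
  | zero => simp
  | add x y _ _ hx hy => rw [map_add, hx, hy, add_zero]
  | smul c x _ hx => rw [map_smul, hx, smul_zero]

/-- An element outside the stabilizer moves the corner to one over another map, which the diagonal
unit kills. An element inside it acts, up to a scalar, as on the corner, where `U` is stable.
Generating and then compressing therefore does not enlarge `U`. -/
theorem HasType.unitOp_translates (hρ : HasType σ ρ) (hu : IsMatrixUnits σ u)
    {f : X → C} {i : X → Σ c, Fin (n c)} (hi : ∀ x, (i x).1 = f x)
    {U : Submodule ℂ V} (hU : U ≤ corner ρ u i)
    (hst : ∀ q ∈ fixer (Q := Q) f, ∀ v ∈ U, unitOp ρ u i (permute q i) (ρ (topHom q) v) ∈ U)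
    {d : V} (hd : d ∈ translates ρ U) : unitOp ρ u i i d ∈ U := by
  rw [translates] at hd
  induction hd using Submodule.span_induction with
  | mem v hv =>
    obtain ⟨g, w, hw, rfl⟩ := hv
    rw [hρ.unitOp_group_apply hu g (hU hw)]
    apply U.smul_mem
    by_cases hg : g.top ∈ fixer f
    · exact hst _ hg w hw
    · rw [hρ.unitOp_eq_zero hu]
      · simp
      · intro h
        apply hg
        rw [← inv_mem_iff]
        intro x
        rw [← hi, ← hi]
        exact (h x).symm
  | zero => simp
  | add x y _ _ hx hy => rw [map_add]; exact U.add_mem hx hy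
  | smul c x _ hx => rw [map_smul]; exact U.smul_mem _ hx

theorem IsStable.unitOp_mem {D : Submodule ℂ V} (hD : IsStable ρ D)
    (i k : X → Σ c, Fin (n c)) {v : V} (hv : v ∈ D) : unitOp ρ u i k v ∈ D :=
  hD.asAlgebraHom_mem _ hv

theorem HasType.exists_unitOp_ne_zero (hρ : HasType σ ρ) (hu : IsMatrixUnits σ u) {v : V}
    (hv : v ≠ 0) : ∃ k, unitOp ρ u k k v ≠ 0 := by
  by_contra! h
  apply hv
  have := congrArg (fun l => l v) (hρ.sum_unitOp hu)
  simp only [LinearMap.sum_apply, h, Finset.sum_const_zero, Module.End.one_apply] at this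
  exact this.symm

/-- The transport is undone by acting with `q` and then applying the matrix unit in the opposite
direction. -/
theorem HasType.transport_ne_zero (hρ : HasType σ ρ) (hu : IsMatrixUnits σ u)
    {i k : X → Σ c, Fin (n c)} {q : Q} (h : ∀ x, (k x).1 = (permute q i x).1) {v : V}
    (hv : unitOp ρ u k k v ≠ 0) :
    unitOp ρ u i (permute q⁻¹ k) (ρ (topHom q⁻¹) (unitOp ρ u k k v)) ≠ 0 := by
  intro h0
  apply hv
  have h1 := congrArg (fun w => unitOp ρ u k (permute q i) (ρ (topHom q) w)) h0
  simp only [map_zero] at h1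
  rw [top_unitOp_apply, ← permute_mul, mul_inv_cancel, permute_one, hρ.unitOp_apply hu h
    (fun x => (h x).symm)] at h1
  have h2 : ∀ w, ρ (topHom q) (ρ (topHom q⁻¹) w) = w := fun w => by
    rw [← Module.End.mul_apply, ← map_mul, ← map_mul, mul_inv_cancel, map_one, map_one,
      Module.End.one_apply]
  rw [h2, hρ.unitOp_apply hu (fun _ => rfl) (fun _ => rfl)] at h1
  exact h1

/-- A nonzero stable `D` has a nonzero component in some corner. Transported to the corner of `i`,
this component gives a nonzero vector of `U ⊓ D`. Irreducibility of `U` forces `U ≤ D`, and `U`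
generates everything. -/
theorem HasType.isIrreducible_translates (hρ : HasType σ ρ) (hu : IsMatrixUnits σ u)
    {f : X → C} {i : X → Σ c, Fin (n c)} (hi : ∀ x, (i x).1 = f x)
    {U : Submodule ℂ V} (hU : U ≤ corner ρ u i) (hne : U ≠ ⊥)
    (hst : ∀ q ∈ fixer (Q := Q) f, ∀ v ∈ U, unitOp ρ u i (permute q i) (ρ (topHom q) v) ∈ U)
    (hirr : ∀ U' ≤ U, (∀ q ∈ fixer (Q := Q) f, ∀ v ∈ U',
      unitOp ρ u i (permute q i) (ρ (topHom q) v) ∈ U') → U' = ⊥ ∨ U' = U) :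
    (isStable_translates (ρ := ρ) U).subrep.IsIrreducible := by
  rw [IsStable.isIrreducible_subrep]
  refine ⟨fun h => hne (eq_bot_iff.2 (h ▸ le_translates U)), fun D hle hD => ?_⟩
  by_cases hD0 : D = ⊥
  · exact Or.inl hD0
  right
  refine le_antisymm hle (translates_le hD ?_)
  obtain ⟨d, hd, hd0⟩ := Submodule.exists_mem_ne_zero_of_ne_bot hD0
  obtain ⟨k, hk⟩ := hρ.exists_unitOp_ne_zero hu hd0
  have hq : ∃ q : Q, ∀ x, (k x).1 = (permute q i x).1 := by
    by_contra h
    push Not at h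
    exact hk (hρ.not_exists_permute hu (fun q hq => by
      obtain ⟨x, hx⟩ := h q; exact hx (hq x)) hU (hle hd))
  obtain ⟨q, hq⟩ := hq
  have hw := hρ.transport_ne_zero hu hq hk
  set w := unitOp ρ u i (permute q⁻¹ k) (ρ (topHom q⁻¹) (unitOp ρ u k k d))
  have hwD : w ∈ D := hD.unitOp_mem _ _ (hD _ _ (hD.unitOp_mem _ _ hd))
  have hwU : w ∈ U := by
    have h1 : unitOp ρ u i i w = w :=
      (hρ.mem_corner hu).1 (hρ.unitOp_mem_corner hu _ : w ∈ corner ρ u i)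
    exact h1 ▸ hρ.unitOp_translates hu hi hU hst (hle hwD)
  rcases hirr (U ⊓ D) inf_le_left (fun q hq v hv => ⟨hst q hq v hv.1,
      hD.unitOp_mem _ _ (hD _ _ hv.2)⟩) with h | h
  · exfalso
    have : w ∈ U ⊓ D := ⟨hwU, hwD⟩
    rw [h] at this
    exact hw (by simpa using this)
  · rw [← h]; exact inf_le_right

/-- A nonzero stable part of the corner generates `V` by irreducibility, and compressing the
generated space back to the corner returns only that part. -/
theorem isIrreducible_cornerRep (hρ : HasType σ ρ) (hu : IsMatrixUnits σ u) {f : X → C}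
    {i : X → Σ c, Fin (n c)} (hi : ∀ x, (i x).1 = f x) (hirr : ρ.IsIrreducible)
    (hne : corner ρ u i ≠ ⊥) : (cornerRep hρ hu hi).IsIrreducible := by
  rw [isIrreducible_iff] at hirr ⊢
  refine ⟨Submodule.nontrivial_iff_ne_bot.2 hne, fun U hU => ?_⟩
  by_cases h0 : U = ⊥
  · exact Or.inl h0
  right
  have hle := Submodule.map_subtype_le (corner ρ u i) U
  rcases hirr.2 _ (isStable_translates (ρ := ρ) (U.map (corner ρ u i).subtype)) with h | h
  · exfalso
    apply h0
    have h1 : U.map (corner ρ u i).subtype = ⊥ := eq_bot_iff.2 (h ▸ le_translates _)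
    exact Submodule.map_injective_of_injective (Submodule.injective_subtype _)
      (by rw [h1, Submodule.map_bot])
  · rw [eq_top_iff]
    rintro ⟨v, hv⟩ -
    have h1 : v ∈ translates ρ (U.map (corner ρ u i).subtype) := by rw [h]; trivial
    have h2 := hρ.unitOp_translates hu hi hle (by
      rintro q hq _ ⟨w, hw, rfl⟩
      exact ⟨cornerRep hρ hu hi ⟨q, hq⟩ w, hU ⟨q, hq⟩ w hw, rfl⟩) h1
    rw [(hρ.mem_corner hu).1 hv] at h2
    obtain ⟨w, hw, hwv⟩ := h2
    have : w = ⟨v, hv⟩ := Subtype.ext hwv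
    rwa [← this]

/-- In both representations a compressed group element is zero, or the same scalar `cornerCoeff`
times the action of the stabilizer. An isomorphism of corners thus satisfies the hypotheses of
`nonempty_equiv_of_corner`. -/
theorem nonempty_equiv_of_cornerRep_equiv (hρ : HasType σ ρ) (hρ' : HasType σ ρ')
    (hu : IsMatrixUnits σ u) {f : X → C} {i : X → Σ c, Fin (n c)} (hi : ∀ x, (i x).1 = f x)
    (hirr : ρ.IsIrreducible) (hirr' : ρ'.IsIrreducible) (hne : corner ρ u i ≠ ⊥)
    (e : (cornerRep hρ hu hi).Equiv (cornerRep hρ' hu hi)) : Nonempty (ρ.Equiv ρ') := by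
  refine nonempty_equiv_of_corner hirr hirr' (tensorHom fun x => u (i x) (i x))
    (corner ρ u i) hne ((corner ρ' u i).subtype ∘ₗ e.toLinearEquiv.toLinearMap)
    (Subtype.val_injective.comp e.toLinearEquiv.injective)
    (fun v => (hρ'.mem_corner hu).1 (e v).2) (fun v => (hρ.mem_corner hu).1 v.2)
    (fun g v => ?_)
  have h1 := hρ.unitOp_group_apply hu g (i := i) v.2
  have h2 := hρ'.unitOp_group_apply hu g (i := i) (e v).2
  by_cases hg : g.top ∈ fixer f
  · refine ⟨cornerCoeff σ g i i • cornerRep hρ hu hi ⟨g.top, hg⟩ v, h1, ?_⟩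
    refine Eq.trans h2 ?_
    rw [map_smul]
    congr 1
    have := equiv_apply e ⟨g.top, hg⟩ v
    exact (congrArg Subtype.val this).symm
  · have hz : ¬ ∀ x, (i x).1 = (permute g.top i x).1 := by
      intro h
      apply hg
      rw [← inv_mem_iff]
      intro x
      rw [← hi, ← hi]
      exact (h x).symm
    rw [hρ.unitOp_eq_zero hu hz] at h1
    rw [hρ'.unitOp_eq_zero hu hz] at h2
    refine ⟨0, ?_, ?_⟩
    · exact h1.trans (by simp)
    · exact h2.trans (by simp)

theorem nonempty_equiv_cornerRep (hρ : HasType σ ρ) (hu : IsMatrixUnits σ u) {f : X → C}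
    {i : X → Σ c, Fin (n c)} (hi : ∀ x, (i x).1 = f x) {A : Type*} [AddCommGroup A] [Module ℂ A]
    (χ : Representation ℂ (fixer (Q := Q) f) A) (θ : A →ₗ[ℂ] V) (hθ : Function.Injective θ)
    (hr : LinearMap.range θ = corner ρ u i)
    (hc : ∀ q a, θ (χ q a) = unitOp ρ u i (permute q.1 i) (ρ (topHom q.1) (θ a))) :
    Nonempty (χ.Equiv (cornerRep hρ hu hi)) := by
  let e : A ≃ₗ[ℂ] corner ρ u i := (LinearEquiv.ofInjective θ hθ).trans (LinearEquiv.ofEq _ _ hr)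
  refine ⟨Representation.Equiv.mk e fun q => ?_⟩
  ext a
  exact hc q a

/-- The standard multi-index over a map to the set of representations. -/
def stdIndex (hn : ∀ c, 0 < n c) (f : X → C) : X → Σ c, Fin (n c) := fun x => ⟨f x, 0, hn _⟩

theorem HasType.finrank_eq_sum (hρ : HasType σ ρ) (hu : IsMatrixUnits σ u)
    [FiniteDimensional ℂ V] :
    Module.finrank ℂ V = ∑ i : X → Σ c, Fin (n c), Module.finrank ℂ (corner ρ u i) := by
  let e : V ≃ₗ[ℂ] (∀ i : X → Σ c, Fin (n c), corner ρ u i) :=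
    { toFun := fun v i => ⟨unitOp ρ u i i v, v, rfl⟩
      map_add' := fun v w => by funext i; ext; simp
      map_smul' := fun c v => by funext i; ext; simp
      invFun := fun w => ∑ i, (w i : V)
      left_inv := fun v => by
        have := congrArg (fun l => l v) (hρ.sum_unitOp hu)
        simpa using this
      right_inv := fun w => by
        funext k
        ext
        simp only [map_sum]
        rw [Finset.sum_eq_single k]
        · exact (hρ.mem_corner hu).1 (w k).2
        · intro i _ hik
          rw [← (hρ.mem_corner hu).1 (w i).2, ← Module.End.mul_apply,
            hρ.unitOp_mul_of_ne hu hik.symm]; rfl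
        · simp }
  rw [e.finrank_eq, Module.finrank_pi_fintype]

theorem HasType.finrank_corner_eq (hρ : HasType σ ρ) (hu : IsMatrixUnits σ u)
    [FiniteDimensional ℂ V] {i k : X → Σ c, Fin (n c)} (q : Q)
    (h : ∀ x, (k x).1 = (permute q i x).1) :
    Module.finrank ℂ (corner ρ u k) = Module.finrank ℂ (corner ρ u i) := by
  have key : ∀ {i k : X → Σ c, Fin (n c)} (q : Q), (∀ x, (k x).1 = (permute q i x).1) →
      Module.finrank ℂ (corner ρ u k) ≤ Module.finrank ℂ (corner ρ u i) := by
    intro i k q h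
    let F : corner ρ u k →ₗ[ℂ] corner ρ u i :=
      (unitOp ρ u i (permute q⁻¹ k) * ρ (topHom q⁻¹)).restrict
        (fun _ _ => hρ.unitOp_mem_corner hu _)
    refine LinearMap.finrank_le_finrank_of_injective (f := F) ?_
    rw [injective_iff_map_eq_zero]
    rintro ⟨v, hv⟩ h0
    by_contra hne
    have hv' := (hρ.mem_corner hu).1 hv
    refine hρ.transport_ne_zero hu h (v := v) ?_ ?_
    · rw [hv']; intro h; apply hne; ext; exact h
    · rw [hv']; exact congrArg Subtype.val h0
  refine le_antisymm (key q h) (key q⁻¹ fun x => ?_)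
  rw [permute, h, permute, inv_inv]; simp

/-- The set of maps `f` whose tensor product occurs in `ρ`. -/
def IsConstituent (hn : ∀ c, 0 < n c) (ρ : Representation ℂ (PermWreath H Q X) V)
    (u : (Σ c, Fin (n c)) → (Σ c, Fin (n c)) → MonoidAlgebra ℂ H) (f : X → C) : Prop :=
  corner ρ u (stdIndex hn f) ≠ ⊥

theorem HasType.corner_ne_bot_iff (hρ : HasType σ ρ) (hu : IsMatrixUnits σ u)
    [FiniteDimensional ℂ V] (hn : ∀ c, 0 < n c) {k : X → Σ c, Fin (n c)} :
    corner ρ u k ≠ ⊥ ↔ IsConstituent hn ρ u (fun x => (k x).1) := by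
  rw [IsConstituent, ne_eq, ne_eq, ← Submodule.finrank_eq_zero (R := ℂ),
    ← Submodule.finrank_eq_zero (R := ℂ), hρ.finrank_corner_eq hu (i := stdIndex hn fun x => (k x).1) (k := k) 1]
  intro x; simp [stdIndex]

theorem HasType.exists_isConstituent (hρ : HasType σ ρ) (hu : IsMatrixUnits σ u)
    [FiniteDimensional ℂ V] (hn : ∀ c, 0 < n c) [Nontrivial V] :
    ∃ f, IsConstituent hn ρ u f := by
  obtain ⟨v, hv⟩ := exists_ne (0 : V)
  obtain ⟨k, hk⟩ := hρ.exists_unitOp_ne_zero hu hv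
  refine ⟨_, (hρ.corner_ne_bot_iff hu hn (k := k)).1 fun h => hk ?_⟩
  have : unitOp ρ u k k v ∈ corner ρ u k := ⟨v, rfl⟩
  rw [h] at this
  simpa using this

/-- The translates of one corner span `V`, and they have no component in corners over maps outside
the orbit; so the constituents form a single orbit. -/
theorem HasType.isConstituent_iff (hρ : HasType σ ρ) (hu : IsMatrixUnits σ u)
    [FiniteDimensional ℂ V] (hn : ∀ c, 0 < n c) (hirr : ρ.IsIrreducible) {f f' : X → C}
    (hf : IsConstituent hn ρ u f) :
    IsConstituent hn ρ u f' ↔ ∃ q : Q, f' = permute q f := by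
  rw [isIrreducible_iff] at hirr
  constructor
  · intro hf'
    by_contra h
    push Not at h
    obtain ⟨v, hv, hv0⟩ := Submodule.exists_mem_ne_zero_of_ne_bot hf'
    have htop : translates ρ (corner ρ u (stdIndex hn f)) = ⊤ := by
      rcases hirr.2 _ (isStable_translates (ρ := ρ) (corner ρ u (stdIndex hn f))) with h | h
      · exact absurd (eq_bot_iff.2 (h ▸ le_translates _)) hf
      · exact h
    apply hv0
    rw [← (hρ.mem_corner hu).1 hv]
    refine hρ.not_exists_permute hu (fun q hq => h q ?_) le_rfl (htop ▸ Submodule.mem_top)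
    funext x
    exact hq x
  · rintro ⟨q, rfl⟩
    rw [IsConstituent, ne_eq, ← Submodule.finrank_eq_zero (R := ℂ)] at hf ⊢
    rwa [hρ.finrank_corner_eq hu (i := stdIndex hn f) q]
    intro x; rfl

omit [DecidableEq X] [Fintype X] in
theorem ncard_setOf_permute {A : Type*} [Finite X] [Finite Q] (f : X → A) :
    {f' | ∃ q : Q, f' = permute q f}.ncard = (fixer (Q := Q) f).index := by
  let _ : MulAction Q (X → A) := arrowAction
  have h1 : MulAction.stabilizer Q f = fixer f := by
    ext q
    rw [mem_fixer_iff_permute, MulAction.mem_stabilizer_iff]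
    rfl
  rw [← h1, MulAction.index_stabilizer]
  congr 1
  ext f'
  exact ⟨fun ⟨q, hq⟩ => ⟨q, hq.symm⟩, fun ⟨q, hq⟩ => ⟨q, hq.symm⟩⟩

/-- `V` is the sum of its corners. The orbit of `f` has as many maps as the index of the stabilizer,
each of them carries `∏ n (f x)` multi-indices, all these corners have the same dimension, and the
others vanish. -/
theorem HasType.finrank_eq (hρ : HasType σ ρ) (hu : IsMatrixUnits σ u)
    [FiniteDimensional ℂ V] [Finite Q] (hn : ∀ c, 0 < n c) (hirr : ρ.IsIrreducible) {f : X → C}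
    (hf : IsConstituent hn ρ u f) : Module.finrank ℂ V =
      (fixer (Q := Q) f).index * (∏ x, n (f x)) *
        Module.finrank ℂ (corner ρ u (stdIndex hn f)) := by
  classical
  rw [hρ.finrank_eq_sum hu]
  have hz : ∀ i : X → Σ c, Fin (n c), Module.finrank ℂ (corner ρ u i) =
      if ∃ q : Q, (fun x => (i x).1) = permute q f then
        Module.finrank ℂ (corner ρ u (stdIndex hn f)) else 0 := by
    intro i
    split_ifs with h
    · obtain ⟨q, hq⟩ := h
      exact hρ.finrank_corner_eq hu q fun x => congrFun hq x
    · rw [← hρ.isConstituent_iff hu hn hirr hf, ← hρ.corner_ne_bot_iff hu hn, not_not] at h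
      rw [h, finrank_bot]
  have hcard : ∀ f' : X → C, (Finset.univ.filter fun i : X → Σ c, Fin (n c) =>
      (fun x => (i x).1) = f').card = ∏ x, n (f' x) := by
    intro f'
    have : (Finset.univ.filter fun i : X → Σ c, Fin (n c) => (fun x => (i x).1) = f') =
        Fintype.piFinset fun x => Finset.univ.map (Function.Embedding.sigmaMk (f' x)) := by
      ext i
      simp only [Finset.mem_filter, Finset.mem_univ, true_and, Fintype.mem_piFinset,
        Finset.mem_map, Function.Embedding.sigmaMk_apply]
      constructor
      · rintro rfl x; exact ⟨(i x).2, rfl⟩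
      · intro h; funext x; obtain ⟨a, ha⟩ := h x; rw [← ha]
    rw [this, Fintype.card_piFinset]
    simp
  rw [Finset.sum_congr rfl fun i _ => hz i,
    ← Finset.sum_fiberwise Finset.univ (fun i : X → Σ c, Fin (n c) => fun x => (i x).1)]
  have hin : ∀ f' : X → C, ∑ i : X → Σ c, Fin (n c) with (fun x => (i x).1) = f',
      (if ∃ q : Q, (fun x => (i x).1) = permute q f then
        Module.finrank ℂ (corner ρ u (stdIndex hn f)) else 0) =
      if ∃ q : Q, f' = permute q f then
        (∏ x, n (f x)) * Module.finrank ℂ (corner ρ u (stdIndex hn f)) else 0 := by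
    intro f'
    rw [Finset.sum_congr rfl (g := fun _ => if ∃ q : Q, f' = permute q f then
        Module.finrank ℂ (corner ρ u (stdIndex hn f)) else 0)
      (fun i hi => by rw [(Finset.mem_filter.1 hi).2]), Finset.sum_const, hcard]
    split_ifs with h
    · obtain ⟨q, rfl⟩ := h
      rw [smul_eq_mul]
      congr 1
      exact Fintype.prod_equiv (MulAction.toPerm q⁻¹) _ _ fun x => rfl
    · simp
  rw [Finset.sum_congr rfl fun f' _ => hin f', ← Finset.sum_filter, Finset.sum_const, smul_eq_mul,
    ← ncard_setOf_permute, ← mul_assoc]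
  congr 2
  rw [← Set.ncard_coe_finset]
  congr 1
  ext f'
  simp

end Corner

/-! ### A representation containing every representation of every stabilizer -/

section BigRep

variable {H : Type u} {Q : Type v} {X : Type w} [Group H] [Group Q] [MulAction Q X]
  [DecidableEq X] [Fintype X] {C : Type*} [Fintype C] [DecidableEq C] {n : C → ℕ}
  (σ : ∀ c, Representation ℂ H (Fin (n c) → ℂ))

/-- The Kronecker product of a family of matrices. -/
def tensorMat {J : Type*} (A : X → Matrix J J ℂ) : Matrix (X → J) (X → J) ℂ :=
  Matrix.of fun k l => ∏ x, A x (k x) (l x)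

theorem tensorMat_apply {J : Type*} (A : X → Matrix J J ℂ) (k l : X → J) :
    tensorMat A k l = ∏ x, A x (k x) (l x) := rfl

theorem tensorMat_mul {J : Type*} [Fintype J] [DecidableEq J] (A B : X → Matrix J J ℂ) :
    tensorMat (A * B) = tensorMat A * tensorMat B := by
  ext k l
  simp only [tensorMat_apply, Pi.mul_apply, Matrix.mul_apply, Finset.prod_univ_sum,
    Fintype.piFinset_univ, Finset.prod_mul_distrib]

theorem tensorMat_one {J : Type*} [Fintype J] [DecidableEq J] :
    tensorMat (1 : X → Matrix J J ℂ) = 1 := by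
  ext k l
  rw [tensorMat_apply, Matrix.one_apply]
  split_ifs with h
  · subst h; simp
  · obtain ⟨x, hx⟩ := Function.ne_iff.1 h
    exact Finset.prod_eq_zero (Finset.mem_univ x) (by simp [Matrix.one_apply_ne hx])

theorem tensorMat_permute {J : Type*} (q : Q) (A : X → Matrix J J ℂ) (k l : X → J) :
    tensorMat (permute q A) (permute q k) (permute q l) = tensorMat A k l :=
  Fintype.prod_equiv (MulAction.toPerm q⁻¹) _ _ fun _ => rfl

variable (Q) in
/-- The action of a tuple of matrices on functions. -/
def baseOp {J : Type*} [Fintype J] [DecidableEq J] :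
    (X → Matrix J J ℂ) →* Module.End ℂ ((X → J) × Q → ℂ) where
  toFun A :=
    { toFun := fun φ p => ∑ l, tensorMat A p.1 l * φ (l, p.2)
      map_add' := fun φ ψ => by funext p; simp [mul_add, Finset.sum_add_distrib]
      map_smul' := fun c φ => by
        funext p; simp [Finset.mul_sum, mul_left_comm] }
  map_one' := by
    ext φ p
    simp [tensorMat_one, Matrix.one_apply]
  map_mul' A B := by
    apply LinearMap.ext; intro φ; funext p
    simp only [tensorMat_mul, Matrix.mul_apply, LinearMap.coe_mk, AddHom.coe_mk,
      Module.End.mul_apply, Finset.sum_mul, Finset.mul_sum]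
    rw [Finset.sum_comm]
    simp only [mul_assoc]

theorem baseOp_apply {J : Type*} [Fintype J] [DecidableEq J] (A : X → Matrix J J ℂ)
    (φ : (X → J) × Q → ℂ) (p : (X → J) × Q) :
    baseOp Q A φ p = ∑ l, tensorMat A p.1 l * φ (l, p.2) := rfl

/-- The action of `Q` on functions by permutation of the arguments. -/
def permOp {J : Type*} : Q →* Module.End ℂ ((X → J) × Q → ℂ) where
  toFun q := LinearMap.funLeft ℂ ℂ fun p => (permute q⁻¹ p.1, q⁻¹ * p.2)
  map_one' := by ext φ p; simp [LinearMap.funLeft_apply]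
  map_mul' q r := by
    apply LinearMap.ext; intro φ; funext p
    simp [LinearMap.funLeft_apply, permute_mul, mul_assoc]

theorem permOp_apply {J : Type*} (q : Q) (φ : (X → J) × Q → ℂ) (p : (X → J) × Q) :
    permOp q φ p = φ (permute q⁻¹ p.1, q⁻¹ * p.2) := rfl

theorem permOp_mul_baseOp {J : Type*} [Fintype J] [DecidableEq J] (q : Q)
    (A : X → Matrix J J ℂ) : permOp q * baseOp Q A = baseOp Q (permute q A) * permOp q := by
  apply LinearMap.ext; intro φ; funext p
  simp only [Module.End.mul_apply, baseOp_apply, permOp_apply]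
  refine Fintype.sum_bijective (fun l => permute q l) ?_ _ _ fun l => ?_
  · refine Function.bijective_iff_has_inverse.2 ⟨permute q⁻¹, fun l => ?_, fun l => ?_⟩ <;>
      simp [← permute_mul]
  · rw [← permute_mul, inv_mul_cancel, permute_one, ← tensorMat_permute q, ← permute_mul,
      mul_inv_cancel, permute_one]

/-- A representation of the wreath product containing all the irreducible representations made
of the representations `σ c` of `H`. -/
noncomputable def bigRep :
    Representation ℂ (PermWreath H Q X) ((X → Σ c, Fin (n c)) × Q → ℂ) where
  toFun g := baseOp Q (fun x => sumMatrix σ (MonoidAlgebra.of ℂ H (g.base x))) * permOp g.top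
  map_one' := by
    simp only [PermWreath.one_base, PermWreath.one_top, map_one, mul_one]
    exact map_one _
  map_mul' g h := by
    rw [mul_assoc, ← mul_assoc (permOp _) (baseOp Q _), permOp_mul_baseOp, mul_assoc, ← mul_assoc,
      ← map_mul, PermWreath.mul_top, map_mul]
    congr 2
    funext x
    simp only [PermWreath.mul_base, map_mul]
    rfl

theorem bigRep_apply (g : PermWreath H Q X) :
    bigRep σ g = baseOp Q (fun x => sumMatrix σ (MonoidAlgebra.of ℂ H (g.base x))) *
      permOp g.top := rfl

theorem bigRep_coordAlg (x : X) (α : MonoidAlgebra ℂ H) :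
    (bigRep (Q := Q) σ).asAlgebraHom (coordAlg x α) =
      baseOp Q (Pi.mulSingle x (sumMatrix σ α)) := by
  have key : ∀ (B : Matrix (Σ c, Fin (n c)) (Σ c, Fin (n c)) ℂ) (k l : X → Σ c, Fin (n c)),
      tensorMat (Pi.mulSingle x B) k l = B (k x) (l x) *
        ∏ y ∈ Finset.univ.erase x, (1 : Matrix (Σ c, Fin (n c)) (Σ c, Fin (n c)) ℂ) (k y) (l y) := by
    intro B k l
    rw [tensorMat_apply, ← Finset.mul_prod_erase _ _ (Finset.mem_univ x), Pi.mulSingle_eq_same]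
    congr 1
    refine Finset.prod_congr rfl fun y hy => ?_
    rw [Pi.mulSingle_eq_of_ne (Finset.ne_of_mem_erase hy)]
  induction α using MonoidAlgebra.induction_linear with
  | zero =>
    apply LinearMap.ext; intro φ; funext p
    rw [baseOp_apply]
    simp only [map_zero, key, Matrix.zero_apply, zero_mul, Finset.sum_const_zero,
      LinearMap.zero_apply, Pi.zero_apply]
  | add a b ha hb =>
    rw [map_add, map_add, ha, hb]
    apply LinearMap.ext; intro φ; funext p
    simp only [LinearMap.add_apply, Pi.add_apply, baseOp_apply, key, map_add, Matrix.add_apply,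
      add_mul, Finset.sum_add_distrib]
  | single h c =>
    rw [coordAlg_single, asAlgebraHom_single, bigRep_apply]
    have h1 : (fun y => sumMatrix σ (MonoidAlgebra.of ℂ H ((coordHom (Q := Q) x h).base y))) =
        Pi.mulSingle x (sumMatrix σ (MonoidAlgebra.of ℂ H h)) := by
      funext y
      by_cases hy : y = x
      · subst hy; simp [coordHom]
      · simp only [coordHom, MonoidHom.coe_mk, OneHom.coe_mk, Pi.mulSingle_eq_of_ne hy, map_one]
    have h2 : (coordHom (Q := Q) x h).top = 1 := rfl
    have h3 : MonoidAlgebra.single h c = c • MonoidAlgebra.of ℂ H h := by simp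
    rw [h1, h2, map_one, mul_one, h3]
    apply LinearMap.ext; intro φ; funext p
    simp only [LinearMap.smul_apply, Pi.smul_apply, baseOp_apply, key, sumMatrix_smul,
      Matrix.smul_apply, smul_eq_mul, Finset.mul_sum, mul_assoc]

theorem hasType_bigRep : HasType σ (bigRep (Q := Q) (X := X) σ) := by
  intro x α hα
  rw [bigRep_coordAlg, hα]
  apply LinearMap.ext; intro φ; funext p
  rw [baseOp_apply]
  simp only [LinearMap.zero_apply, Pi.zero_apply]
  refine Finset.sum_eq_zero fun l _ => ?_
  rw [tensorMat_apply, Finset.prod_eq_zero (Finset.mem_univ x) (by simp), zero_mul]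

theorem tensorOp_bigRep (a : X → MonoidAlgebra ℂ H) :
    tensorOp (bigRep (Q := Q) σ) a = baseOp Q fun x => sumMatrix σ (a x) := by
  let g₀ : (X → MonoidAlgebra ℂ H) →* (X → Matrix (Σ c, Fin (n c)) (Σ c, Fin (n c)) ℂ) :=
    MonoidHom.pi fun x => (RingHom.toMonoidHom (sumMatrix σ)).comp (Pi.evalMonoidHom _ x)
  let g : (X → MonoidAlgebra ℂ H) →* Module.End ℂ ((X → Σ c, Fin (n c)) × Q → ℂ) :=
    (baseOp Q).comp g₀
  have : (tensorOp (bigRep (Q := Q) σ) : (X → MonoidAlgebra ℂ H) →* _) = g := by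
    apply MonoidHom.pi_ext
    intro x α
    have h1 : tensorOp (bigRep (Q := Q) σ) (Pi.mulSingle x α) =
        (bigRep (Q := Q) σ).asAlgebraHom (tensorHom (Pi.mulSingle x α)) := rfl
    have h2 : g₀ (Pi.mulSingle x α) = Pi.mulSingle x (sumMatrix σ α) := by
      funext y
      have h3 : g₀ (Pi.mulSingle x α) y = sumMatrix σ ((Pi.mulSingle x α : X → _) y) := rfl
      rw [h3]
      by_cases hy : y = x
      · subst hy; rw [Pi.mulSingle_eq_same, Pi.mulSingle_eq_same]
      · rw [Pi.mulSingle_eq_of_ne hy, Pi.mulSingle_eq_of_ne hy, map_one]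
    rw [h1, tensorHom_mulSingle, bigRep_coordAlg, MonoidHom.comp_apply, h2]
  rw [this]; rfl

variable {σ}

/-- Consequently the corner of `i` is the space of functions supported on `{i} × Q`. It is a copy of
the functions on `Q`, in which every irreducible representation of the stabilizer occurs. -/
theorem unitOp_bigRep {u : (Σ c, Fin (n c)) → (Σ c, Fin (n c)) → MonoidAlgebra ℂ H}
    (hu : IsMatrixUnits σ u) {i k : X → Σ c, Fin (n c)} (h : ∀ x, (i x).1 = (k x).1)
    (φ : (X → Σ c, Fin (n c)) × Q → ℂ) (p : (X → Σ c, Fin (n c)) × Q) :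
    unitOp (bigRep σ) u i k φ p = if p.1 = i then φ (k, p.2) else 0 := by
  rw [unitOp, tensorOp_bigRep, baseOp_apply]
  have h1 : (fun x => sumMatrix σ (u (i x) (k x))) = fun x => Matrix.single (i x) (k x) 1 := by
    funext x; rw [hu, if_pos (h x)]
  rw [h1]
  rw [Finset.sum_eq_single k]
  · rw [tensorMat_apply]
    split_ifs with hp
    · subst hp; simp
    · obtain ⟨x, hx⟩ := Function.ne_iff.1 hp
      rw [Finset.prod_eq_zero (Finset.mem_univ x), zero_mul]
      rw [Matrix.single_apply, if_neg]; rintro ⟨h1, -⟩; exact hx h1.symm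
  · intro l _ hl
    obtain ⟨x, hx⟩ := Function.ne_iff.1 hl
    rw [tensorMat_apply, Finset.prod_eq_zero (Finset.mem_univ x), zero_mul]
    rw [Matrix.single_apply, if_neg]; rintro ⟨-, h1⟩; exact hx h1.symm
  · simp

theorem continuous_base [TopologicalSpace H] :
    Continuous (PermWreath.base : PermWreath H Q X → X → H) :=
  continuous_iff_le_induced.2 inf_le_left

theorem continuous_comp_top [TopologicalSpace H] {A : Type*} [TopologicalSpace A] (f : Q → A) :
    Continuous fun g : PermWreath H Q X => f g.top := by
  have h1 : @Continuous _ _ _ ⊥ (PermWreath.top : PermWreath H Q X → Q) :=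
    continuous_iff_le_induced.2 inf_le_right
  have h2 : @Continuous _ _ ⊥ _ f := continuous_bot
  exact @Continuous.comp _ _ _ _ ⊥ _ _ _ h2 h1

theorem hasContCoeff_bigRep [TopologicalSpace H] [Finite Q] (hσ : ∀ c, HasContCoeff (σ c)) :
    HasContCoeff (bigRep (Q := Q) (X := X) σ) := by
  have := Fintype.ofFinite Q
  intro φ l
  have hc : Continuous fun g => bigRep (Q := Q) (X := X) σ g φ := by
    refine continuous_pi fun p => ?_
    simp only [bigRep_apply, Module.End.mul_apply, baseOp_apply, permOp_apply]
    refine continuous_finsetSum _ fun l _ => Continuous.mul ?_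
      (continuous_comp_top fun q => φ (permute q⁻¹ l, q⁻¹ * p.2))
    simp only [tensorMat_apply]
    refine continuous_finsetProd _ fun x _ => ?_
    have h1 : Continuous fun g : PermWreath H Q X => g.base x :=
      (continuous_apply x).comp continuous_base
    have h2 : ∀ j k : Σ c, Fin (n c), Continuous fun h : H =>
        sumMatrix σ (MonoidAlgebra.of ℂ H h) j k := by
      rintro ⟨c, j⟩ ⟨c', k⟩
      by_cases hcc : c = c'
      · subst hcc
        simp only [sumMatrix_apply, Matrix.blockDiagonal'_apply_eq, LinearMap.toMatrix'_apply,
          asAlgebraHom_of]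
        exact hσ c _ (LinearMap.proj j)
      · simp only [sumMatrix_apply_ne σ _ (j := ⟨c, j⟩) (k := ⟨c', k⟩) hcc]
        exact continuous_const
    exact (h2 _ _).comp h1
  exact (LinearMap.continuous_of_finiteDimensional l).comp hc

theorem HasType.subrep {V : Type*} [AddCommGroup V] [Module ℂ V]
    {ρ : Representation ℂ (PermWreath H Q X) V} (hρ : HasType σ ρ) {U : Submodule ℂ V}
    (hU : IsStable ρ U) : HasType σ hU.subrep := by
  intro x α hα
  ext v
  rw [hU.subrep_asAlgebraHom, hρ x α hα]
  rfl

theorem HasType.of_equiv {V W : Type*} [AddCommGroup V] [Module ℂ V] [AddCommGroup W] [Module ℂ W]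
    {ρ : Representation ℂ (PermWreath H Q X) V} {ρ' : Representation ℂ (PermWreath H Q X) W}
    (hρ : HasType σ ρ) (e : ρ.Equiv ρ') : HasType σ ρ' := by
  intro x α hα
  apply LinearMap.ext
  intro w
  obtain ⟨v, rfl⟩ := e.toLinearEquiv.surjective w
  have := equiv_asAlgebraHom e (coordAlg x α) v
  rw [hρ x α hα] at this
  simpa using this.symm

/-- Every irreducible representation of the inertia quotient comes from an irreducible
representation of the wreath product. -/
theorem exists_irrep_cornerRep [TopologicalSpace H] [Finite Q] (hσ : ∀ c, HasContCoeff (σ c))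
    {u : (Σ c, Fin (n c)) → (Σ c, Fin (n c)) → MonoidAlgebra ℂ H} (hu : IsMatrixUnits σ u)
    {f : X → C} {i : X → Σ c, Fin (n c)} (hi : ∀ x, (i x).1 = f x) {m : ℕ}
    (χ : Representation ℂ (fixer (Q := Q) f) (Fin m → ℂ)) (hχ : χ.IsIrreducible) :
    ∃ (N : ℕ) (E : Irrep (PermWreath H Q X) N) (hE : HasType σ E.1),
      Nonempty (χ.Equiv (cornerRep hE hu hi)) := by
  classical
  have := Fintype.ofFinite Q
  have hirr := hχ
  rw [isIrreducible_iff] at hχ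
  obtain ⟨hnt, hχ⟩ := hχ
  obtain ⟨v1, hv1⟩ := exists_ne (0 : Fin m → ℂ)
  obtain ⟨j0, hj0⟩ := Function.ne_iff.1 hv1
  let V := (X → Σ c, Fin (n c)) × Q → ℂ
  -- The vector `v` is sent to its matrix coefficient `q ↦ (χ(q)⁻¹ v)_{j0}`, extended by zero off
  -- `{i} × fixer f`. The coordinate `j0` is one at which `v1` does not vanish, so that `ψ v1 ≠ 0`.
  let ψ : (Fin m → ℂ) →ₗ[ℂ] ((X → Σ c, Fin (n c)) × Q → ℂ) :=
    { toFun := fun v p => if h : p.1 = i ∧ p.2 ∈ fixer f then χ ⟨p.2, h.2⟩⁻¹ v j0 else 0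
      map_add' := fun v w => by
        funext p
        simp only [Pi.add_apply, map_add]
        split_ifs
        · rfl
        · rw [add_zero]
      map_smul' := fun c v => by
        funext p
        simp only [Pi.smul_apply, map_smul, RingHom.id_apply]
        split_ifs
        · rfl
        · rw [smul_zero] }
  have hψ : ∀ v p, ψ v p = if h : p.1 = i ∧ p.2 ∈ fixer f then χ ⟨p.2, h.2⟩⁻¹ v j0 else 0 :=
    fun v p => rfl
  let ρ := bigRep (Q := Q) (X := X) σ
  have hρ : HasType σ ρ := hasType_bigRep σ
  have hs : ∀ q : fixer (Q := Q) f, ∀ x, (i x).1 = (permute q.1 i x).1 := fun q x => by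
      rw [permute, hi, hi]; exact ((inv_mem q.2) x).symm
  have hψc : ∀ q v, unitOp ρ u i (permute q.1 i) (ρ (topHom q.1) (ψ v)) = ψ (χ q v) := by
    intro q v
    funext p
    rw [unitOp_bigRep hu (hs q)]
    have h1 : ρ (topHom q.1) = permOp q.1 := by
      rw [bigRep_apply]
      have : (fun x => sumMatrix σ (MonoidAlgebra.of ℂ H ((topHom (H := H) (X := X) q.1).base x))) = 1 := by
        funext x; exact (congrArg (sumMatrix σ) (map_one _)).trans (map_one _)
      rw [this, map_one, one_mul]; rfl
    rw [h1, permOp_apply, hψ, hψ]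
    simp only [← permute_mul, inv_mul_cancel, permute_one, true_and]
    by_cases hp : p.1 = i
    · rw [if_pos hp]
      by_cases hp2 : p.2 ∈ fixer f
      · have h3 : q.1⁻¹ * p.2 ∈ fixer f := mul_mem (inv_mem q.2) hp2
        have h4 : (⟨q.1⁻¹ * p.2, h3⟩ : fixer f)⁻¹ = ⟨p.2, hp2⟩⁻¹ * q := by
          ext; simp
        rw [dif_pos h3, dif_pos ⟨hp, hp2⟩, h4, map_mul]
        rfl
      · have h3 : q.1⁻¹ * p.2 ∉ fixer f := fun h => hp2 (by simpa using mul_mem q.2 h)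
        rw [dif_neg h3, dif_neg (fun h => hp2 h.2)]
    · rw [if_neg hp, dif_neg (fun h => hp h.1)]
  have hψmem : ∀ v, ψ v ∈ corner ρ u i := by
    intro v
    rw [hρ.mem_corner hu]
    funext p
    rw [unitOp_bigRep hu (fun _ => rfl)]
    split_ifs with hp
    · rw [← hp]
    · rw [hψ, dif_neg (fun h => hp h.1)]
  -- The kernel is stable under the irreducible `χ`, and it does not contain `v1`.
  have hker : LinearMap.ker ψ = ⊥ := by
    rcases hχ (LinearMap.ker ψ) (fun q v hv => by
      rw [LinearMap.mem_ker] at hv ⊢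
      rw [← hψc, hv, map_zero, map_zero]) with h | h
    · exact h
    · exfalso
      have : v1 ∈ LinearMap.ker ψ := by rw [h]; trivial
      have h2 := congrFun (LinearMap.mem_ker.1 this) (i, 1)
      rw [hψ, dif_pos ⟨rfl, one_mem _⟩] at h2
      apply hj0
      have h3 : (⟨1, one_mem _⟩ : fixer (Q := Q) f)⁻¹ = 1 := inv_one
      simpa [h3] using h2
  have hinj : Function.Injective ψ := LinearMap.ker_eq_bot.1 hker
  set U := LinearMap.range ψ with hUdef
  have hU : U ≤ corner ρ u i := by rintro _ ⟨v, rfl⟩; exact hψmem v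
  have hUst : ∀ q ∈ fixer (Q := Q) f, ∀ v ∈ U,
      unitOp ρ u i (permute q i) (ρ (topHom q) v) ∈ U := by
    rintro q hq _ ⟨v, rfl⟩
    exact ⟨χ ⟨q, hq⟩ v, (hψc ⟨q, hq⟩ v).symm⟩
  have hUne : U ≠ ⊥ := by
    intro h
    have : ψ v1 ∈ U := ⟨v1, rfl⟩
    rw [h, Submodule.mem_bot] at this
    exact hv1 (hinj (this.trans (map_zero ψ).symm))
  have hDirr := hρ.isIrreducible_translates hu hi hU hUne hUst (by
    intro U' hU' hst'
    rcases hχ (U'.comap ψ) (fun q v hv => by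
      have := hst' q.1 q.2 _ hv
      rw [hψc] at this; exact this) with h | h
    · left
      rw [eq_bot_iff]
      intro w hw
      obtain ⟨v, rfl⟩ := hU' hw
      have : v ∈ U'.comap ψ := hw
      rw [h, Submodule.mem_bot] at this
      simp [this]
    · right
      refine le_antisymm hU' ?_
      rintro _ ⟨v, rfl⟩
      have : v ∈ U'.comap ψ := by rw [h]; trivial
      exact this)
  have hst := isStable_translates (ρ := ρ) U
  obtain ⟨E, ⟨e⟩⟩ := exists_irrep_equiv hDirr ((hasContCoeff_bigRep hσ).subrep hst) rfl
  have hE : HasType σ E.1 := (hρ.subrep hst).of_equiv e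
  refine ⟨_, E, hE, ?_⟩
  let θ₀ : (Fin m → ℂ) →ₗ[ℂ] translates ρ U :=
    ψ.codRestrict _ (fun v => le_translates U ⟨v, rfl⟩)
  have hop : ∀ (k l : X → Σ c, Fin (n c)) (d : translates ρ U),
      unitOp E.1 u k l (e d) = e (unitOp hst.subrep u k l d) := fun k l d =>
    (equiv_asAlgebraHom e _ d).symm
  have hop' : ∀ (k l : X → Σ c, Fin (n c)) (d : translates ρ U),
      (unitOp hst.subrep u k l d : V) = unitOp ρ u k l d := fun k l d =>
    hst.subrep_asAlgebraHom _ d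
  refine nonempty_equiv_cornerRep hE hu hi χ (e.toLinearEquiv.toLinearMap ∘ₗ θ₀) ?_ ?_ ?_
  · refine e.toLinearEquiv.injective.comp fun a b hab => hinj ?_
    exact congrArg Subtype.val hab
  · ext w
    obtain ⟨d, rfl⟩ := e.toLinearEquiv.surjective w
    rw [hE.mem_corner hu]
    change _ ↔ unitOp E.1 u i i (e d) = e d
    rw [hop]
    constructor
    · rintro ⟨v, hv⟩
      have hd : θ₀ v = d := e.toLinearEquiv.injective hv
      congr 1
      ext1
      rw [hop', ← hd]
      exact (hρ.mem_corner hu).1 (hψmem v)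
    · intro h
      have h1 : unitOp hst.subrep u i i d = d := e.toLinearEquiv.injective h
      -- The corner of the generated representation is no larger than the image of `ψ`, so the
      -- corner is exactly `χ`.
      have h2 := hρ.unitOp_translates hu hi hU hUst d.2
      rw [← hop', h1] at h2
      obtain ⟨v, hv⟩ := h2
      exact ⟨v, congrArg e.toLinearEquiv (Subtype.ext hv : θ₀ v = d)⟩
  · intro q v
    change e (θ₀ (χ q v)) = unitOp E.1 u i (permute q.1 i) (E.1 (topHom q.1) (e (θ₀ v)))
    rw [← equiv_apply e, hop]
    congr 1
    ext1
    rw [hop']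
    exact (hψc q v).symm

end BigRep

/-! ### The restriction of an irreducible representation to the coordinates of the base -/

section TypeOf

variable {H : Type u} {Q : Type v} {X : Type w} [Group H] [Group Q] [MulAction Q X]
  [DecidableEq X]

theorem coordHom_mul (x : X) (h : H) (g : PermWreath H Q X) :
    coordHom x h * g = g * coordHom (g.top⁻¹ • x) ((g.base x)⁻¹ * h * g.base x) := by
  ext y
  · by_cases hy : y = x
    · subst hy; simp [coordHom, mul_assoc]
    · have : g.top⁻¹ • y ≠ g.top⁻¹ • x := fun h => hy (MulAction.injective _ h)
      simp [coordHom, Pi.mulSingle_eq_of_ne hy, Pi.mulSingle_eq_of_ne this]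
  · simp [coordHom]

/-- Moving `g` to the left conjugates the coefficient and permutes the coordinate. A condition
imposed on all coordinates by a two-sided ideal thus defines a stable subspace. -/
theorem coordAlg_mul_of (x : X) (α : MonoidAlgebra ℂ H) (g : PermWreath H Q X) :
    coordAlg x α * MonoidAlgebra.of ℂ _ g = MonoidAlgebra.of ℂ _ g * coordAlg (g.top⁻¹ • x)
      (MonoidAlgebra.of ℂ H (g.base x)⁻¹ * α * MonoidAlgebra.of ℂ H (g.base x)) := by
  induction α using MonoidAlgebra.induction_linear with
  | zero => simp only [map_zero, zero_mul, mul_zero]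
  | add a b ha hb => simp only [map_add, add_mul, mul_add, ha, hb]
  | single h c =>
    simp only [MonoidAlgebra.of_apply, MonoidAlgebra.single_mul_single, one_mul, mul_one,
      coordAlg_single, coordHom_mul]

variable [Fintype X] {C : Type*} [Fintype C] [DecidableEq C] {n : C → ℕ}
  {σ : ∀ c, Representation ℂ H (Fin (n c) → ℂ)}

theorem continuous_wreath_iff [TopologicalSpace H] {A : Type*} [TopologicalSpace A]
    {f : A → PermWreath H Q X} :
    Continuous f ↔ (Continuous fun a => (f a).base) ∧ @Continuous _ _ _ ⊥ fun a => (f a).top := by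
  let t₁ : TopologicalSpace (PermWreath H Q X) := .induced PermWreath.base inferInstance
  let t₂ : TopologicalSpace (PermWreath H Q X) := @TopologicalSpace.induced _ _ PermWreath.top ⊥
  have h : @Continuous _ _ _ (t₁ ⊓ t₂) f ↔ @Continuous _ _ _ t₁ f ∧ @Continuous _ _ _ t₂ f :=
    @continuous_inf_rng _ _ _ _ t₁ t₂
  have h₁ : @Continuous _ _ _ t₁ f ↔ Continuous fun a => (f a).base := continuous_induced_rng
  have h₂ : @Continuous _ _ _ t₂ f ↔ @Continuous _ _ _ ⊥ fun a => (f a).top :=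
    let _ : TopologicalSpace Q := ⊥
    continuous_induced_rng
  exact h.trans (and_congr h₁ h₂)

theorem continuous_coordHom [TopologicalSpace H] (x : X) :
    Continuous (coordHom x : H → PermWreath H Q X) := by
  refine continuous_wreath_iff.2 ⟨?_, ?_⟩
  · exact continuous_pi fun y => by
      by_cases hy : y = x
      · subst hy
        simpa [coordHom] using continuous_id'
      · simpa [Function.comp_def, coordHom, Pi.mulSingle_eq_of_ne hy] using continuous_const
  · exact @continuous_const _ _ _ ⊥ (1 : Q)

/-- The restriction of a representation of the wreath product to a factor of the base. -/
def restrictCoord {V : Type*} [AddCommGroup V] [Module ℂ V]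
    (ρ : Representation ℂ (PermWreath H Q X) V) (x : X) : Representation ℂ H V :=
  MonoidHom.comp ρ (coordHom x)

theorem restrictCoord_asAlgebraHom {V : Type*} [AddCommGroup V] [Module ℂ V]
    (ρ : Representation ℂ (PermWreath H Q X) V) (x : X) (α : MonoidAlgebra ℂ H) :
    (restrictCoord ρ x).asAlgebraHom α =
      ρ.asAlgebraHom (coordAlg x α) := by
  induction α using MonoidAlgebra.induction_linear with
  | zero => simp only [map_zero]
  | add a b ha hb => simp only [map_add, ha, hb]
  | single h c =>
    rw [coordAlg_single, asAlgebraHom_single, asAlgebraHom_single]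
    rfl

/-- A representation of the wreath product is made of the `σ c` as soon as every irreducible
representation of `H` of smaller dimension is one of them. -/
theorem hasType_of_irreducible [TopologicalSpace H] {V : Type*} [AddCommGroup V] [Module ℂ V]
    [FiniteDimensional ℂ V] {ρ : Representation ℂ (PermWreath H Q X) V} (hirr : ρ.IsIrreducible)
    (hc : HasContCoeff ρ)
    (hσ : ∀ (k : ℕ) (τ : Irrep H k), k ≤ Module.finrank ℂ V → ∃ c, Nonempty (τ.1.Equiv (σ c))) :
    HasType σ ρ := by
  -- The vectors on which the coordinates in `S` already look like the `σ c`. The aim is that `K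
  -- univ` is nonzero; being stable, it is then everything.
  let K : Finset X → Submodule ℂ V := fun S =>
    { carrier := {v | ∀ x ∈ S, ∀ α, sumMatrix σ α = 0 → ρ.asAlgebraHom (coordAlg x α) v = 0}
      zero_mem' := fun x _ α _ => map_zero _
      add_mem' := fun {a b} ha hb x hx α hα => by rw [map_add, ha x hx α hα, hb x hx α hα, add_zero]
      smul_mem' := fun c a ha x hx α hα => by rw [map_smul, ha x hx α hα, smul_zero] }
  have hK : ∀ S v, v ∈ K S ↔ ∀ x ∈ S, ∀ α, sumMatrix σ α = 0 →
    ρ.asAlgebraHom (coordAlg x α) v = 0 := fun S v => Iff.rfl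
  have hne : ∀ S, K S ≠ ⊥ := by
    intro S
    induction S using Finset.induction_on with
    | empty =>
      have : Nontrivial V := ((isIrreducible_iff ρ).1 hirr).1
      obtain ⟨v, hv⟩ := exists_ne (0 : V)
      intro h
      have : v ∈ K ∅ := by rw [hK]; intro x hx; simp at hx
      rw [h, Submodule.mem_bot] at this
      exact hv this
    | insert y S hy ih =>
      let τ : Representation ℂ H V := restrictCoord ρ y
      have hst : IsStable τ (K S) := by
        intro h v hv
        rw [hK] at hv ⊢
        intro x hx α hα
        have hxy : x ≠ y := fun h => hy (h ▸ hx)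
        have h1 : τ h = ρ.asAlgebraHom (coordAlg y (MonoidAlgebra.of ℂ H h)) := by
          rw [← restrictCoord_asAlgebraHom, asAlgebraHom_of]
        rw [h1, ← Module.End.mul_apply, ← map_mul, (coordAlg_commute hxy _ _).eq, map_mul,
          Module.End.mul_apply, hv x hx α hα, map_zero]
      -- The coordinate `y` commutes with those in `S`, so it acts on `K S`. An irreducible
      -- constituent there has dimension at most that of `V`, hence is some `σ c`, and it lies in `K
      -- (insert y S)`.
      obtain ⟨U, hU, hUst, hUirr⟩ := exists_irreducible_le hst ih
      have hcU : HasContCoeff hUst.subrep := by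
        refine HasContCoeff.subrep ?_ hUst
        intro v l
        exact (hc v l).comp (continuous_coordHom y)
      obtain ⟨σ', ⟨e⟩⟩ := exists_irrep_equiv hUirr hcU rfl
      obtain ⟨c, ⟨e'⟩⟩ := hσ _ σ' (Submodule.finrank_le U)
      intro hbot
      have hUne := (hUst.isIrreducible_subrep.1 hUirr).1
      apply hUne
      rw [eq_bot_iff, ← hbot]
      intro v hv
      rw [hK]
      intro x hx α hα
      rcases Finset.mem_insert.1 hx with rfl | hx
      · rw [← restrictCoord_asAlgebraHom]
        have h2 := equiv_asAlgebraHom (e.trans e') α ⟨v, hv⟩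
        rw [(sumMatrix_eq_zero_iff σ α).1 hα c, LinearMap.zero_apply] at h2
        have h3 : hUst.subrep.asAlgebraHom α ⟨v, hv⟩ = 0 :=
          (e.trans e').toLinearEquiv.injective (h2.trans (map_zero _).symm)
        have h4 := hUst.subrep_asAlgebraHom α ⟨v, hv⟩
        rw [h3] at h4
        exact h4.symm
      · exact (hK S v).1 (hU hv) x hx α hα
  have hst : IsStable ρ (K Finset.univ) := by
    intro g v hv
    rw [hK] at hv ⊢
    intro x _ α hα
    have h1 : ρ g = ρ.asAlgebraHom (MonoidAlgebra.of ℂ _ g) := (asAlgebraHom_of _ _).symm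
    rw [h1, ← Module.End.mul_apply, ← map_mul, coordAlg_mul_of, map_mul, Module.End.mul_apply,
      hv _ (Finset.mem_univ _), map_zero]
    rw [map_mul, map_mul, hα, mul_zero, zero_mul]
  rcases ((isIrreducible_iff ρ).1 hirr).2 _ hst with h | h
  · exact absurd h (hne _)
  · intro x α hα
    ext v
    have : v ∈ K Finset.univ := by rw [h]; trivial
    exact this x (Finset.mem_univ x) α hα

end TypeOf

/-! ### Counting the irreducible representations over a given map -/

section Count

variable {H : Type u} {Q : Type v} {X : Type w} [Group H] [Group Q] [MulAction Q X]
  [DecidableEq X] [Fintype X] {C : Type*} [Fintype C] [DecidableEq C] {n : C → ℕ}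
  {σ : ∀ c, Representation ℂ H (Fin (n c) → ℂ)}
  {V : Type*} [AddCommGroup V] [Module ℂ V] {ρ : Representation ℂ (PermWreath H Q X) V}
  {W : Type*} [AddCommGroup W] [Module ℂ W] {ρ' : Representation ℂ (PermWreath H Q X) W}
  {u : (Σ c, Fin (n c)) → (Σ c, Fin (n c)) → MonoidAlgebra ℂ H}

theorem equiv_mem_corner (hρ : HasType σ ρ) (hρ' : HasType σ ρ') (hu : IsMatrixUnits σ u)
    (e : ρ.Equiv ρ') (i : X → Σ c, Fin (n c)) (v : V) :
    e v ∈ corner ρ' u i ↔ v ∈ corner ρ u i := by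
  rw [hρ.mem_corner hu, hρ'.mem_corner hu]
  have : unitOp ρ' u i i (e v) = e (unitOp ρ u i i v) := (equiv_asAlgebraHom e _ v).symm
  rw [this]
  exact e.toLinearEquiv.injective.eq_iff

theorem nonempty_equiv_cornerRep_of_equiv (hρ : HasType σ ρ) (hρ' : HasType σ ρ')
    (hu : IsMatrixUnits σ u) {f : X → C} {i : X → Σ c, Fin (n c)} (hi : ∀ x, (i x).1 = f x)
    (e : ρ.Equiv ρ') : Nonempty ((cornerRep hρ hu hi).Equiv (cornerRep hρ' hu hi)) := by
  refine nonempty_equiv_cornerRep hρ' hu hi _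
    (e.toLinearEquiv.toLinearMap ∘ₗ (corner ρ u i).subtype) ?_ ?_ ?_
  · exact e.toLinearEquiv.injective.comp Subtype.val_injective
  · ext w
    obtain ⟨v, rfl⟩ := e.toLinearEquiv.surjective w
    constructor
    · rintro ⟨a, ha⟩
      rw [← ha]
      exact (equiv_mem_corner hρ hρ' hu e i _).2 a.2
    · intro h
      exact ⟨⟨v, (equiv_mem_corner hρ hρ' hu e i v).1 h⟩, rfl⟩
  · intro q a
    change e (unitOp ρ u i (permute q.1 i) (ρ (topHom q.1) a)) =
      unitOp ρ' u i (permute q.1 i) (ρ' (topHom q.1) (e a))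
    rw [← equiv_apply e]
    exact equiv_asAlgebraHom e _ _

theorem isConstituent_of_equiv (hρ : HasType σ ρ) (hρ' : HasType σ ρ') (hu : IsMatrixUnits σ u)
    (hn : ∀ c, 0 < n c) (e : ρ.Equiv ρ') {f : X → C} (h : IsConstituent hn ρ u f) :
    IsConstituent hn ρ' u f := by
  obtain ⟨v, hv, hv0⟩ := Submodule.exists_mem_ne_zero_of_ne_bot h
  intro hbot
  have := (equiv_mem_corner hρ hρ' hu e _ v).2 hv
  rw [hbot, Submodule.mem_bot] at this
  exact hv0 (e.toLinearEquiv.injective (this.trans (map_zero _).symm))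

theorem fixer_permute_index [Finite Q] (f : X → C) (q : Q) :
    (fixer (Q := Q) (permute q f)).index = (fixer (Q := Q) f).index := by
  rw [← ncard_setOf_permute, ← ncard_setOf_permute]
  congr 1
  ext f'
  constructor
  · rintro ⟨r, rfl⟩; exact ⟨r * q, (permute_mul r q f).symm⟩
  · rintro ⟨r, rfl⟩; exact ⟨r * q⁻¹, by rw [← permute_mul, inv_mul_cancel_right]⟩

/-- The number of irreducible representations of the finite group `K` of degree `m`. -/
noncomputable def discreteCount (K : Type v) [Group K] (m : ℕ) : ℕ :=
  Nat.card (Quotient (@irrepSetoid K _ ⊥ m))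

variable [TopologicalSpace H] [Finite Q]

/-- The classes of representations with a given constituent. -/
def constituentClasses {H : Type u} {Q : Type v} {X : Type w} [Group H] [Group Q] [MulAction Q X]
    [DecidableEq X] [Fintype X] {C : Type*} [Fintype C] [DecidableEq C] {n : C → ℕ}
    [TopologicalSpace H] (hn : ∀ c, 0 < n c)
    (u : (Σ c, Fin (n c)) → (Σ c, Fin (n c)) → MonoidAlgebra ℂ H) (N : ℕ) (f : X → C) :
    Set (Quotient (irrepSetoid (PermWreath H Q X) N)) :=
  {E | IsConstituent hn E.out.1 u f}

theorem isConstituent_out_iff {N : ℕ} (hT : ∀ E : Irrep (PermWreath H Q X) N, HasType σ E.1)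
    (hu : IsMatrixUnits σ u) (hn : ∀ c, 0 < n c) (E : Irrep (PermWreath H Q X) N) (f : X → C) :
    (Quotient.mk _ E) ∈ constituentClasses hn u N f ↔ IsConstituent hn E.1 u f := by
  obtain ⟨e⟩ : (Quotient.mk _ E : Quotient (irrepSetoid (PermWreath H Q X) N)).out ≈ E :=
    Quotient.mk_out E
  exact ⟨isConstituent_of_equiv (hT _) (hT _) hu hn e,
    isConstituent_of_equiv (hT _) (hT _) hu hn e.symm⟩

theorem constituentClasses_eq_empty {N : ℕ}
    (hT : ∀ E : Irrep (PermWreath H Q X) N, HasType σ E.1)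
    (hu : IsMatrixUnits σ u) (hn : ∀ c, 0 < n c) {f : X → C}
    (h : ¬ (fixer (Q := Q) f).index * (∏ x, n (f x)) ∣ N) :
    constituentClasses (Q := Q) hn u N f = ∅ := by
  rw [Set.eq_empty_iff_forall_notMem]
  intro E hE
  have := (hT E.out).finrank_eq hu hn E.out.2.1 hE
  rw [Module.finrank_fin_fun] at this
  exact h ⟨_, this⟩

/-- The Clifford correspondence, given by the corner. Its degree is forced by `HasType.finrank_eq`,
injectivity is `nonempty_equiv_of_cornerRep_equiv`, and surjectivity is `exists_irrep_cornerRep`. -/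
theorem nonempty_constituentClasses_equiv {m : ℕ} (hσ : ∀ c, HasContCoeff (σ c))
    (hu : IsMatrixUnits σ u) (hn : ∀ c, 0 < n c) (f : X → C)
    (hT : ∀ E : Irrep (PermWreath H Q X) ((fixer (Q := Q) f).index * (∏ x, n (f x)) * m),
      HasType σ E.1) :
    Nonempty (constituentClasses (Q := Q) hn u
      ((fixer (Q := Q) f).index * (∏ x, n (f x)) * m) f ≃
      Quotient (@irrepSetoid (fixer (Q := Q) f) _ ⊥ m)) := by
  let _ : TopologicalSpace (fixer (Q := Q) f) := ⊥
  have hd : DiscreteTopology (fixer (Q := Q) f) := ⟨rfl⟩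
  set N := (fixer (Q := Q) f).index * (∏ x, n (f x)) * m with hN
  have hi : ∀ x, (stdIndex hn f x).1 = f x := fun x => rfl
  have hpos : 0 < (fixer (Q := Q) f).index * ∏ x, n (f x) :=
    Nat.mul_pos (Nat.pos_of_ne_zero Subgroup.index_ne_zero_of_finite)
      (Finset.prod_pos fun x _ => hn _)
  have hex : ∀ E : constituentClasses (Q := Q) hn u N f, ∃ χ : Irrep (fixer (Q := Q) f) m,
      Nonempty ((cornerRep (hT E.1.out) hu hi).Equiv χ.1) := by
    intro E
    refine exists_irrep_equiv (isIrreducible_cornerRep (hT E.1.out) hu hi E.1.out.2.1 E.2) ?_ ?_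
    · intro v l; exact continuous_of_discreteTopology
    · have := (hT E.1.out).finrank_eq hu hn E.1.out.2.1 E.2
      rw [Module.finrank_fin_fun] at this
      exact (Nat.eq_of_mul_eq_mul_left hpos (hN.symm.trans this)).symm
  choose χ hχ using hex
  refine ⟨Equiv.ofBijective (fun E => Quotient.mk _ (χ E)) ⟨?_, ?_⟩⟩
  · intro E E' h
    obtain ⟨e⟩ : χ E ≈ χ E' := Quotient.exact h
    obtain ⟨e1⟩ := hχ E
    obtain ⟨e2⟩ := hχ E'
    ext1
    rw [← Quotient.out_equiv_out]
    exact nonempty_equiv_of_cornerRep_equiv (hT _) (hT _) hu hi E.1.out.2.1 E'.1.out.2.1 E.2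
      ((e1.trans e).trans e2.symm)
  · intro c
    induction c using Quotient.inductionOn with
    | _ τ =>
    obtain ⟨M, E, hE, ⟨e⟩⟩ := exists_irrep_cornerRep (Q := Q) hσ hu hi τ.1 τ.2.1
    have hEc : IsConstituent hn E.1 u f := by
      have hnt : Nontrivial (Fin m → ℂ) := ((isIrreducible_iff τ.1).1 τ.2.1).1
      intro hbot
      obtain ⟨v, hv⟩ := exists_ne (0 : Fin m → ℂ)
      have h1 := (Submodule.mem_bot ℂ).1 (le_of_eq hbot (e v).2)
      exact hv (e.toLinearEquiv.injective ((Subtype.ext h1).trans (map_zero _).symm))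
    -- The representation was constructed with an unspecified degree; the dimension formula
    -- identifies it.
    have hM : M = N := by
      have := hE.finrank_eq hu hn E.2.1 hEc
      rw [Module.finrank_fin_fun, ← finrank_eq_of_equiv e, Module.finrank_fin_fun] at this
      exact this
    clear_value N
    subst hM
    let E' : constituentClasses (Q := Q) hn u M f :=
      ⟨Quotient.mk _ E, (isConstituent_out_iff hT hu hn E f).2 hEc⟩
    refine ⟨E', Quotient.sound ?_⟩
    obtain ⟨e1⟩ := hχ E'
    obtain ⟨e2⟩ : E'.1.out ≈ E := Quotient.mk_out E
    obtain ⟨e3⟩ := nonempty_equiv_cornerRep_of_equiv (hT E'.1.out) hE hu hi e2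
    exact ⟨(e1.symm.trans e3).trans e.symm⟩

end Count

/-! ### Representations of a finite group from a Wedderburn decomposition -/

section FiniteGroup

variable {K : Type v} [Group K] [Fintype K]

/-- The element of the group algebra with given coefficients. -/
noncomputable def ofFun : (K → ℂ) →ₗ[ℂ] MonoidAlgebra ℂ K where
  toFun c := ∑ g, c g • MonoidAlgebra.of ℂ K g
  map_add' c d := by simp only [Pi.add_apply, add_smul, Finset.sum_add_distrib]
  map_smul' z c := by
    simp only [Pi.smul_apply, smul_eq_mul, mul_smul, Finset.smul_sum, RingHom.id_apply]

theorem ofFun_eq (c : K → ℂ) : ofFun c = ∑ g, c g • MonoidAlgebra.of ℂ K g := rfl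

theorem coeff_ofFun (c : K → ℂ) (g : K) : (ofFun c).coeff g = c g := by
  classical
  rw [ofFun_eq, MonoidAlgebra.coeff_sum, Finset.sum_apply']
  simp [MonoidAlgebra.coeff_single, Finsupp.single_apply]

theorem ofFun_coeff (α : MonoidAlgebra ℂ K) : ofFun (fun g => α.coeff g) = α := by
  ext g
  exact coeff_ofFun _ _

theorem ofFun_injective : Function.Injective (ofFun (K := K)) := by
  intro c d h
  funext g
  rw [← coeff_ofFun c, h, coeff_ofFun]

theorem of_mul_ofFun_mul (h : K) (c : K → ℂ) :
    MonoidAlgebra.of ℂ K h * ofFun c * MonoidAlgebra.of ℂ K h⁻¹ =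
      ofFun fun g => c (h⁻¹ * g * h) := by
  simp only [ofFun_eq, Finset.mul_sum, Finset.sum_mul, mul_smul_comm, smul_mul_assoc, ← map_mul]
  refine Fintype.sum_equiv (MulAut.conj h).toEquiv _ _ fun g => ?_
  have h1 : h⁻¹ * (h * g * h⁻¹) * h = g := by group
  simp only [MulEquiv.toEquiv_eq_coe, MulEquiv.coe_toEquiv, MulAut.conj_apply, h1]

theorem isCentral_ofFun_iff (c : K → ℂ) :
    (∀ h, Commute (MonoidAlgebra.of ℂ K h) (ofFun c)) ↔ ∀ g h, c (h * g * h⁻¹) = c g := by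
  have key : ∀ h, Commute (MonoidAlgebra.of ℂ K h) (ofFun c) ↔
      (fun g => c (h⁻¹ * g * h)) = c := by
    intro h
    rw [← ofFun_injective.eq_iff, ← of_mul_ofFun_mul]
    have h1 : MonoidAlgebra.of ℂ K h⁻¹ * MonoidAlgebra.of ℂ K h = 1 := by
      rw [← map_mul, inv_mul_cancel, map_one]
    have h2 : MonoidAlgebra.of ℂ K h * MonoidAlgebra.of ℂ K h⁻¹ = 1 := by
      rw [← map_mul, mul_inv_cancel, map_one]
    constructor
    · intro hc; rw [hc.eq, mul_assoc, h2, mul_one]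
    · intro hc
      rw [Commute, SemiconjBy]
      conv_rhs => rw [← hc, mul_assoc, h1, mul_one]
  constructor
  · intro hc g h
    have := congrFun ((key h⁻¹).1 (hc _)) g
    simpa using this
  · intro hc h
    refine (key h).2 (funext fun g => ?_)
    have := hc g h⁻¹
    simpa using this

theorem commute_of_forall_of {α β : MonoidAlgebra ℂ K}
    (h : ∀ g, Commute (MonoidAlgebra.of ℂ K g) α) : Commute β α := by
  rw [← ofFun_coeff β, ofFun_eq]
  exact Finset.sum_induction _ (Commute · α) (fun _ _ => Commute.add_left)
    (Commute.zero_left α) fun g _ => (h g).smul_left _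

variable {r : ℕ} {d : Fin r → ℕ}
  (φ : MonoidAlgebra ℂ K ≃ₐ[ℂ] ∀ i, Matrix (Fin (d i)) (Fin (d i)) ℂ)

/-- The representation on a factor of a Wedderburn decomposition. -/
noncomputable def factorRep (i : Fin r) : Representation ℂ K (Fin (d i) → ℂ) :=
  ((Matrix.toLinAlgEquiv' (R := ℂ) (n := Fin (d i))).toAlgHom.comp
    ((Pi.evalAlgHom ℂ (fun i => Matrix (Fin (d i)) (Fin (d i)) ℂ) i).comp φ.toAlgHom)).toMonoidHom'.comp
    (MonoidAlgebra.of ℂ K)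

theorem factorRep_apply (i : Fin r) (g : K) :
    factorRep φ i g = Matrix.toLin' (φ (MonoidAlgebra.of ℂ K g) i) := rfl

theorem factorRep_asAlgebraHom (i : Fin r) (α : MonoidAlgebra ℂ K) :
    (factorRep φ i).asAlgebraHom α = Matrix.toLin' (φ α i) := by
  rw [← ofFun_coeff α, ofFun_eq]
  simp only [map_sum, map_smul, Finset.sum_apply, Pi.smul_apply, asAlgebraHom_of, factorRep_apply]

theorem exists_eq_single (i : Fin r) (M : Matrix (Fin (d i)) (Fin (d i)) ℂ) :
    ∃ α, φ α = Pi.single i M := φ.surjective _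

theorem isIrreducible_factorRep (hd : ∀ i, 0 < d i) (i : Fin r) :
    (factorRep φ i).IsIrreducible := by
  rw [isIrreducible_iff]
  have : Nonempty (Fin (d i)) := ⟨⟨0, hd i⟩⟩
  refine ⟨inferInstance, fun U hU => ?_⟩
  rw [or_iff_not_imp_left]
  intro hne
  obtain ⟨v, hv, hv0⟩ := Submodule.exists_mem_ne_zero_of_ne_bot hne
  obtain ⟨k, hk⟩ := Function.ne_iff.1 hv0
  rw [eq_top_iff]
  intro w _
  obtain ⟨α, hα⟩ := exists_eq_single φ i (Matrix.of fun a b => if b = k then w a / v k else 0)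
  have := hU.asAlgebraHom_mem α hv
  rw [factorRep_asAlgebraHom, hα, Pi.single_eq_same] at this
  convert this using 1
  funext a
  have hk' : v k ≠ 0 := hk
  simp [Matrix.mulVec, dotProduct, hk']

theorem eq_of_factorRep_equiv (hd : ∀ i, 0 < d i) {i j : Fin r}
    (e : (factorRep φ i).Equiv (factorRep φ j)) : i = j := by
  by_contra hij
  obtain ⟨α, hα⟩ := exists_eq_single φ i 1
  have : Nonempty (Fin (d i)) := ⟨⟨0, hd i⟩⟩
  obtain ⟨v, hv⟩ := exists_ne (0 : Fin (d i) → ℂ)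
  have h := equiv_asAlgebraHom e α v
  rw [factorRep_asAlgebraHom, factorRep_asAlgebraHom, hα, Pi.single_eq_same,
    Pi.single_eq_of_ne (Ne.symm hij)] at h
  simp only [map_zero, LinearMap.zero_apply, Matrix.toLin'_one, LinearMap.id_apply] at h
  exact hv (e.toLinearEquiv.injective (h.trans (map_zero e.toLinearEquiv).symm))

/-- The identity is the sum of the diagonal matrix units, so some `E i a a` does not kill `v`. The
vectors `E i b a v` then span an image of the factor `i`, and irreducibility on both sides makes
this map an isomorphism. -/
theorem exists_equiv_factorRep {V : Type*} [AddCommGroup V] [Module ℂ V] (hd : ∀ i, 0 < d i)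
    {ρ : Representation ℂ K V} (hρ : ρ.IsIrreducible) :
    ∃ i, Nonempty ((factorRep φ i).Equiv ρ) := by
  have hρ' := (isIrreducible_iff ρ).1 hρ
  have := hρ'.1
  obtain ⟨v, hv⟩ := exists_ne (0 : V)
  let E : ∀ i, Fin (d i) → Fin (d i) → MonoidAlgebra ℂ K := fun i a b =>
    φ.symm (Pi.single i (Matrix.single a b 1))
  have hsum : ∑ i, ∑ a, E i a a = 1 := by
    apply φ.injective
    simp only [E, map_sum, map_one, AlgEquiv.apply_symm_apply]
    funext j
    rw [Finset.sum_apply]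
    simp only [Finset.sum_apply]
    rw [Finset.sum_eq_single j]
    · simp only [Pi.single_eq_same, Pi.one_apply]
      ext a b
      rw [Matrix.sum_apply]
      simp only [Matrix.single_apply, Matrix.one_apply]
      by_cases hab : a = b
      · subst hab; simp
      · rw [if_neg hab]
        exact Finset.sum_eq_zero fun x _ => if_neg fun h => hab (h.1.symm.trans h.2)
    · intro i _ hij
      exact Finset.sum_eq_zero fun a _ => Pi.single_eq_of_ne hij.symm _
    · simp
  have hex : ∃ i a, ρ.asAlgebraHom (E i a a) v ≠ 0 := by
    by_contra! h
    apply hv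
    have : ρ.asAlgebraHom 1 v = v := by rw [map_one]; rfl
    rw [← this, ← hsum, map_sum, LinearMap.sum_apply]
    refine Finset.sum_eq_zero fun i _ => ?_
    rw [map_sum, LinearMap.sum_apply]
    exact Finset.sum_eq_zero fun a _ => h i a
  obtain ⟨i, a, hia⟩ := hex
  refine ⟨i, ?_⟩
  let θ : (Fin (d i) → ℂ) →ₗ[ℂ] V :=
    { toFun := fun w => ∑ b, w b • ρ.asAlgebraHom (E i b a) v
      map_add' := fun x y => by simp only [Pi.add_apply, add_smul, Finset.sum_add_distrib]
      map_smul' := fun z x => by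
        simp only [Pi.smul_apply, smul_eq_mul, mul_smul, Finset.smul_sum, RingHom.id_apply] }
  have hθ : ∀ w, θ w = ∑ b, w b • ρ.asAlgebraHom (E i b a) v := fun w => rfl
  have hmul : ∀ g b, MonoidAlgebra.of ℂ K g * E i b a =
      ∑ c, φ (MonoidAlgebra.of ℂ K g) i c b • E i c a := by
    intro g b
    apply φ.injective
    simp only [E, map_mul, map_sum, map_smul, AlgEquiv.apply_symm_apply]
    funext j
    rw [Finset.sum_apply, Pi.mul_apply]
    by_cases hj : j = i
    · subst hj
      simp only [Pi.single_eq_same, Pi.smul_apply]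
      ext x y
      rw [Matrix.sum_apply]
      by_cases hy : y = a
      · subst hy
        simp [Matrix.single_apply]
      · simp [Ne.symm hy, Matrix.mul_apply]
    · simp [Pi.single_eq_of_ne hj]
  have hcomm : ∀ g w, θ (factorRep φ i g w) = ρ g (θ w) := by
    intro g w
    rw [hθ, hθ, map_sum]
    have h1 : ∀ b, ρ g (ρ.asAlgebraHom (E i b a) v) =
        ∑ c, φ (MonoidAlgebra.of ℂ K g) i c b • ρ.asAlgebraHom (E i c a) v := by
      intro b
      rw [← asAlgebraHom_of, ← Module.End.mul_apply, ← map_mul, hmul, map_sum, LinearMap.sum_apply]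
      simp only [map_smul, LinearMap.smul_apply]
    simp only [map_smul, h1, Finset.smul_sum, smul_smul]
    rw [Finset.sum_comm]
    refine Finset.sum_congr rfl fun c _ => ?_
    rw [← Finset.sum_smul, factorRep_apply, Matrix.toLin'_apply]
    simp only [Matrix.mulVec, dotProduct, mul_comm]
  have hirr := (isIrreducible_iff _).1 (isIrreducible_factorRep φ hd i)
  have hker : LinearMap.ker θ = ⊥ := by
    rcases hirr.2 (LinearMap.ker θ) (fun g w hw => by
      rw [LinearMap.mem_ker] at hw ⊢; rw [hcomm, hw, map_zero]) with h | h
    · exact h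
    · exfalso
      have : Pi.single a 1 ∈ LinearMap.ker θ := by rw [h]; trivial
      rw [LinearMap.mem_ker, hθ, Finset.sum_eq_single a] at this
      · simp at this; exact hia this
      · intro b _ hb; rw [Pi.single_eq_of_ne hb, zero_smul]
      · simp
  have hrange : LinearMap.range θ = ⊤ := by
    rcases hρ'.2 (LinearMap.range θ) (by
      rintro g _ ⟨w, rfl⟩; exact ⟨_, hcomm g w⟩) with h | h
    · exfalso
      have h0 : θ = 0 := LinearMap.range_eq_bot.1 h
      rw [h0, LinearMap.ker_zero] at hker
      have := hirr.1
      exact top_ne_bot hker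
    · exact h
  let e := LinearEquiv.ofBijective θ ⟨LinearMap.ker_eq_bot.1 hker, LinearMap.range_eq_top.1 hrange⟩
  refine ⟨Representation.Equiv.mk e fun g => ?_⟩
  ext w
  exact congrArg _ rfl |>.trans (hcomm g _)

theorem card_fiber_eq_discreteCount
    (φ : MonoidAlgebra ℂ K ≃ₐ[ℂ] ∀ i, Matrix (Fin (d i)) (Fin (d i)) ℂ)
    (hd : ∀ i, 0 < d i) (m : ℕ) :
    Finite (Quotient (@irrepSetoid K _ ⊥ m)) ∧
      (Finset.univ.filter fun i => d i = m).card = discreteCount K m := by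
  let _ : TopologicalSpace K := ⊥
  have hdisc : DiscreteTopology K := ⟨rfl⟩
  have hex : ∀ i : {i // d i = m}, ∃ χ : Irrep K m, Nonempty ((factorRep φ i.1).Equiv χ.1) := by
    intro i
    refine exists_irrep_equiv (isIrreducible_factorRep φ hd i.1) ?_ ?_
    · intro v l; exact continuous_of_discreteTopology
    · rw [Module.finrank_fin_fun, i.2]
  choose χ hχ using hex
  have hb : Function.Bijective fun i => (Quotient.mk _ (χ i) : Quotient (irrepSetoid K m)) := by
    constructor
    · intro i j h
      obtain ⟨e⟩ : χ i ≈ χ j := Quotient.exact h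
      obtain ⟨e1⟩ := hχ i
      obtain ⟨e2⟩ := hχ j
      exact Subtype.ext (eq_of_factorRep_equiv φ hd ((e1.trans e).trans e2.symm))
    · intro c
      induction c using Quotient.inductionOn with
      | _ τ =>
      obtain ⟨i, ⟨e⟩⟩ := exists_equiv_factorRep φ hd τ.2.1
      have hi : d i = m := by simpa using finrank_eq_of_equiv e
      refine ⟨⟨i, hi⟩, Quotient.sound ?_⟩
      obtain ⟨e1⟩ := hχ ⟨i, hi⟩
      exact ⟨e1.symm.trans e⟩
  refine ⟨Finite.of_surjective _ hb.2, ?_⟩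
  rw [discreteCount, ← Nat.card_eq_of_bijective _ hb, Nat.card_eq_fintype_card,
    Fintype.card_subtype]

theorem sum_sq_degrees
    (φ : MonoidAlgebra ℂ K ≃ₐ[ℂ] ∀ i, Matrix (Fin (d i)) (Fin (d i)) ℂ) : ∑ i, d i ^ 2 = Fintype.card K := by
  have h1 := φ.toLinearEquiv.finrank_eq
  rw [Module.finrank_pi_fintype] at h1
  simp only [Module.finrank_matrix, Fintype.card_fin, Module.finrank_self, mul_one] at h1
  have h2 : Module.finrank ℂ (MonoidAlgebra ℂ K) = Fintype.card K := by
    rw [← Module.finrank_fintype_fun_eq_card (R := ℂ) (η := K)]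
    exact (LinearEquiv.ofBijective (ofFun (K := K))
      ⟨ofFun_injective, fun α => ⟨_, ofFun_coeff α⟩⟩).finrank_eq.symm
  rw [← h2, h1]
  simp only [sq]

theorem forall_commute_iff_scalar (α : MonoidAlgebra ℂ K) :
    (∀ g, Commute (MonoidAlgebra.of ℂ K g) α) ↔
      ∃ z : Fin r → ℂ, φ α = fun i => Matrix.scalar (Fin (d i)) (z i) := by
  constructor
  · intro h
    have : ∀ i, ∃ z, Matrix.scalar (Fin (d i)) z = φ α i := by
      intro i
      have := (Matrix.mem_range_scalar_iff_commute_single' (M := φ α i)).2 fun a b => by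
        obtain ⟨β, hβ⟩ := exists_eq_single φ i (Matrix.single a b 1)
        have h1 := (commute_of_forall_of h : Commute β α).map φ
        have h2 := congrFun h1.eq i
        rw [hβ] at h2
        simpa [Commute, SemiconjBy] using h2
      exact this
    choose z hz using this
    exact ⟨z, funext fun i => (hz i).symm⟩
  · rintro ⟨z, hz⟩ g
    have h1 : Commute (φ (MonoidAlgebra.of ℂ K g)) (φ α) := by
      rw [hz]
      funext i
      exact (Matrix.scalar_commute (z i) (fun r => Commute.all _ _) _).symm.eq
    have h2 := h1.map φ.symm
    rwa [AlgEquiv.symm_apply_apply, AlgEquiv.symm_apply_apply] at h2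

/-- Both numbers are the dimension of the centre of the group algebra, described once by class
functions and once by tuples of scalars. -/
theorem card_factors
    (φ : MonoidAlgebra ℂ K ≃ₐ[ℂ] ∀ i, Matrix (Fin (d i)) (Fin (d i)) ℂ)
    (hd : ∀ i, 0 < d i) : r = Nat.card (ConjClasses K) := by
  classical
  have := Fintype.ofFinite (ConjClasses K)
  let A : (ConjClasses K → ℂ) →ₗ[ℂ] MonoidAlgebra ℂ K :=
    ofFun ∘ₗ LinearMap.funLeft ℂ ℂ ConjClasses.mk
  let S : (Fin r → ℂ) →ₗ[ℂ] ∀ i, Matrix (Fin (d i)) (Fin (d i)) ℂ :=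
    LinearMap.pi fun i => (Algebra.linearMap ℂ (Matrix (Fin (d i)) (Fin (d i)) ℂ)) ∘ₗ
      LinearMap.proj i
  let B : (Fin r → ℂ) →ₗ[ℂ] MonoidAlgebra ℂ K := φ.symm.toLinearMap ∘ₗ S
  have hA : Function.Injective A := ofFun_injective.comp
    (LinearMap.funLeft_injective_of_surjective ℂ ℂ _ ConjClasses.mk_surjective)
  have hS : Function.Injective S := by
    intro z z' h
    funext i
    have h1 := congrFun (congrFun (congrFun h i) ⟨0, hd i⟩) ⟨0, hd i⟩
    simpa [S, Algebra.linearMap_apply, Matrix.algebraMap_matrix_apply] using h1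
  have hB : Function.Injective B := φ.symm.injective.comp hS
  have hrange : LinearMap.range A = LinearMap.range B := by
    ext α
    trans ∀ g, Commute (MonoidAlgebra.of ℂ K g) α
    · constructor
      · rintro ⟨F, rfl⟩
        refine (isCentral_ofFun_iff _).2 fun g h => ?_
        simp only [LinearMap.funLeft_apply]
        congr 1
        rw [ConjClasses.mk_eq_mk_iff_isConj]
        exact isConj_comm.1 (isConj_iff.2 ⟨h, rfl⟩)
      · intro h
        rw [← ofFun_coeff α] at h
        have h1 := (isCentral_ofFun_iff _).1 h
        refine ⟨Quotient.lift (fun g => α.coeff g) ?_, ?_⟩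
        · intro a b hab
          obtain ⟨c, rfl⟩ := isConj_iff.1 hab
          exact (h1 a c).symm
        · conv_rhs => rw [← ofFun_coeff α]
          rfl
    · rw [forall_commute_iff_scalar φ]
      constructor
      · rintro ⟨z, hz⟩
        refine ⟨z, φ.injective ?_⟩
        change φ (φ.symm (S z)) = _
        rw [AlgEquiv.apply_symm_apply, hz]
        rfl
      · rintro ⟨z, rfl⟩
        refine ⟨z, ?_⟩
        change φ (φ.symm (S z)) = _
        rw [AlgEquiv.apply_symm_apply]
        rfl
  have h1 := LinearMap.finrank_range_of_inj hA
  have h2 := LinearMap.finrank_range_of_inj hB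
  rw [hrange, h2] at h1
  simpa [Nat.card_eq_fintype_card] using h1

/-- If the irreducible representations have distinct degrees, every element is conjugate to its
inverse. -/
theorem isConj_inv_of_injective
    (φ : MonoidAlgebra ℂ K ≃ₐ[ℂ] ∀ i, Matrix (Fin (d i)) (Fin (d i)) ℂ)
    (hd : ∀ i, 0 < d i) (hinj : Function.Injective d) (g : K) :
    IsConj g g⁻¹ := by
  classical
  -- The dual of a factor is irreducible of the same degree. As the degrees are distinct it is the
  -- factor itself, so every character is invariant under inversion.
  have htr : ∀ i h, (φ (MonoidAlgebra.of ℂ K h⁻¹) i).trace = (φ (MonoidAlgebra.of ℂ K h) i).trace := by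
    intro i h
    let τ : Representation ℂ K (Fin (d i) → ℂ) :=
      { toFun := fun h => Matrix.toLin' (φ (MonoidAlgebra.of ℂ K h⁻¹) i).transpose
        map_one' := by simp only [inv_one, map_one, Pi.one_apply, Matrix.transpose_one,
          Matrix.toLin'_one]; rfl
        map_mul' := fun a b => by
          rw [mul_inv_rev, map_mul, map_mul, Pi.mul_apply, Matrix.transpose_mul, Matrix.toLin'_mul]
          rfl }
    have hτ : ∀ h, τ h = Matrix.toLin' (φ (MonoidAlgebra.of ℂ K h⁻¹) i).transpose := fun h => rfl
    have hirr : τ.IsIrreducible := by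
      have hf := (isIrreducible_iff _).1 (isIrreducible_factorRep φ hd i)
      rw [isIrreducible_iff]
      refine ⟨hf.1, fun U hU => ?_⟩
      have hspan : ∀ M : Matrix (Fin (d i)) (Fin (d i)) ℂ, ∀ v ∈ U, Matrix.toLin' M v ∈ U := by
        intro M v hv
        obtain ⟨α, hα⟩ := exists_eq_single φ i M.transpose
        have h1 : M = (φ α i).transpose := by rw [hα, Pi.single_eq_same, Matrix.transpose_transpose]
        rw [h1, ← ofFun_coeff α, ofFun_eq]
        simp only [map_sum, map_smul, Finset.sum_apply, Pi.smul_apply, Matrix.transpose_sum,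
          Matrix.transpose_smul, LinearMap.sum_apply, LinearMap.smul_apply]
        refine Submodule.sum_mem _ fun x _ => Submodule.smul_mem _ _ ?_
        have := hU x⁻¹ v hv
        rwa [hτ, inv_inv] at this
      refine hf.2 U fun x v hv => ?_
      rw [factorRep_apply]
      exact hspan _ v hv
    obtain ⟨j, ⟨e⟩⟩ := exists_equiv_factorRep φ hd hirr
    have hji : j = i := hinj (by simpa using finrank_eq_of_equiv e)
    subst hji
    have h1 : Matrix.toLin' (φ (MonoidAlgebra.of ℂ K h⁻¹) j).transpose =
        e.toLinearEquiv.conj (Matrix.toLin' (φ (MonoidAlgebra.of ℂ K h) j)) := by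
      apply LinearMap.ext; intro w
      have := equiv_apply e h (e.toLinearEquiv.symm w)
      rw [hτ, factorRep_apply] at this
      have h3 : e (e.toLinearEquiv.symm w) = w := e.toLinearEquiv.apply_symm_apply w
      rw [h3] at this
      exact this.symm
    have h2 := congrArg (LinearMap.trace ℂ _) h1
    rw [LinearMap.trace_conj', Matrix.trace_toLin'_eq, Matrix.trace_toLin'_eq,
      Matrix.trace_transpose] at h2
    exact h2
  let c : K → K → ℂ := fun a => fun x => if IsConj a x then 1 else 0
  have hc : ∀ a, ∀ x h, c a (h * x * h⁻¹) = c a x := by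
    intro a x h
    have : IsConj a (h * x * h⁻¹) ↔ IsConj a x :=
      ⟨fun hx => hx.trans (isConj_comm.1 (isConj_iff.2 ⟨h, rfl⟩)),
        fun hx => hx.trans (isConj_iff.2 ⟨h, rfl⟩)⟩
    simp only [c, this]
  have hci : ∀ x, c g⁻¹ x = c g x⁻¹ := by
    intro x
    have : IsConj g⁻¹ x ↔ IsConj g x⁻¹ := by
      rw [isConj_iff, isConj_iff]
      refine exists_congr fun h => ?_
      rw [← inv_inj]; simp [mul_assoc]
    simp only [c, this]
  -- The class sums of `g` and of `g⁻¹` are central, hence scalars in each factor, and their traces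
  -- agree by inversion invariance.
  have heq : ofFun (c g) = ofFun (c g⁻¹) := by
    obtain ⟨z, hz⟩ := (forall_commute_iff_scalar φ _).1 ((isCentral_ofFun_iff _).2 (hc g))
    obtain ⟨z', hz'⟩ := (forall_commute_iff_scalar φ _).1 ((isCentral_ofFun_iff _).2 (hc g⁻¹))
    apply φ.injective
    funext i
    have ht : (φ (ofFun (c g)) i).trace = (φ (ofFun (c g⁻¹)) i).trace := by
      simp only [ofFun_eq, map_sum, map_smul, Finset.sum_apply, Pi.smul_apply, Matrix.trace_sum,
        Matrix.trace_smul]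
      refine Fintype.sum_equiv (Equiv.inv K) _ _ fun x => ?_
      simp only [Equiv.inv_apply, hci, inv_inv, htr]
    rw [hz, hz'] at ht ⊢
    simp only [Matrix.scalar_apply, Matrix.trace_diagonal, Finset.sum_const, Finset.card_univ,
      Fintype.card_fin, nsmul_eq_mul] at ht
    have : (d i : ℂ) ≠ 0 := by exact_mod_cast (hd i).ne'
    exact congrArg _ (mul_left_cancel₀ this ht)
  have h1 := congrFun (ofFun_injective heq) g
  simp only [c, IsConj.refl, if_true] at h1
  by_contra hcon
  rw [if_neg (fun h => hcon (isConj_comm.1 h))] at h1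
  exact one_ne_zero h1

end FiniteGroup

/-! ### Degrees of a finite group from its order and number of commuting pairs -/

section Degrees

variable (K : Type v) [Group K]

/-- The irreducible representations of the finite group `K` have the degrees in the list `l`. -/
def HasDegrees (l : List ℕ) : Prop :=
  ∀ m, Finite (Quotient (@irrepSetoid K _ ⊥ m)) ∧ discreteCount K m = l.count m

theorem isIrreducible_trivial_fin_one :
    (Representation.trivial ℂ K (Fin 1 → ℂ)).IsIrreducible := by
  rw [isIrreducible_iff]
  refine ⟨inferInstance, fun U _ => ?_⟩
  have h1 : Module.finrank ℂ (Fin 1 → ℂ) = 1 := by simp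
  have h2 := Submodule.finrank_le U
  rw [h1] at h2
  interval_cases h : Module.finrank ℂ U
  · left; exact Submodule.finrank_eq_zero.1 h
  · right; exact Submodule.eq_top_of_finrank_eq (h.trans h1.symm)

/-- The list consists of the sizes of the matrix factors, sorted so that a search over lists need
not consider permutations. The last two clauses serve to decide between several solutions of the
square-sum equation. -/
theorem exists_hasDegrees [Finite K] : ∃ l : List ℕ, HasDegrees K l ∧
    l.Pairwise (· ≥ ·) ∧ (∀ x ∈ l, 0 < x) ∧ l.length = Nat.card (ConjClasses K) ∧
    (l.map (· ^ 2)).sum = Nat.card K ∧ 1 ∈ l ∧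
    (∀ (m : ℕ) (ρ : Representation ℂ K (Fin m → ℂ)), ρ.IsIrreducible → m ∈ l) ∧
    (l.Nodup → ∀ g : K, IsConj g g⁻¹) := by
  have := Fintype.ofFinite K
  have : NeZero (Nat.card K : ℂ) := ⟨by exact_mod_cast Nat.card_pos.ne'⟩
  have : FiniteDimensional ℂ (MonoidAlgebra ℂ K) :=
    Module.Finite.of_surjective (ofFun (K := K)) fun α => ⟨_, ofFun_coeff α⟩
  obtain ⟨r, d, hd', ⟨φ⟩⟩ :=
    IsSemisimpleRing.exists_algEquiv_pi_matrix_of_isAlgClosed ℂ (MonoidAlgebra ℂ K)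
  have hd : ∀ i, 0 < d i := fun i => Nat.pos_of_ne_zero (hd' i).out
  let s : Multiset ℕ := Finset.univ.val.map d
  have hs : ∀ x, x ∈ s ↔ ∃ i, d i = x := by simp [s]
  have hirr : ∀ (m : ℕ) (ρ : Representation ℂ K (Fin m → ℂ)), ρ.IsIrreducible → m ∈ s := by
    intro m ρ hρ
    obtain ⟨i, ⟨e⟩⟩ := exists_equiv_factorRep φ hd hρ
    exact (hs m).2 ⟨i, by simpa using finrank_eq_of_equiv e⟩
  refine ⟨s.sort (· ≥ ·), ?_, s.pairwise_sort _, ?_, ?_, ?_, ?_, ?_, ?_⟩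
  · intro m
    obtain ⟨h1, h2⟩ := card_fiber_eq_discreteCount φ hd m
    refine ⟨h1, ?_⟩
    rw [← h2, ← Multiset.coe_count, Multiset.sort_eq, Multiset.count_map]
    simp only [eq_comm]
    rfl
  · intro x hx
    rw [Multiset.mem_sort, hs] at hx
    obtain ⟨i, rfl⟩ := hx
    exact hd i
  · rw [Multiset.length_sort, ← card_factors φ hd]
    simp [s]
  · rw [Nat.card_eq_fintype_card, ← sum_sq_degrees φ, ← Multiset.sum_coe, ← Multiset.map_coe,
      Multiset.sort_eq, Multiset.map_map]
    rfl
  · rw [Multiset.mem_sort]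
    exact hirr 1 _ (isIrreducible_trivial_fin_one K)
  · intro m ρ hρ
    rw [Multiset.mem_sort]
    exact hirr m ρ hρ
  · intro hnd
    rw [← Multiset.coe_nodup, Multiset.sort_eq] at hnd
    have : Function.Injective d := by
      intro i j h
      exact (Multiset.inj_on_of_nodup_map hnd) i (Finset.mem_univ i) j (Finset.mem_univ j) h
    exact isConj_inv_of_injective φ hd this

/-- The decreasing lists of `k` positive numbers, at most `b`, the sum of whose squares is `n`. -/
def squareSums : ℕ → ℕ → ℕ → List (List ℕ)
  | 0, n, _ => if n = 0 then [[]] else []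
  | k + 1, n, b => ((List.range b).filter fun a => (a + 1) ^ 2 ≤ n).flatMap fun a =>
      (squareSums k (n - (a + 1) ^ 2) (a + 1)).map ((a + 1) :: ·)

theorem mem_squareSums {l : List ℕ} {k n b : ℕ} (hs : l.Pairwise (· ≥ ·)) (hp : ∀ x ∈ l, 0 < x)
    (hb : ∀ x ∈ l, x ≤ b) (hk : l.length = k) (hn : (l.map (· ^ 2)).sum = n) :
    l ∈ squareSums k n b := by
  induction l generalizing k n b with
  | nil =>
    subst hk hn
    simp [squareSums]
  | cons x l ih =>
    subst hk hn
    have hx := hp x (by simp)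
    have hxb := hb x (by simp)
    rw [List.pairwise_cons] at hs
    simp only [List.map_cons, List.sum_cons, List.length_cons, squareSums, List.mem_flatMap,
      List.mem_filter, List.mem_range, List.mem_map, decide_eq_true_eq]
    refine ⟨x - 1, ⟨by omega, ?_⟩, l, ?_, ?_⟩
    · rw [Nat.sub_add_cancel hx]; omega
    · rw [Nat.sub_add_cancel hx]
      exact ih hs.2 (fun y hy => hp y (by simp [hy])) hs.1 rfl (by omega)
    · rw [Nat.sub_add_cancel hx]

/-- The number of commuting pairs is the class number times the order, so two countable quantities
determine the length of the list and the sum of its squares. The bound `b` holds because every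
degree satisfies `d² ≤ n < (b + 1)²`. -/
theorem exists_hasDegrees_mem [Finite K] {n k b : ℕ} (hb : n < (b + 1) * (b + 1)) (hn : Nat.card K = n)
    (hk : Nat.card {p : K × K // Commute p.1 p.2} = k * n) :
    ∃ l ∈ (squareSums k n b).filter (1 ∈ ·), HasDegrees K l ∧
    (∀ (m : ℕ) (ρ : Representation ℂ K (Fin m → ℂ)), ρ.IsIrreducible → m ∈ l) ∧
    (l.Nodup → ∀ g : K, IsConj g g⁻¹) := by
  obtain ⟨l, hl, h1, h2, h3, h4, h5, h6, h7⟩ := exists_hasDegrees K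
  rw [card_comm_eq_card_conjClasses_mul_card, hn] at hk
  have hk' := Nat.eq_of_mul_eq_mul_right (hn ▸ Nat.card_pos) hk
  refine ⟨l, ?_, hl, h6, h7⟩
  rw [List.mem_filter]
  refine ⟨mem_squareSums h1 h2 ?_ (h3.trans hk') (h4.trans hn), by simpa using h5⟩
  intro x hx
  have h8 : x ^ 2 ≤ n := by
    rw [← hn, ← h4]
    exact List.single_le_sum (by simp) _ (List.mem_map.2 ⟨x, hx, rfl⟩)
  nlinarith

end Degrees

/-! ### One-term Dirichlet series -/

theorem monoSeries_apply (a n : ℕ) : monoSeries a n = if n ≠ 0 ∧ n = a then 1 else 0 := rfl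

theorem monoSeries_mul (a b : ℕ) : monoSeries (a * b) = monoSeries a * monoSeries b := by
  ext n
  rw [ArithmeticFunction.mul_apply, monoSeries_apply]
  simp only [monoSeries_apply]
  split_ifs with h
  · obtain ⟨h0, rfl⟩ := h
    rw [Finset.sum_eq_single (a, b)]
    · have ha : a ≠ 0 := left_ne_zero_of_mul h0
      have hb : b ≠ 0 := right_ne_zero_of_mul h0
      simp [ha, hb]
    · rintro ⟨x, y⟩ _ hxy
      by_cases hx : x = a
      · have hy : y ≠ b := fun h => hxy (by rw [hx, h])
        simp [hy]
      · simp [hx]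
    · intro h
      exact absurd (Nat.mem_divisorsAntidiagonal.2 ⟨rfl, h0⟩) h
  · symm
    refine Finset.sum_eq_zero ?_
    rintro ⟨x, y⟩ hxy
    obtain ⟨hxy, hn⟩ := Nat.mem_divisorsAntidiagonal.1 hxy
    by_cases hx : x = a
    · by_cases hy : y = b
      · subst hx hy; exact absurd ⟨hn, hxy.symm⟩ h
      · simp [hy]
    · simp [hx]

theorem monoSeries_one : monoSeries 1 = 1 := by
  ext n
  rw [monoSeries_apply, ArithmeticFunction.one_apply]
  by_cases h : n = 1 <;> simp [h]

theorem monoSeries_prod {ι : Type*} (s : Finset ι) (f : ι → ℕ) :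
    monoSeries (∏ i ∈ s, f i) = ∏ i ∈ s, monoSeries (f i) := by
  classical
  induction s using Finset.induction_on with
  | empty => simp [monoSeries_one]
  | insert a s ha ih => rw [Finset.prod_insert ha, Finset.prod_insert ha, monoSeries_mul, ih]

/-! ### The zeta function of a wreath product as a sum over maps -/

section Wreath

variable {R : Type} [CommRing R] [Algebra ℚ R]

/-- The contribution of the representations of a group with the degrees in the list `l`, induced
from a subgroup of index `i`, each counted with weight `i⁻¹`. -/
def inducedTerm (q : ℕ → R) (i : ℕ) (l : List ℕ) : R :=
  (1 / i : ℚ) • (l.map fun d => q (i * d)).sum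

variable {H : Type u} {Q : Type v} {X : Type w} [Group H] [Group Q] [MulAction Q X]
  [DecidableEq X] [Fintype X] [TopologicalSpace H] [Finite Q]

theorem finset_sum_apply {ι : Type*} (s : Finset ι) (f : ι → ArithmeticFunction ℂ) (n : ℕ) :
    (∑ i ∈ s, f i) n = ∑ i ∈ s, f i n := by
  classical
  induction s using Finset.induction_on with
  | empty => simp
  | insert a s ha ih => simp [Finset.sum_insert ha, ih]

theorem rat_smul_apply (r : ℚ) (f : ArithmeticFunction ℂ) (n : ℕ) :
    (r • f) n = (r : ℂ) * f n := by
  have h : r • f = (r : ℂ) • f := by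
    rw [← smul_one_smul ℂ r f]
    congr 1
    rw [Rat.smul_def, mul_one]
  rw [h]
  simp

theorem inducedTerm_mul_apply (i : ℕ) (l : List ℕ) (a n : ℕ) (hn : n ≠ 0) :
    (inducedTerm monoSeries i l * monoSeries a) n =
      (i : ℂ)⁻¹ * (l.countP fun d => n = i * a * d) := by
  rw [inducedTerm, smul_mul_assoc, rat_smul_apply]
  congr 1
  · push_cast; rw [one_div]
  · induction l with
    | nil => simp
    | cons d l ih =>
      rw [List.map_cons, List.sum_cons, add_mul, ArithmeticFunction.add_apply, ih,
        ← monoSeries_mul, monoSeries_apply, List.countP_cons, mul_right_comm]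
      by_cases h : n = i * a * d
      · rw [if_pos ⟨hn, h⟩, if_pos (decide_eq_true h)]
        push_cast
        ring
      · rw [if_neg (fun h' => h h'.2), if_neg (by simpa using h)]
        simp

theorem isEmpty_irrep_zero (G : Type*) [Group G] [TopologicalSpace G] : IsEmpty (Irrep G 0) := by
  refine ⟨fun E => ?_⟩
  have := ((isIrreducible_iff E.1).1 E.2.1).1
  exact not_nontrivial (Fin 0 → ℂ) this

theorem formalZeta_apply (G : Type*) [Group G] [TopologicalSpace G] (n : ℕ) :
    formalZeta G n = Nat.card (Quotient (irrepSetoid G n)) := by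
  have h : formalZeta G n = if n = 0 then 0 else ((irrepCount G n).toNat : ℂ) := rfl
  rw [h]
  split_ifs with h0
  · subst h0
    have := isEmpty_irrep_zero G
    have : IsEmpty (Quotient (irrepSetoid G 0)) := Quotient.instIsEmpty
    simp
  · rfl

theorem card_constituentClasses {C : Type*} [Fintype C] [DecidableEq C] {n : C → ℕ}
    {σ : ∀ c, Representation ℂ H (Fin (n c) → ℂ)} (hσ : ∀ c, HasContCoeff (σ c))
    {u : (Σ c, Fin (n c)) → (Σ c, Fin (n c)) → MonoidAlgebra ℂ H}
    (hu : IsMatrixUnits σ u) (hn : ∀ c, 0 < n c) (f : X → C) {N : ℕ} (hN : N ≠ 0)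
    (hT : ∀ E : Irrep (PermWreath H Q X) N, HasType σ E.1) {l : List ℕ}
    (hl : HasDegrees (fixer (Q := Q) f) l) :
    Finite (constituentClasses (Q := Q) hn u N f) ∧
      Nat.card (constituentClasses (Q := Q) hn u N f) =
        l.countP fun d => N = (fixer (Q := Q) f).index * (∏ x, n (f x)) * d := by
  by_cases h : (fixer (Q := Q) f).index * (∏ x, n (f x)) ∣ N
  · obtain ⟨m, rfl⟩ := h
    obtain ⟨e⟩ := nonempty_constituentClasses_equiv hσ hu hn f hT
    obtain ⟨h1, h2⟩ := hl m
    refine ⟨Finite.of_equiv _ e.symm, ?_⟩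
    rw [Nat.card_congr e]
    refine h2.trans ?_
    rw [List.count]
    congr 1
    funext d
    have h0 := Nat.pos_of_ne_zero (left_ne_zero_of_mul hN)
    rw [decide_eq_decide.2 (Nat.mul_right_inj h0.ne'), Bool.beq_comm]
    rfl
  · rw [constituentClasses_eq_empty hT hu hn h]
    refine ⟨inferInstance, ?_⟩
    rw [Nat.card_eq_zero.2 (Or.inl inferInstance), eq_comm, List.countP_eq_zero]
    intro d _ hd
    exact h ⟨d, by simpa using hd⟩

/-- The representations of a wreath product with a finite group, up to a given degree. -/
theorem exists_wreath_count (hH : Rigid H) (D : Subgroup Q → List ℕ) (hD : ∀ K : Subgroup Q, HasDegrees K (D K))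
    (N : ℕ) : ∃ (C : Type u) (_ : Fintype C) (deg : C → ℕ),
      (∀ n ≤ N, formalZeta H n = (∑ c, monoSeries (deg c)) n) ∧
      ∀ n ≤ N, Finite (Quotient (irrepSetoid (PermWreath H Q X) n)) ∧
        formalZeta (PermWreath H Q X) n =
          (∑ f : X → C, inducedTerm monoSeries (fixer (Q := Q) f).index (D (fixer (Q := Q) f)) *
            ∏ x, monoSeries (deg (f x))) n := by
  classical
  have hfin : ∀ m, Finite (Quotient (irrepSetoid H m)) := by
    intro m
    rcases Nat.eq_zero_or_pos m with rfl | hm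
    · have := isEmpty_irrep_zero H
      have : IsEmpty (Quotient (irrepSetoid H 0)) := Quotient.instIsEmpty
      infer_instance
    · exact ENat.card_lt_top.1 (hH m hm)
  have hfin' : ∀ m, Fintype (Quotient (irrepSetoid H m)) := fun m => Fintype.ofFinite _
  -- The classes of degree at most `N`. Irreducible representations of larger degree cannot occur in
  -- the restriction of a representation of degree at most `N`, so a finite index type suffices.
  let C := Σ m : Fin (N + 1), Quotient (irrepSetoid H m)
  let deg : C → ℕ := fun c => c.1
  let σ : ∀ c : C, Representation ℂ H (Fin (deg c) → ℂ) := fun c => c.2.out.1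
  have hσirr : ∀ c, (σ c).IsIrreducible := fun c => c.2.out.2.1
  have hσc : ∀ c, HasContCoeff (σ c) := fun c => (hasContCoeff_iff _).2 c.2.out.2.2
  have hdeg : ∀ c, 0 < deg c := by
    intro c
    have h1 := ((isIrreducible_iff (σ c)).1 (hσirr c)).1
    rw [← Module.finrank_fin_fun (R := ℂ) (n := deg c)]
    exact Module.finrank_pos
  have hne : ∀ c c', c ≠ c' → (σ c).Equiv (σ c') → False := by
    rintro ⟨⟨m, hm⟩, c⟩ ⟨⟨m', hm'⟩, c'⟩ hcc e
    have : m = m' := by simpa [deg] using finrank_eq_of_equiv e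
    subst this
    apply hcc
    congr 1
    exact Quotient.out_equiv_out.1 ⟨e⟩
  obtain ⟨u, hu⟩ := exists_isMatrixUnits σ hσirr hne
  refine ⟨C, inferInstance, deg, ?_, ?_⟩
  · intro n hn
    rw [formalZeta_apply, finset_sum_apply, Fintype.sum_sigma]
    rw [Finset.sum_eq_single (⟨n, by omega⟩ : Fin (N + 1))]
    · simp only [deg, monoSeries_apply, Finset.sum_const, Finset.card_univ, nsmul_eq_mul,
        Nat.card_eq_fintype_card]
      by_cases h0 : n = 0
      · subst h0
        have := isEmpty_irrep_zero H
        have : IsEmpty (Quotient (irrepSetoid H 0)) := Quotient.instIsEmpty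
        simp
      · simp [h0]
    · intro m _ hm
      refine Finset.sum_eq_zero fun c _ => ?_
      rw [monoSeries_apply, if_neg]
      rintro ⟨-, h⟩
      exact hm (Fin.ext h.symm)
    · simp
  · intro n hnN
    by_cases hn0 : n = 0
    · subst hn0
      have := isEmpty_irrep_zero (PermWreath H Q X)
      have : IsEmpty (Quotient (irrepSetoid (PermWreath H Q X) 0)) := Quotient.instIsEmpty
      exact ⟨inferInstance, by rw [ArithmeticFunction.map_zero, ArithmeticFunction.map_zero]⟩
    have hT : ∀ E : Irrep (PermWreath H Q X) n, HasType σ E.1 := by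
      intro E
      refine hasType_of_irreducible E.2.1 ((hasContCoeff_iff _).2 E.2.2) ?_
      intro k τ hk
      rw [Module.finrank_fin_fun] at hk
      refine ⟨⟨⟨k, by omega⟩, Quotient.mk _ τ⟩, ?_⟩
      obtain ⟨e⟩ : (Quotient.mk _ τ : Quotient (irrepSetoid H k)).out ≈ τ := Quotient.mk_out τ
      exact ⟨e.symm⟩
    let S : (X → C) → Set (Quotient (irrepSetoid (PermWreath H Q X) n)) := fun f =>
      constituentClasses (Q := Q) hdeg u n f
    have hS := fun f : X → C => card_constituentClasses hσc hu hdeg f hn0 hT (hD _)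
    have hcover : ∀ E, ∃ f, E ∈ S f := by
      intro E
      have := ((isIrreducible_iff _).1 E.out.2.1).1
      exact (hT E.out).exists_isConstituent hu hdeg
    have hfinG : Finite (Quotient (irrepSetoid (PermWreath H Q X) n)) := by
      have h1 : (⋃ f, S f) = Set.univ := Set.eq_univ_of_forall fun E => Set.mem_iUnion.2 (hcover E)
      rw [← Set.finite_univ_iff, ← h1]
      exact Set.finite_iUnion fun f => Set.finite_coe_iff.1 (hS f).1
    refine ⟨hfinG, ?_⟩
    have := Fintype.ofFinite (Quotient (irrepSetoid (PermWreath H Q X) n))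
    rw [formalZeta_apply, finset_sum_apply, Nat.card_eq_fintype_card]
    have h1 : ∀ f : X → C, (inducedTerm monoSeries (fixer (Q := Q) f).index
        (D (fixer (Q := Q) f)) * ∏ x, monoSeries (deg (f x))) n =
        ∑ E, if E ∈ S f then ((fixer (Q := Q) f).index : ℂ)⁻¹ else 0 := by
      intro f
      rw [← monoSeries_prod, inducedTerm_mul_apply _ _ _ _ hn0, ← (hS f).2, ← Finset.sum_filter,
        Finset.sum_const, nsmul_eq_mul, mul_comm, Nat.card_eq_fintype_card,
        Fintype.card_subtype]
    simp only [h1]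
    rw [Finset.sum_comm]
    -- The maps occurring in `E` form one orbit. It has as many members as the index of their
    -- stabilizers, so the reciprocal weights add up to `1`.
    have h2 : ∀ E, (∑ f : X → C, if E ∈ S f then ((fixer (Q := Q) f).index : ℂ)⁻¹ else 0) = 1 := by
      intro E
      obtain ⟨f, hf⟩ := hcover E
      have h3 : ∀ f', E ∈ S f' ↔ ∃ q : Q, f' = permute q f := fun f' =>
        (hT E.out).isConstituent_iff hu hdeg E.out.2.1 hf
      have h4 : ∀ f' : X → C, (if E ∈ S f' then ((fixer (Q := Q) f').index : ℂ)⁻¹ else 0) =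
          if E ∈ S f' then ((fixer (Q := Q) f).index : ℂ)⁻¹ else 0 := by
        intro f'
        split_ifs with h
        · obtain ⟨q, rfl⟩ := (h3 f').1 h
          rw [fixer_permute_index]
        · rfl
      simp only [h4]
      rw [← Finset.sum_filter, Finset.sum_const, nsmul_eq_mul]
      have h5 : (Finset.univ.filter fun f' => E ∈ S f').card = (fixer (Q := Q) f).index := by
        rw [← ncard_setOf_permute, ← Set.ncard_coe_finset]
        congr 1
        ext f'
        simp [h3]
      rw [h5]
      exact mul_inv_cancel₀ (by exact_mod_cast Subgroup.index_ne_zero_of_finite)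
    simp only [h2]
    simp

end Wreath

/-! ### Permutations and equivalence relations as bit masks -/

section Codes

/-- A self-map of `Fin m`, as the list of its values. -/
def valueList {m : ℕ} (p : Fin m → Fin m) : List ℕ := List.ofFn fun x => (p x : ℕ)

/-- The self-map of `Fin m` with given values. -/
def ofValueList (m : ℕ) [NeZero m] (l : List ℕ) : Fin m → Fin m := fun x => Fin.ofNat m (l.getD x 0)

/-- Composition of maps given by the lists of their values. -/
def compList (p q : List ℕ) : List ℕ := q.map fun i => p.getD i 0

/-- The number whose binary digits form the indicator function of the entries of a list. -/
def bitsOf (l : List ℕ) : ℕ := l.foldr (fun i a => (1 <<< i) ||| a) 0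

/-- The graph of a map, as a bit mask. -/
def mapMask (l : List ℕ) : ℕ := bitsOf (l.zipIdx.map fun a => 8 * a.2 + a.1)

/-- The equivalence relation "same value", as a bit mask. -/
def relMask (l : List ℕ) : ℕ :=
  bitsOf (l.zipIdx.flatMap fun a => (l.zipIdx.filter fun b => a.1 == b.1).map fun b =>
    8 * a.2 + b.2)

/-- Inclusion of bit masks. -/
def maskLE (a b : ℕ) : Bool := Nat.beq (Nat.land a b) a

theorem valueList_injective {m : ℕ} : Function.Injective (valueList (m := m)) := by
  intro p q h
  have h1 := List.ofFn_injective h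
  funext x
  exact Fin.ext (congrFun h1 x)

theorem getD_valueList {m : ℕ} (p : Fin m → Fin m) (x : Fin m) :
    (valueList p).getD x 0 = p x := by
  rw [List.getD_eq_getElem _ _ (by simp [valueList])]
  simp [valueList]

theorem compList_valueList {m : ℕ} (p q : Fin m → Fin m) :
    compList (valueList p) (valueList q) = valueList (p ∘ q) := by
  rw [compList]
  conv_lhs => enter [2]; rw [valueList]
  rw [List.map_ofFn, valueList]
  congr 1
  funext x
  exact getD_valueList p (q x)

theorem testBit_bitsOf (l : List ℕ) (j : ℕ) : (bitsOf l).testBit j = decide (j ∈ l) := by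
  induction l with
  | nil => simp [bitsOf]
  | cons a l ih =>
    have : bitsOf (a :: l) = (1 <<< a) ||| bitsOf l := rfl
    rw [this, Nat.testBit_or, ih, Nat.one_shiftLeft, Nat.testBit_two_pow]
    simp [eq_comm]

theorem maskLE_bitsOf (l : List ℕ) (b : ℕ) :
    maskLE (bitsOf l) b = true ↔ ∀ j ∈ l, b.testBit j = true := by
  rw [maskLE, Nat.beq_eq]
  change bitsOf l &&& b = bitsOf l ↔ _
  constructor
  · intro h j hj
    have := congrArg (fun n => n.testBit j) h
    simp only [Nat.testBit_and, testBit_bitsOf, hj, decide_true, Bool.true_and] at this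
    exact this
  · intro h
    apply Nat.eq_of_testBit_eq
    intro j
    rw [Nat.testBit_and, testBit_bitsOf]
    by_cases hj : j ∈ l
    · simp [hj, h j hj]
    · simp [hj]

theorem maskLE_mapMask {m : ℕ} (p : Fin m → Fin m) (b : ℕ) :
    maskLE (mapMask (valueList p)) b = true ↔ ∀ x : Fin m, b.testBit (8 * x + p x) = true := by
  rw [mapMask, maskLE_bitsOf]
  constructor
  · intro h x
    apply h
    rw [List.mem_map]
    refine ⟨(p x, x), ?_, rfl⟩
    rw [List.mem_zipIdx_iff_getElem?]
    simp [valueList]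
  · intro h j hj
    obtain ⟨⟨y, x⟩, hxy, rfl⟩ := List.mem_map.1 hj
    rw [List.mem_zipIdx_iff_getElem?] at hxy
    obtain ⟨hx, hy⟩ := List.getElem?_eq_some_iff.1 hxy
    have hx' : x < m := by simpa [valueList] using hx
    have := h ⟨x, hx'⟩
    simp only [valueList, List.getElem_ofFn] at hy
    simpa [← hy] using this

/-- With at most `8` points, the position `8 * x + y` determines both `x` and `y`. -/
theorem testBit_relMask (l : List ℕ) {x y : ℕ} (hy8 : l.length ≤ 8) (hx : x < l.length)
    (hy : y < l.length) : (relMask l).testBit (8 * x + y) = true ↔ l[x] = l[y] := by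
  rw [relMask, testBit_bitsOf, decide_eq_true_iff, List.mem_flatMap]
  constructor
  · rintro ⟨⟨a, x'⟩, hax, h⟩
    obtain ⟨⟨b, y'⟩, hby, h⟩ := List.mem_map.1 h
    obtain ⟨hby, hab⟩ := List.mem_filter.1 hby
    rw [List.mem_zipIdx_iff_getElem?] at hax hby
    obtain ⟨hx', ha⟩ := List.getElem?_eq_some_iff.1 hax
    obtain ⟨hy', hb⟩ := List.getElem?_eq_some_iff.1 hby
    simp only at h hx' hy' ha hb
    have h1 : x' = x := by omega
    have h2 : y' = y := by omega
    subst h1 h2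
    rw [ha, hb]
    simpa using hab
  · intro h
    refine ⟨(l[x], x), ?_, List.mem_map.2 ⟨(l[y], y), List.mem_filter.2 ⟨?_, ?_⟩, rfl⟩⟩
    · rw [List.mem_zipIdx_iff_getElem?]; simp
    · rw [List.mem_zipIdx_iff_getElem?]; simp
    · simp [h]

/-- The lists of length `n` which send every element to the least one of its class, for an
equivalence relation on `{0, …, n - 1}`. -/
def growthLists : ℕ → List (List ℕ)
  | 0 => [[]]
  | n + 1 => (growthLists n).flatMap fun l =>
      (((List.range n).filter fun i => l.getD i 0 == i) ++ [n]).map fun i => l ++ [i]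

open Classical in
/-- The least element with the same value. -/
noncomputable def leastSame {C : Type*} (g : ℕ → C) (x : ℕ) : ℕ :=
  Nat.find (⟨x, rfl⟩ : ∃ y, g y = g x)

theorem apply_leastSame {C : Type*} (g : ℕ → C) (x : ℕ) : g (leastSame g x) = g x := by
  classical
  exact Nat.find_spec (⟨x, rfl⟩ : ∃ y, g y = g x)

theorem leastSame_le {C : Type*} (g : ℕ → C) {x y : ℕ} (h : g y = g x) : leastSame g x ≤ y := by
  classical
  exact Nat.find_min' (⟨x, rfl⟩ : ∃ y, g y = g x) h

theorem leastSame_eq_iff {C : Type*} (g : ℕ → C) (x y : ℕ) :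
    leastSame g x = leastSame g y ↔ g x = g y := by
  constructor
  · intro h
    exact (apply_leastSame g x).symm.trans ((congrArg g h).trans (apply_leastSame g y))
  · intro h
    exact le_antisymm (leastSame_le g ((apply_leastSame g y).trans h.symm))
      (leastSame_le g ((apply_leastSame g x).trans h))

theorem map_leastSame_mem {C : Type*} (g : ℕ → C) (n : ℕ) :
    (List.range n).map (leastSame g) ∈ growthLists n := by
  induction n with
  | zero => simp [growthLists]
  | succ n ih =>
    rw [growthLists, List.mem_flatMap]
    refine ⟨_, ih, ?_⟩
    refine List.mem_map.2 ⟨leastSame g n, ?_, by rw [List.range_succ, List.map_append]; rfl⟩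
    rw [List.mem_append]
    rcases (leastSame_le g rfl : leastSame g n ≤ n).lt_or_eq with h | h
    · left
      rw [List.mem_filter, List.mem_range]
      refine ⟨h, ?_⟩
      rw [List.getD_eq_getElem _ _ (by simpa using h)]
      simp only [List.getElem_map, List.getElem_range, beq_iff_eq, leastSame_eq_iff]
      exact apply_leastSame g n
    · right; simp [h]

/-- Only the equivalence relation "same value" of `g` matters, and it is recorded by the least
element of each class. A statement about maps into an arbitrary type thereby becomes a check over
finitely many lists. -/
theorem exists_mem_growthLists {m : ℕ} [NeZero m] (hm : m ≤ 8) {C : Type*} (g : Fin m → C) :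
    ∃ l ∈ growthLists m, ∀ p : Fin m → Fin m,
      maskLE (mapMask (valueList p)) (relMask l) = true ↔ ∀ x, g (p x) = g x := by
  refine ⟨_, map_leastSame_mem (fun x => g (Fin.ofNat m x)) m, fun p => ?_⟩
  rw [maskLE_mapMask]
  refine forall_congr' fun x => ?_
  rw [testBit_relMask _ (by simpa using hm) (by simp) (by simp)]
  simp only [List.getElem_map, List.getElem_range, leastSame_eq_iff, Fin.ofNat_eq_cast,
    Fin.cast_val_eq_self]
  exact eq_comm

end Codes

/-! ### Sums over the maps that are constant on the blocks of a partition -/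

section PartitionSums

variable {R : Type} [CommRing R] {C : Type*} [Fintype C]

/-- A map constant on the fibres of the idempotent `p` is a free choice of one value for each fixed
point, and a block of size `k` contributes the factor `∑ c, y c ^ k`. -/
theorem sum_factoring {m : ℕ} (p : Fin m → Fin m) (hp : ∀ x, p (p x) = p x) (y : C → R) :
    ∑ g : Fin m → C, (open Classical in if ∀ x, g (p x) = g x then ∏ x, y (g x) else 0) =
      ∏ b ∈ Finset.univ.filter fun b => p b = b,
        ∑ c, y c ^ (Finset.univ.filter fun x => p x = b).card := by
  classical
  let B := {b // p b = b}
  have h1 : ∏ b ∈ Finset.univ.filter fun b => p b = b,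
        ∑ c, y c ^ (Finset.univ.filter fun x => p x = b).card =
      ∏ b : B, ∑ c, y c ^ (Finset.univ.filter fun x => p x = b).card :=
    Finset.prod_subtype _ (by simp) _
  rw [h1, Finset.prod_univ_sum, Fintype.piFinset_univ, ← Finset.sum_filter,
    Finset.sum_subtype (p := fun g => ∀ x, g (p x) = g x) _ (by simp)]
  let E : {g : Fin m → C // ∀ x, g (p x) = g x} ≃ (B → C) :=
    { toFun := fun g b => g.1 b
      invFun := fun h => ⟨fun x => h ⟨p x, hp x⟩, fun x => by simp only [hp]⟩
      left_inv := fun g => Subtype.ext (funext fun x => g.2 x)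
      right_inv := fun h => funext fun b => congrArg h (Subtype.ext b.2) }
  refine Fintype.sum_equiv E _ _ fun g => ?_
  let P : Fin m → B := fun x => ⟨p x, hp x⟩
  have h2 : ∀ x, y (g.1 x) = y (g.1 (P x).1) := fun x => congrArg y (g.2 x).symm
  refine (Finset.prod_congr rfl fun x _ => h2 x).trans ?_
  refine (Fintype.prod_fiberwise' P fun b : B => y (g.1 b)).symm.trans ?_
  refine Finset.prod_congr rfl fun b _ => ?_
  rw [Finset.prod_const, Finset.card_univ, Fintype.card_subtype]
  congr 2
  ext x
  simp only [P, Finset.mem_filter, Finset.mem_univ, true_and]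
  exact Subtype.ext_iff

/-- A family of partitions of a finite set with the same block sizes. A partition is given by the
map sending every element to a representative of its block, as a bit mask and as a list. -/
structure PartitionFamily where
  /-- the block sizes -/
  shape : List ℕ
  /-- the number of partitions -/
  size : ℕ
  /-- the partitions -/
  members : List (ℕ × List ℕ)

/-- The list is a map which is the identity on its image, with fibres of the given sizes. -/
def isPartition (m : ℕ) [NeZero m] (shape l : List ℕ) : Bool :=
  (valueList (ofValueList m l) == l) &&
  ((List.finRange m).all fun x => ofValueList m l (ofValueList m l x) == ofValueList m l x) &&
  (((List.finRange m).filter fun b => ofValueList m l b == b).map fun b =>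
    ((List.finRange m).filter fun x => ofValueList m l x == b).length).isPerm shape

/-- The family consists of partitions of the given shape. -/
def PartitionFamily.check (m : ℕ) [NeZero m] (F : PartitionFamily) : Bool :=
  (F.members.length == F.size) &&
    F.members.all fun a => (mapMask a.2 == a.1) && isPartition m F.shape a.2

/-- The number of members of the family which refine the given equivalence relation. -/
def PartitionFamily.count (F : PartitionFamily) (M : ℕ) : ℕ :=
  F.members.countP fun a => maskLE a.1 M

theorem sum_factoring_of_isPartition {m : ℕ} [NeZero m] {shape l : List ℕ}
    (h : isPartition m shape l = true) (y : C → R) :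
    ∑ g : Fin m → C, (open Classical in
      if ∀ x, g (ofValueList m l x) = g x then ∏ x, y (g x) else 0) =
      (shape.map fun k => ∑ c, y c ^ k).prod := by
  classical
  simp only [isPartition, Bool.and_eq_true, List.all_eq_true, beq_iff_eq] at h
  obtain ⟨⟨-, h2⟩, h3⟩ := h
  rw [List.isPerm_iff] at h3
  rw [sum_factoring _ (fun x => h2 x (List.mem_finRange x)), ← (h3.map _).prod_eq, List.map_map]
  rw [Finset.prod_eq_multiset_prod, ← Multiset.prod_coe, ← Multiset.map_coe]
  congr 1

/-- After exchanging the two sums, each partition of the family contributes the sum over the maps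
constant on its blocks, and this depends only on the shape. -/
theorem PartitionFamily.sum_count {m : ℕ} [NeZero m] {F : PartitionFamily}
    (hF : F.check m = true) (y : C → R) (M : (Fin m → C) → ℕ)
    (hM : ∀ g, ∀ p : Fin m → Fin m,
      maskLE (mapMask (valueList p)) (M g) = true ↔ ∀ x, g (p x) = g x) :
    ∑ g : Fin m → C, (F.count (M g) : R) * ∏ x, y (g x) =
      F.size * (F.shape.map fun k => ∑ c, y c ^ k).prod := by
  classical
  obtain ⟨shape, size, members⟩ := F
  simp only [PartitionFamily.check, Bool.and_eq_true, beq_iff_eq] at hF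
  obtain ⟨rfl, hF⟩ := hF
  simp only [PartitionFamily.count]
  induction members with
  | nil => simp
  | cons a t ih =>
    rw [List.all_cons, Bool.and_eq_true, Bool.and_eq_true, beq_iff_eq] at hF
    obtain ⟨⟨h1, h2⟩, h3⟩ := hF
    have h4 : valueList (ofValueList m a.2) = a.2 := by
      simp only [isPartition, Bool.and_eq_true, beq_iff_eq] at h2
      exact h2.1.1
    rw [List.length_cons, Nat.cast_add, add_mul, ← ih h3, Nat.cast_one, one_mul,
      ← sum_factoring_of_isPartition h2, ← Finset.sum_add_distrib]
    refine Finset.sum_congr rfl fun g _ => ?_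
    rw [List.countP_cons, Nat.cast_add, add_mul]
    congr 1
    have h5 := hM g (ofValueList m a.2)
    rw [h4, h1] at h5
    by_cases h : maskLE a.1 (M g) = true
    · rw [if_pos h, if_pos (h5.1 h)]; simp
    · rw [if_neg h, if_neg (fun h' => h (h5.2 h'))]; simp

/-- Linear combination of natural numbers with coefficients in a ring. -/
def natDot (c : List R) (n : List ℕ) : R := (List.zipWith (fun (a : R) (b : ℕ) => a * (b : R)) c n).sum

theorem sum_natDot_mul {m : ℕ} [NeZero m] (fams : List PartitionFamily)
    (hF : fams.all (PartitionFamily.check m) = true) (cs : List R) (y : C → R)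
    (M : (Fin m → C) → ℕ)
    (hM : ∀ g, ∀ p : Fin m → Fin m,
      maskLE (mapMask (valueList p)) (M g) = true ↔ ∀ x, g (p x) = g x) :
    ∑ g : Fin m → C, natDot cs (fams.map fun F => F.count (M g)) * ∏ x, y (g x) =
      (List.zipWith (fun a (F : PartitionFamily) =>
        a * (F.size * (F.shape.map fun k => ∑ c, y c ^ k).prod)) cs fams).sum := by
  induction fams generalizing cs with
  | nil => simp [natDot]
  | cons F fams ih =>
    cases cs with
    | nil => simp [natDot]
    | cons a cs =>
      rw [List.all_cons, Bool.and_eq_true] at hF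
      rw [List.zipWith_cons_cons, List.sum_cons, ← ih hF.2, ← PartitionFamily.sum_count hF.1 y M hM,
        Finset.mul_sum, ← Finset.sum_add_distrib]
      refine Finset.sum_congr rfl fun g _ => ?_
      simp only [natDot, List.map_cons, List.zipWith_cons_cons, List.sum_cons]
      ring

end PartitionSums

/-! ### Stabilizers computed from the list of permutations -/

section Transport

/-- Strict evaluation of a natural number. -/
def strict {α : Type*} (n : ℕ) (f : ℕ → α) : α := Nat.rec (f 0) (fun k _ => f (k + 1)) n

/-- The recursor in `strict` makes evaluation bring `n` to a literal once, before `f` uses it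
repeatedly. -/
theorem strict_eq {α : Type*} (n : ℕ) (f : ℕ → α) : strict n f = f n := by
  cases n <;> rfl

/-- The permutations in the list (given by masks and values) which preserve the relation. -/
def stabList (L : List (ℕ × List ℕ)) (M : ℕ) : List (ℕ × List ℕ) := L.filter fun a => maskLE a.1 M

/-- The entry of a list at a position, by structural recursion. -/
def entry (l : List ℕ) : ℕ → ℕ :=
  List.rec (fun _ => 0) (fun x _ ih n => Nat.rec x (fun k _ => ih k) n) l

theorem entry_eq (l : List ℕ) (n : ℕ) : entry l n = l.getD n 0 := by
  induction l generalizing n with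
  | nil => simp [entry]
  | cons x l ih =>
    cases n with
    | zero => rfl
    | succ n => exact (ih n).trans (by simp)

/-- Comparison of the compositions of two maps, one element after the other. -/
def commuteAt (p q xs : List ℕ) : List ℕ → Bool :=
  List.rec (fun ys => ys.isEmpty) (fun x _ ih ys => List.rec false
    (fun y ys _ => Bool.rec false (ih ys) (Nat.beq (entry p y) (entry q x))) ys) xs

theorem commuteAt_eq (p q xs ys : List ℕ) :
    commuteAt p q xs ys = (compList p ys == compList q xs) := by
  induction xs generalizing ys with
  | nil => cases ys <;> rfl
  | cons x xs ih =>
    cases ys with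
    | nil => rfl
    | cons y ys =>
      have h1 : commuteAt p q (x :: xs) (y :: ys) =
        Bool.rec false (commuteAt p q xs ys) (Nat.beq (entry p y) (entry q x)) := rfl
      have h2 : (compList p (y :: ys) == compList q (x :: xs)) =
        ((p.getD y 0 == q.getD x 0) && (compList p ys == compList q xs)) := rfl
      have h3 : Nat.beq (p.getD y 0) (q.getD x 0) = (p.getD y 0 == q.getD x 0) := by
        rw [Bool.eq_iff_iff, Nat.beq_eq, beq_iff_eq]
      rw [h1, h2, ih, entry_eq, entry_eq, h3]
      cases (p.getD y 0 == q.getD x 0) <;> rfl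

/-- The number of commuting pairs in a list of permutations. -/
def commCount (S : List (ℕ × List ℕ)) : ℕ :=
  (S ×ˢ S).countP fun a => commuteAt a.1.2 a.2.2 a.1.2 a.2.2

/-- For every equivalence relation on `Fin m`, the order and number of commuting pairs of its
stabilizer together with the numbers of refining members of the families, form a row of the
table. -/
def tableCheck (m : ℕ) (L : List (ℕ × List ℕ)) (fams : List PartitionFamily)
    (rows : List (ℕ × ℕ × List ℕ)) : Bool :=
  (growthLists m).all fun l => strict (relMask l) fun M => rows.contains
    ((stabList L M).length, commCount (stabList L M), fams.map fun F => F.count M)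

variable {Q : Type v} {X : Type w} [Group Q] [MulAction Q X]

/-- The action on `X`, transported to `Fin m`. -/
def actFin {m : ℕ} (e : X ≃ Fin m) (q : Q) : Fin m → Fin m := fun i => e (q • e.symm i)

theorem actFin_mul {m : ℕ} (e : X ≃ Fin m) (q r : Q) :
    actFin e (q * r) = actFin e q ∘ actFin e r := by
  funext i; simp [actFin, mul_smul]

theorem actFin_injective [FaithfulSMul Q X] {m : ℕ} (e : X ≃ Fin m) :
    Function.Injective (actFin (Q := Q) e) := by
  intro q r h
  apply FaithfulSMul.eq_of_smul_eq_smul (α := X)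
  intro x
  have := congrFun h (e x)
  simpa [actFin] using this

/-- The list consists of the permutations by which the group acts. -/
def IsActionList (Q : Type v) {X : Type w} [Group Q] [MulAction Q X] {m : ℕ} (e : X ≃ Fin m)
    (L : List (ℕ × List ℕ)) : Prop :=
  (L.map Prod.snd).Nodup ∧ (∀ a ∈ L, mapMask a.2 = a.1) ∧
    ∀ l, l ∈ L.map Prod.snd ↔ ∃ q : Q, valueList (actFin e q) = l

theorem card_eq_length {A B : Type*} {φ : A → B} (hφ : Function.Injective φ) {l : List B}
    (hl : l.Nodup) (h : ∀ b, b ∈ l ↔ ∃ a, φ a = b) : Nat.card A = l.length := by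
  classical
  have h1 : Set.range φ = (l.toFinset : Set B) := by
    ext b; simp [h]
  rw [← Nat.card_range_of_injective hφ, h1, Nat.card_coe_set_eq, Set.ncard_coe_finset,
    List.toFinset_card_of_nodup hl]

variable [FaithfulSMul Q X] {m : ℕ} [NeZero m] {e : X ≃ Fin m} {L : List (ℕ × List ℕ)}
  {C : Type*}

theorem mem_stabList (hL : IsActionList Q e L) {f : X → C} {M : ℕ}
    (hM : ∀ p : Fin m → Fin m,
      maskLE (mapMask (valueList p)) M = true ↔ ∀ x, f (e.symm (p x)) = f (e.symm x))
    (l : List ℕ) : l ∈ (stabList L M).map Prod.snd ↔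
      ∃ q : fixer (Q := Q) f, valueList (actFin e q.1) = l := by
  have key : ∀ q : Q, maskLE (mapMask (valueList (actFin e q))) M = true ↔ q ∈ fixer f := by
    intro q
    rw [hM]
    constructor
    · intro h x
      have := h (e x)
      simpa [actFin] using this
    · intro h x
      have := h (e.symm x)
      simpa [actFin] using this
  rw [stabList, List.mem_map]
  constructor
  · rintro ⟨a, ha, rfl⟩
    obtain ⟨ha, haM⟩ := List.mem_filter.1 ha
    obtain ⟨q, hq⟩ := (hL.2.2 a.2).1 (List.mem_map.2 ⟨a, ha, rfl⟩)
    rw [← hL.2.1 a ha, ← hq, key] at haM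
    exact ⟨⟨q, haM⟩, hq⟩
  · rintro ⟨q, rfl⟩
    obtain ⟨a, ha, ha2⟩ := List.mem_map.1 ((hL.2.2 _).2 ⟨q.1, rfl⟩)
    refine ⟨a, List.mem_filter.2 ⟨ha, ?_⟩, ha2⟩
    rw [← hL.2.1 a ha, ha2, key]
    exact q.2

theorem nodup_stabList (hL : IsActionList Q e L) (M : ℕ) : ((stabList L M).map Prod.snd).Nodup :=
  hL.1.sublist (List.filter_sublist.map _)

theorem card_fixer (hL : IsActionList Q e L) {f : X → C} {M : ℕ}
    (hM : ∀ p : Fin m → Fin m,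
      maskLE (mapMask (valueList p)) M = true ↔ ∀ x, f (e.symm (p x)) = f (e.symm x)) :
    Nat.card (fixer (Q := Q) f) = (stabList L M).length := by
  rw [card_eq_length (φ := fun q : fixer (Q := Q) f => valueList (actFin e q.1)) ?_
    (nodup_stabList hL M) (mem_stabList hL hM), List.length_map]
  intro q r h
  exact Subtype.ext (actFin_injective e (valueList_injective h))

theorem card_commute_fixer (hL : IsActionList Q e L) {f : X → C} {M : ℕ}
    (hM : ∀ p : Fin m → Fin m,
      maskLE (mapMask (valueList p)) M = true ↔ ∀ x, f (e.symm (p x)) = f (e.symm x)) :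
    Nat.card {p : fixer (Q := Q) f × fixer (Q := Q) f // Commute p.1 p.2} =
      commCount (stabList L M) := by
  let S := (stabList L M).map Prod.snd
  have hS : S.Nodup := nodup_stabList hL M
  let T := (S ×ˢ S).filter fun a => compList a.1 a.2 == compList a.2 a.1
  have hinj : Function.Injective fun q : fixer (Q := Q) f => valueList (actFin e q.1) := by
    intro q r h
    exact Subtype.ext (actFin_injective e (valueList_injective h))
  have h1 : commCount (stabList L M) = T.length := by
    simp only [commCount, commuteAt_eq]
    rw [← List.countP_eq_length_filter]
    have : S ×ˢ S = (stabList L M ×ˢ stabList L M).map (Prod.map Prod.snd Prod.snd) := by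
      simp only [S, SProd.sprod, List.product, List.map_flatMap, List.flatMap_map, List.map_map]
      rfl
    rw [this, List.countP_map]
    rfl
  rw [h1]
  refine card_eq_length (φ := fun p => (valueList (actFin e p.1.1.1), valueList (actFin e p.1.2.1)))
    ?_ ((hS.product hS).filter _) ?_
  · rintro ⟨⟨a, b⟩, _⟩ ⟨⟨c, d⟩, _⟩ h
    simp only [Prod.mk.injEq] at h
    have h1 := hinj h.1
    have h2 := hinj h.2
    subst h1 h2
    rfl
  · rintro ⟨a, b⟩
    rw [List.mem_filter]
    change (a, b) ∈ List.product S S ∧ _ ↔ _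
    rw [List.pair_mem_product, mem_stabList hL hM, mem_stabList hL hM]
    constructor
    · rintro ⟨⟨⟨q, rfl⟩, ⟨r, rfl⟩⟩, h⟩
      refine ⟨⟨(q, r), ?_⟩, rfl⟩
      simp only [compList_valueList, ← actFin_mul, beq_iff_eq] at h
      exact Subtype.ext (actFin_injective e (valueList_injective h))
    · rintro ⟨⟨⟨q, r⟩, hc⟩, h⟩
      simp only [Prod.mk.injEq] at h
      obtain ⟨rfl, rfl⟩ := h
      refine ⟨⟨⟨q, rfl⟩, ⟨r, rfl⟩⟩, ?_⟩
      simp only [compList_valueList, ← actFin_mul, beq_iff_eq]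
      have := congrArg Subtype.val hc.eq
      rw [Subgroup.coe_mul, Subgroup.coe_mul] at this
      rw [this]

variable {R : Type} [CommRing R] [Fintype C] [Fintype X] [DecidableEq X]

/-- A sum over all maps from `X`, with a weight that is determined by the rows of the table. -/
theorem sum_weight_eq (hm : m ≤ 8) (hL : IsActionList Q e L) {fams : List PartitionFamily}
    (hF : fams.all (PartitionFamily.check m) = true) {rows : List (ℕ × ℕ × List ℕ)}
    (htab : tableCheck m L fams rows = true) (cs : List R) (W : (X → C) → R)
    (hW : ∀ f, ∀ a ∈ rows, Nat.card (fixer (Q := Q) f) = a.1 →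
      Nat.card {p : fixer (Q := Q) f × fixer (Q := Q) f // Commute p.1 p.2} = a.2.1 →
      W f = natDot cs a.2.2) (y : C → R) :
    ∑ f : X → C, W f * ∏ x, y (f x) =
      (List.zipWith (fun a (F : PartitionFamily) =>
        a * (F.size * (F.shape.map fun k => ∑ c, y c ^ k).prod)) cs fams).sum := by
  classical
  have hex := fun g : Fin m → C => exists_mem_growthLists hm g
  choose l hl hM using hex
  -- Each weight is replaced by a combination of counts of refining partitions, after which the sum
  -- can be taken one partition at a time.
  rw [← sum_natDot_mul fams hF cs y (fun g => relMask (l g)) hM]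
  refine Fintype.sum_equiv (Equiv.arrowCongr e (Equiv.refl C)) _ _ fun f => ?_
  have hg : ∀ x, (Equiv.arrowCongr e (Equiv.refl C)) f x = f (e.symm x) := fun x => rfl
  set g := (Equiv.arrowCongr e (Equiv.refl C)) f with hgdef
  congr 1
  · have h1 := List.all_eq_true.1 htab _ (hl g)
    rw [strict_eq, List.contains_iff_mem] at h1
    have hM' : ∀ p : Fin m → Fin m, maskLE (mapMask (valueList p)) (relMask (l g)) = true ↔
        ∀ x, f (e.symm (p x)) = f (e.symm x) := hM g
    exact hW f _ h1 (card_fixer hL hM') (card_commute_fixer hL hM')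
  · exact Fintype.prod_equiv e _ _ fun x => by rw [hg, Equiv.symm_apply_apply]

end Transport

/-! ### Agreement of the first coefficients of Dirichlet series -/

section EqUpTo

/-- The first coefficients of two formal Dirichlet series agree. -/
def EqUpTo (N : ℕ) (f g : ArithmeticFunction ℂ) : Prop := ∀ n ≤ N, f n = g n

theorem EqUpTo.refl (N : ℕ) (f : ArithmeticFunction ℂ) : EqUpTo N f f := fun _ _ => rfl

theorem EqUpTo.symm {N : ℕ} {f g : ArithmeticFunction ℂ} (h : EqUpTo N f g) : EqUpTo N g f :=
  fun n hn => (h n hn).symm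

theorem EqUpTo.trans {N : ℕ} {f g h : ArithmeticFunction ℂ} (hfg : EqUpTo N f g)
    (hgh : EqUpTo N g h) : EqUpTo N f h := fun n hn => (hfg n hn).trans (hgh n hn)

theorem EqUpTo.add {N : ℕ} {f g f' g' : ArithmeticFunction ℂ} (h : EqUpTo N f g)
    (h' : EqUpTo N f' g') : EqUpTo N (f + f') (g + g') := fun n hn => by
  rw [ArithmeticFunction.add_apply, ArithmeticFunction.add_apply, h n hn, h' n hn]

theorem EqUpTo.mul {N : ℕ} {f g f' g' : ArithmeticFunction ℂ} (h : EqUpTo N f g)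
    (h' : EqUpTo N f' g') : EqUpTo N (f * f') (g * g') := fun n hn => by
  rw [ArithmeticFunction.mul_apply, ArithmeticFunction.mul_apply]
  refine Finset.sum_congr rfl fun x hx => ?_
  have hd := Nat.mem_divisorsAntidiagonal.1 hx
  have h1 : x.1 ≤ n := Nat.le_of_dvd (Nat.pos_of_ne_zero hd.2) ⟨x.2, hd.1.symm⟩
  have h2 : x.2 ≤ n := Nat.le_of_dvd (Nat.pos_of_ne_zero hd.2) ⟨x.1, by rw [mul_comm, hd.1]⟩
  rw [h _ (h1.trans hn), h' _ (h2.trans hn)]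

theorem EqUpTo.list_prod {N : ℕ} {ι : Type*} (l : List ι) {f g : ι → ArithmeticFunction ℂ}
    (h : ∀ i ∈ l, EqUpTo N (f i) (g i)) : EqUpTo N (l.map f).prod (l.map g).prod := by
  induction l with
  | nil => exact .refl _ _
  | cons a l ih =>
    rw [List.map_cons, List.prod_cons, List.map_cons, List.prod_cons]
    exact (h a (by simp)).mul (ih fun i hi => h i (by simp [hi]))

theorem eq_of_forall_eqUpTo {f g : ArithmeticFunction ℂ} (h : ∀ N, EqUpTo N f g) : f = g := by
  ext n
  exact h n n le_rfl

theorem dilate_apply (k : ℕ) (f : ArithmeticFunction ℂ) (n : ℕ) :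
    dilate k f n = ∑ m ∈ (Finset.range (n + 1)).filter (fun m => m ^ k = n), f m := rfl

theorem dilate_pow_apply {k : ℕ} (hk : k ≠ 0) (f : ArithmeticFunction ℂ) (m : ℕ) :
    dilate k f (m ^ k) = f m := by
  rw [dilate_apply, Finset.sum_eq_single m]
  · intro b hb hbm
    exact absurd (Nat.pow_left_injective hk (Finset.mem_filter.1 hb).2) hbm
  · intro hm
    exact (hm (Finset.mem_filter.2
      ⟨Finset.mem_range.2 (Nat.lt_succ_of_le (Nat.le_self_pow hk m)), rfl⟩)).elim

theorem dilate_apply_of_forall_ne {k : ℕ} (f : ArithmeticFunction ℂ) {n : ℕ}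
    (h : ∀ m, m ^ k ≠ n) : dilate k f n = 0 := by
  rw [dilate_apply, Finset.filter_false_of_mem fun m _ => h m, Finset.sum_empty]

theorem EqUpTo.dilate {N k : ℕ} {f g : ArithmeticFunction ℂ} (h : EqUpTo N f g) :
    EqUpTo N (dilate k f) (dilate k g) := fun n hn => by
  rw [dilate_apply, dilate_apply]
  refine Finset.sum_congr rfl fun m hm => ?_
  have := Finset.mem_range.1 (Finset.mem_filter.1 hm).1
  exact h m (by omega)

theorem dilate_add (k : ℕ) (f g : ArithmeticFunction ℂ) :
    dilate k (f + g) = dilate k f + dilate k g := by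
  ext n
  simp only [dilate_apply, ArithmeticFunction.add_apply, Finset.sum_add_distrib]

theorem dilate_monoSeries {k : ℕ} (hk : k ≠ 0) (a : ℕ) :
    dilate k (monoSeries a) = monoSeries a ^ k := by
  have h1 : monoSeries a ^ k = monoSeries (a ^ k) := by
    induction k with
    | zero => exact absurd rfl hk
    | succ k ih =>
      rcases Nat.eq_zero_or_pos k with rfl | hk0
      · simp
      · rw [pow_succ, ih hk0.ne', ← monoSeries_mul, pow_succ]
  rw [h1]
  ext n
  by_cases h : ∃ m, m ^ k = n
  · obtain ⟨m, rfl⟩ := h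
    rw [dilate_pow_apply hk, monoSeries_apply, monoSeries_apply]
    have h2 : m ^ k = a ^ k ↔ m = a := (Nat.pow_left_injective hk).eq_iff
    simp only [h2, ne_eq, pow_eq_zero_iff hk]
  · rw [dilate_apply_of_forall_ne _ (fun m hm => h ⟨m, hm⟩), monoSeries_apply, if_neg]
    rintro ⟨-, rfl⟩
    exact h ⟨a, rfl⟩

theorem dilate_sum_monoSeries {C : Type*} (s : Finset C) (deg : C → ℕ) {k : ℕ} (hk : k ≠ 0) :
    dilate k (∑ c ∈ s, monoSeries (deg c)) = ∑ c ∈ s, monoSeries (deg c) ^ k := by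
  classical
  induction s using Finset.induction_on with
  | empty =>
    ext n
    simp [dilate_apply]
  | insert a s ha ih =>
    rw [Finset.sum_insert ha, Finset.sum_insert ha, dilate_add, ih, dilate_monoSeries hk]

end EqUpTo

/-! ### The general formula for a wreath product, from a table of stabilizers -/

section Formula

/-- A family of partitions together with a coefficient gives a monomial. -/
def familySum {R : Type} [CommRing R] (z : ℕ → R) (cs : List R) (fams : List PartitionFamily) : R :=
  (List.zipWith (fun a (F : PartitionFamily) => a * (F.size * (F.shape.map z).prod)) cs fams).sum

theorem EqUpTo.familySum {N : ℕ} {z z' : ℕ → ArithmeticFunction ℂ}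
    (cs : List (ArithmeticFunction ℂ)) (fams : List PartitionFamily)
    (h : ∀ F ∈ fams, ∀ k ∈ F.shape, EqUpTo N (z k) (z' k)) :
    EqUpTo N (familySum z cs fams) (familySum z' cs fams) := by
  induction cs generalizing fams with
  | nil => exact .refl _ _
  | cons a cs ih =>
    cases fams with
    | nil => exact .refl _ _
    | cons F fams =>
      simp only [RepZeta.familySum, List.zipWith_cons_cons, List.sum_cons]
      exact ((EqUpTo.refl N a).mul ((EqUpTo.refl N _).mul
        (EqUpTo.list_prod _ fun k hk => h F (by simp) k hk))).add
        (ih fams fun G hG => h G (by simp [hG]))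

/-- A possible type of a subgroup that stabilizes a function: the order, the number of conjugacy
classes, the degrees of the irreducible representations, and the number of the refining partitions
in each family. -/
structure StabilizerType where
  /-- the order -/
  order : ℕ
  /-- the number of conjugacy classes -/
  classes : ℕ
  /-- the degrees of the irreducible representations -/
  degrees : List ℕ
  /-- the numbers of partitions -/
  counts : List ℕ

/-- The row of the table for a type of stabilizers. -/
def StabilizerType.row (t : StabilizerType) : ℕ × ℕ × List ℕ :=
  (t.order, t.classes * t.order, t.counts)

theorem inducedTerm_eq_of_hasDegrees {K : Type v} [Group K] {R : Type} [CommRing R] [Algebra ℚ R]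
    (q : ℕ → R) (i : ℕ) {l l' : List ℕ} (h : HasDegrees K l) (h' : HasDegrees K l') :
    inducedTerm q i l = inducedTerm q i l' := by
  have hp : l.Perm l' := List.perm_iff_count.2 fun m => (h m).2.symm.trans (h' m).2
  rw [inducedTerm, inducedTerm, (hp.map _).sum_eq]

/-- Up to degree `N` the series of `H` is a finite sum of terms `deg^{-s}`, and the weight of a map
is determined by its stabilizer. The table lists all possible stabilizers with their refining
partitions, `hdeg` supplies their degrees, and `hcs` says that the weight is the sum of the
coefficients of the refining partitions. Summing block by block then turns the power sums of
`deg^{-s}` into dilated series. -/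
theorem rigid_and_formalZeta_eq {H : Type u} {Q : Type v} {X : Type w} [Group H]
    [TopologicalSpace H] [Group Q] [Finite Q] [MulAction Q X] [FaithfulSMul Q X] {m : ℕ} [NeZero m]
    (hm : m ≤ 8) {e : X ≃ Fin m} {L : List (ℕ × List ℕ)} (hL : IsActionList Q e L)
    {fams : List PartitionFamily} (hF : fams.all (PartitionFamily.check m) = true)
    (hF0 : ∀ F ∈ fams, 0 ∉ F.shape)
    {types : List StabilizerType}
    (htab : tableCheck m L fams (types.map StabilizerType.row) = true)
    (hdeg : ∀ K : Subgroup Q, ∀ t ∈ types, Nat.card K = t.order →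
      Nat.card {p : K × K // Commute p.1 p.2} = t.classes * t.order → HasDegrees K t.degrees)
    (cs : List (ArithmeticFunction ℂ))
    (hcs : ∀ t ∈ types, inducedTerm monoSeries (Nat.card Q / t.order) t.degrees =
      natDot cs t.counts) (hH : Rigid H) :
    Rigid (PermWreath H Q X) ∧ formalZeta (PermWreath H Q X) =
      familySum (fun k => dilate k (formalZeta H)) cs fams := by
  classical
  have := Fintype.ofEquiv _ e.symm
  have hD := fun K : Subgroup Q => exists_hasDegrees K
  choose D hD using hD
  have hD' : ∀ K : Subgroup Q, HasDegrees K (D K) := fun K => (hD K).1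
  constructor
  · intro n _
    obtain ⟨C, _, deg, -, h⟩ := exists_wreath_count (X := X) hH D hD' n
    exact ENat.card_lt_top.2 (h n le_rfl).1
  refine eq_of_forall_eqUpTo fun N => ?_
  obtain ⟨C, _, deg, h1, h2⟩ := exists_wreath_count (X := X) hH D hD' N
  have h3 : EqUpTo N (formalZeta H) (∑ c, monoSeries (deg c)) := h1
  have h4 := sum_weight_eq hm hL hF htab cs
    (fun f : X → C => inducedTerm monoSeries (fixer (Q := Q) f).index (D (fixer (Q := Q) f)))
    (by
      intro f a ha hc hp
      obtain ⟨t, ht, rfl⟩ := List.mem_map.1 ha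
      rw [StabilizerType.row] at hc hp ⊢
      rw [← hcs t ht, inducedTerm_eq_of_hasDegrees _ _ (hD' _) (hdeg _ t ht hc hp)]
      congr 1
      rw [← Subgroup.index_mul_card (fixer (Q := Q) f), hc, Nat.mul_div_cancel]
      rw [← hc]; exact Nat.card_pos) (fun c => monoSeries (deg c))
  refine EqUpTo.trans (fun n hn => (h2 n hn).2) ?_
  rw [h4]
  refine EqUpTo.symm (EqUpTo.familySum cs fams fun F hF k hk => ?_)
  have hk0 : k ≠ 0 := fun h => hF0 F hF (h ▸ hk)
  rw [← dilate_sum_monoSeries _ _ hk0]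
  exact h3.dilate

end Formula

/-- The action is faithful, so the group provides as many distinct entries as its order; a list that
is no longer has no others. -/
theorem isActionList_of_forall_mem {Q : Type v} {X : Type w} [Group Q] [Finite Q] [MulAction Q X]
    [FaithfulSMul Q X] {m : ℕ} {e : X ≃ Fin m} {L : List (ℕ × List ℕ)}
    (h1 : (L.map Prod.snd).Nodup) (h2 : ∀ a ∈ L, mapMask a.2 = a.1)
    (h3 : ∀ q : Q, valueList (actFin e q) ∈ L.map Prod.snd) (h4 : L.length ≤ Nat.card Q) :
    IsActionList Q e L := by
  classical
  have := Fintype.ofFinite Q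
  refine ⟨h1, h2, fun l => ⟨fun hl => ?_, fun ⟨q, hq⟩ => hq ▸ h3 q⟩⟩
  have h5 : Finset.univ.image (fun q : Q => valueList (actFin e q)) = (L.map Prod.snd).toFinset := by
    refine Finset.eq_of_subset_of_card_le ?_ ?_
    · intro l hl
      obtain ⟨q, -, rfl⟩ := Finset.mem_image.1 hl
      exact List.mem_toFinset.2 (h3 q)
    · rw [List.toFinset_card_of_nodup h1, List.length_map, Finset.card_image_of_injective _
        fun q r h => actFin_injective e (valueList_injective h), Finset.card_univ,
        ← Nat.card_eq_fintype_card]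
      exact h4
  have h6 := List.mem_toFinset.2 hl
  rw [← h5] at h6
  obtain ⟨q, -, hq⟩ := Finset.mem_image.1 h6
  exact ⟨q, hq⟩

theorem natDot_cons {R : Type} [CommRing R] (a : R) (c : List R) (b : ℕ) (n : List ℕ) :
    natDot (a :: c) (b :: n) = a * b + natDot c n := by
  simp [natDot]

theorem natDot_nil {R : Type} [CommRing R] (n : List ℕ) : natDot ([] : List R) n = 0 := by
  simp [natDot]

theorem hasDegrees_of_squareSums {K : Type*} [Group K] [Finite K] {n k : ℕ} {l : List ℕ}
    (b : ℕ) (hb : n < (b + 1) * (b + 1)) (hn : Nat.card K = n) (hk : Nat.card {p : K × K // Commute p.1 p.2} = k * n)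
    (h : (squareSums k n b).filter (1 ∈ ·) = [l]) : HasDegrees K l := by
  obtain ⟨l', h1, h2, -⟩ := exists_hasDegrees_mem K hb hn hk
  rw [h, List.mem_singleton] at h1
  exact h1 ▸ h2

/-! ### The alternating group on five points -/

section AlternatingGroup

/-- The permutations by which `A5` acts, as bit masks and lists of values. -/
def permsA5 : List (ℕ × List ℕ) := [
    (68853957121, [0, 1, 2, 3, 4]), (17448829441, [0, 1, 3, 4, 2]),
    (34427896321, [0, 1, 4, 2, 3]), (34628305921, [0, 2, 1, 4, 3]),
    (68753556481, [0, 2, 3, 1, 4]), (8725201921, [0, 2, 4, 3, 1]),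
    (68786718721, [0, 3, 1, 2, 4]), (8858634241, [0, 3, 2, 4, 1]),
    (17214474241, [0, 3, 4, 1, 2]), (17314222081, [0, 4, 1, 3, 2]),
    (34393559041, [0, 4, 2, 1, 3]), (8657571841, [0, 4, 3, 2, 1]),
    (34628436226, [1, 0, 2, 4, 3]), (68787110146, [1, 0, 3, 2, 4]),
    (17315135746, [1, 0, 4, 3, 2]), (68853761026, [1, 2, 0, 3, 4]),
    (4563928066, [1, 2, 3, 4, 0]), (34377565186, [1, 2, 4, 0, 3]),
    (17448372226, [1, 3, 0, 4, 2]), (68736518146, [1, 3, 2, 0, 4]),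
    (4363126786, [1, 3, 4, 2, 0]), (34426916866, [1, 4, 0, 2, 3]), (4429451266, [1, 4, 2, 3, 0]),
    (17197174786, [1, 4, 3, 0, 2]), (68853825796, [2, 0, 1, 3, 4]),
    (8858894596, [2, 0, 3, 4, 1]), (34394341636, [2, 0, 4, 1, 3]),
    (34628239876, [2, 1, 0, 4, 3]), (68736778756, [2, 1, 3, 0, 4]),
    (4430234116, [2, 1, 4, 3, 0]), (68753098756, [2, 3, 0, 1, 4]), (4563535876, [2, 3, 1, 4, 0]),
    (8607762436, [2, 3, 4, 0, 1]), (8724221956, [2, 4, 0, 3, 1]), (34376650756, [2, 4, 1, 0, 3]),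
    (4329050116, [2, 4, 3, 1, 0]), (17448435976, [3, 0, 1, 4, 2]),
    (68753293576, [3, 0, 2, 1, 4]), (8658092296, [3, 0, 4, 2, 1]),
    (68786651656, [3, 1, 0, 2, 4]), (4563665416, [3, 1, 2, 4, 0]),
    (17197695496, [3, 1, 4, 0, 2]), (8858436616, [3, 2, 0, 4, 1]),
    (68736386056, [3, 2, 1, 0, 4]), (4329571336, [3, 2, 4, 1, 0]),
    (17213493256, [3, 4, 0, 1, 2]), (4362211336, [3, 4, 1, 2, 0]), (8606978056, [3, 4, 2, 0, 1]),
    (34426978576, [4, 0, 1, 2, 3]), (8724414736, [4, 0, 2, 3, 1]),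
    (17213948176, [4, 0, 3, 1, 2]), (17314152976, [4, 1, 0, 3, 2]),
    (34376778256, [4, 1, 2, 0, 3]), (4362600976, [4, 1, 3, 2, 0]),
    (34393359376, [4, 2, 0, 1, 3]), (4429317136, [4, 2, 1, 3, 0]), (8607237136, [4, 2, 3, 0, 1]),
    (8657111056, [4, 3, 0, 2, 1]), (17196779536, [4, 3, 1, 0, 2]), (4328785936, [4, 3, 2, 1, 0])]

/-- The partitions that are orbit partitions of stabilizers in `A5`. -/
def partitionsA5 : List PartitionFamily := [
  ⟨[1, 1, 1, 1, 1], 1, [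
    (68853957121, [0, 1, 2, 3, 4])]⟩,
  ⟨[1, 1, 3], 10, [
    (68853760257, [0, 0, 0, 3, 4]), (68736516353, [0, 0, 2, 0, 4]),
    (4429447425, [0, 0, 2, 3, 0]), (68736320001, [0, 1, 0, 0, 4]), (4429251073, [0, 1, 0, 3, 0]),
    (68753162753, [0, 1, 1, 1, 4]), (8724283905, [0, 1, 1, 3, 1]), (4312007169, [0, 1, 2, 0, 0]),
    (8623751681, [0, 1, 2, 1, 1]), (17247240705, [0, 1, 2, 2, 2])]⟩,
  ⟨[1, 2, 2], 15, [
    (68786848001, [0, 0, 2, 2, 4]), (17314349313, [0, 0, 2, 3, 2]),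
    (34494218497, [0, 0, 2, 3, 3]), (68753097217, [0, 1, 0, 1, 4]),
    (8724218369, [0, 1, 0, 3, 1]), (34494022145, [0, 1, 0, 3, 3]),
    (68736385537, [0, 1, 1, 0, 4]), (4429316609, [0, 1, 1, 3, 0]),
    (34494087681, [0, 1, 1, 3, 3]), (8606974465, [0, 1, 2, 0, 1]),
    (17196909057, [0, 1, 2, 0, 2]), (4328784385, [0, 1, 2, 1, 0]),
    (17213686273, [0, 1, 2, 1, 2]), (4362338817, [0, 1, 2, 2, 0]), (8657306113, [0, 1, 2, 2, 1])]⟩,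
  ⟨[1, 4], 5, [
    (68736319745, [0, 0, 0, 0, 4]), (4429250817, [0, 0, 0, 3, 0]), (4312006913, [0, 0, 2, 0, 0]),
    (4311810561, [0, 1, 0, 0, 0]), (8623620609, [0, 1, 1, 1, 1])]⟩,
  ⟨[2, 3], 10, [
    (34494021889, [0, 0, 0, 3, 3]), (17196908801, [0, 0, 2, 0, 2]),
    (4362338561, [0, 0, 2, 2, 0]), (17247240449, [0, 0, 2, 2, 2]), (8606777857, [0, 1, 0, 0, 1]),
    (4328587777, [0, 1, 0, 1, 0]), (8623555073, [0, 1, 0, 1, 1]), (4311876097, [0, 1, 1, 0, 0]),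
    (8606843393, [0, 1, 1, 0, 1]), (4328653313, [0, 1, 1, 1, 0])]⟩,
  ⟨[5], 1, [
    (4311810305, [0, 0, 0, 0, 0])]⟩]

/-- The stabilizers in `A5` of functions. -/
def stabilizersA5 : List StabilizerType := [
  ⟨1, 1, [1], [1, 0, 0, 0, 0, 0]⟩,
  ⟨2, 2, [1, 1], [1, 0, 1, 0, 0, 0]⟩,
  ⟨3, 3, [1, 1, 1], [1, 1, 0, 0, 0, 0]⟩,
  ⟨6, 3, [2, 1, 1], [1, 1, 3, 0, 1, 0]⟩,
  ⟨12, 4, [3, 1, 1, 1], [1, 4, 3, 1, 0, 0]⟩,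
  ⟨60, 5, [5, 4, 3, 3, 1], [1, 10, 15, 5, 10, 1]⟩]

/-- The coefficients of the monomials for `A_5`, divided by the numbers of partitions. -/
def coefficientsA5 {R : Type} [CommRing R] [Algebra ℚ R] (q : ℕ → R) : List R :=
  [shift q 60, 3 * shift q 20 - shift q 60, 2 * shift q 30 - shift q 60,
    shift q 5 * (3 + q 3) - 12 * shift q 20 - 6 * shift q 30 + 6 * shift q 60,
    shift q 10 * (2 + q 2) - 3 * shift q 20 - 6 * shift q 30 + 3 * shift q 60,
    1 + 2 * q 3 + q 4 + q 5 - shift q 5 * (3 + q 3) * 5 - shift q 10 * (2 + q 2) * 10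
      + shift q 20 * 60 + shift q 30 * 60 - shift q 60 * 36]

theorem familySum_A5 {R : Type} [CommRing R] [Algebra ℚ R] (z q : ℕ → R) :
    familySum z (coefficientsA5 q) partitionsA5 = rhsA5 z q := by
  simp only [familySum, coefficientsA5, partitionsA5, rhsA5, List.zipWith_cons_cons, List.sum_cons,
    List.map_cons, List.map_nil, List.prod_cons, List.prod_nil, List.zipWith_nil_left,
    List.sum_nil, Nat.cast_ofNat, Nat.cast_one]
  ring

/-- The weight of a stabilizer equals the sum of the coefficients of the partitions refining its
orbits. Ordered by refinement, this system is unitriangular in the coefficients, so it determines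
them: this is Möbius inversion over the orbit partitions. -/
theorem inducedTerm_A5 {R : Type} [CommRing R] [Algebra ℚ R] (q : ℕ → R) (h1 : q 1 = 1)
    (hq : ∀ a b, q (a * b) = q a * q b) (t : StabilizerType) (ht : t ∈ stabilizersA5) :
    inducedTerm q (60 / t.order) t.degrees = natDot (coefficientsA5 q) t.counts := by
  -- The degrees `5 · 3` and `10 · 2`, induced from the stabilizers of orders `12` and `6`, appear
  -- in the formula in factored form.
  have h15 : q 15 = q 5 * q 3 := hq 5 3
  have h20 : q 20 = q 10 * q 2 := hq 10 2
  simp only [stabilizersA5, List.mem_cons, List.not_mem_nil, or_false] at ht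
  rcases ht with rfl | rfl | rfl | rfl | rfl | rfl <;>
  · simp only [inducedTerm, coefficientsA5, natDot_cons, natDot_nil, List.map_cons, List.map_nil,
      List.sum_cons, List.sum_nil, shift]
    norm_num [h1, h15, h20]
    try algebra

theorem isActionList_A5 : IsActionList A5 (Equiv.refl (Fin 5)) permsA5 := by
  have : FaithfulSMul A5 (Fin 5) := inferInstance
  refine isActionList_of_forall_mem (by decide +kernel) (by decide +kernel) ?_ ?_
  · have h : ∀ p : Equiv.Perm (Fin 5), Equiv.Perm.sign p = 1 →
        valueList p ∈ permsA5.map Prod.snd := by decide +kernel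
    rintro ⟨p, hp⟩
    exact h p (Equiv.Perm.mem_alternatingGroup.1 hp)
  · rw [nat_card_alternatingGroup, Nat.card_fin]
    decide +kernel

theorem tableCheck_A5 :
    tableCheck 5 permsA5 partitionsA5 (stabilizersA5.map StabilizerType.row) = true := by
  decide +kernel

theorem rigid_and_formalZeta_A5 {H : Type u} [Group H] [TopologicalSpace H] (hH : Rigid H) :
    Rigid (PermWreath H A5 (Fin 5)) ∧ formalZeta (PermWreath H A5 (Fin 5)) =
      rhsA5 (fun k => dilate k (formalZeta H)) monoSeries := by
  have : FaithfulSMul A5 (Fin 5) := inferInstance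
  have hc : Nat.card A5 = 60 := by
    rw [nat_card_alternatingGroup]; simp [Nat.factorial]
  rw [← familySum_A5]
  refine rigid_and_formalZeta_eq (by norm_num) isActionList_A5 (by decide +kernel)
    (by decide +kernel) tableCheck_A5 ?_ _ ?_ hH
  · intro K t ht h1 h2
    simp only [stabilizersA5, List.mem_cons, List.not_mem_nil, or_false] at ht
    rcases ht with rfl | rfl | rfl | rfl | rfl | rfl <;>
    -- All orders are at most `60 < 9²`, so no degree exceeds `8`. For each type the square-sum
    -- equation with an entry `1` has exactly one solution.
    exact hasDegrees_of_squareSums 8 (by norm_num) h1 h2 (by decide +kernel)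
  · rw [hc]
    exact inducedTerm_A5 _ monoSeries_one monoSeries_mul

end AlternatingGroup

/-! ### `PSL_2(𝔽_5)` on the projective line -/

section ProjectiveLine

/-- The permutations by which `PSL25` acts, as bit masks and lists of values. -/
def permsPSL25 : List (ℕ × List ℕ) := [
    (35253226045953, [0, 1, 2, 3, 4, 5]), (8813810811393, [0, 1, 4, 5, 2, 3]),
    (17729759347713, [0, 2, 1, 3, 5, 4]), (8804953490433, [0, 2, 5, 4, 1, 3]),
    (2336530368513, [0, 3, 4, 2, 5, 1]), (4466801641473, [0, 3, 5, 1, 4, 2]),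
    (4432943255553, [0, 4, 1, 5, 3, 2]), (35193029660673, [0, 4, 3, 2, 1, 5]),
    (2233651699713, [0, 5, 2, 4, 3, 1]), (17609400000513, [0, 5, 3, 1, 2, 4]),
    (8865349632258, [1, 0, 2, 5, 4, 3]), (35201687224578, [1, 0, 4, 3, 2, 5]),
    (17627082720258, [1, 2, 0, 5, 3, 4]), (35188936016898, [1, 2, 3, 4, 0, 5]),
    (1237219280898, [1, 3, 2, 4, 5, 0]), (17609384790018, [1, 3, 5, 0, 2, 4]),
    (4535619751938, [1, 4, 0, 3, 5, 2]), (8800457199618, [1, 4, 5, 2, 0, 3]),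
    (4466783297538, [1, 5, 3, 0, 4, 2]), (1133939531778, [1, 5, 4, 2, 3, 0]),
    (8933800542468, [2, 0, 1, 4, 5, 3]), (17600912294148, [2, 0, 5, 3, 1, 4]),
    (35219000328708, [2, 1, 0, 4, 3, 5]), (17597018407428, [2, 1, 3, 5, 0, 4]),
    (1168768108548, [2, 3, 1, 5, 4, 0]), (35192979851268, [2, 3, 4, 0, 1, 5]),
    (2336479514628, [2, 4, 3, 0, 5, 1]), (1133907021828, [2, 4, 5, 1, 3, 0]),
    (2267877023748, [2, 5, 0, 3, 4, 1]), (8800422600708, [2, 5, 4, 1, 0, 3]),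
    (4535520067848, [3, 0, 4, 1, 5, 2]), (2267811938568, [3, 0, 5, 2, 4, 1]),
    (17729642037768, [3, 1, 2, 0, 5, 4]), (1116962030088, [3, 1, 5, 4, 2, 0]),
    (35253108474888, [3, 2, 1, 0, 4, 5]), (1108639482888, [3, 2, 4, 5, 1, 0]),
    (35201585582088, [3, 4, 0, 1, 2, 5]), (2203855360008, [3, 4, 2, 5, 0, 1]),
    (17600843161608, [3, 5, 0, 2, 1, 4]), (4402610053128, [3, 5, 1, 4, 0, 2]),
    (35218799067408, [4, 0, 1, 2, 3, 5]), (4407173841168, [4, 0, 3, 5, 1, 2]),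
    (8933599150608, [4, 1, 0, 2, 5, 3]), (4402477793808, [4, 1, 5, 3, 0, 2]),
    (1236984661008, [4, 2, 3, 1, 5, 0]), (2233401869328, [4, 2, 5, 0, 3, 1]),
    (2216740063248, [4, 3, 0, 5, 2, 1]), (35188700874768, [4, 3, 2, 1, 0, 5]),
    (1116825853968, [4, 5, 1, 3, 2, 0]), (8804700004368, [4, 5, 2, 0, 1, 3]),
    (17626579599648, [5, 0, 2, 1, 3, 4]), (2216472084768, [5, 0, 3, 4, 2, 1]),
    (1168298738208, [5, 1, 3, 2, 4, 0]), (4432424075808, [5, 1, 4, 0, 3, 2]),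
    (8864846119968, [5, 2, 0, 1, 4, 3]), (2203453490208, [5, 2, 4, 3, 0, 1]),
    (4406904948768, [5, 3, 0, 4, 1, 2]), (17596548253728, [5, 3, 1, 2, 0, 4]),
    (8813289803808, [5, 4, 1, 0, 2, 3]), (1108236046368, [5, 4, 2, 3, 1, 0])]

/-- The partitions that are orbit partitions of stabilizers in `PSL25`. -/
def partitionsPSL25 : List PartitionFamily := [
  ⟨[1, 1, 1, 1, 1, 1], 1, [
    (35253226045953, [0, 1, 2, 3, 4, 5])]⟩,
  ⟨[1, 1, 2, 2], 15, [
    (35201686438145, [0, 0, 2, 3, 2, 5]), (8864946979073, [0, 0, 2, 3, 4, 3]),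
    (35218866110977, [0, 1, 0, 3, 3, 5]), (2267877016065, [0, 1, 0, 3, 4, 1]),
    (35253108474369, [0, 1, 1, 0, 4, 5]), (17661039870465, [0, 1, 1, 3, 4, 4]),
    (17660922561025, [0, 1, 2, 0, 4, 4]), (35188700873217, [0, 1, 2, 1, 0, 5]),
    (4466799804929, [0, 1, 2, 1, 4, 2]), (35193029394945, [0, 1, 2, 2, 1, 5]),
    (1168298476033, [0, 1, 2, 2, 4, 0]), (4402475958785, [0, 1, 2, 3, 0, 2]),
    (1108236042753, [0, 1, 2, 3, 1, 0]), (8813407371777, [0, 1, 2, 3, 2, 3]),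
    (2233517474305, [0, 1, 2, 3, 3, 1])]⟩,
  ⟨[1, 5], 6, [
    (35188683899137, [0, 0, 0, 0, 0, 5]), (1168247947521, [0, 0, 0, 0, 4, 0]),
    (1103940878593, [0, 0, 0, 3, 0, 0]), (1103823634689, [0, 0, 2, 0, 0, 0]),
    (1103823438337, [0, 1, 0, 0, 0, 0]), (2207646876161, [0, 1, 1, 1, 1, 1])]⟩,
  ⟨[2, 2, 2], 5, [
    (8813407371521, [0, 0, 2, 3, 2, 3]), (2233517277697, [0, 1, 0, 3, 3, 1]),
    (17660922429953, [0, 1, 1, 0, 4, 4]), (4402375295489, [0, 1, 2, 1, 0, 2]),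
    (1108168933889, [0, 1, 2, 2, 1, 0])]⟩,
  ⟨[3, 3], 10, [
    (8830587044097, [0, 0, 0, 3, 3, 3]), (4415243419905, [0, 0, 2, 0, 2, 2]),
    (4402408849665, [0, 0, 2, 2, 0, 2]), (1116758868225, [0, 0, 2, 2, 2, 0]),
    (2207630033409, [0, 1, 0, 0, 1, 1]), (2203351843329, [0, 1, 0, 1, 0, 1]),
    (1108135182849, [0, 1, 0, 1, 1, 0]), (2203335131649, [0, 1, 1, 0, 0, 1]),
    (1108118471169, [0, 1, 1, 0, 1, 0]), (1103840281089, [0, 1, 1, 1, 0, 0])]⟩,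
  ⟨[6], 1, [
    (1103823438081, [0, 0, 0, 0, 0, 0])]⟩]

/-- The stabilizers in `PSL25` of functions. -/
def stabilizersPSL25 : List StabilizerType := [
  ⟨1, 1, [1], [1, 0, 0, 0, 0, 0]⟩,
  ⟨2, 2, [1, 1], [1, 1, 0, 0, 0, 0]⟩,
  ⟨4, 4, [1, 1, 1, 1], [1, 3, 0, 1, 0, 0]⟩,
  ⟨6, 3, [2, 1, 1], [1, 3, 0, 0, 1, 0]⟩,
  ⟨10, 4, [2, 2, 1, 1], [1, 5, 1, 0, 0, 0]⟩,
  ⟨60, 5, [5, 4, 3, 3, 1], [1, 15, 6, 5, 10, 1]⟩]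

/-- Matrices that represent the elements of `PSL_2(𝔽_5)`. -/
def matricesPSL25 : List (ZMod 5 × ZMod 5 × ZMod 5 × ZMod 5) := [
    (1, 0, 0, 1), (2, 0, 4, 3), (2, 0, 3, 3), (1, 0, 2, 1), (1, 0, 1, 1), (2, 0, 1, 3),
    (1, 0, 3, 1), (2, 0, 0, 3), (2, 0, 2, 3), (1, 0, 4, 1), (1, 4, 2, 4), (2, 3, 0, 3),
    (1, 3, 4, 3), (1, 1, 0, 1), (0, 2, 2, 2), (2, 4, 3, 4), (2, 1, 1, 1), (2, 2, 4, 2),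
    (1, 2, 3, 2), (0, 1, 4, 1), (2, 3, 4, 4), (1, 4, 4, 2), (2, 1, 0, 3), (2, 2, 3, 1),
    (0, 1, 4, 3), (1, 2, 0, 1), (2, 4, 2, 2), (0, 2, 2, 1), (1, 3, 1, 4), (1, 1, 2, 3),
    (1, 4, 3, 3), (2, 3, 2, 1), (1, 2, 4, 4), (0, 1, 4, 2), (2, 4, 0, 3), (0, 2, 2, 4),
    (1, 3, 0, 1), (1, 1, 1, 2), (2, 1, 3, 2), (2, 2, 1, 4), (1, 4, 0, 1), (2, 3, 1, 2),
    (1, 3, 2, 2), (1, 1, 3, 4), (0, 1, 4, 4), (1, 2, 1, 3), (2, 1, 2, 4), (2, 2, 0, 3),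
    (0, 2, 2, 3), (2, 4, 4, 1), (2, 3, 3, 0), (1, 4, 1, 0), (0, 2, 2, 0), (2, 4, 1, 0),
    (2, 1, 4, 0), (2, 2, 2, 0), (1, 3, 3, 0), (1, 1, 4, 0), (1, 2, 2, 0), (0, 1, 4, 0)]

/-- The position of the point with the given homogeneous coordinates. -/
def lineIndex (x y : ZMod 5) : Fin 6 := if y = 0 then 5 else Fin.ofNat 6 (x * y⁻¹).val

/-- Homogeneous coordinates of a point. -/
def lineCoord (i : Fin 6) : ZMod 5 × ZMod 5 := if i = 5 then (1, 0) else ((i : ℕ), 1)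

/-- The values of the action of a matrix. -/
def lineValues (A : ZMod 5 × ZMod 5 × ZMod 5 × ZMod 5) : List ℕ :=
  valueList fun i => lineIndex (A.1 * (lineCoord i).1 + A.2.1 * (lineCoord i).2)
    (A.2.2.1 * (lineCoord i).1 + A.2.2.2 * (lineCoord i).2)

theorem lineCoord_ne (i : Fin 6) : ![(lineCoord i).1, (lineCoord i).2] ≠ 0 := by
  have h : ∀ i : Fin 6, ¬ ((lineCoord i).1 = 0 ∧ (lineCoord i).2 = 0) := by decide +kernel
  intro h0
  exact h i ⟨congrFun h0 0, congrFun h0 1⟩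

/-- A numbering of the points of the projective line. -/
def lineEquiv : Line5 ≃ Fin 6 where
  toFun := Projectivization.lift (fun v => lineIndex (v.1 0) (v.1 1)) (by
    rintro ⟨a, ha⟩ ⟨b, hb⟩ t h
    simp only at h
    subst h
    have ht : t ≠ 0 := fun h0 => ha (by rw [h0, zero_smul])
    have : ∀ t x y : ZMod 5, t ≠ 0 → lineIndex (t * x) (t * y) = lineIndex x y := by
      decide +kernel
    exact this t (b 0) (b 1) ht)
  invFun i := Projectivization.mk _ ![(lineCoord i).1, (lineCoord i).2] (lineCoord_ne i)
  left_inv p := by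
    induction p using Projectivization.ind with
    | h v hv =>
      rw [Projectivization.lift_mk, Projectivization.mk_eq_mk_iff']
      have : ∀ x y : ZMod 5, ¬ (x = 0 ∧ y = 0) → ∃ a : ZMod 5,
          a * x = (lineCoord (lineIndex x y)).1 ∧ a * y = (lineCoord (lineIndex x y)).2 := by
        decide +kernel
      obtain ⟨a, h1, h2⟩ := this (v 0) (v 1) fun h => hv (by ext i; fin_cases i; exacts [h.1, h.2])
      refine ⟨a, ?_⟩
      ext i
      fin_cases i
      · exact h1
      · exact h2
  right_inv i := by
    rw [Projectivization.lift_mk]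
    have : ∀ i : Fin 6, lineIndex (lineCoord i).1 (lineCoord i).2 = i := by decide +kernel
    exact this i

theorem lineEquiv_mk (v : Fin 2 → ZMod 5) (hv : v ≠ 0) :
    lineEquiv (Projectivization.mk _ v hv) = lineIndex (v 0) (v 1) := rfl

theorem valueList_actFin_PSL25 (g : Matrix.SpecialLinearGroup (Fin 2) (ZMod 5)) :
    valueList (actFin lineEquiv (QuotientGroup.mk g : PSL25)) =
      lineValues (g.1 0 0, g.1 0 1, g.1 1 0, g.1 1 1) := by
  rw [lineValues]
  congr 1
  funext i
  change lineEquiv ((QuotientGroup.mk g : PSL25) • Projectivization.mk _ _ (lineCoord_ne i)) = _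
  rw [Matrix.ProjectiveSpecialLinearGroup.smul_proj_mk, Projectivization.smul_mk, lineEquiv_mk]
  simp [Matrix.SpecialLinearGroup.smul_def, Matrix.mulVec, dotProduct, Fin.sum_univ_two]

/-- Every matrix of determinant `1` acts by a listed permutation, and every listed permutation is
the action of an explicit matrix. The order of the group is not needed; it follows from the list in
`card_PSL25`. -/
theorem isActionList_PSL25 : IsActionList PSL25 lineEquiv permsPSL25 := by
  have h1 : ∀ a b c d : ZMod 5, a * d - b * c = 1 →
      lineValues (a, b, c, d) ∈ permsPSL25.map Prod.snd := by decide +kernel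
  have h2 : matricesPSL25.map lineValues = permsPSL25.map Prod.snd := by decide +kernel
  have h3 : ∀ A ∈ matricesPSL25, A.1 * A.2.2.2 - A.2.1 * A.2.2.1 = 1 := by decide +kernel
  refine ⟨by decide +kernel, by decide +kernel, fun l => ⟨fun hl => ?_, ?_⟩⟩
  · rw [← h2] at hl
    obtain ⟨⟨a, b, c, d⟩, hA, rfl⟩ := List.mem_map.1 hl
    refine ⟨QuotientGroup.mk ⟨!![a, b; c, d], ?_⟩, valueList_actFin_PSL25 _⟩
    rw [Matrix.det_fin_two_of]
    exact h3 _ hA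
  · rintro ⟨q, rfl⟩
    obtain ⟨g, rfl⟩ := QuotientGroup.mk_surjective q
    rw [valueList_actFin_PSL25]
    refine h1 _ _ _ _ ?_
    rw [← Matrix.det_fin_two]
    exact g.2

/-- The coefficients of the monomials for `PSL_2(𝔽_5)`, divided by the numbers of partitions. -/
def coefficientsPSL25 {R : Type} [CommRing R] [Algebra ℚ R] (q : ℕ → R) : List R :=
  [shift q 60, (1 / 15 : ℚ) • (q 30 - (1 / 4 : ℚ) • q 60),
    (1 / 6 : ℚ) • (2 * q 6 + 2 * q 12 - 2 * q 30 + (2 / 5 : ℚ) • q 60),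
    (1 / 5 : ℚ) • ((4 / 3 : ℚ) • q 15 - q 30 + (1 / 6 : ℚ) • q 60),
    (1 / 10 : ℚ) • (2 * q 10 + q 20 - 2 * q 30 + (1 / 3 : ℚ) • q 60),
    1 + 2 * q 3 + q 4 + q 5 - 2 * q 6 - 2 * q 10 - 2 * q 12 - (4 / 3 : ℚ) • q 15
      - q 20 + 4 * q 30 - (2 / 3 : ℚ) • q 60]

theorem familySum_PSL25 {R : Type} [CommRing R] [Algebra ℚ R] (z q : ℕ → R) :
    familySum z (coefficientsPSL25 q) partitionsPSL25 = rhsPSL25 z q := by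
  simp only [familySum, coefficientsPSL25, partitionsPSL25, rhsPSL25, List.zipWith_cons_cons,
    List.sum_cons, List.map_cons, List.map_nil, List.prod_cons, List.prod_nil,
    List.zipWith_nil_left, List.sum_nil, Nat.cast_ofNat, Nat.cast_one, shift]
  algebra

theorem inducedTerm_PSL25 {R : Type} [CommRing R] [Algebra ℚ R] (q : ℕ → R) (h1 : q 1 = 1)
    (t : StabilizerType) (ht : t ∈ stabilizersPSL25) :
    inducedTerm q (60 / t.order) t.degrees = natDot (coefficientsPSL25 q) t.counts := by
  simp only [stabilizersPSL25, List.mem_cons, List.not_mem_nil, or_false] at ht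
  rcases ht with rfl | rfl | rfl | rfl | rfl | rfl <;>
  · simp only [inducedTerm, coefficientsPSL25, natDot_cons, natDot_nil, List.map_cons, List.map_nil,
      List.sum_cons, List.sum_nil, shift]
    norm_num [h1]
    try algebra

theorem tableCheck_PSL25 :
    tableCheck 6 permsPSL25 partitionsPSL25 (stabilizersPSL25.map StabilizerType.row) = true := by
  decide +kernel

theorem card_PSL25 : Nat.card PSL25 = 60 := by
  rw [card_eq_length (φ := fun q : PSL25 => valueList (actFin lineEquiv q))
    (fun q r h => actFin_injective _ (valueList_injective h)) isActionList_PSL25.1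
    isActionList_PSL25.2.2]
  decide +kernel

theorem rigid_and_formalZeta_PSL25 {H : Type u} [Group H] [TopologicalSpace H] (hH : Rigid H) :
    Rigid (PermWreath H PSL25 Line5) ∧ formalZeta (PermWreath H PSL25 Line5) =
      rhsPSL25 (fun k => dilate k (formalZeta H)) monoSeries := by
  rw [← familySum_PSL25]
  refine rigid_and_formalZeta_eq (by norm_num) isActionList_PSL25 (by decide +kernel)
    (by decide +kernel) tableCheck_PSL25 ?_ _ ?_ hH
  · intro K t ht h1 h2
    simp only [stabilizersPSL25, List.mem_cons, List.not_mem_nil, or_false] at ht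
    rcases ht with rfl | rfl | rfl | rfl | rfl | rfl <;>
    exact hasDegrees_of_squareSums 8 (by norm_num) h1 h2 (by decide +kernel)
  · rw [card_PSL25]
    exact inducedTerm_PSL25 _ monoSeries_one

end ProjectiveLine

/-! ### The irreducible part of a two-transitive permutation representation -/

section TwoTransitive

variable {K : Type v} {X : Type w} [Group K] [MulAction K X]

/-- The permutation representation on functions. -/
def permRep (K : Type v) (X : Type w) [Group K] [MulAction K X] :
    Representation ℂ K (X → ℂ) where
  toFun g := LinearMap.funLeft ℂ ℂ fun x => g⁻¹ • x
  map_one' := by ext; simp [LinearMap.funLeft]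
  map_mul' a b := by
    apply LinearMap.ext
    intro f
    funext x
    simp [LinearMap.funLeft, mul_smul]

theorem permRep_apply (g : K) (f : X → ℂ) (x : X) : permRep K X g f x = f (g⁻¹ • x) := rfl

variable [Fintype X]

/-- The sum of the values of a function. -/
def sumValues (X : Type w) [Fintype X] : (X → ℂ) →ₗ[ℂ] ℂ where
  toFun f := ∑ x, f x
  map_add' f g := by simp [Finset.sum_add_distrib]
  map_smul' c f := by simp [Finset.mul_sum]

theorem isStable_ker_sumValues : IsStable (permRep K X) (LinearMap.ker (sumValues X)) := by
  intro g f hf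
  rw [LinearMap.mem_ker] at hf ⊢
  rw [← hf]
  exact Fintype.sum_equiv (MulAction.toPerm g⁻¹) _ _ fun x => rfl

/-- The functions with sum zero form an irreducible representation. A nonzero stable subspace
contains a function that is constant off one point but not constant, and the translates of such a
function span all functions of sum zero. -/
theorem exists_isIrreducible_of_two_transitive [Finite K] {n : ℕ} (hn : n ≠ 0)
    (hX : Fintype.card X = n + 1)
    (h : ∀ x y x' y' : X, x ≠ y → x' ≠ y' → ∃ g : K, g • x = x' ∧ g • y = y') :
    ∃ ρ : Representation ℂ K (Fin n → ℂ), ρ.IsIrreducible := by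
  classical
  have hnt : Nontrivial X := Fintype.one_lt_card_iff_nontrivial.1 (by omega)
  have htr : ∀ x x' : X, ∃ g : K, g • x = x' := by
    intro x x'
    obtain ⟨y, hy⟩ := exists_ne x
    obtain ⟨y', hy'⟩ := exists_ne x'
    obtain ⟨g, hg, -⟩ := h x y x' y' hy.symm hy'.symm
    exact ⟨g, hg⟩
  have hfin : Module.finrank ℂ (LinearMap.ker (sumValues X)) = n := by
    have h1 := LinearMap.finrank_range_add_finrank_ker (sumValues X)
    have h2 : LinearMap.range (sumValues X) = ⊤ := by
      rw [LinearMap.range_eq_top]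
      intro c
      obtain ⟨x, -⟩ := exists_pair_ne X
      exact ⟨Pi.single x c, by simp [sumValues]⟩
    rw [h2, finrank_top, Module.finrank_self, Module.finrank_fintype_fun_eq_card, hX] at h1
    omega
  have hirr : (isStable_ker_sumValues (K := K) (X := X)).subrep.IsIrreducible := by
    rw [IsStable.isIrreducible_subrep]
    refine ⟨fun h0 => hn ?_, fun U hUV hU => or_iff_not_imp_left.2 fun hU0 => ?_⟩
    · rw [h0, finrank_bot] at hfin
      exact hfin.symm
    obtain ⟨u, hu, hu0⟩ := (Submodule.ne_bot_iff U).1 hU0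
    obtain ⟨x₀, hx₀⟩ := Function.ne_iff.1 hu0
    have := Fintype.ofFinite (MulAction.stabilizer K x₀)
    -- Averaging over the stabilizer of `x₀` keeps the nonzero value at `x₀` up to a factor. It
    -- makes the function constant elsewhere, since the stabilizer is transitive on the other
    -- points.
    let w : X → ℂ := ∑ g : MulAction.stabilizer K x₀, permRep K X g.1 u
    have hwU : w ∈ U := U.sum_mem fun g _ => hU g.1 u hu
    have hwx : w x₀ ≠ 0 := by
      have h1 : w x₀ = Fintype.card (MulAction.stabilizer K x₀) * u x₀ := by
        simp only [w, Finset.sum_apply, permRep_apply]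
        rw [Finset.sum_congr rfl fun g _ => by
          rw [MulAction.mem_stabilizer_iff.1 (inv_mem g.2)]]
        simp
      rw [h1]
      exact mul_ne_zero (by exact_mod_cast Fintype.card_ne_zero) hx₀
    obtain ⟨y₀, hy₀⟩ := exists_ne x₀
    have hwy : ∀ z, z ≠ x₀ → w z = w y₀ := by
      intro z hz
      obtain ⟨g, hg1, hg2⟩ := h x₀ z x₀ y₀ hz.symm hy₀.symm
      simp only [w, Finset.sum_apply, permRep_apply]
      refine Fintype.sum_equiv (Equiv.mulLeft (⟨g, hg1⟩ : MulAction.stabilizer K x₀)) _ _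
        fun k => ?_
      simp [mul_smul, ← hg2]
    have hsum : ∑ x, w x = 0 := LinearMap.mem_ker.1 (hUV hwU)
    have hne : w x₀ - w y₀ ≠ 0 := by
      intro h0
      rw [sub_eq_zero] at h0
      have h1 : ∀ x, w x = w x₀ := fun x => by
        by_cases hx : x = x₀
        · rw [hx]
        · rw [hwy x hx, h0]
      rw [Finset.sum_congr rfl fun x _ => h1 x, Finset.sum_const, Finset.card_univ, hX,
        nsmul_eq_mul] at hsum
      exact mul_ne_zero (by exact_mod_cast Nat.succ_ne_zero n) hwx hsum
    choose t ht using htr x₀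
    refine le_antisymm hUV fun f hf => ?_
    have hf0 : ∑ x, f x = 0 := LinearMap.mem_ker.1 hf
    -- The translate of `w` to `x` is the constant `w y₀` plus a multiple of the indicator of `x`;
    -- the constants cancel because the values of `f` sum to zero.
    have key : ∑ x, f x • permRep K X (t x) w = (w x₀ - w y₀) • f := by
      funext z
      have h1 : ∀ x, w ((t x)⁻¹ • z) = w y₀ + if x = z then w x₀ - w y₀ else 0 := by
        intro x
        split_ifs with hx
        · rw [← hx, inv_smul_eq_iff.2 (ht x).symm]; ring
        · rw [hwy, add_zero]
          intro h2
          rw [inv_smul_eq_iff, ht] at h2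
          exact hx h2.symm
      simp only [Finset.sum_apply, Pi.smul_apply, permRep_apply, h1, smul_eq_mul, mul_add,
        Finset.sum_add_distrib, ← Finset.sum_mul, hf0, zero_mul, zero_add, mul_ite, mul_zero,
        Finset.sum_ite_eq', Finset.mem_univ, if_true]
      ring
    have h2 : (w x₀ - w y₀) • f ∈ U := key ▸ U.sum_mem fun x _ => U.smul_mem _ (hU _ _ hwU)
    exact (U.smul_mem_iff hne).1 h2
  let : TopologicalSpace K := ⊥
  have : DiscreteTopology K := ⟨rfl⟩
  obtain ⟨σ, -⟩ := exists_irrep_equiv hirr (fun _ _ => continuous_of_discreteTopology) hfin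
  exact ⟨σ.1, σ.2.1⟩

end TwoTransitive

/-! ### `PGL_3(𝔽_2)` on the projective plane -/

section ProjectivePlane

/-- The permutations by which `PGL32` acts, as bit masks and lists of values. -/
def permsPGL32 : List (ℕ × List ℕ) := [
    (18049651735527937, [0, 1, 2, 3, 4, 5, 6]), (9077602627355137, [0, 1, 2, 4, 3, 6, 5]),
    (4512671135433217, [0, 1, 2, 5, 6, 3, 4]), (2269530512687617, [0, 1, 2, 6, 5, 4, 3]),
    (9077636852745217, [0, 2, 1, 3, 4, 6, 5]), (18049617509876737, [0, 2, 1, 4, 3, 5, 6]),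
    (2269667414639617, [0, 2, 1, 5, 6, 4, 3]), (4512534233220097, [0, 2, 1, 6, 5, 3, 4]),
    (18049600096045057, [0, 3, 4, 1, 2, 5, 6]), (9077576657012737, [0, 3, 4, 2, 1, 6, 5]),
    (1128374345926657, [0, 3, 4, 5, 6, 1, 2]), (567486513678337, [0, 3, 4, 6, 5, 2, 1]),
    (9077585212870657, [0, 4, 3, 1, 2, 6, 5]), (18049591539142657, [0, 4, 3, 2, 1, 5, 6]),
    (567623415238657, [0, 4, 3, 5, 6, 2, 1]), (1128237443321857, [0, 4, 3, 6, 5, 1, 2]),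
    (4512412938018817, [0, 5, 6, 1, 2, 3, 4]), (2269400660975617, [0, 5, 6, 2, 1, 4, 3]),
    (1128167787995137, [0, 5, 6, 3, 4, 1, 2]), (567382632308737, [0, 5, 6, 4, 3, 2, 1]),
    (2269409215266817, [0, 6, 5, 1, 2, 4, 3]), (4512404379549697, [0, 6, 5, 2, 1, 3, 4]),
    (567416855740417, [0, 6, 5, 3, 4, 2, 1]), (1128133560385537, [0, 6, 5, 4, 3, 1, 2]),
    (18032128268960002, [1, 0, 2, 3, 5, 4, 6]), (9016270494368002, [1, 0, 2, 4, 6, 3, 5]),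
    (4574003268419842, [1, 0, 2, 5, 3, 6, 4]), (2287053979255042, [1, 0, 2, 6, 4, 5, 3]),
    (4574105944785922, [1, 2, 0, 3, 5, 6, 4]), (2287259332183042, [1, 2, 0, 4, 6, 5, 3]),
    (18032025592202242, [1, 2, 0, 5, 3, 4, 6]), (9016065141048322, [1, 2, 0, 6, 4, 3, 5]),
    (18032007894272002, [1, 3, 5, 0, 2, 4, 6]), (4573972735723522, [1, 3, 5, 2, 0, 6, 4]),
    (1127274566912002, [1, 3, 5, 4, 6, 0, 2]), (285942818539522, [1, 3, 5, 6, 4, 2, 0]),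
    (9016012548608002, [1, 4, 6, 0, 2, 3, 5]), (2286988552048642, [1, 4, 6, 2, 0, 5, 3]),
    (1127136995840002, [1, 4, 6, 3, 5, 0, 2]), (285907924029442, [1, 4, 6, 5, 3, 2, 0]),
    (4573985568727042, [1, 5, 3, 0, 2, 6, 4]), (18031995058135042, [1, 5, 3, 2, 0, 4, 6]),
    (286148170096642, [1, 5, 3, 4, 6, 2, 0]), (1127069212221442, [1, 5, 3, 6, 4, 0, 2]),
    (2287001383485442, [1, 6, 4, 0, 2, 5, 3]), (9015999710904322, [1, 6, 4, 2, 0, 3, 5]),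
    (286010597457922, [1, 6, 4, 3, 5, 2, 0]), (1127034316144642, [1, 6, 4, 5, 3, 0, 2]),
    (9025066453041412, [2, 0, 1, 3, 6, 4, 5]), (18023332310024452, [2, 0, 1, 4, 5, 3, 6]),
    (2322237814341892, [2, 0, 1, 5, 4, 6, 3]), (4538819433070852, [2, 0, 1, 6, 3, 5, 4]),
    (4539059011650052, [2, 1, 0, 3, 6, 5, 4]), (2322306265317892, [2, 1, 0, 4, 5, 6, 3]),
    (18023263858917892, [2, 1, 0, 5, 4, 3, 6]), (9024826874331652, [2, 1, 0, 6, 3, 4, 5]),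
    (9024800051693572, [2, 3, 6, 0, 1, 4, 5]), (4538788332177412, [2, 3, 6, 1, 0, 5, 4]),
    (564187176634372, [2, 3, 6, 4, 5, 0, 1]), (283743260510212, [2, 3, 6, 5, 4, 1, 0]),
    (18023203211317252, [2, 4, 5, 0, 1, 3, 6]), (2322172888485892, [2, 4, 5, 1, 0, 6, 3]),
    (564324479275012, [2, 4, 5, 3, 6, 0, 1]), (283709435547652, [2, 4, 5, 6, 3, 1, 0]),
    (2322177165631492, [2, 5, 4, 0, 1, 6, 3]), (18023198932082692, [2, 5, 4, 1, 0, 3, 6]),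
    (283949013147652, [2, 5, 4, 3, 6, 1, 0]), (564084899586052, [2, 5, 4, 6, 3, 0, 1]),
    (4538792606711812, [2, 6, 3, 0, 1, 5, 4]), (9024795769847812, [2, 6, 3, 1, 0, 4, 5]),
    (283811707895812, [2, 6, 3, 4, 5, 1, 0]), (564118721937412, [2, 6, 3, 5, 4, 0, 1]),
    (18018934029549832, [3, 0, 4, 1, 5, 2, 6]), (9009673224061192, [3, 0, 4, 2, 6, 1, 5]),
    (1196277778874632, [3, 0, 4, 5, 1, 6, 2]), (598152580169992, [3, 0, 4, 6, 2, 5, 1]),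
    (18018865294344712, [3, 1, 5, 0, 4, 2, 6]), (4504974086111752, [3, 1, 5, 2, 6, 0, 4]),
    (1196273216520712, [3, 1, 5, 4, 0, 6, 2]), (299085418463752, [3, 1, 5, 6, 2, 4, 0]),
    (9009467018445832, [3, 2, 6, 0, 4, 1, 5]), (4504836615701512, [3, 2, 6, 1, 5, 0, 4]),
    (598138893108232, [3, 2, 6, 4, 0, 5, 1]), (299076293755912, [3, 2, 6, 5, 1, 4, 0]),
    (1196406123597832, [3, 4, 0, 1, 5, 6, 2]), (598409270595592, [3, 4, 0, 2, 6, 5, 1]),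
    (18018805682868232, [3, 4, 0, 5, 1, 2, 6]), (9009416531677192, [3, 4, 0, 6, 2, 1, 5]),
    (1196337387413512, [3, 5, 1, 0, 4, 6, 2]), (299342107910152, [3, 5, 1, 2, 6, 4, 0]),
    (18018801119535112, [3, 5, 1, 4, 0, 2, 6]), (4504717392748552, [3, 5, 1, 6, 2, 0, 4]),
    (598203062042632, [3, 6, 2, 0, 4, 5, 1]), (299204635541512, [3, 6, 2, 1, 5, 4, 0]),
    (9009402841677832, [3, 6, 2, 4, 0, 1, 5]), (4504708266082312, [3, 6, 2, 5, 1, 0, 4]),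
    (9011872213238032, [4, 0, 3, 1, 6, 2, 5]), (18016735039324432, [4, 0, 3, 2, 5, 1, 6]),
    (633336414863632, [4, 0, 3, 5, 2, 6, 1]), (1161093943132432, [4, 0, 3, 6, 1, 5, 2]),
    (9011631681962512, [4, 1, 6, 0, 3, 2, 5]), (2253036835570192, [4, 1, 6, 2, 5, 0, 3]),
    (1161088712311312, [4, 1, 6, 3, 0, 5, 2]), (290288790667792, [4, 1, 6, 5, 2, 3, 0]),
    (18016631911351312, [4, 2, 5, 0, 3, 1, 6]), (2253174238872592, [4, 2, 5, 1, 6, 0, 3]),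
    (633323128882192, [4, 2, 5, 3, 0, 6, 1]), (290280735507472, [4, 2, 5, 6, 1, 3, 0]),
    (1161359190460432, [4, 3, 0, 1, 6, 5, 2]), (633456203728912, [4, 3, 0, 2, 5, 6, 1]),
    (18016615249545232, [4, 3, 0, 5, 2, 1, 6]), (9011606964996112, [4, 3, 0, 6, 1, 2, 5]),
    (633353074384912, [4, 5, 2, 0, 3, 6, 1]), (290545981464592, [4, 5, 2, 1, 6, 3, 0]),
    (18016601962192912, [4, 5, 2, 3, 0, 1, 6]), (2252908989259792, [4, 5, 2, 6, 1, 0, 3]),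
    (1161118655594512, [4, 6, 1, 0, 3, 5, 2]), (290408575942672, [4, 6, 1, 2, 5, 3, 0]),
    (9011601730584592, [4, 6, 1, 3, 0, 2, 5]), (2252917042200592, [4, 6, 1, 5, 2, 0, 3]),
    (4508032071368992, [5, 0, 6, 1, 3, 2, 4]), (2254067627720992, [5, 0, 6, 2, 4, 1, 3]),
    (1143500821233952, [5, 0, 6, 3, 1, 4, 2]), (571763498942752, [5, 0, 6, 4, 2, 3, 1]),
    (4508272569090592, [5, 1, 3, 0, 6, 2, 4]), (18015566808220192, [5, 1, 3, 2, 4, 0, 6]),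
    (351861169717792, [5, 1, 3, 4, 2, 6, 0]), (1143497462120992, [5, 1, 3, 6, 0, 4, 2]),
    (2254273732674592, [5, 2, 4, 0, 6, 1, 3]), (18015532415452192, [5, 2, 4, 1, 3, 0, 6]),
    (351852446090272, [5, 2, 4, 3, 1, 6, 0]), (571751416202272, [5, 2, 4, 6, 0, 3, 1]),
    (1143766987704352, [5, 3, 1, 0, 6, 4, 2]), (351912507607072, [5, 3, 1, 2, 4, 6, 0]),
    (18015515469547552, [5, 3, 1, 4, 2, 0, 6]), (4508003042723872, [5, 3, 1, 6, 0, 2, 4]),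
    (572020941393952, [5, 4, 2, 0, 6, 3, 1]), (351878114447392, [5, 4, 2, 1, 3, 6, 0]),
    (18015506745528352, [5, 4, 2, 3, 1, 0, 6]), (2254004205916192, [5, 4, 2, 6, 0, 1, 3]),
    (1143526486261792, [5, 6, 0, 1, 3, 4, 2]), (571814833111072, [5, 6, 0, 2, 4, 3, 1]),
    (4508006398115872, [5, 6, 0, 3, 1, 2, 4]), (2254016285327392, [5, 6, 0, 4, 2, 1, 3]),
    (2256266615324992, [6, 0, 5, 1, 4, 2, 3]), (4505833079570752, [6, 0, 5, 2, 3, 1, 4]),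
    (580559455650112, [6, 0, 5, 3, 2, 4, 1]), (1134704860332352, [6, 0, 5, 4, 1, 3, 2]),
    (2256335316976192, [6, 1, 4, 0, 5, 2, 3]), (9008333194265152, [6, 1, 4, 2, 3, 0, 5]),
    (316676663935552, [6, 1, 4, 3, 2, 5, 0]), (1134700832752192, [6, 1, 4, 5, 0, 3, 2]),
    (4505936106882112, [6, 2, 3, 0, 5, 1, 4]), (9008367519925312, [6, 2, 3, 1, 4, 0, 5]),
    (316668207694912, [6, 2, 3, 4, 1, 5, 0]), (580546971829312, [6, 2, 3, 5, 0, 4, 1]),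
    (580679595460672, [6, 3, 2, 0, 5, 4, 1]), (316728102094912, [6, 3, 2, 1, 4, 5, 0]),
    (9008307625003072, [6, 3, 2, 4, 1, 0, 5]), (4505803482728512, [6, 3, 2, 5, 0, 1, 4]),
    (1134833455730752, [6, 4, 1, 0, 5, 3, 2]), (316693775781952, [6, 4, 1, 2, 3, 5, 0]),
    (9008316080590912, [6, 4, 1, 3, 2, 0, 5]), (2256202692169792, [6, 4, 1, 5, 0, 2, 3]),
    (1134764752969792, [6, 5, 0, 1, 4, 3, 2]), (580576566386752, [6, 5, 0, 2, 3, 4, 1]),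
    (4505815964786752, [6, 5, 0, 3, 2, 1, 4]), (2256206718640192, [6, 5, 0, 4, 1, 2, 3])]

/-- The partitions that are orbit partitions of stabilizers in `PGL32`. -/
def partitionsPGL32 : List PartitionFamily := [
  ⟨[1, 1, 1, 1, 1, 1, 1], 1, [
    (18049651735527937, [0, 1, 2, 3, 4, 5, 6])]⟩,
  ⟨[1, 1, 1, 2, 2], 21, [
    (18032059549483265, [0, 0, 2, 3, 4, 4, 6]), (2287053039730945, [0, 0, 2, 3, 4, 5, 3]),
    (18023263456264705, [0, 1, 0, 3, 4, 3, 6]), (4538852853219841, [0, 1, 0, 3, 4, 5, 4]),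
    (18049617375658497, [0, 1, 1, 3, 3, 5, 6]), (9042452480655873, [0, 1, 1, 3, 4, 5, 5]),
    (18018865292509697, [0, 1, 2, 0, 4, 2, 6]), (598203062026753, [0, 1, 2, 0, 4, 5, 1]),
    (18049600095257089, [0, 1, 2, 1, 2, 5, 6]), (316728102093313, [0, 1, 2, 1, 4, 5, 0]),
    (18049591538876929, [0, 1, 2, 2, 1, 5, 6]), (18015566807958017, [0, 1, 2, 2, 4, 0, 6]),
    (18016601962185217, [0, 1, 2, 3, 0, 1, 6]), (1161088708379137, [0, 1, 2, 3, 0, 5, 2]),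
    (18015506745524737, [0, 1, 2, 3, 1, 0, 6]), (316676663149057, [0, 1, 2, 3, 2, 5, 0]),
    (9042418121048577, [0, 1, 2, 3, 3, 5, 5]), (1128167784055297, [0, 1, 2, 3, 4, 1, 2]),
    (567416853889537, [0, 1, 2, 3, 4, 2, 1]), (4512464574349825, [0, 1, 2, 3, 4, 3, 4]),
    (2269460853686785, [0, 1, 2, 3, 4, 4, 3])]⟩,
  ⟨[1, 1, 1, 4], 7, [
    (316728085315841, [0, 0, 2, 0, 4, 5, 0]), (18015502450557185, [0, 0, 2, 3, 0, 0, 6]),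
    (18015566757429761, [0, 1, 0, 0, 4, 0, 6]), (316663778050561, [0, 1, 0, 3, 0, 5, 0]),
    (18049591505191425, [0, 1, 1, 1, 1, 5, 6]), (565217830502913, [0, 1, 1, 3, 4, 1, 1]),
    (2260630400926209, [0, 1, 2, 3, 3, 3, 3])]⟩,
  ⟨[1, 2, 2, 2], 7, [
    (2269460853686529, [0, 0, 2, 3, 4, 4, 3]), (4512464574153217, [0, 1, 0, 3, 4, 3, 4]),
    (9042418120917505, [0, 1, 1, 3, 3, 5, 5]), (567416736449025, [0, 1, 2, 0, 4, 2, 1]),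
    (316676562485761, [0, 1, 2, 1, 2, 5, 0]), (18015506678415873, [0, 1, 2, 2, 1, 0, 6]),
    (1128103359545857, [0, 1, 2, 3, 0, 1, 2])]⟩,
  ⟨[1, 2, 4], 21, [
    (316676545708289, [0, 0, 2, 0, 2, 5, 0]), (285941759738113, [0, 0, 2, 0, 4, 2, 0]),
    (299135899271425, [0, 0, 2, 0, 4, 4, 0]), (18015502383448321, [0, 0, 2, 2, 0, 0, 6]),
    (1127003847917825, [0, 0, 2, 3, 0, 0, 2]), (2252903754760449, [0, 0, 2, 3, 0, 0, 3]),
    (2260630400925953, [0, 0, 2, 3, 3, 3, 3]), (18015506627887617, [0, 1, 0, 0, 1, 0, 6]),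
    (564118201369089, [0, 1, 0, 0, 4, 0, 1]), (4504767875318273, [0, 1, 0, 0, 4, 0, 4]),
    (316663677387265, [0, 1, 0, 1, 0, 5, 0]), (283678429217281, [0, 1, 0, 3, 0, 1, 0]),
    (290275498983937, [0, 1, 0, 3, 0, 3, 0]), (2260630400729601, [0, 1, 0, 3, 3, 3, 3]),
    (565217713062401, [0, 1, 1, 0, 4, 1, 1]), (18015506644730369, [0, 1, 1, 1, 1, 0, 6]),
    (316667972420097, [0, 1, 1, 1, 1, 5, 0]), (9042392250450433, [0, 1, 1, 1, 1, 5, 5]),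
    (565153405993473, [0, 1, 1, 3, 0, 1, 1]), (565183470764545, [0, 1, 1, 3, 3, 1, 1]),
    (2260630400795137, [0, 1, 1, 3, 3, 3, 3])]⟩,
  ⟨[1, 3, 3], 28, [
    (18023229096526081, [0, 0, 0, 3, 3, 3, 6]), (2287018679795969, [0, 0, 0, 3, 3, 5, 3]),
    (2260664760467713, [0, 0, 0, 3, 4, 3, 3]), (4521260667175169, [0, 0, 0, 3, 4, 4, 4]),
    (18018813752901889, [0, 0, 2, 0, 2, 2, 6]), (1161088641270017, [0, 0, 2, 2, 0, 5, 2]),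
    (1127068205318401, [0, 0, 2, 2, 4, 0, 2]), (285890337571073, [0, 0, 2, 3, 2, 2, 0]),
    (598142932288001, [0, 1, 0, 0, 1, 5, 1]), (18016601861325313, [0, 1, 0, 1, 0, 1, 6]),
    (283742753063425, [0, 1, 0, 1, 4, 1, 0]), (564058189267457, [0, 1, 0, 3, 1, 0, 1]),
    (18016601844613633, [0, 1, 1, 0, 0, 1, 6]), (598138637386241, [0, 1, 1, 0, 0, 5, 1]),
    (282643241501185, [0, 1, 1, 1, 4, 0, 0]), (282583212622337, [0, 1, 1, 3, 1, 0, 0]),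
    (565153288684033, [0, 1, 2, 0, 0, 1, 1]), (1130302265360897, [0, 1, 2, 0, 0, 2, 2]),
    (564058072023553, [0, 1, 2, 0, 1, 0, 1]), (285890220130817, [0, 1, 2, 0, 2, 2, 0]),
    (283678328750593, [0, 1, 2, 1, 0, 1, 0]), (282583112090113, [0, 1, 2, 1, 1, 0, 0]),
    (1128116143784449, [0, 1, 2, 1, 2, 1, 2]), (567365213618689, [0, 1, 2, 1, 2, 2, 1]),
    (1127003780809217, [0, 1, 2, 2, 0, 0, 2]), (1128107587404289, [0, 1, 2, 2, 1, 1, 2]),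
    (567356657238529, [0, 1, 2, 2, 1, 2, 1]), (282591735579137, [0, 1, 2, 2, 2, 0, 0])]⟩,
  ⟨[1, 6], 7, [
    (18015502332920065, [0, 0, 0, 0, 0, 0, 6]), (316663660609793, [0, 0, 0, 0, 0, 5, 0]),
    (282643224658177, [0, 0, 0, 0, 4, 0, 0]), (282578917589249, [0, 0, 0, 3, 0, 0, 0]),
    (282578800345345, [0, 0, 2, 0, 0, 0, 0]), (282578800148993, [0, 1, 0, 0, 0, 0, 0]),
    (565157600297473, [0, 1, 1, 1, 1, 1, 1])]⟩,
  ⟨[3, 4], 7, [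
    (2260630400729345, [0, 0, 0, 3, 3, 3, 3]), (285890220130561, [0, 0, 2, 0, 2, 2, 0]),
    (1127003780808961, [0, 0, 2, 2, 0, 0, 2]), (564058071826945, [0, 1, 0, 0, 1, 0, 1]),
    (283678328553985, [0, 1, 0, 1, 0, 1, 0]), (565153288552961, [0, 1, 1, 0, 0, 1, 1]),
    (282583111959041, [0, 1, 1, 1, 1, 0, 0])]⟩,
  ⟨[7], 1, [
    (282578800148737, [0, 0, 0, 0, 0, 0, 0])]⟩]

/-- The stabilizers in `PGL32` of functions. -/
def stabilizersPGL32 : List StabilizerType := [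
  ⟨1, 1, [1], [1, 0, 0, 0, 0, 0, 0, 0, 0]⟩,
  ⟨2, 2, [1, 1], [1, 1, 0, 0, 0, 0, 0, 0, 0]⟩,
  ⟨4, 4, [1, 1, 1, 1], [1, 3, 0, 1, 0, 0, 0, 0, 0]⟩,
  ⟨4, 4, [1, 1, 1, 1], [1, 3, 1, 0, 0, 0, 0, 0, 0]⟩,
  ⟨6, 3, [2, 1, 1], [1, 3, 0, 0, 0, 1, 0, 0, 0]⟩,
  ⟨8, 5, [2, 1, 1, 1, 1], [1, 5, 1, 1, 1, 0, 0, 0, 0]⟩,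
  ⟨24, 5, [3, 3, 2, 1, 1], [1, 9, 1, 3, 3, 4, 0, 1, 0]⟩,
  ⟨24, 5, [3, 3, 2, 1, 1], [1, 9, 3, 1, 3, 4, 1, 0, 0]⟩,
  ⟨168, 6, [8, 7, 6, 3, 3, 1], [1, 21, 7, 7, 21, 28, 7, 7, 1]⟩]

/-- The position of the point with the given homogeneous coordinates. -/
def planeIndex (x y z : ZMod 2) : Fin 7 := Fin.ofNat 7 (x.val + 2 * y.val + 4 * z.val - 1)

/-- Homogeneous coordinates of a point. -/
def planeCoord (i : Fin 7) : ZMod 2 × ZMod 2 × ZMod 2 :=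
  (((i + 1 : ℕ) : ZMod 2), (((i + 1) / 2 : ℕ) : ZMod 2), (((i + 1) / 4 : ℕ) : ZMod 2))

/-- The values of the action of a matrix with given rows. -/
def planeValues (a b c : ZMod 2 × ZMod 2 × ZMod 2) : List ℕ :=
  valueList fun i =>
    planeIndex (a.1 * (planeCoord i).1 + a.2.1 * (planeCoord i).2.1 + a.2.2 * (planeCoord i).2.2)
    (b.1 * (planeCoord i).1 + b.2.1 * (planeCoord i).2.1 + b.2.2 * (planeCoord i).2.2)
    (c.1 * (planeCoord i).1 + c.2.1 * (planeCoord i).2.1 + c.2.2 * (planeCoord i).2.2)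

/-- A row of the matrix that acts by a given list. -/
def rowOfValues (f : ZMod 2 × ZMod 2 × ZMod 2 → ZMod 2) (l : List ℕ) : ZMod 2 × ZMod 2 × ZMod 2 :=
  -- The points `0`, `1`, `3` are the three basis vectors. Over `𝔽_2` a point is a nonzero vector,
  -- so their images are the columns of the matrix.
  (f (planeCoord (ofValueList 7 l 0)), f (planeCoord (ofValueList 7 l 1)),
    f (planeCoord (ofValueList 7 l 3)))

/-- The determinant of the matrix with given rows. -/
def rowsDet (a b c : ZMod 2 × ZMod 2 × ZMod 2) : ZMod 2 :=
  a.1 * b.2.1 * c.2.2 - a.1 * b.2.2 * c.2.1 - a.2.1 * b.1 * c.2.2 + a.2.1 * b.2.2 * c.1 +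
    a.2.2 * b.1 * c.2.1 - a.2.2 * b.2.1 * c.1

theorem planeCoord_ne (i : Fin 7) :
    ![(planeCoord i).1, (planeCoord i).2.1, (planeCoord i).2.2] ≠ 0 := by
  have h : ∀ i : Fin 7, ¬ ((planeCoord i).1 = 0 ∧ (planeCoord i).2.1 = 0 ∧
    (planeCoord i).2.2 = 0) := by decide +kernel
  intro h0
  exact h i ⟨congrFun h0 0, congrFun h0 1, congrFun h0 2⟩

/-- A numbering of the points of the projective plane. -/
def planeEquiv : Plane2 ≃ Fin 7 where
  toFun := Projectivization.lift (fun v => planeIndex (v.1 0) (v.1 1) (v.1 2)) (by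
    rintro ⟨a, ha⟩ ⟨b, hb⟩ t h
    simp only at h
    subst h
    have ht : t ≠ 0 := fun h0 => ha (by rw [h0, zero_smul])
    have : ∀ t x y z : ZMod 2, t ≠ 0 →
        planeIndex (t * x) (t * y) (t * z) = planeIndex x y z := by decide +kernel
    exact this t (b 0) (b 1) (b 2) ht)
  invFun i := Projectivization.mk _ ![(planeCoord i).1, (planeCoord i).2.1, (planeCoord i).2.2]
    (planeCoord_ne i)
  left_inv p := by
    induction p using Projectivization.ind with
    | h v hv =>
      rw [Projectivization.lift_mk, Projectivization.mk_eq_mk_iff']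
      have : ∀ x y z : ZMod 2, ¬ (x = 0 ∧ y = 0 ∧ z = 0) →
          planeCoord (planeIndex x y z) = (x, y, z) := by
        decide +kernel
      have h1 := this (v 0) (v 1) (v 2) fun h => hv (by
        ext i; fin_cases i; exacts [h.1, h.2.1, h.2.2])
      refine ⟨1, ?_⟩
      rw [one_smul]
      ext i
      fin_cases i
      · exact (congrArg (fun p => p.1) h1).symm
      · exact (congrArg (fun p => p.2.1) h1).symm
      · exact (congrArg (fun p => p.2.2) h1).symm
  right_inv i := by
    rw [Projectivization.lift_mk]
    have : ∀ i : Fin 7, planeIndex (planeCoord i).1 (planeCoord i).2.1 (planeCoord i).2.2 = i := by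
      decide +kernel
    exact this i

theorem planeEquiv_mk (v : Fin 3 → ZMod 2) (hv : v ≠ 0) :
    planeEquiv (Projectivization.mk _ v hv) = planeIndex (v 0) (v 1) (v 2) := rfl

theorem valueList_actFin_PGL32 (g : GL (Fin 3) (ZMod 2)) :
    valueList (actFin planeEquiv (Matrix.ProjGenLinGroup.mk g : PGL32)) =
      planeValues (g.1 0 0, g.1 0 1, g.1 0 2) (g.1 1 0, g.1 1 1, g.1 1 2)
        (g.1 2 0, g.1 2 1, g.1 2 2) := by
  rw [planeValues]
  congr 1
  funext i
  change planeEquiv ((Matrix.ProjGenLinGroup.mk g : PGL32) •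
    Projectivization.mk _ _ (planeCoord_ne i)) = _
  rw [Projectivization.PGL.mk_smul_mk, planeEquiv_mk]
  have h : ∀ v : Fin 3 → ZMod 2, g • v = g.1.mulVec v := fun v => rfl
  simp [h, Matrix.mulVec, dotProduct, Fin.sum_univ_three]

/-- The only unit of `𝔽_2` is `1`, so matrices that agree on points agree on vectors. -/
instance faithfulSMul_PGL32 : FaithfulSMul PGL32 Plane2 where
  eq_of_smul_eq_smul {q r} h := by
    induction q using Matrix.ProjGenLinGroup.induction_on with | mk g =>
    induction r using Matrix.ProjGenLinGroup.induction_on with | mk k =>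
    congr 1
    have h1 : ∀ v : Fin 3 → ZMod 2, g.1.mulVec v = k.1.mulVec v := by
      intro v
      by_cases hv : v = 0
      · simp [hv]
      have h2 := h (Projectivization.mk _ v hv)
      rw [Projectivization.PGL.mk_smul_mk, Projectivization.PGL.mk_smul_mk,
        Projectivization.mk_eq_mk_iff] at h2
      obtain ⟨a, ha⟩ := h2
      have ha1 : a = 1 := Subsingleton.elim _ _
      rw [ha1, one_smul] at ha
      exact ha.symm
    exact Units.ext (Matrix.toLin'.injective (LinearMap.ext fun v => by
      rw [Matrix.toLin'_apply, Matrix.toLin'_apply]; exact h1 v))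

/-- For the harder inclusion, the matrix is read off from the images of the basis points; it is then
checked to be invertible and to act by the given permutation. -/
theorem isActionList_PGL32 : IsActionList PGL32 planeEquiv permsPGL32 := by
  have h1 : ∀ a b c d e f g h i : ZMod 2, rowsDet (a, b, c) (d, e, f) (g, h, i) ≠ 0 →
      planeValues (a, b, c) (d, e, f) (g, h, i) ∈ permsPGL32.map Prod.snd := by decide +kernel
  have h2 : ∀ l ∈ permsPGL32.map Prod.snd,
      planeValues (rowOfValues (fun p => p.1) l) (rowOfValues (fun p => p.2.1) l)
        (rowOfValues (fun p => p.2.2) l) = l ∧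
      rowsDet (rowOfValues (fun p => p.1) l) (rowOfValues (fun p => p.2.1) l)
        (rowOfValues (fun p => p.2.2) l) ≠ 0 := by decide +kernel
  refine ⟨by decide +kernel, by decide +kernel, fun l => ⟨fun hl => ?_, ?_⟩⟩
  · obtain ⟨h3, h4⟩ := h2 l hl
    set a := rowOfValues (fun p => p.1) l
    set b := rowOfValues (fun p => p.2.1) l
    set c := rowOfValues (fun p => p.2.2) l
    let M : Matrix (Fin 3) (Fin 3) (ZMod 2) := !![a.1, a.2.1, a.2.2; b.1, b.2.1, b.2.2;
      c.1, c.2.1, c.2.2]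
    have hM : M.det ≠ 0 := by
      rw [Matrix.det_fin_three]
      exact h4
    refine ⟨Matrix.ProjGenLinGroup.mk (Matrix.GeneralLinearGroup.mkOfDetNeZero M hM), ?_⟩
    rw [valueList_actFin_PGL32]
    exact h3
  · rintro ⟨q, rfl⟩
    induction q using Matrix.ProjGenLinGroup.induction_on with | mk g =>
    rw [valueList_actFin_PGL32]
    refine h1 _ _ _ _ _ _ _ _ _ ?_
    have h3 := g.det.ne_zero
    rw [Matrix.GeneralLinearGroup.val_det_apply, Matrix.det_fin_three] at h3
    exact h3

/-- The coefficients of the monomials for `PGL_3(𝔽_2)`, divided by the numbers of partitions. -/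
def coefficientsPGL32 {R : Type} [CommRing R] [Algebra ℚ R] (q : ℕ → R) : List R :=
  [(1 / 168 : ℚ) • q 168, (1 / 21 : ℚ) • ((1 / 2 : ℚ) • q 84 - (1 / 8 : ℚ) • q 168),
    (1 / 7 : ℚ) • ((2 / 3 : ℚ) • q 42 - (1 / 2 : ℚ) • q 84 + (1 / 12 : ℚ) • q 168),
    (1 / 7 : ℚ) • ((2 / 3 : ℚ) • q 42 - (1 / 2 : ℚ) • q 84 + (1 / 12 : ℚ) • q 168),
    (1 / 21 : ℚ) • (4 * q 21 - 3 * q 42 + (1 / 2 : ℚ) • q 84),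
    (1 / 28 : ℚ) • (2 * q 28 + q 56 - 2 * q 84 + (1 / 3 : ℚ) • q 168),
    (1 / 7 : ℚ) • (2 * q 7 + q 14 - 2 * q 21 - 2 * q 28 + (1 / 3 : ℚ) • q 42 - q 56 + 2 * q 84
      - (1 / 3 : ℚ) • q 168),
    (1 / 7 : ℚ) • (2 * q 7 + q 14 - 2 * q 21 - 2 * q 28 + (1 / 3 : ℚ) • q 42 - q 56 + 2 * q 84
      - (1 / 3 : ℚ) • q 168),
    1 + 2 * q 3 + q 6 - 3 * q 7 + q 8 - 2 * q 14 + 2 * q 28 + q 42 + q 56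
      - 2 * q 84 + (2 / 7 : ℚ) • q 168]

theorem familySum_PGL32 {R : Type} [CommRing R] [Algebra ℚ R] (z q : ℕ → R) :
    familySum z (coefficientsPGL32 q) partitionsPGL32 = rhsPGL32 z q := by
  simp only [familySum, coefficientsPGL32, partitionsPGL32, rhsPGL32, List.zipWith_cons_cons,
    List.sum_cons, List.map_cons, List.map_nil, List.prod_cons, List.prod_nil,
    List.zipWith_nil_left, List.sum_nil, Nat.cast_ofNat, Nat.cast_one]
  algebra

theorem inducedTerm_PGL32 {R : Type} [CommRing R] [Algebra ℚ R] (q : ℕ → R) (h1 : q 1 = 1)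
    (t : StabilizerType) (ht : t ∈ stabilizersPGL32) :
    inducedTerm q (168 / t.order) t.degrees = natDot (coefficientsPGL32 q) t.counts := by
  simp only [stabilizersPGL32, List.mem_cons, List.not_mem_nil, or_false] at ht
  rcases ht with rfl | rfl | rfl | rfl | rfl | rfl | rfl | rfl | rfl <;>
  · simp only [inducedTerm, coefficientsPGL32, natDot_cons, natDot_nil, List.map_cons, List.map_nil,
      List.sum_cons, List.sum_nil]
    norm_num [h1]
    try algebra

theorem tableCheck_PGL32 :
    tableCheck 7 permsPGL32 partitionsPGL32 (stabilizersPGL32.map StabilizerType.row) = true := by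
  decide +kernel

theorem card_PGL32 : Nat.card PGL32 = 168 := by
  rw [card_eq_length (φ := fun q : PGL32 => valueList (actFin planeEquiv q))
    (fun q r h => actFin_injective _ (valueList_injective h)) isActionList_PGL32.1
    isActionList_PGL32.2.2]
  decide +kernel

/-- The equation `c g c⁻¹ = g⁻¹` is equivalent to `g c g = c`, whose failure for every `c` can be
checked in the list of permutations. -/
theorem exists_not_isConj_inv_PGL32 : ∃ g : PGL32, ¬ IsConj g g⁻¹ := by
  have h : ∃ l ∈ permsPGL32.map Prod.snd, ∀ a ∈ permsPGL32.map Prod.snd,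
      compList l (compList a l) ≠ a := by decide +kernel
  obtain ⟨l, hl, h⟩ := h
  obtain ⟨g, rfl⟩ := (isActionList_PGL32.2.2 l).1 hl
  refine ⟨g, fun hg => ?_⟩
  obtain ⟨c, hc⟩ := isConj_iff.1 hg
  refine h _ ((isActionList_PGL32.2.2 _).2 ⟨c, rfl⟩) ?_
  rw [compList_valueList, compList_valueList, ← actFin_mul, ← actFin_mul]
  congr 2
  rw [mul_inv_eq_iff_eq_mul] at hc
  rw [hc, mul_inv_cancel_left]

theorem two_transitive_PGL32 (x y x' y' : Plane2) (h : x ≠ y) (h' : x' ≠ y') :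
    ∃ g : PGL32, g • x = x' ∧ g • y = y' := by
  have h2 : MulAction.IsMultiplyPretransitive (Matrix.SpecialLinearGroup (Fin 3) (ZMod 2))
    Plane2 2 := inferInstance
  rw [MulAction.is_two_pretransitive_iff] at h2
  obtain ⟨g, hg1, hg2⟩ := h2 h h'
  have key : ∀ p : Plane2, Matrix.SpecialLinearGroup.toPGL g • p = g • p := by
    intro p
    induction p using Projectivization.ind with
    | h v hv => rfl
  exact ⟨Matrix.SpecialLinearGroup.toPGL g, by rw [key, hg1], by rw [key, hg2]⟩

/-- Order and class number alone are not used to single out the degrees here. The two-transitive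
action on seven points provides the degree `6`, and an element not conjugate to its inverse forces a
repeated degree. Only one solution has both properties. -/
theorem hasDegrees_PGL32 (K : Subgroup PGL32) (hK : Nat.card K = 168)
    (hc : Nat.card {p : K × K // Commute p.1 p.2} = 6 * 168) : HasDegrees K [8, 7, 6, 3, 3, 1] := by
  have hfin : Finite PGL32 := Nat.finite_of_card_ne_zero (by rw [card_PGL32]; norm_num)
  have htop : K = ⊤ := Subgroup.eq_top_of_card_eq K (hK.trans card_PGL32.symm)
  -- The bound `12` suffices since `168 < 13²`.
  obtain ⟨l, hl, hdeg, hirr, hconj⟩ := exists_hasDegrees_mem K (b := 12) (by norm_num) hK hc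
  have := Fintype.ofEquiv _ planeEquiv.symm
  have h6 : 6 ∈ l := by
    obtain ⟨ρ, hρ⟩ := exists_isIrreducible_of_two_transitive (K := K) (X := Plane2) (n := 6)
      (by norm_num) (by rw [Fintype.card_congr planeEquiv]; rfl) (by
        intro x y x' y' h h'
        obtain ⟨g, hg⟩ := two_transitive_PGL32 x y x' y' h h'
        exact ⟨⟨g, htop ▸ Subgroup.mem_top g⟩, hg⟩)
    exact hirr 6 ρ hρ
  have hnd : ¬ l.Nodup := by
    intro h
    obtain ⟨g, hg⟩ := exists_not_isConj_inv_PGL32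
    have h1 := hconj h ⟨g, htop ▸ Subgroup.mem_top g⟩
    exact hg (MonoidHom.map_isConj K.subtype h1)
  have h8 : ∀ l ∈ (squareSums 6 168 12).filter (1 ∈ ·), 6 ∈ l → ¬ l.Nodup →
      l = [8, 7, 6, 3, 3, 1] := by decide +kernel
  exact h8 l hl h6 hnd ▸ hdeg

theorem rigid_and_formalZeta_PGL32 {H : Type u} [Group H] [TopologicalSpace H] (hH : Rigid H) :
    Rigid (PermWreath H PGL32 Plane2) ∧ formalZeta (PermWreath H PGL32 Plane2) =
      rhsPGL32 (fun k => dilate k (formalZeta H)) monoSeries := by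
  have hfin : Finite PGL32 := Nat.finite_of_card_ne_zero (by rw [card_PGL32]; norm_num)
  rw [← familySum_PGL32]
  refine rigid_and_formalZeta_eq (by norm_num) isActionList_PGL32 (by decide +kernel)
    (by decide +kernel) tableCheck_PGL32 ?_ _ ?_ hH
  · intro K t ht h1 h2
    simp only [stabilizersPGL32, List.mem_cons, List.not_mem_nil, or_false] at ht
    rcases ht with rfl | rfl | rfl | rfl | rfl | rfl | rfl | rfl | rfl
    on_goal 9 => exact hasDegrees_PGL32 K h1 h2
    all_goals
      exact hasDegrees_of_squareSums 8 (by norm_num) h1 h2 (by decide +kernel)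
  · rw [card_PGL32]
    exact inducedTerm_PGL32 _ monoSeries_one

end ProjectivePlane

/-! ### The formulas as lists of terms, and their values at points of convergence -/

section TermFormula

/-- The value `r · q n · ∏ z k` of a term `(r, n, [k, …])`. -/
def termValue {R : Type} [CommRing R] [Algebra ℚ R] (z q : ℕ → R) (t : ℚ × ℕ × List ℕ) : R :=
  t.1 • (q t.2.1 * (t.2.2.map z).prod)

/-- The value of a polynomial given by a list of terms. -/
def formulaValue {R : Type} [CommRing R] [Algebra ℚ R] (m : ℕ) (z q : ℕ → R)
    (T : List (ℚ × ℕ × List ℕ)) : R :=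
  -- The term with `n = 1` is kept apart. In all the listed terms `n ≥ 2`, and the recursion for the
  -- coefficients rests on this.
  z m + (T.map (termValue z q)).sum

theorem lseriesHasSum_monoSeries {n : ℕ} (hn : n ≠ 0) (s : ℂ) :
    LSeriesHasSum (monoSeries n) s ((n : ℂ) ^ (-s)) := by
  have h := hasSum_single (f := LSeries.term (monoSeries n) s) n (fun b hb => by
    rcases eq_or_ne b 0 with rfl | hb0
    · simp
    · rw [LSeries.term_of_ne_zero hb0, monoSeries_apply, if_neg (fun h => hb h.2), zero_div])
  rw [LSeries.term_of_ne_zero hn, monoSeries_apply, if_pos ⟨hn, rfl⟩, one_div,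
    ← Complex.cpow_neg] at h
  exact h

theorem term_dilate {k : ℕ} (hk : k ≠ 0) (f : ArithmeticFunction ℂ) (s : ℂ) (m : ℕ) :
    LSeries.term (dilate k f) s (m ^ k) = LSeries.term f (k * s) m := by
  rcases eq_or_ne m 0 with rfl | hm
  · simp [hk]
  · rw [LSeries.term_of_ne_zero (pow_ne_zero k hm), LSeries.term_of_ne_zero hm,
      dilate_pow_apply hk, Complex.natCast_cpow_natCast_mul]
    push_cast
    rfl

/-- The dilated series is supported on `k`-th powers, and its term at `m ^ k` is the term of `f` at
`m` for the argument `k s`. -/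
theorem lseriesHasSum_dilate {k : ℕ} (hk : k ≠ 0) {f : ArithmeticFunction ℂ} {s a : ℂ}
    (h : LSeriesHasSum f (k * s) a) : LSeriesHasSum (dilate k f) s a := by
  have h1 : LSeries.term f (k * s) = LSeries.term (dilate k f) s ∘ fun m => m ^ k :=
    funext fun m => (term_dilate hk f s m).symm
  rw [LSeriesHasSum, h1, (Nat.pow_left_injective hk).hasSum_iff] at h
  · exact h
  · intro n hn
    rcases eq_or_ne n 0 with rfl | hn0
    · simp
    · rw [LSeries.term_of_ne_zero hn0, dilate_apply_of_forall_ne f fun m hm => hn ⟨m, hm⟩, zero_div]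

theorem lseriesHasSum_rat_smul {f : ArithmeticFunction ℂ} {s a : ℂ} (h : LSeriesHasSum f s a)
    (r : ℚ) : LSeriesHasSum (r • f : ArithmeticFunction ℂ) s (r • a) := by
  have h1 : ((r • f : ArithmeticFunction ℂ) : ℕ → ℂ) = (r : ℂ) • (f : ℕ → ℂ) := by
    funext n
    rw [rat_smul_apply]
    rfl
  rw [h1, Rat.smul_def]
  exact h.smul (r : ℂ)

theorem lseriesHasSum_one (s : ℂ) : LSeriesHasSum (1 : ArithmeticFunction ℂ) s 1 := by
  have := lseriesHasSum_monoSeries one_ne_zero s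
  rwa [monoSeries_one, Nat.cast_one, Complex.one_cpow] at this

theorem lseriesHasSum_add {f g : ArithmeticFunction ℂ} {s a b : ℂ} (hf : LSeriesHasSum f s a)
    (hg : LSeriesHasSum g s b) : LSeriesHasSum (f + g : ArithmeticFunction ℂ) s (a + b) := by
  have h1 : ((f + g : ArithmeticFunction ℂ) : ℕ → ℂ) = (f : ℕ → ℂ) + g := rfl
  rw [h1]
  exact hf.add hg

theorem lseriesHasSum_termValue {f : ArithmeticFunction ℂ} {s : ℂ} {z : ℕ → ℂ}
    (hz : ∀ k : ℕ, k ≠ 0 → LSeriesHasSum f (k * s) (z k)) {t : ℚ × ℕ × List ℕ} (ht : t.2.1 ≠ 0)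
    (ht' : 0 ∉ t.2.2) :
    LSeriesHasSum (termValue (fun k => dilate k f) monoSeries t : ArithmeticFunction ℂ) s
      (termValue z (fun n => (n : ℂ) ^ (-s)) t) := by
  obtain ⟨r, n, l⟩ := t
  refine lseriesHasSum_rat_smul (ArithmeticFunction.LSeriesHasSum_mul
    (lseriesHasSum_monoSeries ht s) ?_) r
  change n ≠ 0 at ht
  simp only at ht'
  induction l with
  | nil => exact lseriesHasSum_one s
  | cons k l ih =>
    rw [List.mem_cons, not_or] at ht'
    exact ArithmeticFunction.LSeriesHasSum_mul
      (lseriesHasSum_dilate (Ne.symm ht'.1) (hz k (Ne.symm ht'.1))) (ih ht'.2)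

theorem lseriesHasSum_formulaValue {f : ArithmeticFunction ℂ} {s : ℂ} {z : ℕ → ℂ}
    (hz : ∀ k : ℕ, k ≠ 0 → LSeriesHasSum f (k * s) (z k)) {m : ℕ} (hm : m ≠ 0)
    {T : List (ℚ × ℕ × List ℕ)} (hT : ∀ t ∈ T, t.2.1 ≠ 0 ∧ 0 ∉ t.2.2) :
    LSeriesHasSum (formulaValue m (fun k => dilate k f) monoSeries T : ArithmeticFunction ℂ) s
      (formulaValue m z (fun n => (n : ℂ) ^ (-s)) T) := by
  refine lseriesHasSum_add (lseriesHasSum_dilate hm (hz m hm)) ?_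
  induction T with
  | nil =>
    have := lseriesHasSum_rat_smul (lseriesHasSum_one s) 0
    rwa [zero_smul, zero_smul] at this
  | cons t T ih =>
    exact lseriesHasSum_add (lseriesHasSum_termValue hz (hT t (by simp)).1 (hT t (by simp)).2)
      (ih fun u hu => hT u (by simp [hu]))

theorem formalZeta_eq_natCast (G : Type u) [Group G] [TopologicalSpace G] (n : ℕ) :
    ∃ k : ℕ, formalZeta G n = k := ⟨_, formalZeta_apply G n⟩

/-- For `Re s ≥ 0` this is comparison. For `Re s < 0` the terms are natural numbers times factors of
norm at least `1`; as they tend to zero, almost all coefficients vanish. -/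
theorem zetaConverges_natCast_mul {G : Type u} [Group G] [TopologicalSpace G] {s : ℂ}
    (h : ZetaConverges G s) {k : ℕ} (hk : k ≠ 0) : ZetaConverges G (k * s) := by
  rcases le_or_gt 0 s.re with hs | hs
  · refine LSeriesSummable.of_re_le_re ?_ h
    have h1 : (1 : ℝ) ≤ k := by exact_mod_cast Nat.one_le_iff_ne_zero.2 hk
    have h2 : ((k : ℂ) * s).re = k * s.re := by simp
    rw [h2]
    nlinarith
  · have h0 : ∀ᶠ n in Filter.atTop, ‖LSeries.term (formalZeta G) s n‖ < 1 :=
      h.tendsto_atTop_zero.norm.eventually_lt_const (by simp)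
    have h1 : (formalZeta G : ℕ → ℂ) =ᶠ[Filter.atTop] 0 := by
      filter_upwards [h0, Filter.eventually_ne_atTop 0] with n hn hn0
      obtain ⟨j, hj⟩ := formalZeta_eq_natCast G n
      rw [LSeries.norm_term_eq, if_neg hn0, hj, Complex.norm_natCast, div_lt_one (by positivity)] at hn
      have h2 : (n : ℝ) ^ s.re ≤ 1 := Real.rpow_le_one_of_one_le_of_nonpos
        (by exact_mod_cast Nat.one_le_iff_ne_zero.2 hn0) hs.le
      have h3 : j = 0 := by
        have : (j : ℝ) < 1 := hn.trans_le h2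
        exact_mod_cast Nat.lt_one_iff.1 (by exact_mod_cast this)
      rw [hj, h3]
      simp
    exact (LSeriesSummable_congr' _ h1).2 LSeriesSummable_zero

theorem converges_and_zeta_eq {G : Type u} [Group G] [TopologicalSpace G] {G' : Type v} [Group G']
    [TopologicalSpace G'] {m : ℕ} (hm : m ≠ 0) {T : List (ℚ × ℕ × List ℕ)}
    (hT : ∀ t ∈ T, t.2.1 ≠ 0 ∧ 0 ∉ t.2.2)
    (h : formalZeta G' = formulaValue m (fun k => dilate k (formalZeta G)) monoSeries T) {s : ℂ}
    (hs : ZetaConverges G s) : ZetaConverges G' s ∧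
      zeta G' s = formulaValue m (fun k => zeta G (k * s)) (fun n => (n : ℂ) ^ (-s)) T := by
  have h1 := lseriesHasSum_formulaValue (f := formalZeta G) (s := s) (z := fun k => zeta G (k * s))
    (fun k hk => (zetaConverges_natCast_mul hs hk).LSeriesHasSum) hm hT
  rw [← h] at h1
  exact ⟨h1.LSeriesSummable, h1.LSeries_eq⟩

/-- The terms of the formula for `A_5`. -/
def termsA5 : List (ℚ × ℕ × List ℕ) := [
    (1/60, 60, [1, 1, 1, 1, 1]), (3/2, 20, [1, 1, 3]), (-1/6, 60, [1, 1, 3]), (1, 30, [1, 2, 2]),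
    (-1/4, 60, [1, 2, 2]), (3, 5, [1, 4]), (1, 15, [1, 4]), (-3, 20, [1, 4]), (-1, 30, [1, 4]),
    (1/2, 60, [1, 4]), (2, 10, [2, 3]), (1, 20, [2, 3]), (-3/2, 20, [2, 3]), (-2, 30, [2, 3]),
    (1/2, 60, [2, 3]), (2, 3, [5]), (1, 4, [5]), (1, 5, [5]), (-3, 5, [5]), (-1, 15, [5]),
    (-2, 10, [5]), (-1, 20, [5]), (3, 20, [5]), (2, 30, [5]), (-3/5, 60, [5])]

/-- The terms of the formula for `PSL_2(𝔽_5)`. -/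
def termsPSL25 : List (ℚ × ℕ × List ℕ) := [
    (1/60, 60, [1, 1, 1, 1, 1, 1]), (1, 30, [1, 1, 2, 2]), (-1/4, 60, [1, 1, 2, 2]),
    (2, 6, [1, 5]), (2, 12, [1, 5]), (-2, 30, [1, 5]), (2/5, 60, [1, 5]), (4/3, 15, [2, 2, 2]),
    (-1, 30, [2, 2, 2]), (1/6, 60, [2, 2, 2]), (2, 10, [3, 3]), (1, 20, [3, 3]),
    (-2, 30, [3, 3]), (1/3, 60, [3, 3]), (2, 3, [6]), (1, 4, [6]), (1, 5, [6]), (-2, 6, [6]),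
    (-2, 10, [6]), (-2, 12, [6]), (-4/3, 15, [6]), (-1, 20, [6]), (4, 30, [6]), (-2/3, 60, [6])]

/-- The terms of the formula for `PGL_3(𝔽_2)`. -/
def termsPGL32 : List (ℚ × ℕ × List ℕ) := [
    (1/168, 168, [1, 1, 1, 1, 1, 1, 1]), (1/2, 84, [1, 1, 1, 2, 2]),
    (-1/8, 168, [1, 1, 1, 2, 2]), (2/3, 42, [1, 1, 1, 4]), (-1/2, 84, [1, 1, 1, 4]),
    (1/12, 168, [1, 1, 1, 4]), (2/3, 42, [1, 2, 2, 2]), (-1/2, 84, [1, 2, 2, 2]),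
    (1/12, 168, [1, 2, 2, 2]), (4, 21, [1, 2, 4]), (-3, 42, [1, 2, 4]), (1/2, 84, [1, 2, 4]),
    (2, 28, [1, 3, 3]), (1, 56, [1, 3, 3]), (-2, 84, [1, 3, 3]), (1/3, 168, [1, 3, 3]),
    (2, 7, [1, 6]), (1, 14, [1, 6]), (-2, 21, [1, 6]), (-2, 28, [1, 6]), (1/3, 42, [1, 6]),
    (-1, 56, [1, 6]), (2, 84, [1, 6]), (-1/3, 168, [1, 6]), (2, 7, [3, 4]), (1, 14, [3, 4]),
    (-2, 21, [3, 4]), (-2, 28, [3, 4]), (1/3, 42, [3, 4]), (-1, 56, [3, 4]), (2, 84, [3, 4]),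
    (-1/3, 168, [3, 4]), (2, 3, [7]), (1, 6, [7]), (-3, 7, [7]), (1, 8, [7]), (-2, 14, [7]),
    (2, 28, [7]), (1, 42, [7]), (1, 56, [7]), (-2, 84, [7]), (2/7, 168, [7])]

theorem rhsA5_eq {R : Type} [CommRing R] [Algebra ℚ R] (z q : ℕ → R)
    (h15 : q 15 = q 5 * q 3) (h20 : q 20 = q 10 * q 2) :
    rhsA5 z q = formulaValue 5 z q termsA5 := by
  simp only [rhsA5, formulaValue, termsA5, termValue, shift, List.map_cons, List.map_nil,
    List.sum_cons, List.sum_nil, List.prod_cons, List.prod_nil, h15, h20]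
  norm_num only [Nat.cast_ofNat]
  algebra

theorem rhsPSL25_eq {R : Type} [CommRing R] [Algebra ℚ R] (z q : ℕ → R) :
    rhsPSL25 z q = formulaValue 6 z q termsPSL25 := by
  simp only [rhsPSL25, formulaValue, termsPSL25, termValue, shift, List.map_cons, List.map_nil,
    List.sum_cons, List.sum_nil, List.prod_cons, List.prod_nil]
  norm_num only [Nat.cast_ofNat]
  algebra

theorem rhsPGL32_eq {R : Type} [CommRing R] [Algebra ℚ R] (z q : ℕ → R) :
    rhsPGL32 z q = formulaValue 7 z q termsPGL32 := by
  simp only [rhsPGL32, formulaValue, termsPGL32, termValue, List.map_cons, List.map_nil,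
    List.sum_cons, List.sum_nil, List.prod_cons, List.prod_nil]
  norm_num only [Nat.cast_ofNat]
  algebra

theorem rhsFunctionalEquation_eq {R : Type} [CommRing R] [Algebra ℚ R] (z q : ℕ → R) :
    rhsFunctionalEquation z q = rhsA5 z q := by
  simp only [rhsFunctionalEquation, rhsA5]
  ring

theorem cpow_neg_mul (a b : ℕ) (s : ℂ) :
    ((a * b : ℕ) : ℂ) ^ (-s) = (a : ℂ) ^ (-s) * (b : ℂ) ^ (-s) := by
  rw [Nat.cast_mul, Complex.natCast_mul_natCast_cpow]

end TermFormula

/-! ### Inflation of representations, and absence of small subgroups -/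

section Inflation

variable {G : Type u} {G' : Type v} [Group G] [TopologicalSpace G] [Group G'] [TopologicalSpace G']

theorem isIrreducible_comp_iff {V : Type w} [AddCommGroup V] [Module ℂ V] {p : G →* G'}
    (hp : Function.Surjective p) (ρ : Representation ℂ G' V) :
    Representation.IsIrreducible (ρ.comp p : Representation ℂ G V) ↔ ρ.IsIrreducible := by
  rw [isIrreducible_iff, isIrreducible_iff]
  refine and_congr Iff.rfl (forall_congr' fun U => imp_congr_left ?_)
  constructor
  · intro h g
    obtain ⟨g, rfl⟩ := hp g
    exact h g
  · exact fun h g => h (p g)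

/-- Inflation of irreducible representations along a continuous epimorphism. -/
def Irrep.inflate {p : G →* G'} (hp : Function.Surjective p) (hc : Continuous p) {n : ℕ}
    (E : Irrep G' n) : Irrep G n :=
  ⟨E.1.comp p, (isIrreducible_comp_iff hp E.1).2 E.2.1, fun v => (E.2.2 v).comp hc⟩

/-- Inflation of classes of irreducible representations along a continuous epimorphism. -/
def inflateClass {p : G →* G'} (hp : Function.Surjective p) (hc : Continuous p) (n : ℕ) :
    Quotient (irrepSetoid G' n) → Quotient (irrepSetoid G n) :=
  Quotient.map (Irrep.inflate hp hc) fun _ _ ⟨e⟩ =>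
    ⟨Representation.Equiv.mk e.toLinearEquiv fun g => e.isIntertwining' (p g)⟩

theorem inflateClass_injective {p : G →* G'} (hp : Function.Surjective p) (hc : Continuous p)
    (n : ℕ) : Function.Injective (inflateClass hp hc n) := by
  intro x y
  induction x using Quotient.inductionOn with | h E =>
  induction y using Quotient.inductionOn with | h F =>
  intro h
  obtain ⟨e⟩ := Quotient.exact h
  refine Quotient.sound ⟨Representation.Equiv.mk e.toLinearEquiv fun g => ?_⟩
  obtain ⟨g, rfl⟩ := hp g
  exact e.isIntertwining' g

/-- The identity `2(φ g - 1) = (φ(g²) - 1) - (φ g - 1)²` improves a bound `δ` valid on the whole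
group to `(δ + δ/2)/2 = 3δ/4`. Iteration gives zero. -/
theorem eq_one_of_norm_sub_one_le {R : Type*} [NormedRing R] [NormedAlgebra ℂ R] (φ : G →* R)
    (h : ∀ g, ‖φ g - 1‖ ≤ 1 / 2) (g : G) : φ g = 1 := by
  have key : ∀ (j : ℕ) (g : G), ‖φ g - 1‖ ≤ (3 / 4) ^ j * (1 / 2) := by
    intro j
    induction j with
    | zero => simpa using h
    | succ j ih =>
      intro g
      have h1 : (2 : ℂ) • (φ g - 1) = (φ (g * g) - 1) - (φ g - 1) * (φ g - 1) := by
        rw [map_mul, two_smul]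
        noncomm_ring
      have h2 : ‖(2 : ℂ) • (φ g - 1)‖ ≤ ‖φ (g * g) - 1‖ + ‖φ g - 1‖ * ‖φ g - 1‖ := by
        rw [h1]
        exact (norm_sub_le _ _).trans (add_le_add_right (norm_mul_le _ _) _)
      rw [norm_smul, Complex.norm_ofNat] at h2
      have h3 := ih (g * g)
      have h4 := ih g
      have h5 : ‖φ g - 1‖ * ‖φ g - 1‖ ≤ 1 / 2 * ((3 / 4) ^ j * (1 / 2)) :=
        mul_le_mul (h g) h4 (norm_nonneg _) (by norm_num)
      rw [pow_succ]
      linarith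
  have h6 : Filter.Tendsto (fun j : ℕ => (3 / 4 : ℝ) ^ j * (1 / 2)) Filter.atTop (nhds (0 * (1 / 2))) :=
    (tendsto_pow_atTop_nhds_zero_of_lt_one (by norm_num) (by norm_num)).mul_const _
  rw [zero_mul] at h6
  have h7 : ‖φ g - 1‖ ≤ 0 := ge_of_tendsto' h6 fun j => key j g
  exact sub_eq_zero.1 (norm_le_zero_iff.1 h7)

end Inflation

/-! ### The finite levels and the inverse limit -/

section Levels

variable {Q : Type u} {X : Type v} [Group Q] [MulAction Q X]

instance discreteTopology_permWreath {H : Type w} [Group H] [TopologicalSpace H]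
    [DiscreteTopology H]
    [Finite X] : DiscreteTopology (PermWreath H Q X) := by
  classical
  have := Fintype.ofFinite X
  refine discreteTopology_iff_isOpen_singleton.2 fun a => ?_
  obtain ⟨h1, h2⟩ := (continuous_wreath_iff (f := fun b : PermWreath H Q X => b)).1 continuous_id
  let _ : TopologicalSpace Q := ⊥
  have : DiscreteTopology Q := ⟨rfl⟩
  have h3 : {a} = PermWreath.base ⁻¹' {a.base} ∩ PermWreath.top ⁻¹' {a.top} := by
    ext b
    simp [PermWreath.ext_iff]
  rw [h3]
  exact ((isOpen_discrete _).preimage h1).inter ((isOpen_discrete _).preimage h2)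

instance finite_permWreath {H : Type w} [Finite H] [Finite Q] [Finite X] :
    Finite (PermWreath H Q X) :=
  Finite.of_injective (fun a => (a.base, a.top)) fun a b h => by
    rw [Prod.mk.injEq] at h
    exact PermWreath.ext h.1 h.2

instance finite_iterWreath [Finite Q] [Finite X] : ∀ k, Finite (IterWreath Q X k)
  | 0 => inferInstanceAs (Finite PUnit)
  | k + 1 =>
    have := finite_iterWreath k
    inferInstanceAs (Finite (PermWreath (IterWreath Q X k) Q X))

/-- The groups in the inverse system are discrete. -/
instance iterWreathTopology (k : ℕ) : TopologicalSpace (IterWreath Q X k) := ⊥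

instance (k : ℕ) : DiscreteTopology (IterWreath Q X k) := ⟨rfl⟩

theorem rigid_of_finite {G : Type w} [Group G] [Finite G] [TopologicalSpace G]
    [DiscreteTopology G] : Rigid G := by
  obtain ⟨l, hl, -⟩ := exists_hasDegrees G
  intro n _
  have := (hl n).1
  rw [← DiscreteTopology.eq_bot (α := G)] at this
  exact ENat.card_lt_top.2 this

/-- The level is discrete by definition, while the wreath product carries its own topology; for
finite `X` and a discrete base the two coincide. -/
theorem formalZeta_iterWreath_succ [Finite X] (k : ℕ) :
    formalZeta (IterWreath Q X (k + 1)) = formalZeta (PermWreath (IterWreath Q X k) Q X) := by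
  have h := DiscreteTopology.eq_bot (α := PermWreath (IterWreath Q X k) Q X)
  change @formalZeta (PermWreath (IterWreath Q X k) Q X) _ ⊥ = _
  rw [← h]

theorem permWreath_map_surjective {H : Type*} {H' : Type*} [Group H] [Group H'] {f : H →* H'}
    (hf : Function.Surjective f) :
    Function.Surjective (PermWreath.map (Q := Q) (X := X) f) := by
  intro a
  choose b hb using fun x => hf (a.base x)
  exact ⟨⟨b, a.top⟩, PermWreath.ext (funext hb) rfl⟩

theorem iterWreath_proj_surjective : ∀ k, Function.Surjective (IterWreath.proj Q X k)
  | 0 => fun _ => ⟨1, rfl⟩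
  | k + 1 => permWreath_map_surjective (iterWreath_proj_surjective k)

/-- The projection of the inverse limit. -/
def levelProj (Q : Type u) (X : Type v) [Group Q] [MulAction Q X] (k : ℕ) :
    ProfWreath Q X →* IterWreath Q X k :=
  (Pi.evalMonoidHom _ k).comp (ProfWreath Q X).subtype

theorem proj_levelProj (k : ℕ) (g : ProfWreath Q X) :
    IterWreath.proj Q X k (levelProj Q X (k + 1) g) = levelProj Q X k g := g.2 k

theorem continuous_levelProj (k : ℕ) : Continuous (levelProj Q X k) :=
  continuous_iff_le_induced.2 (iInf_le _ k)

/-- The family of elements that extends an element of a group in the inverse system, with trivial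
components in the deeper levels. -/
def extendLevel : ∀ k, IterWreath Q X k → ∀ j, IterWreath Q X j
  | _, _, 0 => PUnit.unit
  | 0, _, _ + 1 => 1
  | k + 1, g, j + 1 =>
    (⟨fun x => extendLevel k ((show PermWreath (IterWreath Q X k) Q X from g).base x) j,
      (show PermWreath (IterWreath Q X k) Q X from g).top⟩ : PermWreath (IterWreath Q X j) Q X)

theorem extendLevel_mul : ∀ (k : ℕ) (a b : IterWreath Q X k) (j : ℕ),
    extendLevel k (a * b) j = extendLevel k a j * extendLevel k b j
  | _, _, _, 0 => rfl
  | 0, _, _, _ + 1 => (one_mul _).symm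
  | k + 1, _, _, j + 1 => PermWreath.ext (funext fun _ => extendLevel_mul k _ _ j) rfl

theorem extendLevel_one (k j : ℕ) : extendLevel (Q := Q) (X := X) k 1 j = 1 := by
  have h := extendLevel_mul (Q := Q) (X := X) k 1 1 j
  rw [mul_one] at h
  exact left_eq_mul.1 h

theorem proj_extendLevel : ∀ (k : ℕ) (a : IterWreath Q X k) (j : ℕ),
    IterWreath.proj Q X j (extendLevel k a (j + 1)) = extendLevel k a j
  | 0, _, 0 => rfl
  | _ + 1, _, 0 => rfl
  | 0, _, _ + 1 => map_one _
  | k + 1, _, j + 1 => PermWreath.ext (funext fun _ => proj_extendLevel k _ j) rfl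

theorem extendLevel_self : ∀ (k : ℕ) (a : IterWreath Q X k), extendLevel k a k = a
  | 0, _ => rfl
  | k + 1, _ => PermWreath.ext (funext fun _ => extendLevel_self k _) rfl

/-- The homomorphic section of the projection of the inverse limit. -/
def levelSection (Q : Type u) (X : Type v) [Group Q] [MulAction Q X] (k : ℕ) :
    IterWreath Q X k →* ProfWreath Q X where
  toFun a := ⟨extendLevel k a, fun j => proj_extendLevel k a j⟩
  map_one' := Subtype.ext (funext fun j => extendLevel_one k j)
  map_mul' a b := Subtype.ext (funext fun j => extendLevel_mul k a b j)

theorem levelProj_levelSection (k : ℕ) (a : IterWreath Q X k) :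
    levelProj Q X k (levelSection Q X k a) = a := extendLevel_self k a

/-- The homomorphic section gives surjectivity without compactness; it also lets a representation
that is trivial on the kernel descend to the level. -/
theorem levelProj_surjective (k : ℕ) : Function.Surjective (levelProj Q X k) :=
  fun a => ⟨_, levelProj_levelSection k a⟩

theorem hasBasis_nhds_one_profWreath : (nhds (1 : ProfWreath Q X)).HasBasis (fun _ : ℕ => True)
    fun k => {g | levelProj Q X k g = 1} := by
  have h : nhds (1 : ProfWreath Q X) = ⨅ k, Filter.principal {g | levelProj Q X k g = 1} := by
    rw [nhds_iInf]
    refine iInf_congr fun k => ?_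
    let _ : TopologicalSpace (IterWreath Q X k) := ⊥
    rw [nhds_induced, nhds_discrete, Filter.comap_pure]
    rfl
  rw [h]
  refine Filter.hasBasis_iInf_principal ?_
  refine (antitone_nat_of_succ_le fun k g hg => ?_).directed_ge
  have h1 : levelProj Q X (k + 1) g = 1 := hg
  change levelProj Q X k g = 1
  rw [← proj_levelProj, h1, map_one]

/-- By continuity the kernel of some level is mapped into a ball of radius `1/2` around the
identity. Being a group, it is mapped to the identity, so the representation factors through that
level. -/
theorem exists_eq_inflate {n : ℕ} (E : Irrep (ProfWreath Q X) n) :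
    ∃ (k : ℕ) (F : Irrep (IterWreath Q X k) n),
      E = F.inflate (levelProj_surjective k) (continuous_levelProj k) := by
  let A : ProfWreath Q X →* ((Fin n → ℂ) →L[ℂ] (Fin n → ℂ)) :=
    { toFun := fun g => LinearMap.toContinuousLinearMap (E.1 g)
      map_one' := by ext; simp
      map_mul' := fun a b => by ext; simp }
  have hA : Continuous A := continuous_clm_apply.2 E.2.2
  have hU : {g | ‖A g - 1‖ < 1 / 2} ∈ nhds (1 : ProfWreath Q X) := by
    refine (isOpen_lt (hA.sub continuous_const).norm continuous_const).mem_nhds ?_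
    simp
  obtain ⟨k, -, hk⟩ := hasBasis_nhds_one_profWreath.mem_iff.1 hU
  have hker : ∀ g, levelProj Q X k g = 1 → E.1 g = 1 := by
    intro g hg
    have h1 := eq_one_of_norm_sub_one_le (A.comp (levelProj Q X k).ker.subtype)
      (fun g => (hk g.2).le) ⟨g, hg⟩
    exact LinearMap.ext fun v => congrArg (fun B => B v) h1
  have h2 : E.1 = (E.1.comp (levelSection Q X k)).comp (levelProj Q X k) := by
    ext1 g
    have h3 := hker (g * (levelSection Q X k (levelProj Q X k g))⁻¹) (by
      rw [map_mul, map_inv, levelProj_levelSection, mul_inv_cancel])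
    have h4 : g = g * (levelSection Q X k (levelProj Q X k g))⁻¹ *
      levelSection Q X k (levelProj Q X k g) := by group
    conv_lhs => rw [h4, map_mul, h3, one_mul]
    rfl
  refine ⟨k, ⟨E.1.comp (levelSection Q X k), ?_, fun v => continuous_of_discreteTopology⟩,
    Subtype.ext h2⟩
  rw [← isIrreducible_comp_iff (levelProj_surjective (Q := Q) (X := X) k)]
  exact h2 ▸ E.2.1

end Levels

/-! ### The formula determines each coefficient from the preceding ones -/

section Recursion

theorem EqUpTo.mono {N M : ℕ} {f g : ArithmeticFunction ℂ} (h : EqUpTo N f g) (hM : M ≤ N) :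
    EqUpTo M f g := fun n hn => h n (hn.trans hM)

/-- The coefficient at `n ≤ N + 1` involves only the one at `n / j`, and this argument is at most
`N` because `j ≥ 2`. -/
theorem EqUpTo.monoSeries_mul_succ {N j : ℕ} {f g : ArithmeticFunction ℂ} (h : EqUpTo N f g)
    (hj : 2 ≤ j) : EqUpTo (N + 1) (monoSeries j * f) (monoSeries j * g) := fun n hn => by
  rw [ArithmeticFunction.mul_apply, ArithmeticFunction.mul_apply]
  refine Finset.sum_congr rfl fun x hx => ?_
  have hd := Nat.mem_divisorsAntidiagonal.1 hx
  rw [monoSeries_apply]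
  split_ifs with h1
  · rw [h x.2]
    have h2 : x.2 ≠ 0 := fun h0 => hd.2 (by rw [← hd.1, h0, mul_zero])
    have h3 : 2 * x.2 ≤ n := by
      rw [← hd.1]
      exact Nat.mul_le_mul_right _ (h1.2 ▸ hj)
    omega
  · simp

/-- If `i ^ m ≤ N + 1` with `m ≥ 2`, then `i ≤ N`; the case `i = 1` is where `N ≥ 1` is needed. -/
theorem EqUpTo.dilate_succ {N m : ℕ} {f g : ArithmeticFunction ℂ} (h : EqUpTo N f g)
    (hm : 2 ≤ m) (hN : 1 ≤ N) : EqUpTo (N + 1) (RepZeta.dilate m f) (RepZeta.dilate m g) := by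
  intro n hn
  rw [dilate_apply, dilate_apply]
  refine Finset.sum_congr rfl fun i hi => h i ?_
  have h1 := (Finset.mem_filter.1 hi).2
  rcases Nat.lt_or_ge i 2 with h2 | h2
  · omega
  · have h3 : i ^ 2 ≤ n := h1 ▸ Nat.pow_le_pow_right (by omega) hm
    nlinarith

theorem EqUpTo.rat_smul {N : ℕ} {f g : ArithmeticFunction ℂ} (h : EqUpTo N f g) (r : ℚ) :
    EqUpTo N (r • f) (r • g) := fun n hn => by
  rw [rat_smul_apply, rat_smul_apply, h n hn]

theorem EqUpTo.termValue_of_mul {N : ℕ} {f g : ArithmeticFunction ℂ} (t : ℚ × ℕ × List ℕ)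
    (h : EqUpTo N (monoSeries t.2.1 * (t.2.2.map fun k => RepZeta.dilate k f).prod)
      (monoSeries t.2.1 * (t.2.2.map fun k => RepZeta.dilate k g).prod)) :
    EqUpTo N (termValue (fun k => RepZeta.dilate k f) monoSeries t)
      (termValue (fun k => RepZeta.dilate k g) monoSeries t) := by
  rw [termValue, termValue]
  exact h.rat_smul t.1

theorem EqUpTo.termValue_succ {N : ℕ} {f g : ArithmeticFunction ℂ} (h : EqUpTo N f g)
    (t : ℚ × ℕ × List ℕ) (ht : 2 ≤ t.2.1) :
    EqUpTo (N + 1) (termValue (fun k => RepZeta.dilate k f) monoSeries t)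
      (termValue (fun k => RepZeta.dilate k g) monoSeries t) := by
  have h2 : EqUpTo N (t.2.2.map fun k => RepZeta.dilate k f).prod
    (t.2.2.map fun k => RepZeta.dilate k g).prod := EqUpTo.list_prod t.2.2 fun k _ => h.dilate
  have h3 := h2.monoSeries_mul_succ ht
  exact EqUpTo.termValue_of_mul t h3

theorem EqUpTo.sum_termValue_succ {N : ℕ} {f g : ArithmeticFunction ℂ} (h : EqUpTo N f g)
    {T : List (ℚ × ℕ × List ℕ)} (hT : ∀ t ∈ T, 2 ≤ t.2.1) :
    EqUpTo (N + 1) (T.map (termValue (fun k => RepZeta.dilate k f) monoSeries)).sum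
      (T.map (termValue (fun k => RepZeta.dilate k g) monoSeries)).sum := by
  induction T with
  | nil =>
    rw [List.map_nil, List.map_nil]
    exact .refl _ _
  | cons t T ih =>
    intro n hn
    have h1 := h.termValue_succ t (hT t (by simp)) n hn
    have h2 := ih (fun u hu => hT u (by simp [hu])) n hn
    rw [List.map_cons, List.sum_cons, List.map_cons, List.sum_cons, ArithmeticFunction.add_apply,
      ArithmeticFunction.add_apply, h1, h2]

/-- The coefficients of the formula are determined by the preceding coefficients. -/
theorem EqUpTo.formulaValue_succ {N m : ℕ} {f g : ArithmeticFunction ℂ} (h : EqUpTo N f g)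
    (hm : 2 ≤ m) (hN : 1 ≤ N) {T : List (ℚ × ℕ × List ℕ)} (hT : ∀ t ∈ T, 2 ≤ t.2.1) :
    EqUpTo (N + 1) (formulaValue m (fun k => RepZeta.dilate k f) monoSeries T)
      (formulaValue m (fun k => RepZeta.dilate k g) monoSeries T) := by
  rw [formulaValue, formulaValue]
  exact (h.dilate_succ hm hN).add (h.sum_termValue_succ hT)

/-- Only the dilated term reaches the coefficient at `1`. This starts the recursion. -/
theorem formulaValue_apply_one {m : ℕ} (hm : m ≠ 0) (f : ArithmeticFunction ℂ)
    {T : List (ℚ × ℕ × List ℕ)} (hT : ∀ t ∈ T, 2 ≤ t.2.1) :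
    formulaValue m (fun k => RepZeta.dilate k f) monoSeries T 1 = f 1 := by
  have h1 : (RepZeta.dilate m f) 1 = f 1 := by
    simpa using dilate_pow_apply hm f 1
  have h2 : (T.map (termValue (fun k => RepZeta.dilate k f) monoSeries)).sum 1 = 0 := by
    induction T with
    | nil => rfl
    | cons t T ih =>
      rw [List.map_cons, List.sum_cons, ArithmeticFunction.add_apply,
        ih fun u hu => hT u (by simp [hu]), add_zero, termValue, rat_smul_apply,
        ArithmeticFunction.mul_apply_one, monoSeries_apply, if_neg, zero_mul, mul_zero]
      have := hT t (by simp)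
      omega
  rw [formulaValue, ArithmeticFunction.add_apply, h1, h2, add_zero]

end Recursion

/-! ### Stabilization of the coefficients and the functional equation of the limit -/

section Limit

variable {Q X : Type} [Group Q] [MulAction Q X] [Finite Q] [Finite X] {m : ℕ}
  {T : List (ℚ × ℕ × List ℕ)}

theorem formalZeta_subsingleton_one {G : Type u} [Group G] [TopologicalSpace G] [Subsingleton G] :
    formalZeta G 1 = 1 := by
  obtain ⟨l, hl, -, -, h3, -, h5, -⟩ := exists_hasDegrees G
  have h0 : ‹TopologicalSpace G› = ⊥ := Subsingleton.elim _ _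
  have hc : Nat.card (ConjClasses G) = 1 := by
    have h6 : Subsingleton (ConjClasses G) :=
      Function.Surjective.subsingleton ConjClasses.mk_surjective
    exact Nat.card_of_subsingleton (ConjClasses.mk 1)
  rw [hc] at h3
  obtain ⟨a, rfl⟩ := List.length_eq_one_iff.1 h3
  have h1 : a = 1 := by simpa [eq_comm] using h5
  subst h1
  have h2 : Nat.card (Quotient (@irrepSetoid G _ ⊥ 1)) = 1 := (hl 1).2
  subst h0
  rw [formalZeta_apply, h2, Nat.cast_one]

/-- The formula for the wreath products with finite groups. -/
def WreathFormula (Q X : Type) [Group Q] [MulAction Q X] (m : ℕ) (T : List (ℚ × ℕ × List ℕ)) :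
    Prop :=
  ∀ (H : Type) [Group H] [TopologicalSpace H], Rigid H →
    formalZeta (PermWreath H Q X) = formulaValue m (fun k => dilate k (formalZeta H)) monoSeries T

theorem formalZeta_iterWreath (hW : WreathFormula Q X m T) (k : ℕ) :
    formalZeta (IterWreath Q X (k + 1)) =
      formulaValue m (fun j => dilate j (formalZeta (IterWreath Q X k))) monoSeries T := by
  rw [formalZeta_iterWreath_succ, hW _ rigid_of_finite]

theorem formalZeta_iterWreath_apply_one (hW : WreathFormula Q X m T) (hm : 2 ≤ m)
    (hT : ∀ t ∈ T, 2 ≤ t.2.1) (k : ℕ) : formalZeta (IterWreath Q X k) 1 = 1 := by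
  induction k with
  | zero =>
    have : Subsingleton (IterWreath Q X 0) := (inferInstance : Subsingleton PUnit)
    exact formalZeta_subsingleton_one
  | succ k ih => rw [formalZeta_iterWreath hW, formulaValue_apply_one (by omega) _ hT, ih]

/-- At every level the first coefficient is `1`, and each application of the formula gains one more
coefficient. -/
theorem eqUpTo_iterWreath (hW : WreathFormula Q X m T) (hm : 2 ≤ m) (hT : ∀ t ∈ T, 2 ≤ t.2.1)
    (n k : ℕ) (hk : n ≤ k) :
    EqUpTo (n + 1) (formalZeta (IterWreath Q X k)) (formalZeta (IterWreath Q X (k + 1))) := by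
  induction n generalizing k with
  | zero =>
    intro j hj
    interval_cases j
    · simp
    · rw [formalZeta_iterWreath_apply_one hW hm hT, formalZeta_iterWreath_apply_one hW hm hT]
  | succ n ih =>
    obtain ⟨k, rfl⟩ : ∃ j, k = j + 1 := ⟨k - 1, by omega⟩
    rw [formalZeta_iterWreath hW, formalZeta_iterWreath hW (k + 1)]
    exact (ih k (by omega)).formulaValue_succ hm (by omega) hT

theorem finite_irrep_classes {G : Type u} [Group G] [Finite G] [TopologicalSpace G]
    [DiscreteTopology G] (n : ℕ) : Finite (Quotient (irrepSetoid G n)) := by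
  obtain ⟨l, hl, -⟩ := exists_hasDegrees G
  have := (hl n).1
  rwa [← DiscreteTopology.eq_bot (α := G)] at this

/-- The classes inflated from the levels form an increasing sequence of finite sets that exhausts
all classes. From level `n` on they have the same number of elements, hence are equal. -/
theorem inflateClass_bijective (hW : WreathFormula Q X m T) (hm : 2 ≤ m)
    (hT : ∀ t ∈ T, 2 ≤ t.2.1) (n : ℕ) :
    Function.Bijective (inflateClass (levelProj_surjective (Q := Q) (X := X) n)
      (continuous_levelProj n) n) := by
  refine ⟨inflateClass_injective _ _ n, fun x => ?_⟩
  let I : ∀ k, Quotient (irrepSetoid (IterWreath Q X k) n) →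
      Quotient (irrepSetoid (ProfWreath Q X) n) := fun k =>
    inflateClass (levelProj_surjective k) (continuous_levelProj k) n
  have hI : ∀ k, Function.Injective (I k) := fun k => inflateClass_injective _ _ n
  have hsub : ∀ k, Set.range (I k) ⊆ Set.range (I (k + 1)) := by
    rintro k _ ⟨y, rfl⟩
    refine ⟨inflateClass (iterWreath_proj_surjective k) continuous_of_discreteTopology n y, ?_⟩
    induction y using Quotient.inductionOn with | h E =>
    refine congrArg (Quotient.mk _) (Subtype.ext ?_)
    ext1 g
    exact congrArg E.1 (proj_levelProj k g)
  have hfin : ∀ k, Finite (Quotient (irrepSetoid (IterWreath Q X k) n)) :=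
    fun k => finite_irrep_classes n
  have heq : ∀ k, n ≤ k → Set.range (I k) = Set.range (I (k + 1)) := by
    intro k hk
    refine Set.eq_of_subset_of_ncard_le (hsub k) ?_ (Set.finite_range _)
    have h1 := eqUpTo_iterWreath hW hm hT n k hk n (by omega)
    rw [formalZeta_apply, formalZeta_apply, Nat.cast_inj] at h1
    rw [← Nat.card_coe_set_eq, ← Nat.card_coe_set_eq, Nat.card_range_of_injective (hI _),
      Nat.card_range_of_injective (hI _), h1]
  have hconst : ∀ j, Set.range (I (n + j)) = Set.range (I n) := by
    intro j
    induction j with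
    | zero => rfl
    | succ j ih => rw [← ih, ← add_assoc, ← heq (n + j) (by omega)]
  have hmono : ∀ k j, Set.range (I k) ⊆ Set.range (I (j + k)) := by
    intro k j
    induction j with
    | zero => rw [Nat.zero_add]
    | succ j ih => rw [Nat.add_right_comm]; exact ih.trans (hsub _)
  have hx : ∃ k, x ∈ Set.range (I k) := by
    induction x using Quotient.inductionOn with | h E =>
    obtain ⟨k, F, hF⟩ := exists_eq_inflate E
    exact ⟨k, Quotient.mk _ F, congrArg (Quotient.mk _) hF.symm⟩
  obtain ⟨k, hk⟩ := hx
  have := hmono k n hk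
  rw [hconst] at this
  exact this

theorem formalZeta_profWreath_apply (hW : WreathFormula Q X m T) (hm : 2 ≤ m)
    (hT : ∀ t ∈ T, 2 ≤ t.2.1) {n k : ℕ} (hk : n ≤ k) :
    formalZeta (ProfWreath Q X) n = formalZeta (IterWreath Q X k) n := by
  induction k, hk using Nat.le_induction with
  | base =>
    rw [formalZeta_apply, formalZeta_apply,
      Nat.card_congr (Equiv.ofBijective _ (inflateClass_bijective hW hm hT n))]
  | succ k hk ih => rw [ih, eqUpTo_iterWreath hW hm hT n k hk n (by omega)]

theorem rigid_profWreath (hW : WreathFormula Q X m T) (hm : 2 ≤ m) (hT : ∀ t ∈ T, 2 ≤ t.2.1) :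
    Rigid (ProfWreath Q X) := by
  intro n _
  have : Finite (Quotient (irrepSetoid (IterWreath Q X n) n)) := finite_irrep_classes n
  exact ENat.card_lt_top.2
    (Finite.of_equiv _ (Equiv.ofBijective _ (inflateClass_bijective hW hm hT n)))

/-- Up to any bound the limit agrees with two consecutive deep levels, which are related by the
formula. -/
theorem formalZeta_profWreath (hW : WreathFormula Q X m T) (hm : 2 ≤ m)
    (hT : ∀ t ∈ T, 2 ≤ t.2.1) : formalZeta (ProfWreath Q X) =
      formulaValue m (fun k => dilate k (formalZeta (ProfWreath Q X))) monoSeries T := by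
  refine eq_of_forall_eqUpTo fun N => ?_
  have h1 : EqUpTo (N + 1) (formalZeta (IterWreath Q X (N + 1))) (formalZeta (ProfWreath Q X)) :=
    fun n hn => (formalZeta_profWreath_apply hW hm hT hn).symm
  have h2 : EqUpTo (N + 1) (formalZeta (ProfWreath Q X)) (formalZeta (IterWreath Q X (N + 2))) :=
    fun n hn => formalZeta_profWreath_apply hW hm hT (by omega)
  refine (h2.trans ?_).mono (Nat.le_succ N)
  rw [formalZeta_iterWreath hW (N + 1)]
  exact (h1.formulaValue_succ hm (by omega) hT).mono (by omega)

end Limit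

/-! ### Estimates for partial sums -/

section PartialNorm

/-- The partial sum `∑_{n ≤ N} |f(n)| n^{-s}`. -/
noncomputable def partialNorm (s : ℝ) (N : ℕ) (f : ArithmeticFunction ℂ) : ℝ :=
  ∑ n ∈ Finset.Icc 1 N, ‖f n‖ * (n : ℝ) ^ (-s)

theorem rpow_natCast_nonneg (n : ℕ) (s : ℝ) : 0 ≤ (n : ℝ) ^ s := Real.rpow_nonneg n.cast_nonneg s

theorem partialNorm_nonneg (s : ℝ) (N : ℕ) (f : ArithmeticFunction ℂ) : 0 ≤ partialNorm s N f :=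
  Finset.sum_nonneg fun n _ => mul_nonneg (norm_nonneg _) (rpow_natCast_nonneg n _)

theorem partialNorm_congr {s : ℝ} {N : ℕ} {f g : ArithmeticFunction ℂ} (h : EqUpTo N f g) :
    partialNorm s N f = partialNorm s N g :=
  Finset.sum_congr rfl fun n hn => by rw [h n (Finset.mem_Icc.1 hn).2]

theorem partialNorm_add_le (s : ℝ) (N : ℕ) (f g : ArithmeticFunction ℂ) :
    partialNorm s N (f + g) ≤ partialNorm s N f + partialNorm s N g := by
  rw [partialNorm, partialNorm, partialNorm, ← Finset.sum_add_distrib]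
  refine Finset.sum_le_sum fun n _ => ?_
  rw [ArithmeticFunction.add_apply, ← add_mul]
  exact mul_le_mul_of_nonneg_right (norm_add_le _ _) (rpow_natCast_nonneg n _)

theorem partialNorm_rat_smul (s : ℝ) (N : ℕ) (r : ℚ) (f : ArithmeticFunction ℂ) :
    partialNorm s N (r • f) = |(r : ℝ)| * partialNorm s N f := by
  rw [partialNorm, partialNorm, Finset.mul_sum]
  refine Finset.sum_congr rfl fun n _ => ?_
  have h : ‖(r : ℂ)‖ = |(r : ℝ)| := by
    rw [← Complex.ofReal_ratCast, Complex.norm_real, Real.norm_eq_abs]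
  rw [rat_smul_apply, norm_mul, h, mul_assoc]

theorem partialNorm_mul_le (s : ℝ) (N : ℕ) (f g : ArithmeticFunction ℂ) :
    partialNorm s N (f * g) ≤ partialNorm s N f * partialNorm s N g := by
  let F : ℕ × ℕ → ℝ := fun p => (‖f p.1‖ * (p.1 : ℝ) ^ (-s)) * (‖g p.2‖ * (p.2 : ℝ) ^ (-s))
  have hF : ∀ p, 0 ≤ F p := fun p => mul_nonneg
    (mul_nonneg (norm_nonneg _) (rpow_natCast_nonneg _ _))
    (mul_nonneg (norm_nonneg _) (rpow_natCast_nonneg _ _))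
  have h1 : ∀ n ∈ Finset.Icc 1 N, ‖(f * g) n‖ * (n : ℝ) ^ (-s) ≤
      ∑ p ∈ (Finset.Icc 1 N ×ˢ Finset.Icc 1 N).filter (fun p => p.1 * p.2 = n), F p := by
    intro n hn
    rw [Finset.mem_Icc] at hn
    have h2 : n.divisorsAntidiagonal ⊆
        (Finset.Icc 1 N ×ˢ Finset.Icc 1 N).filter (fun p => p.1 * p.2 = n) := by
      intro p hp
      obtain ⟨hp1, hp2⟩ := Nat.mem_divisorsAntidiagonal.1 hp
      rw [Finset.mem_filter, Finset.mem_product, Finset.mem_Icc, Finset.mem_Icc]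
      have h3 : p.1 ≠ 0 := fun h => hp2 (by rw [← hp1, h, zero_mul])
      have h4 : p.2 ≠ 0 := fun h => hp2 (by rw [← hp1, h, mul_zero])
      have h5 : p.1 ≤ n := Nat.le_of_dvd (by omega) ⟨p.2, hp1.symm⟩
      have h6 : p.2 ≤ n := Nat.le_of_dvd (by omega) ⟨p.1, by rw [mul_comm, hp1]⟩
      exact ⟨⟨⟨by omega, by omega⟩, ⟨by omega, by omega⟩⟩, hp1⟩
    refine le_trans ?_ (Finset.sum_le_sum_of_subset_of_nonneg h2 fun p _ _ => hF p)
    rw [ArithmeticFunction.mul_apply]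
    refine (mul_le_mul_of_nonneg_right (norm_sum_le _ _) (rpow_natCast_nonneg n _)).trans ?_
    rw [Finset.sum_mul]
    refine Finset.sum_le_sum fun p hp => le_of_eq ?_
    obtain ⟨hp1, -⟩ := Nat.mem_divisorsAntidiagonal.1 hp
    rw [← hp1, norm_mul, Nat.cast_mul, Real.mul_rpow p.1.cast_nonneg p.2.cast_nonneg]
    ring
  refine (Finset.sum_le_sum h1).trans ?_
  have h2 : partialNorm s N f * partialNorm s N g =
      ∑ p ∈ Finset.Icc 1 N ×ˢ Finset.Icc 1 N, F p := by
    rw [partialNorm, partialNorm, Finset.sum_mul_sum, Finset.sum_product]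
  rw [h2, Finset.sum_fiberwise_eq_sum_filter]
  exact Finset.sum_le_sum_of_subset_of_nonneg (Finset.filter_subset _ _) fun p _ _ => hF p

theorem partialNorm_monoSeries_le (s : ℝ) (N j : ℕ) :
    partialNorm s N (monoSeries j) ≤ (j : ℝ) ^ (-s) := by
  have h1 : ∀ n ∈ Finset.Icc 1 N, ‖monoSeries j n‖ * (n : ℝ) ^ (-s) ≤
      if n = j then (j : ℝ) ^ (-s) else 0 := by
    intro n _
    rw [monoSeries_apply]
    by_cases h : n = j
    · subst h
      rw [if_pos rfl]
      split_ifs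
      · simp
      · simpa using rpow_natCast_nonneg n (-s)
    · rw [if_neg (fun h' => h h'.2), if_neg h]
      simp
  refine (Finset.sum_le_sum h1).trans ?_
  rw [Finset.sum_ite_eq']
  split_ifs
  · exact le_rfl
  · exact rpow_natCast_nonneg j _

theorem partialNorm_list_prod_le {s : ℝ} {N : ℕ} {B : ℝ} {z : ℕ → ArithmeticFunction ℂ}
    (l : List ℕ) (hz : ∀ k ∈ l, partialNorm s N (z k) ≤ B) (hB : 0 ≤ B) :
    partialNorm s N (l.map z).prod ≤ B ^ l.length := by
  induction l with
  | nil =>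
    rw [List.map_nil, List.prod_nil, List.length_nil, pow_zero, ← monoSeries_one]
    simpa using partialNorm_monoSeries_le s N 1
  | cons k l ih =>
    rw [List.map_cons, List.prod_cons, List.length_cons, pow_succ']
    exact (partialNorm_mul_le s N _ _).trans (mul_le_mul (hz k (by simp))
      (ih fun i hi => hz i (by simp [hi])) (partialNorm_nonneg _ _ _) hB)

theorem partialNorm_dilate_le_sum (s : ℝ) (N : ℕ) {k : ℕ} (hk : k ≠ 0) (f : ArithmeticFunction ℂ) :
    partialNorm s N (dilate k f) ≤ ∑ i ∈ Finset.Icc 1 N, ‖f i‖ * ((i ^ k : ℕ) : ℝ) ^ (-s) := by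
  classical
  let F : ℕ → ℝ := fun n => ‖dilate k f n‖ * (n : ℝ) ^ (-s)
  have hF : ∀ n, 0 ≤ F n := fun n => mul_nonneg (norm_nonneg _) (rpow_natCast_nonneg _ _)
  have h1 : ∑ i ∈ Finset.Icc 1 N, ‖f i‖ * ((i ^ k : ℕ) : ℝ) ^ (-s) =
      ∑ n ∈ (Finset.Icc 1 N).image (fun i => i ^ k), F n := by
    rw [Finset.sum_image fun i _ j _ h => Nat.pow_left_injective hk h]
    refine Finset.sum_congr rfl fun i _ => ?_
    simp only [F, dilate_pow_apply hk]
  rw [h1]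
  have h2 : partialNorm s N (dilate k f) = ∑ n ∈ (Finset.Icc 1 N).filter (fun n => F n ≠ 0), F n :=
    (Finset.sum_filter_ne_zero _).symm
  rw [h2]
  refine Finset.sum_le_sum_of_subset_of_nonneg ?_ fun n _ _ => hF n
  intro n hn
  rw [Finset.mem_filter, Finset.mem_Icc] at hn
  obtain ⟨⟨hn1, hnN⟩, hn0⟩ := hn
  by_cases h : ∃ i, i ^ k = n
  · obtain ⟨i, rfl⟩ := h
    refine Finset.mem_image.2 ⟨i, Finset.mem_Icc.2 ⟨?_, ?_⟩, rfl⟩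
    · rw [Nat.one_le_iff_ne_zero]
      rintro rfl
      rw [zero_pow hk] at hn1
      omega
    · exact (Nat.le_self_pow hk i).trans hnN
  · refine absurd ?_ hn0
    simp only [F]
    rw [dilate_apply_of_forall_ne _ fun i hi => h ⟨i, hi⟩, norm_zero, zero_mul]

theorem partialNorm_dilate_le {s : ℝ} (hs : 0 ≤ s) (N : ℕ) {k : ℕ} (hk : k ≠ 0)
    (f : ArithmeticFunction ℂ) : partialNorm s N (dilate k f) ≤ partialNorm s N f := by
  refine (partialNorm_dilate_le_sum s N hk f).trans (Finset.sum_le_sum fun i hi => ?_)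
  have hi1 : 1 ≤ i := (Finset.mem_Icc.1 hi).1
  refine mul_le_mul_of_nonneg_left ?_ (norm_nonneg _)
  refine Real.rpow_le_rpow_of_nonpos (by exact_mod_cast hi1) ?_ (by linarith)
  exact_mod_cast Nat.le_self_pow hk i

/-- The index `1` contributes `‖f 1‖`. For `i ≥ 2` one has `i ^ m ≥ 2 i`, which produces the small
factor `2 ^ (-s)`. -/
theorem partialNorm_dilate_le' {s : ℝ} (hs : 0 ≤ s) (N : ℕ) {m : ℕ} (hm : 2 ≤ m)
    (f : ArithmeticFunction ℂ) :
    partialNorm s N (dilate m f) ≤ ‖f 1‖ + 2 ^ (-s) * partialNorm s N f := by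
  refine (partialNorm_dilate_le_sum s N (by omega) f).trans ?_
  have h1 : ∀ i ∈ Finset.Icc 1 N, ‖f i‖ * ((i ^ m : ℕ) : ℝ) ^ (-s) ≤
      (if i = 1 then ‖f 1‖ else 0) + 2 ^ (-s) * (‖f i‖ * (i : ℝ) ^ (-s)) := by
    intro i hi
    have hi1 : 1 ≤ i := (Finset.mem_Icc.1 hi).1
    have h2 : 0 ≤ (2 : ℝ) ^ (-s) * (‖f i‖ * (i : ℝ) ^ (-s)) :=
      mul_nonneg (Real.rpow_nonneg zero_le_two _)
        (mul_nonneg (norm_nonneg _) (rpow_natCast_nonneg _ _))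
    split_ifs with h
    · subst h
      simp only [one_pow, Nat.cast_one, Real.one_rpow, mul_one] at h2 ⊢
      linarith
    · have h3 : 2 * i ≤ i ^ m :=
        calc 2 * i ≤ i * i := Nat.mul_le_mul_right _ (by omega)
          _ = i ^ 2 := (sq i).symm
          _ ≤ i ^ m := Nat.pow_le_pow_right hi1 hm
      have h4 : ((i ^ m : ℕ) : ℝ) ^ (-s) ≤ 2 ^ (-s) * (i : ℝ) ^ (-s) := by
        rw [← Real.mul_rpow zero_le_two i.cast_nonneg]
        refine Real.rpow_le_rpow_of_nonpos (by positivity) (by exact_mod_cast h3) (by linarith)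
      calc ‖f i‖ * ((i ^ m : ℕ) : ℝ) ^ (-s) ≤ ‖f i‖ * (2 ^ (-s) * (i : ℝ) ^ (-s)) :=
            mul_le_mul_of_nonneg_left h4 (norm_nonneg _)
        _ = 0 + 2 ^ (-s) * (‖f i‖ * (i : ℝ) ^ (-s)) := by ring
  refine (Finset.sum_le_sum h1).trans ?_
  rw [Finset.sum_add_distrib, ← Finset.mul_sum, Finset.sum_ite_eq']
  refine add_le_add ?_ le_rfl
  split_ifs
  · exact le_rfl
  · exact norm_nonneg _

/-- The polynomial with the first coefficients of a formal Dirichlet series. -/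
def truncate (N : ℕ) (f : ArithmeticFunction ℂ) : ArithmeticFunction ℂ :=
  ⟨fun n => if n ≤ N then f n else 0, by simp⟩

theorem truncate_apply (N : ℕ) (f : ArithmeticFunction ℂ) (n : ℕ) :
    truncate N f n = if n ≤ N then f n else 0 := rfl

theorem partialNorm_truncate_le (s : ℝ) (N M : ℕ) (f : ArithmeticFunction ℂ) :
    partialNorm s M (truncate N f) ≤ partialNorm s N f := by
  have h1 : ∀ n ∈ Finset.Icc 1 M, ‖truncate N f n‖ * (n : ℝ) ^ (-s) =
      if n ≤ N then ‖f n‖ * (n : ℝ) ^ (-s) else 0 := by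
    intro n _
    rw [truncate_apply]
    split_ifs <;> simp
  rw [partialNorm, Finset.sum_congr rfl h1, ← Finset.sum_filter]
  refine Finset.sum_le_sum_of_subset_of_nonneg ?_ fun n _ _ =>
    mul_nonneg (norm_nonneg _) (rpow_natCast_nonneg _ _)
  intro n hn
  simp only [Finset.mem_filter, Finset.mem_Icc] at hn ⊢
  omega

/-- A bound for the terms of a formula, if the variables are at most `B`. -/
noncomputable def termsBound (T : List (ℚ × ℕ × List ℕ)) (B : ℝ) : ℝ :=
  (T.map fun t => |(t.1 : ℝ)| * B ^ t.2.2.length).sum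

theorem termsBound_nonneg (T : List (ℚ × ℕ × List ℕ)) {B : ℝ} (hB : 0 ≤ B) : 0 ≤ termsBound T B :=
  List.sum_nonneg fun x hx => by
    obtain ⟨t, -, rfl⟩ := List.mem_map.1 hx
    positivity

/-- Each term contains some `n ^ (-s)` with `n ≥ 2`, and dilation does not increase the partial
norm. -/
theorem partialNorm_sum_termValue_le {s : ℝ} (hs : 0 ≤ s) {N : ℕ} {f : ArithmeticFunction ℂ}
    {B : ℝ} (hB : 0 ≤ B) (hf : partialNorm s N f ≤ B) {T : List (ℚ × ℕ × List ℕ)}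
    (hT : ∀ t ∈ T, 2 ≤ t.2.1 ∧ 0 ∉ t.2.2) :
    partialNorm s N (T.map (termValue (fun k => dilate k f) monoSeries)).sum ≤
      2 ^ (-s) * termsBound T B := by
  induction T with
  | nil =>
    rw [List.map_nil, List.sum_nil]
    simp [partialNorm, termsBound]
  | cons t T ih =>
    have h1 := ih fun u hu => hT u (by simp [hu])
    rw [List.map_cons, List.sum_cons]
    have h2 : termsBound (t :: T) B = |(t.1 : ℝ)| * B ^ t.2.2.length + termsBound T B := by
      simp [termsBound]
    rw [h2, mul_add]
    refine (partialNorm_add_le s N _ _).trans (add_le_add ?_ h1)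
    obtain ⟨ht1, ht2⟩ := hT t (by simp)
    rw [termValue, partialNorm_rat_smul, mul_left_comm]
    refine mul_le_mul_of_nonneg_left ?_ (abs_nonneg _)
    refine (partialNorm_mul_le s N _ _).trans ?_
    refine mul_le_mul ((partialNorm_monoSeries_le s N _).trans ?_)
      (partialNorm_list_prod_le _ (fun k hk => (partialNorm_dilate_le hs N
        (fun h0 => ht2 (h0 ▸ hk)) f).trans hf) hB) (partialNorm_nonneg _ _ _)
      (Real.rpow_nonneg zero_le_two _)
    exact Real.rpow_le_rpow_of_nonpos zero_lt_two (by exact_mod_cast ht1) (by linarith)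

end PartialNorm

/-! ### Convergence far to the right, and boundedness at real points -/

section Abscissa

variable {f : ArithmeticFunction ℂ} {m : ℕ} {T : List (ℚ × ℕ × List ℕ)}

/-- The next coefficient is computed from the truncated series. If its partial norm is at most `2`,
the new one is at most `1 + 2 ^ (-s) * (2 + termsBound T 2) ≤ 2`. -/
theorem partialNorm_le_two (hf : f = formulaValue m (fun k => dilate k f) monoSeries T)
    (hf1 : f 1 = 1) (hm : 2 ≤ m) (hT : ∀ t ∈ T, 2 ≤ t.2.1 ∧ 0 ∉ t.2.2) {s : ℝ} (hs : 0 ≤ s)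
    (hs2 : 2 ^ (-s) * (2 + termsBound T 2) ≤ 1) (N : ℕ) : partialNorm s (N + 1) f ≤ 2 := by
  induction N with
  | zero => simp [partialNorm, hf1]
  | succ N ih =>
    have h0 : EqUpTo (N + 1) f (truncate (N + 1) f) := fun n hn => by
      rw [truncate_apply, if_pos hn]
    have h1 := h0.formulaValue_succ hm (by omega) fun t ht => (hT t ht).1
    rw [← hf] at h1
    rw [partialNorm_congr h1]
    set g := truncate (N + 1) f with hg
    have h2 : partialNorm s (N + 1 + 1) g ≤ 2 := (partialNorm_truncate_le s _ _ f).trans ih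
    have h3 := partialNorm_sum_termValue_le hs zero_le_two h2 hT
    have h4 := partialNorm_dilate_le' hs (N + 1 + 1) hm g
    have h5 : g 1 = 1 := by rw [hg, truncate_apply, if_pos (by omega), hf1]
    rw [h5, norm_one] at h4
    rw [formulaValue]
    refine (partialNorm_add_le s _ _ _).trans ((add_le_add h4 h3).trans ?_)
    have h6 : (0 : ℝ) ≤ 2 ^ (-s) := Real.rpow_nonneg zero_le_two _
    nlinarith

theorem exists_lseriesSummable (hf : f = formulaValue m (fun k => dilate k f) monoSeries T)
    (hf1 : f 1 = 1) (hm : 2 ≤ m) (hT : ∀ t ∈ T, 2 ≤ t.2.1 ∧ 0 ∉ t.2.2) :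
    ∃ s : ℝ, LSeriesSummable f s := by
  have h1 : Filter.Tendsto (fun j : ℕ => ((1 / 2 : ℝ)) ^ j * (2 + termsBound T 2)) Filter.atTop
      (nhds (0 * (2 + termsBound T 2))) :=
    (tendsto_pow_atTop_nhds_zero_of_lt_one (by norm_num) (by norm_num)).mul_const _
  rw [zero_mul] at h1
  obtain ⟨j, hj⟩ := (h1.eventually_lt_const one_pos).exists
  have hj2 : (2 : ℝ) ^ (-(j : ℝ)) = (1 / 2) ^ j := by
    rw [Real.rpow_neg zero_le_two, Real.rpow_natCast, one_div, inv_pow]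
  refine ⟨j, ?_⟩
  rw [LSeriesSummable, ← summable_norm_iff]
  refine summable_of_sum_range_le (c := 2) (fun n => norm_nonneg _) fun n => ?_
  have h2 := partialNorm_le_two hf hf1 hm hT (s := j) (by positivity) (by rw [hj2]; exact hj.le) n
  refine le_trans ?_ h2
  rw [partialNorm]
  have h3 : ∑ i ∈ Finset.range n, ‖LSeries.term f ((j : ℝ) : ℂ) i‖ ≤
      ∑ i ∈ Finset.range (n + 2), ‖LSeries.term f ((j : ℝ) : ℂ) i‖ :=
    Finset.sum_le_sum_of_subset_of_nonneg (Finset.range_mono (by omega)) fun i _ _ => norm_nonneg _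
  refine h3.trans (le_of_eq ?_)
  rw [Finset.sum_range_succ', LSeries.term_zero, norm_zero, add_zero, Finset.range_eq_Ico,
    ← Finset.Ico_add_one_right_eq_Icc, Finset.sum_Ico_eq_sum_range, Finset.sum_Ico_eq_sum_range]
  refine Finset.sum_congr rfl fun i _ => ?_
  rw [LSeries.norm_term_eq, if_neg (by omega), Nat.zero_add, Nat.add_comm 1 i, Complex.ofReal_re,
    Real.rpow_neg (Nat.cast_nonneg _), div_eq_mul_inv]

theorem norm_sum_termValue_le {z q : ℕ → ℂ} {B : ℝ} (hz : ∀ k ≠ 0, ‖z k‖ ≤ B)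
    (hq : ∀ n ≠ 0, ‖q n‖ ≤ 1) (hB : 0 ≤ B) (hT : ∀ t ∈ T, 2 ≤ t.2.1 ∧ 0 ∉ t.2.2) :
    ‖(T.map (termValue z q)).sum‖ ≤ termsBound T B := by
  induction T with
  | nil => simp [termsBound]
  | cons t T ih =>
    have h1 := ih fun u hu => hT u (by simp [hu])
    have h2 : termsBound (t :: T) B = |(t.1 : ℝ)| * B ^ t.2.2.length + termsBound T B := by
      simp [termsBound]
    rw [List.map_cons, List.sum_cons, h2]
    refine (norm_add_le _ _).trans (add_le_add ?_ h1)
    obtain ⟨ht1, ht2⟩ := hT t (by simp)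
    have h : ‖(t.1 : ℂ)‖ = |(t.1 : ℝ)| := by
      rw [← Complex.ofReal_ratCast, Complex.norm_real, Real.norm_eq_abs]
    rw [termValue, Rat.smul_def, norm_mul, h, norm_mul]
    refine mul_le_mul_of_nonneg_left ?_ (abs_nonneg _)
    have h3 : ∀ l : List ℕ, 0 ∉ l → ‖(l.map z).prod‖ ≤ B ^ l.length := by
      intro l hl
      induction l with
      | nil => simp
      | cons k l ih =>
        rw [List.mem_cons, not_or] at hl
        rw [List.map_cons, List.prod_cons, List.length_cons, pow_succ', norm_mul]
        exact mul_le_mul (hz k (Ne.symm hl.1)) (ih hl.2) (norm_nonneg _) hB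
    calc ‖q t.2.1‖ * ‖(t.2.2.map z).prod‖ ≤ 1 * B ^ t.2.2.length :=
          mul_le_mul (hq _ (by omega)) (h3 _ ht2) (norm_nonneg _) zero_le_one
      _ = B ^ t.2.2.length := one_mul _

theorem termsBound_le_mul_pow {B : ℝ} (hB : 1 ≤ B) (hl : ∀ t ∈ T, t.2.2.length + 1 ≤ m) :
    termsBound T B ≤ termsBound T 1 * B ^ (m - 1) := by
  induction T with
  | nil => simp [termsBound]
  | cons t T ih =>
    have h1 := ih fun u hu => hl u (by simp [hu])
    have h2 : ∀ B : ℝ, termsBound (t :: T) B = |(t.1 : ℝ)| * B ^ t.2.2.length + termsBound T B := by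
      intro B
      simp [termsBound]
    rw [h2, h2, one_pow, mul_one, add_mul]
    have h3 := hl t (by simp)
    exact add_le_add (mul_le_mul_of_nonneg_left (pow_le_pow_right₀ hB (by omega)) (abs_nonneg _)) h1

theorem lseries_term_eq_norm {f : ℕ → ℂ} (hnat : ∀ n, ∃ k : ℕ, f n = k) (s : ℝ) (n : ℕ) :
    LSeries.term f s n = ((‖LSeries.term f s n‖ : ℝ) : ℂ) := by
  rcases eq_or_ne n 0 with rfl | hn
  · simp
  · obtain ⟨k, hk⟩ := hnat n
    rw [LSeries.norm_term_eq, if_neg hn, LSeries.term_of_ne_zero hn, hk, Complex.norm_natCast,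
      Complex.ofReal_re]
    push_cast
    rw [Complex.ofReal_cpow n.cast_nonneg]
    simp

theorem sum_norm_term_le_norm_lseries (hnat : ∀ n, ∃ k : ℕ, f n = k) {s : ℝ}
    (hs : LSeriesSummable f s) (S : Finset ℕ) :
    ∑ n ∈ S, ‖LSeries.term f s n‖ ≤ ‖LSeries f s‖ := by
  have h1 : LSeries f s = ((∑' n, ‖LSeries.term f s n‖ : ℝ) : ℂ) := by
    rw [LSeries, Complex.ofReal_tsum]
    exact tsum_congr (lseries_term_eq_norm hnat s)
  rw [h1, Complex.norm_real, Real.norm_of_nonneg (tsum_nonneg fun n => norm_nonneg _)]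
  exact hs.norm.sum_le_tsum S fun n _ => norm_nonneg _

theorem norm_lseries_natCast_mul_le (hnat : ∀ n, ∃ k : ℕ, f n = k) {s : ℝ}
    (hs0 : 0 ≤ s) (hs : LSeriesSummable f s) {k : ℕ} (hk : k ≠ 0) :
    LSeriesSummable f (k * s) ∧ ‖LSeries f (k * s)‖ ≤ ‖LSeries f s‖ := by
  have h1 : (s : ℂ).re ≤ ((k : ℂ) * s).re := by
    have : (1 : ℝ) ≤ k := by exact_mod_cast Nat.one_le_iff_ne_zero.2 hk
    rw [Complex.ofReal_re, ← Complex.ofReal_natCast, ← Complex.ofReal_mul, Complex.ofReal_re]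
    nlinarith
  have h2 : LSeriesSummable f (k * s) := hs.of_re_le_re h1
  refine ⟨h2, ?_⟩
  refine (norm_tsum_le_tsum_norm h2.norm).trans ?_
  refine (h2.norm.tsum_le_tsum (fun n => LSeries.norm_term_le_of_re_le_re f h1 n) hs.norm).trans ?_
  exact hs.norm.tsum_le_of_sum_le fun S => sum_norm_term_le_norm_lseries hnat hs S

theorem lseries_eq_of_eq_formulaValue_cons {r : ℚ} {j : ℕ}
    (hf : f = formulaValue m (fun k => dilate k f) monoSeries ((r, j, List.replicate m 1) :: T))
    (hm : m ≠ 0) (hj : j ≠ 0) (hT : ∀ t ∈ T, 2 ≤ t.2.1 ∧ 0 ∉ t.2.2) {s : ℂ}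
    (hs : ∀ k : ℕ, k ≠ 0 → LSeriesSummable f (k * s)) :
    LSeries f s = LSeries f (m * s) + (r * ((j : ℂ) ^ (-s) * LSeries f s ^ m) +
      (T.map (termValue (fun k => LSeries f (k * s)) (fun n : ℕ => (n : ℂ) ^ (-s)))).sum) := by
  have hT' : ∀ t ∈ (r, j, List.replicate m 1) :: T, t.2.1 ≠ 0 ∧ 0 ∉ t.2.2 := by
    intro t ht
    rcases List.mem_cons.1 ht with rfl | ht
    · exact ⟨hj, fun h => absurd (List.eq_of_mem_replicate h) zero_ne_one⟩
    · exact ⟨fun h => absurd (hT t ht).1 (by omega), (hT t ht).2⟩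
  have h1 := (lseriesHasSum_formulaValue (f := f) (s := s) (z := fun k => LSeries f (k * s))
    (fun k hk => (hs k hk).LSeriesHasSum) hm hT').LSeries_eq
  rw [← hf, formulaValue, List.map_cons, List.sum_cons] at h1
  have h4 : termValue (fun k => LSeries f (k * s)) (fun n : ℕ => (n : ℂ) ^ (-s))
      (r, j, List.replicate m 1) = r * ((j : ℂ) ^ (-s) * LSeries f s ^ m) := by
    rw [termValue, Rat.smul_def]
    dsimp only
    rw [List.map_replicate, List.prod_replicate, Nat.cast_one, one_mul]
  rw [h4] at h1
  exact h1

/-- At real points of convergence the value is bounded. -/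
theorem norm_lseries_le (hnat : ∀ n, ∃ k : ℕ, f n = k) (hf1 : f 1 = 1) {r : ℚ} (hr : 0 < r) {j : ℕ}
    (hf : f = formulaValue m (fun k => dilate k f) monoSeries ((r, j, List.replicate m 1) :: T))
    (hm : 2 ≤ m) (hj : 2 ≤ j) (hT : ∀ t ∈ T, 2 ≤ t.2.1 ∧ 0 ∉ t.2.2)
    (hl : ∀ t ∈ T, t.2.2.length + 1 ≤ m) {s : ℝ} (hs0 : 0 ≤ s) (hs : LSeriesSummable f s) :
    ‖LSeries f s‖ ≤ (2 + termsBound T 1) * (j : ℝ) ^ s / r := by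
  have h1 := lseries_eq_of_eq_formulaValue_cons hf (by omega) (by omega) hT
    fun k hk => (norm_lseries_natCast_mul_le hnat hs0 hs hk).1
  obtain ⟨x, hx⟩ : ∃ x, ‖LSeries f s‖ = x := ⟨_, rfl⟩
  rw [hx]
  have hz : ∀ k : ℕ, k ≠ 0 → ‖LSeries f (k * s)‖ ≤ x := fun k hk => hx ▸
    (norm_lseries_natCast_mul_le hnat hs0 hs hk).2
  have hx1 : 1 ≤ x := by
    have := sum_norm_term_le_norm_lseries hnat hs {1}
    rw [← hx]
    simpa [LSeries.term_of_ne_zero, hf1] using this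
  have hq : ∀ n : ℕ, n ≠ 0 → ‖(n : ℂ) ^ (-(s : ℂ))‖ = (n : ℝ) ^ (-s) := fun n hn => by
    rw [← Complex.ofReal_neg, Complex.norm_natCast_cpow_of_pos (Nat.pos_of_ne_zero hn),
      Complex.ofReal_re]
  have hq1 : ∀ n : ℕ, n ≠ 0 → ‖(n : ℂ) ^ (-(s : ℂ))‖ ≤ 1 := fun n hn => by
    rw [hq n hn]
    exact Real.rpow_le_one_of_one_le_of_nonpos
      (by exact_mod_cast Nat.one_le_iff_ne_zero.2 hn) (by linarith)
  have h2 := norm_sum_termValue_le (T := T) (q := fun n : ℕ => (n : ℂ) ^ (-(s : ℂ))) hz hq1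
    (by linarith) hT
  have h3 := h2.trans (termsBound_le_mul_pow hx1 hl)
  have hrn : ‖(r : ℂ)‖ = r := by
    rw [← Complex.ofReal_ratCast, Complex.norm_real, Real.norm_eq_abs, abs_of_pos]
    exact_mod_cast hr
  -- The term of degree `m` is isolated. All values at `k s` are bounded by `x`, so everything else
  -- has degree at most `m - 1` in `x`; this bounds `x`.
  have h5 : (r : ℝ) * ((j : ℝ) ^ (-s) * x ^ m) ≤ x + x + termsBound T 1 * x ^ (m - 1) := by
    have h6 : ‖(r : ℂ) * ((j : ℂ) ^ (-(s : ℂ)) * LSeries f s ^ m)‖ =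
        r * ((j : ℝ) ^ (-s) * x ^ m) := by
      rw [norm_mul, norm_mul, norm_pow, hrn, hq j (by omega), hx]
    rw [← h6]
    have h7 : (r : ℂ) * ((j : ℂ) ^ (-(s : ℂ)) * LSeries f s ^ m) =
        LSeries f s - LSeries f (m * s) - (T.map (termValue (fun k => LSeries f (k * s))
          (fun n : ℕ => (n : ℂ) ^ (-(s : ℂ))))).sum := by
      linear_combination (-1 : ℂ) * h1
    rw [h7]
    refine (norm_sub_le _ _).trans (add_le_add ((norm_sub_le _ _).trans
      (add_le_add hx.le (hz m (by omega)))) h3)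
  have h8 : x ≤ x ^ (m - 1) := le_self_pow₀ hx1 (by omega)
  have h9 : x ^ m = x ^ (m - 1) * x := by rw [← pow_succ]; congr 1; omega
  have hxm : 0 < x ^ (m - 1) := by positivity
  have hj0 : (0 : ℝ) < j := by exact_mod_cast (by omega : 0 < j)
  have h10 : (r : ℝ) * ((j : ℝ) ^ (-s) * x) ≤ 2 + termsBound T 1 := by
    refine le_of_mul_le_mul_right ?_ hxm
    calc (r : ℝ) * ((j : ℝ) ^ (-s) * x) * x ^ (m - 1) = r * ((j : ℝ) ^ (-s) * x ^ m) := by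
          rw [h9]; ring
      _ ≤ x + x + termsBound T 1 * x ^ (m - 1) := h5
      _ ≤ (2 + termsBound T 1) * x ^ (m - 1) := by linarith
  have hr' : (0 : ℝ) < r := by exact_mod_cast hr
  rw [le_div_iff₀ hr']
  rw [Real.rpow_neg hj0.le] at h10
  have hjs : 0 < (j : ℝ) ^ s := Real.rpow_pos_of_pos hj0 s
  calc x * r = (r * (((j : ℝ) ^ s)⁻¹ * x)) * (j : ℝ) ^ s := by field_simp
    _ ≤ (2 + termsBound T 1) * (j : ℝ) ^ s := mul_le_mul_of_nonneg_right h10 hjs.le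

end Abscissa

/-! ### Convergence at the abscissa, and its positivity -/

section RealPoints

open Filter Topology

theorem exists_real_lseries_eq {f : ArithmeticFunction ℂ} (hnat : ∀ n, ∃ k : ℕ, f n = k)
    (hf1 : f 1 = 1) {s : ℝ} (hs : LSeriesSummable f s) :
    ∃ x : ℝ, 1 ≤ x ∧ LSeries f s = x := by
  refine ⟨∑' n, ‖LSeries.term f s n‖, ?_, ?_⟩
  · have h := hs.norm.sum_le_tsum {1} fun n _ => norm_nonneg _
    simpa [LSeries.term_of_ne_zero, hf1] using h
  · rw [LSeries, Complex.ofReal_tsum]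
    exact tsum_congr (lseries_term_eq_norm hnat s)

/-- A finite sum of norms of terms is continuous in `s`, so the uniform bound passes to the limit
`σ`. -/
theorem lseriesSummable_of_forall_sum_le {f : ℕ → ℂ} {σ B : ℝ}
    (h : ∀ s : ℝ, σ < s → s ≤ σ + 1 → ∀ S : Finset ℕ, ∑ n ∈ S, ‖LSeries.term f s n‖ ≤ B) :
    LSeriesSummable f σ := by
  rw [LSeriesSummable, ← summable_norm_iff]
  refine summable_of_sum_le (c := B) (fun n => norm_nonneg _) fun S => ?_
  have h1 : Tendsto (fun s : ℝ => ∑ n ∈ S, ‖LSeries.term f s n‖) (𝓝[>] σ)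
      (𝓝 (∑ n ∈ S, ‖LSeries.term f σ n‖)) := by
    refine tendsto_nhdsWithin_of_tendsto_nhds ?_
    refine tendsto_finsetSum _ fun n _ => ?_
    have h2 : ContinuousAt (fun z : ℂ => LSeries.term f z n) (σ : ℂ) :=
      (LSeries.hasDerivAt_term f n σ).continuousAt
    exact (h2.tendsto.comp (Complex.continuous_ofReal.tendsto σ)).norm
  refine le_of_tendsto h1 ?_
  filter_upwards [Ioc_mem_nhdsGT (lt_add_one σ)] with s hs
  exact h s hs.1 hs.2 S

theorem continuousOn_lseries {f : ℕ → ℂ} {σ : ℝ} (h : LSeriesSummable f σ) :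
    ContinuousOn (LSeries f) {s | σ ≤ s.re} := by
  refine continuousOn_tsum (u := fun n => ‖LSeries.term f σ n‖) (fun n s _ =>
    (LSeries.hasDerivAt_term f n s).continuousAt.continuousWithinAt) h.norm fun n s hs => ?_
  exact LSeries.norm_term_le_of_re_le_re f (by simpa using hs) n

variable {f : ArithmeticFunction ℂ} {m : ℕ} {T : List (ℚ × ℕ × List ℕ)} {r : ℚ} {j : ℕ}

/-- If the series converges to the right of `σ ≥ 0`, then also at `σ`. -/
theorem lseriesSummable_of_forall_lt (hnat : ∀ n, ∃ k : ℕ, f n = k) (hf1 : f 1 = 1) (hr : 0 < r)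
    (hf : f = formulaValue m (fun k => dilate k f) monoSeries ((r, j, List.replicate m 1) :: T))
    (hm : 2 ≤ m) (hj : 2 ≤ j) (hT : ∀ t ∈ T, 2 ≤ t.2.1 ∧ 0 ∉ t.2.2)
    (hl : ∀ t ∈ T, t.2.2.length + 1 ≤ m) {σ : ℝ} (hσ : 0 ≤ σ)
    (hs : ∀ s : ℝ, σ < s → LSeriesSummable f s) : LSeriesSummable f σ := by
  refine lseriesSummable_of_forall_sum_le (B := (2 + termsBound T 1) * (j : ℝ) ^ (σ + 1) / r)
    fun s h1 h2 S => ?_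
  refine (sum_norm_term_le_norm_lseries hnat (hs s h1) S).trans
    ((norm_lseries_le hnat hf1 hr hf hm hj hT hl (hσ.trans h1.le) (hs s h1)).trans ?_)
  have hr0 : (0 : ℝ) < r := by exact_mod_cast hr
  have hj1 : (1 : ℝ) ≤ j := by exact_mod_cast (by omega : 1 ≤ j)
  refine div_le_div_of_nonneg_right (mul_le_mul_of_nonneg_left
    (Real.rpow_le_rpow_of_exponent_le hj1 h2) ?_) hr0.le
  have := termsBound_nonneg T zero_le_one
  linarith

/-- The abscissa of convergence is positive and finite, if the functional equation has no real
solution at `s = 0`. -/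
theorem exists_pos_abscissa (hnat : ∀ n, ∃ k : ℕ, f n = k) (hf1 : f 1 = 1) (hr : 0 < r)
    (hf : f = formulaValue m (fun k => dilate k f) monoSeries ((r, j, List.replicate m 1) :: T))
    (hm : 2 ≤ m) (hj : 2 ≤ j) (hT : ∀ t ∈ T, 2 ≤ t.2.1 ∧ 0 ∉ t.2.2)
    (hl : ∀ t ∈ T, t.2.2.length + 1 ≤ m)
    (hne : ∀ x : ℝ, 1 ≤ x → formulaValue m (fun _ => (x : ℂ)) (fun _ => 1)
      ((r, j, List.replicate m 1) :: T) ≠ x) :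
    ∃ σ₀ : ℝ, 0 < σ₀ ∧ LSeries.abscissaOfAbsConv f = (σ₀ : EReal) := by
  have hT' : ∀ t ∈ (r, j, List.replicate m 1) :: T, 2 ≤ t.2.1 ∧ 0 ∉ t.2.2 := by
    intro t ht
    rcases List.mem_cons.1 ht with rfl | ht
    · exact ⟨hj, fun h => absurd (List.eq_of_mem_replicate h) zero_ne_one⟩
    · exact hT t ht
  obtain ⟨s, hs⟩ := exists_lseriesSummable hf hf1 hm hT'
  have htop : LSeries.abscissaOfAbsConv f ≠ ⊤ :=
    ne_top_of_le_ne_top (EReal.coe_ne_top _) hs.abscissaOfAbsConv_le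
  -- Otherwise the series converges for all `s > 0`, hence by boundedness also at `0`. There all
  -- values `ζ(k s)` equal one number `x ≥ 1` and all `n ^ (-s)` equal `1`, contradicting `hne`.
  have hpos : 0 < LSeries.abscissaOfAbsConv f := by
    by_contra hle
    rw [not_lt] at hle
    have h1 : ∀ s : ℝ, 0 < s → LSeriesSummable f s := fun s hs =>
      LSeriesSummable_of_abscissaOfAbsConv_lt_re (hle.trans_lt (by simpa using hs))
    have h0 := lseriesSummable_of_forall_lt hnat hf1 hr hf hm hj hT hl le_rfl h1
    obtain ⟨x, hx1, hx⟩ := exists_real_lseries_eq hnat hf1 h0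
    refine hne x hx1 ?_
    have hk : ∀ k : ℕ, (k : ℂ) * ((0 : ℝ) : ℂ) = ((0 : ℝ) : ℂ) := fun k => by simp
    have h2 := (lseriesHasSum_formulaValue (f := f) (s := ((0 : ℝ) : ℂ)) (m := m)
      (z := fun _ => (x : ℂ)) (fun k _ => by
        rw [hk]
        exact hx ▸ h0.LSeriesHasSum) (by omega)
      (fun t ht => ⟨by have := (hT' t ht).1; omega, (hT' t ht).2⟩)).LSeries_eq
    have hq : (fun n : ℕ => (n : ℂ) ^ (-((0 : ℝ) : ℂ))) = fun _ => 1 := by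
      funext n
      simp
    rw [← hf, hx, hq] at h2
    exact h2.symm
  lift LSeries.abscissaOfAbsConv f to ℝ using
    ⟨htop, ne_bot_of_gt hpos⟩ with σ hσ
  exact ⟨σ, by exact_mod_cast hpos, rfl⟩

end RealPoints

/-! ### Landau's theorem on the abscissa of a series with nonnegative coefficients -/

section Landau

open Filter Topology

theorem logMul_iterate_apply (f : ℕ → ℂ) (i n : ℕ) :
    (LSeries.logMul^[i] f) n = (Real.log n : ℂ) ^ i * f n := by
  induction i with
  | zero => simp
  | succ i ih =>
    rw [Function.iterate_succ_apply', LSeries.logMul, ih, Complex.natCast_log, pow_succ']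
    ring

theorem term_logMul_iterate (f : ℕ → ℂ) (i n : ℕ) (s : ℂ) :
    LSeries.term (LSeries.logMul^[i] f) s n = (Real.log n : ℂ) ^ i * LSeries.term f s n := by
  rcases eq_or_ne n 0 with rfl | hn
  · simp
  · rw [LSeries.term_of_ne_zero hn, LSeries.term_of_ne_zero hn, logMul_iterate_apply, mul_div_assoc]

/-- Landau's theorem: a Dirichlet series with nonnegative coefficients has no analytic continuation
to its abscissa of convergence. -/
theorem not_analytic_continuation {f : ℕ → ℂ} (hnat : ∀ n, ∃ k : ℕ, f n = k) {σ : ℝ}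
    (hσ : LSeries.abscissaOfAbsConv f = (σ : EReal)) {h : ℂ → ℂ} (hh : AnalyticAt ℂ h σ)
    (heq : ∀ᶠ s in 𝓝[{s : ℂ | σ < s.re}] (σ : ℂ), LSeries f s = h s) : False := by
  rw [eventually_nhdsWithin_iff] at heq
  obtain ⟨ρ, hρ, hball⟩ := Metric.eventually_nhds_iff_ball.1 (heq.and hh.eventually_analyticAt)
  -- The disc of radius `ρ / 2` around `b` lies in the disc of analyticity around `σ` and contains
  -- the point `x` to the left of `σ`.
  let b : ℝ := σ + ρ / 4
  let x : ℝ := σ - ρ / 8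
  have hdist : dist (b : ℂ) (σ : ℂ) = ρ / 4 := by
    rw [Complex.dist_eq, ← Complex.ofReal_sub, Complex.norm_real, Real.norm_eq_abs,
      show b - σ = ρ / 4 by simp [b], abs_of_pos (by positivity)]
  have hb1 : LSeries.abscissaOfAbsConv f < (b : EReal) := by
    rw [hσ]
    exact_mod_cast (by simp only [b]; linarith : σ < b)
  have hdiff : DifferentiableOn ℂ h (Metric.ball (b : ℂ) (ρ / 2)) := by
    intro s hs
    refine (hball s ?_).2.differentiableAt.differentiableWithinAt
    have := dist_triangle s b σ
    rw [Metric.mem_ball] at hs ⊢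
    linarith
  have hxb : (x : ℂ) ∈ Metric.ball (b : ℂ) (ρ / 2) := by
    rw [Metric.mem_ball, Complex.dist_eq, ← Complex.ofReal_sub, Complex.norm_real, Real.norm_eq_abs,
      abs_lt]
    constructor <;> (simp only [b, x]; linarith)
  have hnear : h =ᶠ[𝓝 (b : ℂ)] LSeries f := by
    have h1 : ∀ᶠ s : ℂ in 𝓝 (b : ℂ), s ∈ Metric.ball (σ : ℂ) ρ :=
      Metric.isOpen_ball.mem_nhds (by rw [Metric.mem_ball, hdist]; linarith)
    have h2 : ∀ᶠ s : ℂ in 𝓝 (b : ℂ), σ < s.re :=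
      (isOpen_lt continuous_const Complex.continuous_re).mem_nhds (by
        rw [Set.mem_ofPred_eq, Complex.ofReal_re]; simp only [b]; linarith)
    filter_upwards [h1, h2] with s hs1 hs2
    exact ((hball s hs1).1 hs2).symm
  have hsum := (Complex.hasSum_taylorSeries_on_ball hdiff hxb).summable.norm
  -- The Taylor series of `h` at `b`, evaluated at `x`, is a double series with nonnegative terms `F
  -- i n`. Summed over `i` first, the exponential series turns the term at `b` into the term at `x`,
  -- so the Dirichlet series would converge at `x < σ`.
  let F : ℕ → ℕ → ℝ := fun i n =>
    ((b - x) * Real.log n) ^ i / i.factorial * ‖LSeries.term f b n‖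
  have hbx : 0 < b - x := by simp only [b, x]; linarith
  have hF : ∀ i n, 0 ≤ F i n := fun i n => mul_nonneg (div_nonneg (pow_nonneg
    (mul_nonneg hbx.le (Real.log_natCast_nonneg n)) _) (Nat.cast_nonneg _)) (norm_nonneg _)
  have hreal := lseries_term_eq_norm hnat b
  have hterm : ∀ i, Summable (F i) ∧ ‖(i.factorial : ℂ)⁻¹ • ((x : ℂ) - b) ^ i •
      iteratedDeriv i h b‖ = ∑' n, F i n := by
    intro i
    have hs1 : LSeriesSummable (LSeries.logMul^[i] f) b := by
      refine LSeriesSummable_of_abscissaOfAbsConv_lt_re ?_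
      rw [LSeries.absicssaOfAbsConv_logPowMul]
      simpa using hb1
    have h1 : ∀ n, LSeries.term (LSeries.logMul^[i] f) b n =
        ((Real.log n ^ i * ‖LSeries.term f b n‖ : ℝ) : ℂ) := by
      intro n
      rw [term_logMul_iterate, Complex.ofReal_mul, Complex.ofReal_pow, ← hreal]
    have hs2 : Summable fun n : ℕ => Real.log n ^ i * ‖LSeries.term f b n‖ := by
      have h2 := hs1
      rw [LSeriesSummable, funext h1] at h2
      exact_mod_cast h2
    have hF2 : F i = fun n : ℕ => (b - x) ^ i / i.factorial *
        (Real.log n ^ i * ‖LSeries.term f b n‖) := by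
      funext n
      simp only [F]
      rw [mul_pow]
      ring
    refine ⟨hF2 ▸ hs2.mul_left _, ?_⟩
    rw [hnear.iteratedDeriv_eq i, LSeries_iteratedDeriv i (by simpa using hb1), LSeries,
      tsum_congr h1, ← Complex.ofReal_tsum, hF2, tsum_mul_left, norm_smul, norm_smul, norm_mul,
      Complex.norm_real, Real.norm_of_nonneg (tsum_nonneg fun n => mul_nonneg
        (pow_nonneg (Real.log_natCast_nonneg n) _) (norm_nonneg _)), norm_pow, norm_pow, norm_neg,
      norm_one, one_pow, one_mul, norm_inv, Complex.norm_natCast, ← Complex.ofReal_sub,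
      Complex.norm_real, Real.norm_eq_abs, abs_sub_comm, abs_of_pos hbx]
    ring
  have hxσ : x < σ := by simp only [x]; linarith
  clear_value b x
  have hx : LSeriesSummable f x := by
    rw [LSeriesSummable, ← summable_norm_iff]
    refine summable_of_sum_le (c := ∑' i, ‖(i.factorial : ℂ)⁻¹ • ((x : ℂ) - b) ^ i •
      iteratedDeriv i h b‖) (fun n => norm_nonneg _) fun S => ?_
    have h1 : ∀ n, HasSum (fun i => F i n) ‖LSeries.term f x n‖ := by
      intro n
      have h2 := (NormedSpace.expSeries_div_hasSum_exp ((b - x) * Real.log n)).mul_right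
        ‖LSeries.term f b n‖
      rw [← Real.exp_eq_exp_ℝ] at h2
      convert! h2 using 1
      rcases eq_or_ne n 0 with rfl | hn
      · simp
      · have hn0 : (0 : ℝ) < n := by exact_mod_cast Nat.pos_of_ne_zero hn
        rw [LSeries.norm_term_eq, LSeries.norm_term_eq, if_neg hn, if_neg hn, Complex.ofReal_re,
          Complex.ofReal_re, mul_comm (b - x), ← Real.rpow_def_of_pos hn0, Real.rpow_sub hn0]
        have := Real.rpow_pos_of_pos hn0 b
        have := Real.rpow_pos_of_pos hn0 x
        field_simp
    have h3 := hasSum_sum fun n (_ : n ∈ S) => h1 n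
    refine hasSum_le (fun i => ?_) h3 hsum.hasSum
    rw [(hterm i).2]
    exact (hterm i).1.sum_le_tsum S fun n _ => hF i n
  have h4 := hx.abscissaOfAbsConv_le
  rw [hσ, Complex.ofReal_re, EReal.coe_le_coe_iff] at h4
  linarith

end Landau

/-! ### Square-root singularities of solutions of analytic equations -/

section Puiseux

open Filter Topology

theorem exists_analytic_implicit {E : Type*} [NormedAddCommGroup E] [NormedSpace ℂ E]
    [CompleteSpace E] {F : E × ℂ → ℂ} {e : E} {z d : ℂ} (hF : AnalyticAt ℂ F (e, z))
    (hd : HasDerivAt (fun y => F (e, y)) d z) (hd0 : d ≠ 0) (h0 : F (e, z) = 0) :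
    ∃ ψ : E → ℂ, AnalyticAt ℂ ψ e ∧ ψ e = z ∧ ∀ᶠ v in 𝓝 (e, z), F v = 0 ↔ ψ v.1 = v.2 := by
  -- The exponent `⊤` of `WithTop ℕ∞` stands for analyticity, so the implicit function is analytic.
  have hn : (⊤ : WithTop ℕ∞) ≠ 0 := by simp
  have hc : ContDiffAt ℂ ⊤ F (e, z) := hF.contDiffAt
  have h1 : HasFDerivAt (fun y => F (e, y))
      (fderiv ℂ F (e, z) ∘L ContinuousLinearMap.inr ℂ E ℂ) z :=
    (hF.differentiableAt.hasFDerivAt (x := (e, z))).comp z (hasFDerivAt_prodMk_right e z)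
  have h2 : (fderiv ℂ F (e, z) ∘L ContinuousLinearMap.inr ℂ E ℂ).IsInvertible := by
    refine ⟨ContinuousLinearEquiv.unitsEquivAut ℂ (Units.mk0 d hd0), ?_⟩
    rw [h1.unique hd.hasFDerivAt]
    ext
    simp
  refine ⟨hc.implicitFunction hn h2, (hc.contDiffAt_implicitFunction hn h2).analyticAt,
    hc.implicitFunction_apply_self hn h2, ?_⟩
  have h3 := hc.eventually_apply_eq_iff_implicitFunction hn h2
  rwa [h0] at h3

/-- The remainder in the expansion of `(c + y)^k` to first order in `y`. -/
def powRemainder : ℕ → ℂ → ℂ → ℂ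
  | 0, _, _ => 0
  | k + 1, c, y => k * c ^ (k - 1) + (c + y) * powRemainder k c y

theorem add_pow_eq_powRemainder (k : ℕ) (c y : ℂ) :
    (c + y) ^ k = c ^ k + k * c ^ (k - 1) * y + y ^ 2 * powRemainder k c y := by
  induction k with
  | zero => simp [powRemainder]
  | succ k ih =>
    rw [pow_succ', ih, powRemainder]
    rcases k with - | k
    · simp [powRemainder]
    · simp only [Nat.add_sub_cancel]
      push_cast
      ring

/-- Twice the remainder at `y = 0` is the second derivative of the power. This identifies the
leading coefficient of the quadratic equation with the second derivative of the polynomial. -/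
theorem two_mul_powRemainder_zero (k : ℕ) (c : ℂ) :
    2 * powRemainder k c 0 = k * (k - 1) * c ^ (k - 2) := by
  induction k with
  | zero => simp [powRemainder]
  | succ k ih =>
    rw [powRemainder, mul_add, add_zero, mul_left_comm 2 c, ih]
    rcases k with - | k
    · simp
    rcases k with - | k
    · norm_num
    · simp only [Nat.add_sub_cancel, show k + 1 + 1 + 1 - 2 = k + 1 by omega,
        show k + 1 + 1 - 2 = k by omega]
      push_cast
      ring

theorem analyticAt_powRemainder {E : Type*} [NormedAddCommGroup E] [NormedSpace ℂ E]
    {c y : E → ℂ} {p : E} (hc : AnalyticAt ℂ c p) (hy : AnalyticAt ℂ y p) (k : ℕ) :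
    AnalyticAt ℂ (fun p => powRemainder k (c p) (y p)) p := by
  induction k with
  | zero => exact analyticAt_const
  | succ k ih => exact (analyticAt_const.mul (hc.pow _)).add ((hc.add hy).mul ih)

theorem analyticAt_sqrt_of_eq_one {E : Type*} [NormedAddCommGroup E] [NormedSpace ℂ E]
    {f : E → ℂ} {p : E} (hf : AnalyticAt ℂ f p) (h1 : f p = 1) :
    AnalyticAt ℂ (fun p => f p ^ ((2 : ℕ) : ℂ)⁻¹) p :=
  hf.cpow analyticAt_const (by rw [h1]; exact Complex.one_mem_slitPlane)

variable {σ : ℝ}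

/-- A continuous solution of `D + y² G(·, y) = 0` on a half disc is an analytic function of the
square root. -/
theorem exists_analyticAt_comp_sqrt {y D : ℂ → ℂ} {G : ℂ × ℂ → ℂ}
    (hy : ∀ᶠ s in 𝓝[{s : ℂ | σ < s.re}] (σ : ℂ), ContinuousAt y s)
    (hy0 : Tendsto y (𝓝[{s : ℂ | σ < s.re}] (σ : ℂ)) (𝓝 0))
    (hD : AnalyticAt ℂ D σ) (hD0 : D σ = 0) (hG : AnalyticAt ℂ G ((σ : ℂ), 0))
    (hG0 : G ((σ : ℂ), 0) ≠ 0)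
    (heq : ∀ᶠ s in 𝓝[{s : ℂ | σ < s.re}] (σ : ℂ), D s + y s ^ 2 * G (s, y s) = 0)
    (hne : ¬ ∀ᶠ s in 𝓝[{s : ℂ | σ < s.re}] (σ : ℂ), y s = 0) :
    ∃ A : ℂ → ℂ, AnalyticAt ℂ A 0 ∧
      ∀ᶠ s in 𝓝[{s : ℂ | σ < s.re}] (σ : ℂ), y s = A ((s - σ) ^ ((2 : ℕ) : ℂ)⁻¹) := by
  have hid : Tendsto (fun s : ℂ => s) (𝓝[{s : ℂ | σ < s.re}] (σ : ℂ)) (𝓝 (σ : ℂ)) :=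
    tendsto_nhdsWithin_of_tendsto_nhds tendsto_id
  have hpair : Tendsto (fun s => (s, y s)) (𝓝[{s : ℂ | σ < s.re}] (σ : ℂ)) (𝓝 ((σ : ℂ), 0)) :=
    hid.prodMk_nhds hy0
  -- With a square root `Q` of the normalized `G`, the equation says that `(y Q)²` is an analytic
  -- function of `s` alone.
  let Q : ℂ × ℂ → ℂ := fun p => (G p / G ((σ : ℂ), 0)) ^ ((2 : ℕ) : ℂ)⁻¹
  have hQ : AnalyticAt ℂ Q ((σ : ℂ), 0) :=
    analyticAt_sqrt_of_eq_one (hG.div analyticAt_const hG0) (div_self hG0)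
  have hQ1 : Q ((σ : ℂ), 0) = 1 := by
    simp only [Q]
    rw [div_self hG0, Complex.one_cpow]
  have hQ2 : ∀ p, Q p ^ 2 = G p / G ((σ : ℂ), 0) := fun p =>
    Complex.cpow_nat_inv_pow _ two_ne_zero
  -- The function `ψ` recovers `y` from `s` and `W = y Q(s, y)`; the derivative of `y Q` in `y` at
  -- the origin is `Q = 1`.
  obtain ⟨ψ, hψ, -, hψ2⟩ := exists_analytic_implicit (e := ((σ : ℂ), (0 : ℂ))) (z := 0) (d := 1)
    (F := fun v : (ℂ × ℂ) × ℂ => v.2 * Q (v.1.1, v.2) - v.1.2) (by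
      have h1 : AnalyticAt ℂ (fun v : (ℂ × ℂ) × ℂ => (v.1.1, v.2)) (((σ : ℂ), (0 : ℂ)), (0 : ℂ)) :=
        (analyticAt_fst.comp analyticAt_fst).prod analyticAt_snd
      have h2 : AnalyticAt ℂ (fun v : (ℂ × ℂ) × ℂ => Q (v.1.1, v.2))
          (((σ : ℂ), (0 : ℂ)), (0 : ℂ)) := hQ.comp_of_eq h1 rfl
      exact (analyticAt_snd.mul h2).sub (analyticAt_snd.comp analyticAt_fst)) (by
      have h1 : DifferentiableAt ℂ (fun y : ℂ => Q ((σ : ℂ), y)) 0 :=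
        (hQ.comp_of_eq (f := fun y : ℂ => ((σ : ℂ), y)) (by fun_prop) rfl).differentiableAt
      have h2 := ((hasDerivAt_id (0 : ℂ)).mul h1.hasDerivAt).sub_const (0 : ℂ)
      convert! h2 using 1
      simp [hQ1]) one_ne_zero (by simp)
  -- If `D` vanished identically near `σ`, so would `y`, since `G` is nonzero there. Hence `D` is a
  -- power of `s - σ` times a nonvanishing function.
  have hDne : ¬ ∀ᶠ s in 𝓝 (σ : ℂ), D s = 0 := by
    intro h
    refine hne ?_
    have h1 : ∀ᶠ s in 𝓝[{s : ℂ | σ < s.re}] (σ : ℂ), G (s, y s) ≠ 0 :=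
      hpair.eventually (hG.continuousAt.eventually_ne hG0)
    filter_upwards [heq, h1, h.filter_mono nhdsWithin_le_nhds] with s hs1 hs2 hs3
    rw [hs3, zero_add, mul_eq_zero] at hs1
    exact pow_eq_zero_iff two_ne_zero |>.1 (hs1.resolve_right hs2)
  obtain ⟨m, u, hu, hu0, hDu⟩ := hD.exists_eventuallyEq_pow_smul_nonzero_iff.2 hDne
  have hm : m ≠ 0 := by
    rintro rfl
    have := hDu.self_of_nhds
    rw [hD0, pow_zero, one_smul] at this
    exact hu0 this.symm
  let v : ℂ → ℂ := fun s => -u s / G ((σ : ℂ), 0)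
  have hv : AnalyticAt ℂ v σ := hu.neg.div analyticAt_const hG0
  have hv0 : v σ ≠ 0 := div_ne_zero (neg_ne_zero.2 hu0) hG0
  obtain ⟨κ, hκ⟩ := IsAlgClosed.exists_pow_nat_eq (v σ) two_pos
  have hκ0 : κ ≠ 0 := by
    rintro rfl
    exact hv0 (by rw [← hκ, zero_pow two_ne_zero])
  let r : ℂ → ℂ := fun s => κ * (v s / v σ) ^ ((2 : ℕ) : ℂ)⁻¹
  have hr : AnalyticAt ℂ r σ := analyticAt_const.mul
    (analyticAt_sqrt_of_eq_one (hv.div analyticAt_const hv0) (div_self hv0))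
  have hr0 : r σ ≠ 0 := by
    simp only [r]
    rw [div_self hv0, Complex.one_cpow, mul_one]
    exact hκ0
  have hr2 : ∀ s, r s ^ 2 = v s := fun s => by
    simp only [r]
    rw [mul_pow, Complex.cpow_nat_inv_pow _ two_ne_zero, hκ, mul_div_cancel₀ _ hv0]
  let τ : ℂ → ℂ := fun s => (s - σ) ^ ((2 : ℕ) : ℂ)⁻¹
  have hτ2 : ∀ s, τ s ^ 2 = s - σ := fun s => Complex.cpow_nat_inv_pow _ two_ne_zero
  let W : ℂ → ℂ := fun s => y s * Q (s, y s)
  have hW : ∀ᶠ s in 𝓝[{s : ℂ | σ < s.re}] (σ : ℂ), W s ^ 2 = (τ s ^ m * r s) ^ 2 := by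
    filter_upwards [heq, hDu.filter_mono nhdsWithin_le_nhds] with s hs1 hs2
    rw [hs2, smul_eq_mul] at hs1
    rw [mul_pow (τ s ^ m), hr2, ← pow_mul, mul_comm m 2, pow_mul, hτ2, mul_pow (y s), hQ2]
    simp only [v]
    field_simp
    linear_combination hs1
  have hW0 : Tendsto W (𝓝[{s : ℂ | σ < s.re}] (σ : ℂ)) (𝓝 0) := by
    have h1 := hy0.mul (hQ.continuousAt.tendsto.comp hpair)
    rwa [zero_mul] at h1
  have hall := (hy.and hW).and ((hpair.eventually hQ.eventually_analyticAt).and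
    ((hr.eventually_analyticAt.and (hr.continuousAt.eventually_ne hr0)).filter_mono
      nhdsWithin_le_nhds))
  rw [eventually_nhdsWithin_iff] at hall
  obtain ⟨ε, hε, hball⟩ := Metric.eventually_nhds_iff_ball.1 hall
  have hconv : Convex ℝ (Metric.ball (σ : ℂ) ε ∩ {s : ℂ | σ < s.re}) :=
    (convex_ball _ _).inter (convex_halfSpace_re_gt σ)
  -- The half disc is connected, and `τ ^ m * r` is continuous without zeros on it, so the sign of
  -- the square root is constant.
  have hsign : ∃ κ' : ℂ, ∀ s ∈ Metric.ball (σ : ℂ) ε ∩ {s : ℂ | σ < s.re},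
      W s = κ' * (τ s ^ m * r s) := by
    have hslit : ∀ s ∈ Metric.ball (σ : ℂ) ε ∩ {s : ℂ | σ < s.re}, s - σ ∈ Complex.slitPlane := by
      intro s hs
      refine Or.inl ?_
      rw [Complex.sub_re, Complex.ofReal_re]
      exact sub_pos.2 hs.2
    have h1 : ContinuousOn W (Metric.ball (σ : ℂ) ε ∩ {s : ℂ | σ < s.re}) := by
      intro s hs
      obtain ⟨⟨h1, -⟩, h2, -⟩ := hball s hs.1 hs.2
      exact (h1.mul (ContinuousAt.comp (f := fun s => (s, y s)) h2.continuousAt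
        (continuousAt_id.prodMk h1))).continuousWithinAt
    have h2 : ContinuousOn (fun s => τ s ^ m * r s) (Metric.ball (σ : ℂ) ε ∩ {s : ℂ | σ < s.re}) := by
      intro s hs
      obtain ⟨-, -, h2, -⟩ := hball s hs.1 hs.2
      have h3 : ContinuousAt τ s := (continuousAt_id.sub continuousAt_const).cpow
        continuousAt_const (hslit s hs)
      exact ((h3.pow m).mul h2.continuousAt).continuousWithinAt
    have h3 : ∀ {s}, s ∈ Metric.ball (σ : ℂ) ε ∩ {s : ℂ | σ < s.re} → τ s ^ m * r s ≠ 0 := by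
      intro s hs
      refine mul_ne_zero (pow_ne_zero _ fun h => ?_) (hball s hs.1 hs.2).2.2.2
      have h4 := hτ2 s
      rw [h, zero_pow two_ne_zero] at h4
      exact Complex.slitPlane_ne_zero (hslit s hs) h4.symm
    rcases hconv.isPreconnected.eq_or_eq_neg_of_sq_eq h1 h2
      (fun s hs => (hball s hs.1 hs.2).1.2) h3 with h4 | h4
    · exact ⟨1, fun s hs => by rw [one_mul]; exact h4 hs⟩
    · exact ⟨-1, fun s hs => by rw [neg_one_mul]; exact h4 hs⟩
  obtain ⟨κ', hκ'⟩ := hsign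
  refine ⟨fun t => ψ (σ + t ^ 2, κ' * (t ^ m * r (σ + t ^ 2))), ?_, ?_⟩
  · have h1 : AnalyticAt ℂ (fun t : ℂ => (σ : ℂ) + t ^ 2) 0 := by fun_prop
    have h2 : AnalyticAt ℂ (fun t : ℂ => r (σ + t ^ 2)) 0 := hr.comp_of_eq h1 (by simp)
    have h3 : AnalyticAt ℂ (fun t : ℂ => κ' * (t ^ m * r (σ + t ^ 2))) 0 :=
      analyticAt_const.mul ((analyticAt_id.pow m).mul h2)
    exact hψ.comp_of_eq (h1.prod h3) (by simp [hm])
  · have h1 : Tendsto (fun s => ((s, W s), y s)) (𝓝[{s : ℂ | σ < s.re}] (σ : ℂ))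
        (𝓝 (((σ : ℂ), (0 : ℂ)), (0 : ℂ))) := (hid.prodMk_nhds hW0).prodMk_nhds hy0
    have h2 : ∀ᶠ s in 𝓝[{s : ℂ | σ < s.re}] (σ : ℂ), s ∈ Metric.ball (σ : ℂ) ε :=
      hid.eventually (Metric.ball_mem_nhds _ hε)
    filter_upwards [h1.eventually hψ2, h2, self_mem_nhdsWithin] with s hs1 hs2 hs3
    have h4 := hs1.1 (sub_self _)
    have h5 : (σ : ℂ) + τ s ^ 2 = s := by rw [hτ2]; ring
    change y s = ψ (σ + τ s ^ 2, κ' * (τ s ^ m * r (σ + τ s ^ 2)))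
    rw [h5, ← hκ' s ⟨hs2, hs3⟩]
    exact h4.symm

/-- The coefficients are those of the power series of `A`. If all odd ones vanished, the even ones
would give a power series in `s - σ` that continues `g` analytically. -/
theorem hasSqrtPuiseux_of_comp_sqrt {g A : ℂ → ℂ} (hA : AnalyticAt ℂ A 0)
    (hgA : ∀ᶠ s in 𝓝[{s : ℂ | σ < s.re}] (σ : ℂ), g s = A ((s - σ) ^ ((2 : ℕ) : ℂ)⁻¹))
    (hno : ∀ h : ℂ → ℂ, AnalyticAt ℂ h σ →
      ¬ ∀ᶠ s in 𝓝[{s : ℂ | σ < s.re}] (σ : ℂ), g s = h s) : HasSqrtPuiseux g σ := by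
  obtain ⟨p, hp⟩ := hA
  obtain ⟨ρ, hρ⟩ := hp
  have hsumA : ∀ t : ℂ, ‖t‖ₑ < ρ → HasSum (fun n => p.coeff n * t ^ n) (A t) := by
    intro t ht
    have h := hρ.hasSum (y := t) (by simpa using ht)
    rw [zero_add] at h
    convert! h using 1
    funext n
    rw [FormalMultilinearSeries.apply_eq_pow_smul_coeff, smul_eq_mul, mul_comm]
  obtain ⟨δ, hδ0, hδ⟩ := ENNReal.lt_iff_exists_nnreal_btwn.1 hρ.r_pos
  have hδ0' : (0 : ℝ) < δ := by exact_mod_cast hδ0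
  have hnorm : ∀ t : ℂ, ‖t‖ ≤ δ → ‖t‖ₑ < ρ := fun t ht => lt_of_le_of_lt (by
    rw [enorm_eq_nnnorm]; exact_mod_cast ht) hδ
  rw [eventually_nhdsWithin_iff] at hgA
  obtain ⟨ε, hε, hball⟩ := Metric.eventually_nhds_iff_ball.1 hgA
  have hexp : ∀ s : ℂ, σ < s.re → ‖s - σ‖ < min ε ((δ : ℝ) ^ 2) →
      HasSum (fun n => p.coeff n * ((s - σ) ^ ((2 : ℕ) : ℂ)⁻¹) ^ n) (g s) := by
    intro s hs1 hs2
    rw [hball s (by rw [Metric.mem_ball, Complex.dist_eq]; exact hs2.trans_le (min_le_left _ _)) hs1]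
    refine hsumA _ (hnorm _ ?_)
    refine le_of_lt (lt_of_pow_lt_pow_left₀ 2 δ.2 ?_)
    rw [← norm_pow, Complex.cpow_nat_inv_pow _ two_ne_zero]
    exact hs2.trans_le (min_le_right _ _)
  refine ⟨p.coeff, min ε ((δ : ℝ) ^ 2), lt_min hε (by positivity), ?_, ?_⟩
  · by_contra hodd
    push Not at hodd
    have hsummable : Summable fun k => ‖p.coeff (2 * k)‖ * ((δ : ℝ) ^ 2) ^ k := by
      have h1 := (hsumA (δ : ℝ) (hnorm _ (by simp))).summable.norm
      have h2 := h1.comp_injective (i := fun k : ℕ => 2 * k) fun a b hab => by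
        simpa using hab
      refine h2.congr fun k => ?_
      simp only [Function.comp_apply, norm_mul, norm_pow, Complex.norm_real]
      rw [Real.norm_of_nonneg δ.coe_nonneg, ← pow_mul]
    let h : ℂ → ℂ := fun s => ∑' k, p.coeff (2 * k) * (s - σ) ^ k
    have hh : DifferentiableOn ℂ h (Metric.ball (σ : ℂ) ((δ : ℝ) ^ 2)) := by
      refine Complex.differentiableOn_tsum_of_summable_norm hsummable (fun k => by fun_prop)
        Metric.isOpen_ball fun k s hs => ?_
      rw [norm_mul, norm_pow]
      rw [Metric.mem_ball, Complex.dist_eq] at hs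
      exact mul_le_mul_of_nonneg_left (pow_le_pow_left₀ (norm_nonneg _) hs.le _) (norm_nonneg _)
    refine hno h (hh.analyticAt (Metric.ball_mem_nhds _ (by positivity))) ?_
    rw [eventually_nhdsWithin_iff]
    filter_upwards [Metric.ball_mem_nhds (σ : ℂ) (lt_min hε (by positivity :
      0 < (δ : ℝ) ^ 2))] with s hs1 hs2
    rw [Metric.mem_ball, Complex.dist_eq] at hs1
    have h3 := hexp s hs2 hs1
    have h4 : Function.Injective fun k : ℕ => 2 * k := fun a b hab => by simpa using hab
    have h5 := (h4.hasSum_iff (f := fun n => p.coeff n * ((s - σ) ^ ((2 : ℕ) : ℂ)⁻¹) ^ n)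
      (a := g s) fun n hn => ?_).2 h3
    · refine h5.tsum_eq.symm.trans (tsum_congr fun k => ?_)
      simp only [Function.comp_apply]
      rw [pow_mul, Complex.cpow_nat_inv_pow _ two_ne_zero]
    · rw [hodd n ?_, zero_mul]
      rw [← Nat.not_even_iff_odd]
      rintro ⟨k, hk⟩
      exact hn ⟨k, by simp only; omega⟩
  · intro s hs1 hs2
    convert! hexp s hs1 hs2 using 2 with n
    rw [div_eq_mul_inv, Complex.cpow_nat_mul, Nat.cast_ofNat]

/-- A solution `g` of a polynomial equation over the analytic functions at `σ`, continuous on a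
closed half plane and without analytic continuation to `σ`, has a Puiseux expansion in a square
root if the second derivative of the equation does not vanish. -/
theorem hasSqrtPuiseux_of_polynomial {ι : Type*} [Fintype ι] {g : ℂ → ℂ}
    (hg : ContinuousOn g {s | σ ≤ s.re}) (a : ι → ℂ → ℂ) (e : ι → ℕ)
    (ha : ∀ i, AnalyticAt ℂ (a i) σ) (heq : ∀ s : ℂ, σ ≤ s.re → ∑ i, a i s * g s ^ e i = 0)
    (hd2 : ∑ i, a i σ * (e i * (e i - 1) * g σ ^ (e i - 2)) ≠ 0)
    (hno : ∀ h : ℂ → ℂ, AnalyticAt ℂ h σ →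
      ¬ ∀ᶠ s in 𝓝[{s : ℂ | σ < s.re}] (σ : ℂ), g s = h s) : HasSqrtPuiseux g σ := by
  have hσ : σ ≤ (σ : ℂ).re := by rw [Complex.ofReal_re]
  have hg0 : Tendsto g (𝓝[{s : ℂ | σ < s.re}] (σ : ℂ)) (𝓝 (g σ)) :=
    (hg σ hσ).tendsto.mono_left (nhdsWithin_mono _ fun s (hs : σ < s.re) => hs.le)
  have hid : Tendsto (fun s : ℂ => s) (𝓝[{s : ℂ | σ < s.re}] (σ : ℂ)) (𝓝 (σ : ℂ)) :=
    tendsto_nhdsWithin_of_tendsto_nhds tendsto_id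
  have hgat : ∀ s ∈ {s : ℂ | σ < s.re}, ContinuousAt g s := fun s hs =>
    hg.continuousAt (mem_of_superset ((isOpen_lt continuous_const Complex.continuous_re).mem_nhds hs)
      fun z (h : σ < z.re) => h.le)
  have haF : ∀ i, AnalyticAt ℂ (fun v : ℂ × ℂ => a i v.1) ((σ : ℂ), g σ) := fun i =>
    (ha i).comp_of_eq analyticAt_fst rfl
  -- Were the first derivative nonzero, the implicit function theorem would continue `g`
  -- analytically to `σ`.
  have hd1 : ∑ i, a i σ * (e i * g σ ^ (e i - 1)) = 0 := by
    by_contra hne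
    obtain ⟨ψ, hψ, -, hψ2⟩ := exists_analytic_implicit (e := (σ : ℂ)) (z := g σ)
      (F := fun v : ℂ × ℂ => ∑ i, a i v.1 * v.2 ^ e i)
      (Finset.analyticAt_fun_sum _ fun i _ => (haF i).mul (analyticAt_snd.pow _))
      (HasDerivAt.fun_sum fun i _ => (hasDerivAt_pow (e i) (g σ)).const_mul (a i σ)) hne
      (heq σ hσ)
    refine hno ψ hψ ?_
    filter_upwards [(hid.prodMk_nhds hg0).eventually hψ2, self_mem_nhdsWithin] with s hs1 hs2
    exact (hs1.1 (heq s (le_of_lt hs2))).symm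
  -- The critical point `c s` of the polynomial near `g σ`, analytic because the second derivative
  -- does not vanish. Expanded around `c s`, the equation has no linear term.
  obtain ⟨c, hc, hc0, hc2⟩ := exists_analytic_implicit (e := (σ : ℂ)) (z := g σ)
    (F := fun v : ℂ × ℂ => ∑ i, a i v.1 * (e i * v.2 ^ (e i - 1)))
    (Finset.analyticAt_fun_sum _ fun i _ =>
      (haF i).mul (analyticAt_const.mul (analyticAt_snd.pow _)))
    (HasDerivAt.fun_sum fun i _ => ((hasDerivAt_pow (e i - 1) (g σ)).const_mul
      (e i : ℂ)).const_mul (a i σ)) (by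
        convert! hd2 using 3 with i
        rcases h : e i with - | k
        · simp
        · rw [Nat.add_sub_cancel, show k + 1 - 2 = k - 1 by omega]
          push_cast
          ring) hd1
  have hcc : Tendsto (fun s => (s, c s)) (𝓝 (σ : ℂ)) (𝓝 ((σ : ℂ), g σ)) := by
    have h := hc.continuousAt.tendsto
    rw [hc0] at h
    exact tendsto_id.prodMk_nhds h
  let D : ℂ → ℂ := fun s => ∑ i, a i s * c s ^ e i
  let G : ℂ × ℂ → ℂ := fun p => ∑ i, a i p.1 * powRemainder (e i) (c p.1) p.2
  have hc3 : AnalyticAt ℂ (fun p : ℂ × ℂ => c p.1) ((σ : ℂ), 0) := hc.comp_of_eq analyticAt_fst rfl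
  obtain ⟨A, hA, hA2⟩ := exists_analyticAt_comp_sqrt (σ := σ) (y := fun s => g s - c s) (D := D)
    (G := G) (by
      filter_upwards [hc.eventually_analyticAt.filter_mono nhdsWithin_le_nhds,
        self_mem_nhdsWithin] with s hs1 hs2
      exact (hgat s hs2).sub hs1.continuousAt) (by
      have h := hg0.sub (hc.continuousAt.tendsto.mono_left nhdsWithin_le_nhds)
      rwa [hc0, sub_self] at h)
    (Finset.analyticAt_fun_sum _ fun i _ => (ha i).mul (hc.pow _)) (by
      simp only [D, hc0]
      exact heq σ hσ)
    (Finset.analyticAt_fun_sum _ fun i _ => ((ha i).comp_of_eq analyticAt_fst rfl).mul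
      (analyticAt_powRemainder hc3 analyticAt_snd _)) (by
      intro h
      refine hd2 ?_
      have h1 : ∑ i, a i σ * (e i * (e i - 1) * g σ ^ (e i - 2)) = 2 * G ((σ : ℂ), 0) := by
        simp only [G, hc0]
        rw [Finset.mul_sum]
        refine Finset.sum_congr rfl fun i _ => ?_
        rw [mul_left_comm 2 (a i σ), two_mul_powRemainder_zero]
      rw [h1, h, mul_zero]) (by
      filter_upwards [(hcc.eventually hc2).filter_mono nhdsWithin_le_nhds,
        self_mem_nhdsWithin] with s hs1 hs2
      have h1 := hs1.2 rfl
      have h2 := heq s (le_of_lt hs2)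
      have h3 : ∑ i, a i s * g s ^ e i = D s + (∑ i, a i s * (e i * c s ^ (e i - 1))) * (g s - c s) +
          (g s - c s) ^ 2 * G (s, g s - c s) := by
        simp only [D, G]
        rw [Finset.sum_mul, Finset.mul_sum, ← Finset.sum_add_distrib, ← Finset.sum_add_distrib]
        refine Finset.sum_congr rfl fun i _ => ?_
        have h4 := add_pow_eq_powRemainder (e i) (c s) (g s - c s)
        rw [add_sub_cancel] at h4
        rw [h4]
        ring
      rw [h1, zero_mul, add_zero, h2] at h3
      exact h3.symm) (by
      intro h
      refine hno c hc ?_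
      filter_upwards [h] with s hs
      exact sub_eq_zero.1 hs)
  refine hasSqrtPuiseux_of_comp_sqrt (A := fun t => c (σ + t ^ 2) + A t)
    ((hc.comp_of_eq (by fun_prop) (by simp)).add hA) ?_ hno
  filter_upwards [hA2] with s hs
  rw [← hs, Complex.cpow_nat_inv_pow _ two_ne_zero, add_sub_cancel, add_sub_cancel]

end Puiseux

/-! ### Nonvanishing second derivatives for the two projective groups -/

section Singularity

open Filter Topology

variable {σ : ℝ} {z q : ℕ → ℂ → ℂ}

/-- As a polynomial in `z 1` the equation has degrees `6, 2, 1, 0`. Only the first two contribute to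
the second derivative. Both contributions are positive, because `60 ^ (-σ) ≤ 30 ^ (-σ)` and the
values of `z` are real and at least `1`. -/
theorem hasSqrtPuiseux_of_rhsPSL25 (hq : ∀ n, n ≠ 0 → AnalyticAt ℂ (q n) σ)
    (hz : ∀ k, 2 ≤ k → AnalyticAt ℂ (z k) σ) (hg : ContinuousOn (z 1) {s | σ ≤ s.re})
    (heq : ∀ s : ℂ, σ ≤ s.re → z 1 s = rhsPSL25 (fun k => z k s) (fun n => q n s))
    (hno : ∀ h : ℂ → ℂ, AnalyticAt ℂ h σ →
      ¬ ∀ᶠ s in 𝓝[{s : ℂ | σ < s.re}] (σ : ℂ), z 1 s = h s)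
    (hz1 : ∀ k, k ≠ 0 → ∃ x : ℝ, 1 ≤ x ∧ z k σ = x)
    (hq1 : ∀ n : ℕ, q n σ = ((n : ℝ) ^ (-σ) : ℝ)) (hσ : 0 ≤ σ) : HasSqrtPuiseux (z 1) σ := by
  refine hasSqrtPuiseux_of_polynomial hg
    ![fun s => 1 / 60 * q 60 s, fun s => (q 30 s - 1 / 4 * q 60 s) * z 2 s ^ 2,
      fun s => (2 * q 6 s + 2 * q 12 s - 2 * q 30 s + 2 / 5 * q 60 s) * z 5 s - 1,
      fun s => (4 / 3 * q 15 s - q 30 s + 1 / 6 * q 60 s) * z 2 s ^ 3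
        + (2 * q 10 s + q 20 s - 2 * q 30 s + 1 / 3 * q 60 s) * z 3 s ^ 2
        + (1 + 2 * q 3 s + q 4 s + q 5 s - 2 * q 6 s - 2 * q 10 s - 2 * q 12 s - 4 / 3 * q 15 s
          - q 20 s + 4 * q 30 s - 2 / 3 * q 60 s) * z 6 s] ![6, 2, 1, 0] ?_ ?_ ?_ hno
  · intro i
    fin_cases i <;> simp only [Fin.zero_eta, Fin.mk_one, Fin.reduceFinMk, Matrix.cons_val] <;>
      repeat' first
        | exact analyticAt_const
        | exact hq _ (by norm_num)
        | exact hz _ (by norm_num)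
        | apply AnalyticAt.fun_add
        | apply AnalyticAt.fun_sub
        | apply AnalyticAt.fun_mul
  · intro s hs
    have h := heq s hs
    simp only [rhsPSL25, shift, Rat.smul_def] at h
    push_cast at h
    simp only [Fin.sum_univ_four, Matrix.cons_val]
    linear_combination -h
  · obtain ⟨x1, h1, hx1⟩ := hz1 1 (by norm_num)
    obtain ⟨x2, h2, hx2⟩ := hz1 2 (by norm_num)
    simp only [Fin.sum_univ_four, Matrix.cons_val]
    rw [hx1, hx2, hq1, hq1]
    have h60 : (0 : ℝ) < ((60 : ℕ) : ℝ) ^ (-σ) := by positivity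
    have h30 : ((60 : ℕ) : ℝ) ^ (-σ) ≤ ((30 : ℕ) : ℝ) ^ (-σ) :=
      Real.rpow_le_rpow_of_nonpos (by norm_num) (by norm_num) (by linarith)
    generalize ((60 : ℕ) : ℝ) ^ (-σ) = y at *
    generalize ((30 : ℕ) : ℝ) ^ (-σ) = w at *
    have h : (0 : ℝ) < 1 / 60 * y * (6 * (6 - 1) * x1 ^ 4) + (w - 1 / 4 * y) * x2 ^ 2 * 2 := by
      have h3 : 0 < w - 1 / 4 * y := by linarith
      positivity
    refine fun h0 => Complex.ofReal_ne_zero.2 h.ne' ?_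
    rw [← h0]
    push_cast
    ring

/-- Here the degrees are `7, 3, 1, 0`. The contributions of degrees `7` and `3` to the second
derivative are positive by the inequalities `168 ^ (-σ) ≤ 84 ^ (-σ) ≤ 42 ^ (-σ)`. -/
theorem hasSqrtPuiseux_of_rhsPGL32 (hq : ∀ n, n ≠ 0 → AnalyticAt ℂ (q n) σ)
    (hz : ∀ k, 2 ≤ k → AnalyticAt ℂ (z k) σ) (hg : ContinuousOn (z 1) {s | σ ≤ s.re})
    (heq : ∀ s : ℂ, σ ≤ s.re → z 1 s = rhsPGL32 (fun k => z k s) (fun n => q n s))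
    (hno : ∀ h : ℂ → ℂ, AnalyticAt ℂ h σ →
      ¬ ∀ᶠ s in 𝓝[{s : ℂ | σ < s.re}] (σ : ℂ), z 1 s = h s)
    (hz1 : ∀ k, k ≠ 0 → ∃ x : ℝ, 1 ≤ x ∧ z k σ = x)
    (hq1 : ∀ n : ℕ, q n σ = ((n : ℝ) ^ (-σ) : ℝ)) (hσ : 0 ≤ σ) : HasSqrtPuiseux (z 1) σ := by
  refine hasSqrtPuiseux_of_polynomial hg
    ![fun s => 1 / 168 * q 168 s,
      fun s => (1 / 2 * q 84 s - 1 / 8 * q 168 s) * z 2 s ^ 2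
        + (2 / 3 * q 42 s - 1 / 2 * q 84 s + 1 / 12 * q 168 s) * z 4 s,
      fun s => (2 / 3 * q 42 s - 1 / 2 * q 84 s + 1 / 12 * q 168 s) * z 2 s ^ 3
        + (4 * q 21 s - 3 * q 42 s + 1 / 2 * q 84 s) * (z 2 s * z 4 s)
        + (2 * q 28 s + q 56 s - 2 * q 84 s + 1 / 3 * q 168 s) * z 3 s ^ 2
        + (2 * q 7 s + q 14 s - 2 * q 21 s - 2 * q 28 s + 1 / 3 * q 42 s - q 56 s + 2 * q 84 s
          - 1 / 3 * q 168 s) * z 6 s - 1,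
      fun s => (2 * q 7 s + q 14 s - 2 * q 21 s - 2 * q 28 s + 1 / 3 * q 42 s - q 56 s + 2 * q 84 s
          - 1 / 3 * q 168 s) * (z 3 s * z 4 s)
        + (1 + 2 * q 3 s + q 6 s - 3 * q 7 s + q 8 s - 2 * q 14 s + 2 * q 28 s + q 42 s + q 56 s
          - 2 * q 84 s + 2 / 7 * q 168 s) * z 7 s] ![7, 3, 1, 0] ?_ ?_ ?_ hno
  · intro i
    fin_cases i <;> simp only [Fin.zero_eta, Fin.mk_one, Fin.reduceFinMk, Matrix.cons_val] <;>
      repeat' first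
        | exact analyticAt_const
        | exact hq _ (by norm_num)
        | exact hz _ (by norm_num)
        | apply AnalyticAt.fun_add
        | apply AnalyticAt.fun_sub
        | apply AnalyticAt.fun_mul
  · intro s hs
    have h := heq s hs
    simp only [rhsPGL32, Rat.smul_def] at h
    push_cast at h
    simp only [Fin.sum_univ_four, Matrix.cons_val]
    linear_combination -h
  · obtain ⟨x1, h1, hx1⟩ := hz1 1 (by norm_num)
    obtain ⟨x2, h2, hx2⟩ := hz1 2 (by norm_num)
    obtain ⟨x4, h4, hx4⟩ := hz1 4 (by norm_num)
    simp only [Fin.sum_univ_four, Matrix.cons_val]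
    rw [hx1, hx2, hx4, hq1, hq1, hq1]
    have h168 : (0 : ℝ) < ((168 : ℕ) : ℝ) ^ (-σ) := by positivity
    have h84 : ((168 : ℕ) : ℝ) ^ (-σ) ≤ ((84 : ℕ) : ℝ) ^ (-σ) :=
      Real.rpow_le_rpow_of_nonpos (by norm_num) (by norm_num) (by linarith)
    have h42 : ((84 : ℕ) : ℝ) ^ (-σ) ≤ ((42 : ℕ) : ℝ) ^ (-σ) :=
      Real.rpow_le_rpow_of_nonpos (by norm_num) (by norm_num) (by linarith)
    generalize ((168 : ℕ) : ℝ) ^ (-σ) = y at *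
    generalize ((84 : ℕ) : ℝ) ^ (-σ) = w at *
    generalize ((42 : ℕ) : ℝ) ^ (-σ) = v at *
    have h : (0 : ℝ) < 1 / 168 * y * (7 * (7 - 1) * x1 ^ 5) + ((1 / 2 * w - 1 / 8 * y) * x2 ^ 2 +
        (2 / 3 * v - 1 / 2 * w + 1 / 12 * y) * x4) * (3 * 2 * x1) := by
      have h5 : 0 < 1 / 2 * w - 1 / 8 * y := by linarith
      have h6 : 0 < 2 / 3 * v - 1 / 2 * w + 1 / 12 * y := by linarith
      have h7 : 0 < x1 := by linarith
      have h8 : 0 < x4 := by linarith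
      positivity
    refine fun h0 => Complex.ofReal_ne_zero.2 h.ne' ?_
    rw [← h0]
    push_cast
    ring

end Singularity

/-! ### The three wreath formulas in terms of lists -/

section Groups

open Filter Topology

theorem monoSeries_fifteen : monoSeries 15 = monoSeries 5 * monoSeries 3 := monoSeries_mul 5 3

theorem monoSeries_twenty : monoSeries 20 = monoSeries 10 * monoSeries 2 := monoSeries_mul 10 2

theorem cpow_neg_fifteen (s : ℂ) :
    ((15 : ℕ) : ℂ) ^ (-s) = ((5 : ℕ) : ℂ) ^ (-s) * ((3 : ℕ) : ℂ) ^ (-s) := cpow_neg_mul 5 3 s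

theorem cpow_neg_twenty (s : ℂ) :
    ((20 : ℕ) : ℂ) ^ (-s) = ((10 : ℕ) : ℂ) ^ (-s) * ((2 : ℕ) : ℂ) ^ (-s) := cpow_neg_mul 10 2 s

theorem wreathFormula_A5 : WreathFormula A5 (Fin 5) 5 termsA5 := fun H _ _ hH => by
  rw [(rigid_and_formalZeta_A5 hH).2, rhsA5_eq _ _ monoSeries_fifteen monoSeries_twenty]

theorem wreathFormula_PSL25 : WreathFormula PSL25 Line5 6 termsPSL25 := fun H _ _ hH => by
  rw [(rigid_and_formalZeta_PSL25 hH).2, rhsPSL25_eq]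

theorem wreathFormula_PGL32 : WreathFormula PGL32 Plane2 7 termsPGL32 := fun H _ _ hH => by
  rw [(rigid_and_formalZeta_PGL32 hH).2, rhsPGL32_eq]

theorem termsA5_bounds : ∀ t ∈ termsA5, 2 ≤ t.2.1 ∧ 0 ∉ t.2.2 := by decide

theorem termsPSL25_bounds : ∀ t ∈ termsPSL25, 2 ≤ t.2.1 ∧ 0 ∉ t.2.2 := by decide

theorem termsPGL32_bounds : ∀ t ∈ termsPGL32, 2 ≤ t.2.1 ∧ 0 ∉ t.2.2 := by decide

end Groups

/-! ### Abscissa and singularity for the iterated wreath products -/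

section IteratedWreath

open Filter Topology

variable {Q X : Type} [Group Q] [MulAction Q X] [Finite Q] [Finite X] {m : ℕ}
  {T : List (ℚ × ℕ × List ℕ)}

theorem zeta_profWreath_eq (hW : WreathFormula Q X m T) (hm : 2 ≤ m)
    (hT : ∀ t ∈ T, 2 ≤ t.2.1 ∧ 0 ∉ t.2.2) {s : ℂ} (hs : ZetaConverges (ProfWreath Q X) s) :
    zeta (ProfWreath Q X) s = formulaValue m (fun k => zeta (ProfWreath Q X) (k * s))
      (fun n => (n : ℂ) ^ (-s)) T :=
  (converges_and_zeta_eq (by omega) (fun t ht => ⟨fun h => absurd (hT t ht).1 (by omega),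
    (hT t ht).2⟩) (formalZeta_profWreath hW hm fun t ht => (hT t ht).1) hs).2

theorem formalZeta_profWreath_one (hW : WreathFormula Q X m T) (hm : 2 ≤ m)
    (hT : ∀ t ∈ T, 2 ≤ t.2.1) : formalZeta (ProfWreath Q X) 1 = 1 := by
  rw [formalZeta_profWreath_apply hW hm hT le_rfl, formalZeta_iterWreath_apply_one hW hm hT]

theorem exists_isAbscissa_profWreath {r : ℚ} {j : ℕ}
    (hW : WreathFormula Q X m ((r, j, List.replicate m 1) :: T)) (hm : 2 ≤ m) (hr : 0 < r)
    (hj : 2 ≤ j) (hT : ∀ t ∈ T, (2 ≤ t.2.1 ∧ 0 ∉ t.2.2) ∧ t.2.2.length + 1 ≤ m)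
    (hne : ∀ x : ℝ, 1 ≤ x → formulaValue m (fun _ => (x : ℂ)) (fun _ => 1)
      ((r, j, List.replicate m 1) :: T) ≠ x) :
    ∃ σ₀ : ℝ, 0 < σ₀ ∧ IsAbscissa (ProfWreath Q X) σ₀ ∧ ZetaConverges (ProfWreath Q X) σ₀ := by
  have hT2 : ∀ t ∈ (r, j, List.replicate m 1) :: T, 2 ≤ t.2.1 := by
    intro t ht
    rcases List.mem_cons.1 ht with rfl | ht
    · exact hj
    · exact (hT t ht).1.1
  have hf1 := formalZeta_profWreath_one hW hm hT2
  have hf := formalZeta_profWreath hW hm hT2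
  have hnat := formalZeta_eq_natCast (ProfWreath Q X)
  obtain ⟨σ, h0, hσ⟩ := exists_pos_abscissa hnat hf1 hr hf hm hj (fun t ht => (hT t ht).1)
    (fun t ht => (hT t ht).2) hne
  refine ⟨σ, h0, hσ, lseriesSummable_of_forall_lt hnat hf1 hr hf hm hj (fun t ht => (hT t ht).1)
    (fun t ht => (hT t ht).2) h0.le fun s hs => ?_⟩
  refine LSeriesSummable_of_abscissaOfAbsConv_lt_re ?_
  rw [hσ, Complex.ofReal_re]
  exact_mod_cast hs

variable {σ : ℝ}

theorem analyticAt_natCast_cpow_neg {n : ℕ} (hn : n ≠ 0) (s : ℂ) :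
    AnalyticAt ℂ (fun s => (n : ℂ) ^ (-s)) s :=
  analyticAt_const.cpow analyticAt_id.neg (Complex.natCast_mem_slitPlane.2 hn)

/-- Positivity of `σ` puts `k σ` strictly to the right of the abscissa. -/
theorem analyticAt_zeta_natCast_mul {G : Type u} [Group G] [TopologicalSpace G] (h0 : 0 < σ)
    (hσ : IsAbscissa G σ) {k : ℕ} (hk : 2 ≤ k) :
    AnalyticAt ℂ (fun s => zeta G (k * s)) (σ : ℂ) := by
  have h1 : ((k : ℂ) * σ).re = k * σ := by simp
  have h2 : (2 : ℝ) ≤ k := by exact_mod_cast hk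
  have h3 : AnalyticAt ℂ (zeta G) ((k : ℂ) * σ) := by
    refine LSeries_analyticOnNhd (formalZeta G) _ ?_
    rw [Set.mem_ofPred_eq, hσ, h1]
    exact_mod_cast (by nlinarith : σ < k * σ)
  exact h3.comp_of_eq (f := fun s : ℂ => (k : ℂ) * s) (by fun_prop) rfl

theorem exists_real_zeta_eq (hW : WreathFormula Q X m T) (hm : 2 ≤ m)
    (hT : ∀ t ∈ T, 2 ≤ t.2.1) (hs : ZetaConverges (ProfWreath Q X) σ) {k : ℕ}
    (hk : k ≠ 0) : ∃ x : ℝ, 1 ≤ x ∧ zeta (ProfWreath Q X) (k * σ) = x := by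
  have h1 : ((k : ℂ) * σ) = ((k * σ : ℝ) : ℂ) := by push_cast; ring
  have h2 := zetaConverges_natCast_mul hs hk
  rw [h1] at h2 ⊢
  exact exists_real_lseries_eq (formalZeta_eq_natCast _) (formalZeta_profWreath_one hW hm hT) h2

theorem zetaConverges_of_le {G : Type u} [Group G] [TopologicalSpace G]
    (h : ZetaConverges G σ) {s : ℂ} (hs : σ ≤ s.re) : ZetaConverges G s :=
  LSeriesSummable.of_re_le_re (by rwa [Complex.ofReal_re]) h

theorem natCast_cpow_neg_ofReal (n : ℕ) (σ : ℝ) :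
    (n : ℂ) ^ (-(σ : ℂ)) = ((n : ℝ) ^ (-σ) : ℝ) := by
  rw [Complex.ofReal_cpow n.cast_nonneg]
  push_cast
  rfl

theorem hasSqrtPuiseux_PSL25 (h0 : 0 < σ) (hσ : IsAbscissa (ProfWreath PSL25 Line5) σ)
    (hs : ZetaConverges (ProfWreath PSL25 Line5) σ) :
    HasSqrtPuiseux (zeta (ProfWreath PSL25 Line5)) σ := by
  have h1 : (fun s => zeta (ProfWreath PSL25 Line5) ((1 : ℕ) * s)) =
      zeta (ProfWreath PSL25 Line5) := by
    funext s
    rw [Nat.cast_one, one_mul]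
  rw [← h1]
  refine hasSqrtPuiseux_of_rhsPSL25 (z := fun k s => zeta (ProfWreath PSL25 Line5) (k * s))
    (q := fun n s => (n : ℂ) ^ (-s)) (fun n hn => analyticAt_natCast_cpow_neg hn _)
    (fun k hk => analyticAt_zeta_natCast_mul h0 hσ hk) ?_
    (fun s hs' => ?_) (fun h hh heq => ?_)
    (fun k hk => exists_real_zeta_eq wreathFormula_PSL25 (by norm_num)
      (fun t ht => (termsPSL25_bounds t ht).1) hs hk)
    (fun n => natCast_cpow_neg_ofReal n σ) h0.le
  · refine ContinuousOn.congr (continuousOn_lseries hs) fun s _ => ?_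
    exact congrFun h1 s
  · rw [rhsPSL25_eq, Nat.cast_one, one_mul]
    exact zeta_profWreath_eq wreathFormula_PSL25 (by norm_num) termsPSL25_bounds
      (zetaConverges_of_le hs hs')
  · refine not_analytic_continuation (formalZeta_eq_natCast _) hσ hh ?_
    filter_upwards [heq] with s hs
    rwa [Nat.cast_one, one_mul] at hs

instance finite_PGL32 : Finite PGL32 := Nat.finite_of_card_ne_zero (by rw [card_PGL32]; norm_num)

theorem hasSqrtPuiseux_PGL32 (h0 : 0 < σ) (hσ : IsAbscissa (ProfWreath PGL32 Plane2) σ)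
    (hs : ZetaConverges (ProfWreath PGL32 Plane2) σ) :
    HasSqrtPuiseux (zeta (ProfWreath PGL32 Plane2)) σ := by
  have h1 : (fun s => zeta (ProfWreath PGL32 Plane2) ((1 : ℕ) * s)) =
      zeta (ProfWreath PGL32 Plane2) := by
    funext s
    rw [Nat.cast_one, one_mul]
  rw [← h1]
  refine hasSqrtPuiseux_of_rhsPGL32 (z := fun k s => zeta (ProfWreath PGL32 Plane2) (k * s))
    (q := fun n s => (n : ℂ) ^ (-s)) (fun n hn => analyticAt_natCast_cpow_neg hn _)
    (fun k hk => analyticAt_zeta_natCast_mul h0 hσ hk) ?_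
    (fun s hs' => ?_) (fun h hh heq => ?_)
    (fun k hk => exists_real_zeta_eq wreathFormula_PGL32 (by norm_num)
      (fun t ht => (termsPGL32_bounds t ht).1) hs hk)
    (fun n => natCast_cpow_neg_ofReal n σ) h0.le
  · refine ContinuousOn.congr (continuousOn_lseries hs) fun s _ => ?_
    exact congrFun h1 s
  · rw [rhsPGL32_eq, Nat.cast_one, one_mul]
    exact zeta_profWreath_eq wreathFormula_PGL32 (by norm_num) termsPGL32_bounds
      (zetaConverges_of_le hs hs')
  · refine not_analytic_continuation (formalZeta_eq_natCast _) hσ hh ?_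
    filter_upwards [heq] with s hs
    rwa [Nat.cast_one, one_mul] at hs

theorem exists_isAbscissa_A5 : ∃ σ₀ : ℝ, 0 < σ₀ ∧ IsAbscissa (ProfWreath A5 (Fin 5)) σ₀ ∧
    ZetaConverges (ProfWreath A5 (Fin 5)) σ₀ := by
  refine exists_isAbscissa_profWreath (m := 5) (T := termsA5.tail) (r := 1 / 60) (j := 60)
    wreathFormula_A5 (by norm_num) (by norm_num) (by norm_num) (by decide) fun x hx h => ?_
  have h1 := (rhsA5_eq (fun _ => (x : ℂ)) (fun _ => 1) (one_mul 1).symm (one_mul 1).symm).trans h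
  simp only [rhsA5, shift, Rat.smul_def] at h1
  -- The equation at `s = 0` with all zeta values equal to `x`, collected; every coefficient is
  -- positive.
  have h2 : 1 / 60 * x ^ 5 + 25 / 12 * x ^ 3 + 1 / 2 * x ^ 2 + 7 / 5 * x = 0 := by
    rw [← Complex.ofReal_inj]
    push_cast at h1 ⊢
    linear_combination h1
  have h3 : 0 < 1 / 60 * x ^ 5 + 25 / 12 * x ^ 3 + 1 / 2 * x ^ 2 + 7 / 5 * x := by positivity
  exact h3.ne' h2

theorem exists_isAbscissa_PSL25 : ∃ σ₀ : ℝ, 0 < σ₀ ∧ IsAbscissa (ProfWreath PSL25 Line5) σ₀ ∧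
    ZetaConverges (ProfWreath PSL25 Line5) σ₀ := by
  refine exists_isAbscissa_profWreath (m := 6) (T := termsPSL25.tail) (r := 1 / 60) (j := 60)
    wreathFormula_PSL25 (by norm_num) (by norm_num) (by norm_num) (by decide) fun x hx h => ?_
  have h1 := (rhsPSL25_eq (fun _ => (x : ℂ)) (fun _ => 1)).trans h
  simp only [rhsPSL25, shift, Rat.smul_def] at h1
  -- The negative term of the collected equation is absorbed by the quadratic one, since `x ≥ 1`.
  have h2 : 1 / 60 * x ^ 6 + 3 / 4 * x ^ 4 + 1 / 2 * x ^ 3 + 56 / 15 * x ^ 2 - x = 0 := by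
    rw [← Complex.ofReal_inj]
    push_cast at h1 ⊢
    linear_combination h1
  have h3 : 0 < 1 / 60 * x ^ 6 + 3 / 4 * x ^ 4 + 1 / 2 * x ^ 3 + 56 / 15 * x ^ 2 - x := by
    have : 0 < 1 / 60 * x ^ 6 + 3 / 4 * x ^ 4 + 1 / 2 * x ^ 3 := by positivity
    nlinarith
  exact h3.ne' h2

theorem exists_isAbscissa_PGL32 : ∃ σ₀ : ℝ, 0 < σ₀ ∧ IsAbscissa (ProfWreath PGL32 Plane2) σ₀ ∧
    ZetaConverges (ProfWreath PGL32 Plane2) σ₀ := by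
  refine exists_isAbscissa_profWreath (m := 7) (T := termsPGL32.tail) (r := 1 / 168) (j := 168)
    wreathFormula_PGL32 (by norm_num) (by norm_num) (by norm_num) (by decide) fun x hx h => ?_
  have h1 := (rhsPGL32_eq (fun _ => (x : ℂ)) (fun _ => 1)).trans h
  simp only [rhsPGL32, Rat.smul_def] at h1
  have h2 : 1 / 168 * x ^ 7 + 3 / 8 * x ^ 5 + 1 / 2 * x ^ 4 + 17 / 6 * x ^ 3 + 9 / 7 * x = 0 := by
    rw [← Complex.ofReal_inj]
    push_cast at h1 ⊢
    linear_combination h1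
  have h3 : 0 < 1 / 168 * x ^ 7 + 3 / 8 * x ^ 5 + 1 / 2 * x ^ 4 + 17 / 6 * x ^ 3 + 9 / 7 * x := by
    positivity
  exact h3.ne' h2

end IteratedWreath

end RepZeta

/-! ### Assembly of the three statements -/

open RepZeta

theorem proposition25 :
    -- the formulas for `ζ(H ≀_X Q, s)`, for every rigid topological group `H`,
    -- as identities of formal Dirichlet series and wherever `ζ_H(s)` converges
    (∀ (H : Type*) [Group H] [TopologicalSpace H] [IsTopologicalGroup H], Rigid H →
      (Rigid (PermWreath H A5 (Fin 5)) ∧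
        formalZeta (PermWreath H A5 (Fin 5)) =
          rhsA5 (fun k => dilate k (formalZeta H)) monoSeries ∧
        ∀ s : ℂ, ZetaConverges H s →
          ZetaConverges (PermWreath H A5 (Fin 5)) s ∧
          zeta (PermWreath H A5 (Fin 5)) s =
            rhsA5 (fun k => zeta H (k * s)) (fun n => (n : ℂ) ^ (-s))) ∧
      (Rigid (PermWreath H PSL25 Line5) ∧
        formalZeta (PermWreath H PSL25 Line5) =
          rhsPSL25 (fun k => dilate k (formalZeta H)) monoSeries ∧
        ∀ s : ℂ, ZetaConverges H s →
          ZetaConverges (PermWreath H PSL25 Line5) s ∧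
          zeta (PermWreath H PSL25 Line5) s =
            rhsPSL25 (fun k => zeta H (k * s)) (fun n => (n : ℂ) ^ (-s))) ∧
      (Rigid (PermWreath H PGL32 Plane2) ∧
        formalZeta (PermWreath H PGL32 Plane2) =
          rhsPGL32 (fun k => dilate k (formalZeta H)) monoSeries ∧
        ∀ s : ℂ, ZetaConverges H s →
          ZetaConverges (PermWreath H PGL32 Plane2) s ∧
          zeta (PermWreath H PGL32 Plane2) s =
            rhsPGL32 (fun k => zeta H (k * s)) (fun n => (n : ℂ) ^ (-s)))) ∧
    -- the functional equation of `ζ(W(A_5), s)`, where `W` is the profinite iterated wreath product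
    (Rigid (ProfWreath A5 (Fin 5)) ∧
      (∃ σ₀ : ℝ, 0 < σ₀ ∧ IsAbscissa (ProfWreath A5 (Fin 5)) σ₀) ∧
      formalZeta (ProfWreath A5 (Fin 5)) =
        rhsFunctionalEquation (fun k => dilate k (formalZeta (ProfWreath A5 (Fin 5)))) monoSeries ∧
      ∀ s : ℂ, ZetaConverges (ProfWreath A5 (Fin 5)) s →
        zeta (ProfWreath A5 (Fin 5)) s =
          rhsFunctionalEquation (fun k => zeta (ProfWreath A5 (Fin 5)) (k * s))
            (fun n => (n : ℂ) ^ (-s))) ∧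
    -- abscissa of convergence and Puiseux expansion for `W(PSL_2(𝔽_5))`
    (Rigid (ProfWreath PSL25 Line5) ∧
      ∃ σ₀ : ℝ, 0 < σ₀ ∧ IsAbscissa (ProfWreath PSL25 Line5) σ₀ ∧
        HasSqrtPuiseux (zeta (ProfWreath PSL25 Line5)) σ₀) ∧
    -- abscissa of convergence and Puiseux expansion for `W(PGL_3(𝔽_2))`
    (Rigid (ProfWreath PGL32 Plane2) ∧
      ∃ σ₀ : ℝ, 0 < σ₀ ∧ IsAbscissa (ProfWreath PGL32 Plane2) σ₀ ∧
        HasSqrtPuiseux (zeta (ProfWreath PGL32 Plane2)) σ₀) := by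
  refine ⟨fun H _ _ _ hH => ⟨?_, ?_, ?_⟩, ?_, ?_, ?_⟩
  · obtain ⟨h1, h2⟩ := rigid_and_formalZeta_A5 hH
    refine ⟨h1, h2, fun s hs => ?_⟩
    rw [rhsA5_eq _ _ monoSeries_fifteen monoSeries_twenty] at h2
    rw [rhsA5_eq _ _ (cpow_neg_fifteen s) (cpow_neg_twenty s)]
    exact converges_and_zeta_eq (by norm_num) (by decide) h2 hs
  · obtain ⟨h1, h2⟩ := rigid_and_formalZeta_PSL25 hH
    refine ⟨h1, h2, fun s hs => ?_⟩
    rw [rhsPSL25_eq] at h2 ⊢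
    exact converges_and_zeta_eq (by norm_num) (by decide) h2 hs
  · obtain ⟨h1, h2⟩ := rigid_and_formalZeta_PGL32 hH
    refine ⟨h1, h2, fun s hs => ?_⟩
    rw [rhsPGL32_eq] at h2 ⊢
    exact converges_and_zeta_eq (by norm_num) (by decide) h2 hs
  · obtain ⟨σ, h0, hσ, -⟩ := exists_isAbscissa_A5
    refine ⟨rigid_profWreath wreathFormula_A5 (by norm_num) fun t ht => (termsA5_bounds t ht).1,
      ⟨σ, h0, hσ⟩, ?_, fun s hs => ?_⟩
    · rw [rhsFunctionalEquation_eq, rhsA5_eq _ _ monoSeries_fifteen monoSeries_twenty]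
      exact formalZeta_profWreath wreathFormula_A5 (by norm_num) fun t ht =>
        (termsA5_bounds t ht).1
    · rw [rhsFunctionalEquation_eq, rhsA5_eq _ _ (cpow_neg_fifteen s) (cpow_neg_twenty s)]
      exact zeta_profWreath_eq wreathFormula_A5 (by norm_num) termsA5_bounds hs
  · obtain ⟨σ, h0, hσ, hs⟩ := exists_isAbscissa_PSL25
    exact ⟨rigid_profWreath wreathFormula_PSL25 (by norm_num) fun t ht =>
      (termsPSL25_bounds t ht).1, σ, h0, hσ, hasSqrtPuiseux_PSL25 h0 hσ hs⟩
  · obtain ⟨σ, h0, hσ, hs⟩ := exists_isAbscissa_PGL32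
    exact ⟨rigid_profWreath wreathFormula_PGL32 (by norm_num) fun t ht =>
      (termsPGL32_bounds t ht).1, σ, h0, hσ, hasSqrtPuiseux_PGL32 h0 hσ hs⟩
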